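/- Let $\mathcal S,\mathcal X,\mathcal Y_1,\mathcal Y_2,\mathcal Z$ be finite alphabets. Consider a state-dependent 3-receiver discrete memoryless broadcast channel with transition law $p_{Y_1,Y_2,Z|X,S}$ and i.i.d. state $S\sim p_S$. All logarithms are to base $2$, and $[x]^+=\max\{x,0\}$. **Protocols and achievability.** Let $R_0,R_1,R_2\ge 0$ and $n\in\mathbb N$. Key number $i$ ($i=0,1,2$) takes values in $[1:2^{nR_i})=\{1,\dots,2^{\lfloor nR_i\rfloor}\}$. In a protocol of length $n$ (without public feedback) the transmitter, knowing the whole state sequence $S^n$ non-causally, randomly generates a common key $K_0$ and private keys $K_1,K_2$, where $K_1$ and $K_2$ are independent, and then the channel input $X^n$ as a random function of $(K_0,K_1,K_2,S^n)$. For $j=1,2$, receiver $j$ computes estimates $\hat K_0^{(j)},\hat K_j$ of $K_0,K_j$ as a function of $Y_j^n$; the eavesdropper observes $Z^n$. The triple $(R_0,R_1,R_2)$ is achievable if for every $\epsilon>0$ and all sufficiently large $n$ there is a protocol of length $n$ such that $$\Pr\{K_0\ne\hat K_0^{(j)}\}<\epsilon,\qquad \Pr\{K_j\ne\hat K_j\}<\epsilon\qquad(j=1,2),$$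 $$\tfrac1n I(K_0,K_1,K_2;Z^n)<\epsilon,\qquad \tfrac1n I(K_1;Y_2^n)<\epsilon,\qquad \tfrac1n I(K_2;Y_1^n)<\epsilon,$$ $$\tfrac1n H(K_i)>R_i-\epsilon\qquad(i=0,1,2).$$ **Theorem 1 (Inner bound, model without public feedback).** Let $U_0,U_1,U_2$ be auxiliary random variables with finite alphabets such that $(S,U_0,U_1,U_2,X,Y_1,Y_2,Z)$ has joint law $$p(s)\,p(u_0|s)\,p(u_1|s,u_0)\,p(u_2|s,u_0)\,p(x|s,u_0,u_1,u_2)\,p(y_1,y_2,z|x,s),$$ and suppose that for $j=1,2$ $$I(U_0;Y_j)\ge I(U_0;S),\qquad I(U_j;Y_j|U_0)\ge I(U_j;S|U_0).$$ Put $I_0=\min\{I(U_0;Y_1),I(U_0;Y_2)\}$. Then every triple $(R_0,R_1,R_2)$ with $R_0,R_1,R_2\ge0$ and $$\begin{aligned} R_0&\le[I_0-I(U_0;Z)]^+,\\ R_1&\le[I(U_1;Y_1|U_0)-I(U_1;Y_2,U_2|U_0)]^+,\\ R_2&\le[I(U_2;Y_2|U_0)-I(U_2;Y_1,U_1|U_0)]^+,\\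 R_0+R_1&\le[I_0+I(U_1;Y_1|U_0)-I(U_0,U_1;Z)]^+,\\ R_0+R_2&\le[I_0+I(U_2;Y_2|U_0)-I(U_0,U_2;Z)]^+,\\ R_0+R_1+R_2&\le[I_0+I(U_1;Y_1|U_0)+I(U_2;Y_2|U_0)-I(U_0,U_1,U_2;Z)-I(U_1;U_2|U_0)]^+ \end{aligned}$$ is achievable. -/

import Mathlib

noncomputable section

namespace KeyAgreement

/-! ### Finite probability and Shannon information (in bits) -/

/-- Product law on `Fin n → α` of independent coordinates with laws `p i`. -/
def piPMF {α : Type*} [Fintype α] {n : ℕ} (p : Fin n → PMF α) : PMF (Fin n → α) :=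
  PMF.ofFintype (fun a => ∏ i, p i (a i)) (by
    classical
    rw [← Fintype.piFinset_univ, ← Finset.prod_univ_sum]
    refine Finset.prod_eq_one fun i _ => ?_
    rw [← tsum_fintype (L := .unconditional _), (p i).tsum_coe])

/-- Probability of an event. -/
def prob {Ω : Type*} (p : PMF Ω) (E : Set Ω) : ℝ := (p.toOuterMeasure E).toReal

/-- Shannon entropy `-∑ p(a) log₂ p(a)` of a law on a finite alphabet. -/
def pmfEntropy {α : Type*} [Fintype α] (q : PMF α) : ℝ :=
  ∑ a, -((q a).toReal * Real.logb 2 (q a).toReal)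

/-- `H(A)` for a random variable `A` on the probability space `(Ω, p)`. -/
def H {Ω α : Type*} [Fintype α] (p : PMF Ω) (A : Ω → α) : ℝ := pmfEntropy (p.map A)

/-- `H(A | C) = H(A, C) - H(C)`. -/
def condH {Ω α γ : Type*} [Fintype α] [Fintype γ] (p : PMF Ω) (A : Ω → α) (C : Ω → γ) : ℝ :=
  H p (fun ω => (A ω, C ω)) - H p C

/-- Mutual information `I(A; B) = H(A) - H(A | B)`. -/
def I {Ω α β : Type*} [Fintype α] [Fintype β] (p : PMF Ω) (A : Ω → α) (B : Ω → β) : ℝ :=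
  H p A - condH p A B

/-- Conditional mutual information `I(A; B | C) = H(A | C) - H(A | B, C)`. -/
def condI {Ω α β γ : Type*} [Fintype α] [Fintype β] [Fintype γ] (p : PMF Ω)
    (A : Ω → α) (B : Ω → β) (C : Ω → γ) : ℝ :=
  condH p A C - condH p A (fun ω => (B ω, C ω))

/-- Independence of two discrete random variables. -/
def Indep {Ω α β : Type*} (p : PMF Ω) (A : Ω → α) (B : Ω → β) : Prop :=
  ∀ a b, p.map (fun ω => (A ω, B ω)) (a, b) = p.map A a * p.map B b

/-! ### The channel -/

/-- A state-dependent 3-receiver discrete memoryless broadcast channel: the law `p_S` of the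
i.i.d. state and the transition law `p_{Y₁,Y₂,Z|X,S}`. -/
structure Channel (S X Y₁ Y₂ Z : Type*) where
  state : PMF S
  trans : X → S → PMF (Y₁ × Y₂ × Z)

/-! ### Key agreement protocols without public feedback -/

/-- The key alphabet `[1 : 2^{nR})`, i.e. `2^⌊nR⌋` possible keys. -/
abbrev KeySet (n : ℕ) (R : ℝ) : Type := Fin (2 ^ ⌊(n : ℝ) * R⌋₊)

/-- A protocol of block length `n`. Knowing `sⁿ` (non-causally), the transmitter randomly generates
the keys `(k₀, k₁, k₂)`, then the channel input `xⁿ` as a random function of the keys and `sⁿ`.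
Receiver `j` estimates `(k₀, k_j)` from `y_jⁿ`. -/
structure Protocol (S X Y₁ Y₂ : Type*) (n : ℕ) (R₀ R₁ R₂ : ℝ) where
  keyGen : (Fin n → S) → PMF (KeySet n R₀ × KeySet n R₁ × KeySet n R₂)
  enc : KeySet n R₀ × KeySet n R₁ × KeySet n R₂ → (Fin n → S) → PMF (Fin n → X)
  dec₁ : (Fin n → Y₁) → KeySet n R₀ × KeySet n R₁
  dec₂ : (Fin n → Y₂) → KeySet n R₀ × KeySet n R₂

/-- Everything that happens in one run of a protocol. -/
structure Run (S X Y₁ Y₂ Z : Type*) (n : ℕ) (R₀ R₁ R₂ : ℝ) where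
  s : Fin n → S
  k₀ : KeySet n R₀
  k₁ : KeySet n R₁
  k₂ : KeySet n R₂
  x : Fin n → X
  y₁ : Fin n → Y₁
  y₂ : Fin n → Y₂
  z : Fin n → Z

section

variable {S X Y₁ Y₂ Z : Type*} [Fintype S] [Fintype X] [Fintype Y₁] [Fintype Y₂] [Fintype Z]
  {n : ℕ} {R₀ R₁ R₂ : ℝ}

/-- The joint law of states, keys, inputs and outputs when a protocol is used over the channel. -/
def Protocol.law (P : Protocol S X Y₁ Y₂ n R₀ R₁ R₂) (W : Channel S X Y₁ Y₂ Z) :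
    PMF (Run S X Y₁ Y₂ Z n R₀ R₁ R₂) :=
  (piPMF fun _ : Fin n => W.state).bind fun s =>
  (P.keyGen s).bind fun k =>
  (P.enc k s).bind fun x =>
  (piPMF fun i : Fin n => W.trans (x i) (s i)).map fun y =>
    { s := s, k₀ := k.1, k₁ := k.2.1, k₂ := k.2.2, x := x,
      y₁ := fun i => (y i).1, y₂ := fun i => (y i).2.1, z := fun i => (y i).2.2 }

/-- The protocol generates independent private keys and meets, up to `ε`, the requirements of
reliability, secrecy from the eavesdropper, mutual secrecy of the private keys, and uniformity. -/
structure Protocol.IsGood (P : Protocol S X Y₁ Y₂ n R₀ R₁ R₂) (W : Channel S X Y₁ Y₂ Z)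
    (ε : ℝ) : Prop where
  indep : Indep (P.law W) (fun ω => ω.k₁) (fun ω => ω.k₂)
  reliable₀₁ : prob (P.law W) {ω | ω.k₀ ≠ (P.dec₁ ω.y₁).1} < ε
  reliable₀₂ : prob (P.law W) {ω | ω.k₀ ≠ (P.dec₂ ω.y₂).1} < ε
  reliable₁ : prob (P.law W) {ω | ω.k₁ ≠ (P.dec₁ ω.y₁).2} < ε
  reliable₂ : prob (P.law W) {ω | ω.k₂ ≠ (P.dec₂ ω.y₂).2} < ε
  secret : (1 / (n : ℝ)) * I (P.law W) (fun ω => (ω.k₀, ω.k₁, ω.k₂)) (fun ω => ω.z) < ε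
  private₁ : (1 / (n : ℝ)) * I (P.law W) (fun ω => ω.k₁) (fun ω => ω.y₂) < ε
  private₂ : (1 / (n : ℝ)) * I (P.law W) (fun ω => ω.k₂) (fun ω => ω.y₁) < ε
  uniform₀ : R₀ - ε < (1 / (n : ℝ)) * H (P.law W) (fun ω => ω.k₀)
  uniform₁ : R₁ - ε < (1 / (n : ℝ)) * H (P.law W) (fun ω => ω.k₁)
  uniform₂ : R₂ - ε < (1 / (n : ℝ)) * H (P.law W) (fun ω => ω.k₂)

/-- Achievability of a rate triple: for every `ε > 0` and all sufficiently large `n` there is a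
good protocol of block length `n`. -/
def Achievable (W : Channel S X Y₁ Y₂ Z) (R₀ R₁ R₂ : ℝ) : Prop :=
  ∀ ε : ℝ, 0 < ε → ∃ N : ℕ, ∀ n : ℕ, N ≤ n →
    ∃ P : Protocol S X Y₁ Y₂ n R₀ R₁ R₂, P.IsGood W ε

end

/-! ### Single-letter input distributions with auxiliary variables -/

/-- An outcome of `(S, U₀, U₁, U₂, X, Y₁, Y₂, Z)`. -/
structure Letter (S U₀ U₁ U₂ X Y₁ Y₂ Z : Type*) where
  s : S
  u₀ : U₀
  u₁ : U₁
  u₂ : U₂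
  x : X
  y₁ : Y₁
  y₂ : Y₂
  z : Z

/-- The law `p(s) p(u₀|s) p(u₁|s,u₀) p(u₂|s,u₀) p(x|s,u₀,u₁,u₂) p(y₁,y₂,z|x,s)`. -/
def Channel.letterLaw {S U₀ U₁ U₂ X Y₁ Y₂ Z : Type*} (W : Channel S X Y₁ Y₂ Z)
    (pU₀ : S → PMF U₀) (pU₁ : S → U₀ → PMF U₁) (pU₂ : S → U₀ → PMF U₂)
    (pX : S → U₀ → U₁ → U₂ → PMF X) : PMF (Letter S U₀ U₁ U₂ X Y₁ Y₂ Z) :=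
  W.state.bind fun s =>
  (pU₀ s).bind fun u₀ =>
  (pU₁ s u₀).bind fun u₁ =>
  (pU₂ s u₀).bind fun u₂ =>
  (pX s u₀ u₁ u₂).bind fun x =>
  (W.trans x s).map fun y =>
    { s := s, u₀ := u₀, u₁ := u₁, u₂ := u₂, x := x, y₁ := y.1, y₂ := y.2.1, z := y.2.2 }

end KeyAgreement

end

/-!
The proof combines random binning of superposed auxiliary layers with second-moment bounds, and
removes the degenerate cases of the hypotheses by a small perturbation of the input distribution.

**One shot.** A `Model` consists of a state `s`, layers `u₀`, `u₁`, `u₂` with `u₁` and `u₂` independent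
given `(s, u₀)`, and a channel output. Each layer is restricted to a random bin of density `1 / Mᵢ`.
If `Mᵢ` is below `1 / P(uᵢ | s)`, the bins still cover: the restricted conditional law of the layer has
total weight close to one, so the encoder can draw the layers from the bins without disturbing the law
of the state and the outputs. If `Mᵢ` is above the number of layers that are typical with the output,
the receivers can find the layers in the bins. The keys are independent random functions of `u₀`, of
`(u₀, u₁)` and of `(u₀, u₂)`. A second-moment bound shows that they are nearly uniform and independent
of an observation, provided that the conditional probabilities of the layers given the observation
are small compared to the product of key and bin sizes (`Model.PassesTest`). This holds on a fixed set
of good points only, so all bounds are restricted to such points. The result is `Model.one_shot`. For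
the eavesdropper, the test is made with the layers of some set `A` added to the observation, `A` being
the set for which the available key rate is least; the keys for the layers in `A` are then trivial.

**From layers to protocols.** The law of state and keys produced by `Model.one_shot` is only close to
one with exactly the given state law and exactly uniform keys. `exists_coupling` corrects it, which
makes the private keys exactly independent, at the expense of a small total variation distance; the
mutual informations are then bounded by continuity of the entropy (`exists_isGood`).

**Long blocks.** `Model.eventually_one_shot` applies this to `n` independent copies of a model. By
the weak law of large numbers all sizes are exponential, with rates given by the entropies
`Model.entPat` of sets of layers together with the state or an output. In these terms, the rate bounds
of the theorem say that the sum of the key rates of each set of layers is at most the equivocation of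
these layers at the eavesdropper minus the sum of their bin rates, the equivocations at the receivers.

**Degenerate cases.** Covering and decoding together need the strict inequalities
`H(U₀ | Y_j) < H(U₀ | S)` and `H(U_j | U₀, Y_j) < H(U_j | U₀, S)`, while the hypotheses of the theorem
give weak ones. There are two cases for each receiver.
* If the output `Y_j` depends on the input in some possible state, then the inequalities hold strictly
  when the layers are independent uniform maps from states to inputs, one of which is used as the
  input (`Encoder.strategy_strict`). Using these layers with a small probability `θ`, and letting each
  layer reveal whether this is done, makes the inequalities strict (`Encoder.entPat_mix_lt`) and
  changes the rate bounds little.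
* If `Y_j` depends on the state only, then the layers, the state and `Y_j` form a Markov chain, and
  the hypotheses are cases of equality in the data processing inequality. Hence the conditional laws
  of `U₀` and `U_j` given the state are determined by `Y_j` (`Model.StateOnly.margPat_fst_eq`). The
  encoder then selects points of the bins as deterministic functions of these laws
  (`exists_kernel`), and the receiver recomputes them without error.
-/

noncomputable section

set_option linter.unusedSectionVars false

namespace KeyAgreement

/-! ### Indicators and uniform averages -/

/-- The real-valued indicator of a proposition. Decidability is chosen classically inside the
definition, so that no decidability instance occurs in statements. -/
def ind (p : Prop) : ℝ := by classical exact if p then 1 else 0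

lemma ind_of {p : Prop} (h : p) : ind p = 1 := by simp [ind, h]

lemma ind_of_not {p : Prop} (h : ¬p) : ind p = 0 := by simp [ind, h]

@[simp] lemma ind_true : ind True = 1 := ind_of trivial

@[simp] lemma ind_false : ind False = 0 := ind_of_not id

lemma ind_nonneg (p : Prop) : 0 ≤ ind p := by
  by_cases h : p <;> simp [h]

lemma ind_le_one (p : Prop) : ind p ≤ 1 := by
  by_cases h : p <;> simp [h]

lemma ind_and (p q : Prop) : ind (p ∧ q) = ind p * ind q := by
  by_cases hp : p <;> by_cases hq : q <;> simp [hp, hq]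

lemma ind_not (p : Prop) : ind (¬p) = 1 - ind p := by
  by_cases h : p <;> simp [h]

lemma ind_mono {p q : Prop} (h : p → q) : ind p ≤ ind q := by
  by_cases hp : p
  · rw [ind_of hp, ind_of (h hp)]
  · rw [ind_of_not hp]; exact ind_nonneg q

lemma ind_congr {p q : Prop} (h : p ↔ q) : ind p = ind q := by rw [propext h]

lemma ind_mul_self (p : Prop) : ind p * ind p = ind p := by
  by_cases h : p <;> simp [h]

lemma ind_comm_eq {α : Type*} (a b : α) : ind (a = b) = ind (b = a) := ind_congr eq_comm

lemma sum_ind_mul {α : Type*} [Fintype α] (b : α) (f : α → ℝ) :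
    ∑ a, ind (b = a) * f a = f b := by
  rw [Finset.sum_eq_single b]
  · simp
  · intro a _ h; rw [ind_of_not (Ne.symm h), zero_mul]
  · simp

lemma sum_mul_ind {α : Type*} [Fintype α] (b : α) (f : α → ℝ) :
    ∑ a, f a * ind (b = a) = f b := by
  simpa [mul_comm] using sum_ind_mul b f

lemma sum_ind {α : Type*} [Fintype α] (b : α) : ∑ a, ind (b = a) = 1 := by
  simpa using sum_ind_mul b (fun _ : α => (1 : ℝ))

/-- The uniform average over a finite type. -/
def avg {Θ : Type*} [Fintype Θ] (F : Θ → ℝ) : ℝ := (∑ θ, F θ) / Fintype.card Θ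

section avg

variable {Θ : Type*} [Fintype Θ]

lemma avg_add (F G : Θ → ℝ) : avg (fun θ => F θ + G θ) = avg F + avg G := by
  simp [avg, Finset.sum_add_distrib, add_div]

lemma avg_sub (F G : Θ → ℝ) : avg (fun θ => F θ - G θ) = avg F - avg G := by
  simp [avg, Finset.sum_sub_distrib, sub_div]

lemma avg_mul_left (c : ℝ) (F : Θ → ℝ) : avg (fun θ => c * F θ) = c * avg F := by
  simp [avg, ← Finset.mul_sum, mul_div_assoc]

lemma avg_mul_right (c : ℝ) (F : Θ → ℝ) : avg (fun θ => F θ * c) = avg F * c := by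
  simp only [mul_comm _ c, avg_mul_left]

lemma avg_div (c : ℝ) (F : Θ → ℝ) : avg (fun θ => F θ / c) = avg F / c := by
  simp only [div_eq_mul_inv, avg_mul_right]

lemma avg_sum {ι : Type*} (s : Finset ι) (F : ι → Θ → ℝ) :
    avg (fun θ => ∑ i ∈ s, F i θ) = ∑ i ∈ s, avg (F i) := by
  simp only [avg, Finset.sum_div]
  rw [Finset.sum_comm]

lemma avg_mono {F G : Θ → ℝ} (h : ∀ θ, F θ ≤ G θ) : avg F ≤ avg G :=
  div_le_div_of_nonneg_right (Finset.sum_le_sum fun θ _ => h θ) (Nat.cast_nonneg _)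

lemma avg_const [Nonempty Θ] (c : ℝ) : avg (fun _ : Θ => c) = c := by
  have : (Fintype.card Θ : ℝ) ≠ 0 := by exact_mod_cast Fintype.card_ne_zero
  simp [avg, this]

lemma avg_prod {Θ' : Type*} [Fintype Θ'] (F : Θ × Θ' → ℝ) :
    avg F = avg fun θ => avg fun θ' => F (θ, θ') := by
  simp only [avg, Fintype.sum_prod_type, Fintype.card_prod, Nat.cast_mul, ← Finset.sum_div]
  rw [div_div, mul_comm]

lemma avg_prod_mul {Θ' : Type*} [Fintype Θ'] (f : Θ → ℝ) (g : Θ' → ℝ) :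
    avg (fun θ : Θ × Θ' => f θ.1 * g θ.2) = avg f * avg g := by
  rw [avg_prod]
  simp only [avg_mul_left, avg_mul_right]

lemma avg_prod_mul₃ {Θ' Θ'' : Type*} [Fintype Θ'] [Fintype Θ''] (f : Θ → ℝ) (g : Θ' → ℝ)
    (h : Θ'' → ℝ) :
    avg (fun θ : Θ × Θ' × Θ'' => f θ.1 * g θ.2.1 * h θ.2.2) = avg f * avg g * avg h := by
  have := avg_prod_mul f (fun θ : Θ' × Θ'' => g θ.1 * h θ.2)
  rw [avg_prod_mul] at this
  simpa only [mul_assoc] using this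

/-- Finitely many nonnegative costs with average at most `e i` can be kept simultaneously within a
factor `card ι` of these averages. -/
lemma exists_forall_le_of_avg_le [Nonempty Θ] {ι : Type*} [Fintype ι] (F : ι → Θ → ℝ)
    (e : ι → ℝ) (he : ∀ i, 0 < e i) (hF : ∀ i θ, 0 ≤ F i θ) (h : ∀ i, avg (F i) ≤ e i) :
    ∃ θ, ∀ i, F i θ ≤ Fintype.card ι * e i := by
  have key : avg (fun θ => ∑ i, F i θ / e i) ≤ Fintype.card ι := by
    rw [avg_sum]
    calc ∑ i, avg (fun θ => F i θ / e i) ≤ ∑ _i : ι, (1 : ℝ) := by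
          refine Finset.sum_le_sum fun i _ => ?_
          rw [avg_div, div_le_one (he i)]
          exact h i
      _ = _ := by simp
  obtain ⟨θ, hθ⟩ : ∃ θ, ∑ i, F i θ / e i ≤ Fintype.card ι := by
    by_contra hcon
    push Not at hcon
    have hlt : ∑ θ : Θ, (Fintype.card ι : ℝ) < ∑ θ, ∑ i, F i θ / e i :=
      Finset.sum_lt_sum_of_nonempty Finset.univ_nonempty fun θ _ => hcon θ
    have hc : (0 : ℝ) < Fintype.card Θ := by exact_mod_cast Fintype.card_pos
    rw [avg, div_le_iff₀ hc] at key
    simp only [Finset.sum_const, Finset.card_univ, nsmul_eq_mul] at hlt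
    linarith [mul_comm (Fintype.card ι : ℝ) (Fintype.card Θ)]
  refine ⟨θ, fun i => ?_⟩
  have h1 : F i θ / e i ≤ ∑ i, F i θ / e i :=
    Finset.single_le_sum (f := fun i => F i θ / e i)
      (fun j _ => div_nonneg (hF j θ) (he j).le) (Finset.mem_univ i)
  exact (div_le_iff₀ (he i)).1 (h1.trans hθ)

end avg

/-! ### Random functions and random bins -/

section hash

variable {W : Type*} {A : Type*} [Fintype A]

lemma avg_equiv {Θ Θ' : Type*} [Fintype Θ] [Fintype Θ'] (e : Θ ≃ Θ') (F : Θ' → ℝ) :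
    avg (fun θ => F (e θ)) = avg F := by
  simp only [avg, Fintype.card_congr e, e.sum_comp F]

lemma avg_fun_apply [Fintype W] [DecidableEq W] [Nonempty A] (w : W) (f : A → ℝ) :
    avg (fun h : W → A => f (h w)) = avg f := by
  have h1 := avg_equiv (Equiv.funSplitAt w A) (fun x : A × ({j // j ≠ w} → A) => f x.1 * 1)
  rw [avg_prod_mul f (fun _ => 1), avg_const] at h1
  simpa using h1

/-- The values of a uniformly random function at two distinct points are independent. -/
lemma avg_fun_apply_mul [Fintype W] [DecidableEq W] [Nonempty A] {w w' : W} (hw : w ≠ w')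
    (f g : A → ℝ) :
    avg (fun h : W → A => f (h w) * g (h w')) = avg f * avg g := by
  have h1 := avg_equiv (Equiv.funSplitAt w A)
    (fun x : A × ({j // j ≠ w} → A) => f x.1 * g (x.2 ⟨w', hw.symm⟩))
  rw [avg_prod_mul f (fun x : {j // j ≠ w} → A => g (x ⟨w', hw.symm⟩)), avg_fun_apply] at h1
  simpa using h1

/-- `M` times the probability that a random function into `M` values collides at `w` and `w'`. -/
def coll {W : Type*} (M : ℕ) (w w' : W) : ℝ := 1 + ((M : ℝ) - 1) * ind (w = w')

lemma coll_self (M : ℕ) (w : W) : coll M w w = M := by simp [coll]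

lemma coll_ne (M : ℕ) {w w' : W} (h : w ≠ w') : coll M w w' = 1 := by
  simp [coll, ind_of_not h]

lemma avg_ind_eq (n : ℕ) (a : Fin n) : avg (fun b : Fin n => ind (b = a)) = 1 / n := by
  simp only [avg, Fintype.card_fin]
  congr 1
  simp only [ind_comm_eq _ a]
  exact sum_ind a

/-- Collision probability of a random function. -/
lemma avg_collision [Fintype W] [DecidableEq W] {N : ℕ} (hN : 0 < N) (w w' : W) :
    avg (fun k : W → Fin N => ind (k w = k w')) = coll N w w' / N := by
  have : Nonempty (Fin N) := ⟨⟨0, hN⟩⟩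
  have hN' : (N : ℝ) ≠ 0 := by positivity
  by_cases h : w = w'
  · subst h
    simp [coll_self, avg_const, hN']
  · rw [coll_ne N h]
    have h1 : ∀ k : W → Fin N, ind (k w = k w') = ∑ a, ind (k w = a) * ind (k w' = a) := by
      intro k
      rw [sum_ind_mul (k w) (fun a => ind (k w' = a)), ind_comm_eq]
    simp only [h1]
    rw [avg_sum]
    have h2 : ∀ a : Fin N, avg (fun k : W → Fin N => ind (k w = a) * ind (k w' = a))
        = 1 / N * (1 / N) := by
      intro a
      rw [avg_fun_apply_mul h (fun b => ind (b = a)) (fun b => ind (b = a)), avg_ind_eq]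
    simp only [h2]
    simp
    field_simp

/-- A random bin of relative size `1 / M`: a finite ensemble of weights `φ θ : W → {0, M}` of mean
one that are uncorrelated at distinct points. -/
structure IsBinning {Θ W : Type*} [Fintype Θ] (M : ℕ) (φ : Θ → W → ℝ) : Prop where
  values : ∀ θ w, φ θ w = 0 ∨ φ θ w = M
  corr : ∀ w w', avg (fun θ => φ θ w * φ θ w') = coll M w w'
  mean : ∀ w, avg (fun θ => φ θ w) = 1

lemma IsBinning.nonneg {Θ W : Type*} [Fintype Θ] {M : ℕ} {φ : Θ → W → ℝ} (h : IsBinning M φ)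
    (θ : Θ) (w : W) : 0 ≤ φ θ w := by
  rcases h.values θ w with h | h <;> rw [h]
  exact Nat.cast_nonneg _

/-- Random bins exist: assign to each point one of `M` labels uniformly at random, and keep the points
with a fixed label. -/
lemma exists_isBinning.{u} (W : Type u) [Finite W] {M : ℕ} (hM : 0 < M) :
    ∃ (Θ : Type u) (_ : Fintype Θ) (_ : Nonempty Θ) (φ : Θ → W → ℝ), IsBinning M φ := by
  classical
  have := Fintype.ofFinite W
  have : Nonempty (Fin M) := ⟨⟨0, hM⟩⟩
  have hM' : (M : ℝ) ≠ 0 := by positivity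
  have hmean : avg (fun b : Fin M => (M : ℝ) * ind (b = ⟨0, hM⟩)) = 1 := by
    rw [avg_mul_left, avg_ind_eq]; field_simp
  refine ⟨W → Fin M, inferInstance, inferInstance, fun h w => M * ind (h w = ⟨0, hM⟩), ?_, ?_, ?_⟩
  · intro h w
    by_cases hw : h w = ⟨0, hM⟩
    · right; simp [hw]
    · left; simp [hw]
  · intro w w'
    by_cases h : w = w'
    · subst h
      have h1 : ∀ k : W → Fin M, (M * ind (k w = ⟨0, hM⟩)) * (M * ind (k w = ⟨0, hM⟩))
          = M * (M * ind (k w = ⟨0, hM⟩)) := by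
        intro k
        linear_combination (M : ℝ) * M * ind_mul_self (k w = ⟨0, hM⟩)
      simp only [h1]
      rw [avg_mul_left, avg_fun_apply w (fun b : Fin M => (M : ℝ) * ind (b = ⟨0, hM⟩)), hmean,
        coll_self, mul_one]
    · rw [avg_fun_apply_mul h (fun b : Fin M => (M : ℝ) * ind (b = ⟨0, hM⟩))
        (fun b : Fin M => (M : ℝ) * ind (b = ⟨0, hM⟩)), hmean, coll_ne M h, mul_one]
  · intro w
    rw [avg_fun_apply w (fun b : Fin M => (M : ℝ) * ind (b = ⟨0, hM⟩)), hmean]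

end hash

/-! ### Second-moment bounds for random bins and random keys -/

/-- The inequality of arithmetic and geometric means, which turns second-moment bounds into bounds on
`L¹` norms without square roots. -/
lemma abs_le_weighted_sq {x r τ : ℝ} (hr : 0 < r) (hτ : 0 < τ) :
    |x| ≤ (τ * r + x ^ 2 / (τ * r)) / 2 := by
  have h : 0 < τ * r := mul_pos hτ hr
  have h1 : 0 ≤ (|x| - τ * r) ^ 2 / (τ * r) := by positivity
  have h2 : (|x| - τ * r) ^ 2 / (τ * r) = x ^ 2 / (τ * r) - 2 * |x| + τ * r := by
    rw [sub_sq, sq_abs]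
    field_simp
  linarith

/-- Covering: if the law `k` puts mass at most `β` on each point outside a set of small mass, then a
random bin has relative mass close to one. -/
lemma avg_abs_bin_sub_one_le {Θ U : Type*} [Fintype Θ] [Nonempty Θ] [Fintype U] {M : ℕ}
    {φ : Θ → U → ℝ} (hφ : IsBinning M φ) (hM : 0 < M) (k : U → ℝ) (hk : ∀ u, 0 ≤ k u)
    (hk1 : ∑ u, k u = 1) (T : U → Prop) {β τ : ℝ} (hτ : 0 < τ) (hβ0 : 0 ≤ β)
    (hβ : ∀ u, T u → k u ≤ β) :
    avg (fun θ => |∑ u, φ θ u * k u - 1|) ≤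
      2 * ∑ u, k u * ind (¬T u) + (τ + (M - 1) * β / τ) / 2 := by
  have hM1 : (1 : ℝ) ≤ M := by exact_mod_cast hM
  set g : U → ℝ := fun u => k u * ind (T u) with hg
  set b : U → ℝ := fun u => k u * ind (¬T u) with hb
  have hsplit : ∀ u, k u = g u + b u := by
    intro u; simp only [hg, hb, ind_not]; ring
  have hg0 : ∀ u, 0 ≤ g u := fun u => mul_nonneg (hk u) (ind_nonneg _)
  have hb0 : ∀ u, 0 ≤ b u := fun u => mul_nonneg (hk u) (ind_nonneg _)
  have hgβ : ∀ u, g u ≤ β := by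
    intro u
    by_cases h : T u
    · simpa [hg, ind_of h] using hβ u h
    · simpa [hg, ind_of_not h] using hβ0
  have hgs : ∑ u, g u ≤ 1 := by
    rw [← hk1]; exact Finset.sum_le_sum fun u _ => by linarith [hsplit u, hb0 u]
  set X : Θ → ℝ := fun θ => ∑ u, φ θ u * g u - ∑ u, g u with hX
  have h1 : ∀ θ, |∑ u, φ θ u * k u - 1| ≤
      (∑ u, φ θ u * b u + ∑ u, b u) + (τ * 1 + X θ ^ 2 / (τ * 1)) / 2 := by
    intro θ
    have e1 : ∑ u, φ θ u * k u - 1 = X θ + (∑ u, φ θ u * b u - ∑ u, b u) := by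
      rw [← hk1]
      simp only [hX, hsplit, mul_add, Finset.sum_add_distrib]
      ring
    have e2 : |∑ u, φ θ u * b u - ∑ u, b u| ≤ ∑ u, φ θ u * b u + ∑ u, b u := by
      have p1 : 0 ≤ ∑ u, φ θ u * b u :=
        Finset.sum_nonneg fun u _ => mul_nonneg (hφ.nonneg θ u) (hb0 u)
      have p2 : 0 ≤ ∑ u, b u := Finset.sum_nonneg fun u _ => hb0 u
      rw [abs_le]; constructor <;> linarith
    rw [e1]
    have e3 := abs_add_le (X θ) (∑ u, φ θ u * b u - ∑ u, b u)
    have e4 := abs_le_weighted_sq (x := X θ) one_pos hτ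
    linarith
  have hX2 : avg (fun θ => X θ ^ 2) ≤ (M - 1) * β := by
    have e1 : ∀ θ, X θ ^ 2 = ∑ u, ∑ u', (φ θ u * φ θ u' - φ θ u - φ θ u' + 1) * (g u * g u') := by
      intro θ
      have : X θ = ∑ u, (φ θ u - 1) * g u := by
        simp only [hX, sub_mul, one_mul, Finset.sum_sub_distrib]
      rw [this, sq, Finset.sum_mul_sum]
      refine Finset.sum_congr rfl fun u _ => Finset.sum_congr rfl fun u' _ => ?_
      ring
    simp only [e1]
    rw [avg_sum]
    have e2 : ∀ u, avg (fun θ => ∑ u', (φ θ u * φ θ u' - φ θ u - φ θ u' + 1) * (g u * g u'))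
        = (M - 1) * g u * g u := by
      intro u
      rw [avg_sum]
      have e3 : ∀ u', avg (fun θ => (φ θ u * φ θ u' - φ θ u - φ θ u' + 1) * (g u * g u'))
          = ind (u = u') * ((M - 1) * g u * g u') := by
        intro u'
        rw [avg_mul_right, avg_add, avg_sub, avg_sub, hφ.corr, hφ.mean, hφ.mean, avg_const, coll]
        ring
      simp only [e3]
      rw [sum_ind_mul u (fun u' => ((M : ℝ) - 1) * g u * g u')]
    simp only [e2]
    calc ∑ u, (M - 1) * g u * g u ≤ ∑ u, ((M - 1) * β) * g u := by
          refine Finset.sum_le_sum fun u _ => ?_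
          refine mul_le_mul_of_nonneg_right ?_ (hg0 u)
          exact mul_le_mul_of_nonneg_left (hgβ u) (by linarith)
      _ = (M - 1) * β * ∑ u, g u := by rw [Finset.mul_sum]
      _ ≤ (M - 1) * β * 1 :=
          mul_le_mul_of_nonneg_left hgs (mul_nonneg (by linarith) hβ0)
      _ = _ := mul_one _
  refine (avg_mono h1).trans ?_
  rw [avg_add, avg_add, avg_div, avg_add, avg_div, avg_sum, avg_const, avg_const]
  have e5 : ∀ u, avg (fun θ => φ θ u * b u) = b u := by
    intro u; rw [avg_mul_right, hφ.mean, one_mul]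
  simp only [e5]
  have e6 : avg (fun θ => X θ ^ 2) / (τ * 1) ≤ (M - 1) * β / τ := by
    rw [mul_one]; exact div_le_div_of_nonneg_right hX2 hτ.le
  linarith

/-- Privacy amplification for one observation: a random key with `N` values and collision
probability `c u u' / N` splits the measure `Q` almost evenly. The scale `r` is free. -/
lemma avg_key_deviation_le {Ξ U 𝒦 : Type*} [Fintype Ξ] [Nonempty Ξ] [Fintype U] [Fintype 𝒦]
    (K : Ξ → U → 𝒦) {N : ℝ} (hN : 0 < N) (hcard : (Fintype.card 𝒦 : ℝ) = N) (c : U → U → ℝ)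
    (hc : ∀ u u', avg (fun ξ => ind (K ξ u = K ξ u')) = c u u' / N)
    (Q : U → ℝ) {r τ : ℝ} (hr : 0 ≤ r) (hτ : 0 < τ) (hr0 : r = 0 → ∀ u, Q u = 0) :
    avg (fun ξ => ∑ κ, |∑ u, Q u * ind (K ξ u = κ) - (∑ u, Q u) / N|) ≤
      (τ * r + (∑ u, ∑ u', Q u * Q u' * (c u u' - 1)) / (τ * r)) / 2 := by
  rcases hr.eq_or_lt with h0 | hr
  · have hQ := hr0 h0.symm
    simp [hQ, ← h0, avg_const]
  have hrN : 0 < r / N := div_pos hr hN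
  have hK : ∀ (ξ : Ξ) (f : U → ℝ), ∑ κ, ∑ u, f u * ind (K ξ u = κ) = ∑ u, f u := by
    intro ξ f
    rw [Finset.sum_comm]
    refine Finset.sum_congr rfl fun u _ => ?_
    rw [← Finset.mul_sum, sum_ind, mul_one]
  have h1 : ∀ ξ, ∑ κ, |∑ u, Q u * ind (K ξ u = κ) - (∑ u, Q u) / N| ≤
      (τ * r + (∑ u, ∑ u', Q u * Q u' * (N * ind (K ξ u = K ξ u') - 1)) / (τ * r)) / 2 := by
    intro ξ
    have e1 : ∑ κ, |∑ u, Q u * ind (K ξ u = κ) - (∑ u, Q u) / N| ≤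
        ∑ κ, (τ * (r / N) +
          (∑ u, Q u * ind (K ξ u = κ) - (∑ u, Q u) / N) ^ 2 / (τ * (r / N))) / 2 :=
      Finset.sum_le_sum fun κ _ => abs_le_weighted_sq hrN hτ
    refine e1.trans (le_of_eq ?_)
    rw [← Finset.sum_div, Finset.sum_add_distrib, ← Finset.sum_div]
    have e2 : ∑ κ, (∑ u, Q u * ind (K ξ u = κ) - (∑ u, Q u) / N) ^ 2
        = (∑ u, ∑ u', Q u * Q u' * (N * ind (K ξ u = K ξ u') - 1)) / N := by
      have e3 : ∀ κ, (∑ u, Q u * ind (K ξ u = κ) - (∑ u, Q u) / N) ^ 2 =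
          (∑ u, Q u * ind (K ξ u = κ)) ^ 2 - 2 * (∑ u, Q u) / N * (∑ u, Q u * ind (K ξ u = κ))
            + ((∑ u, Q u) / N) ^ 2 := by intro κ; ring
      simp only [e3]
      rw [Finset.sum_add_distrib, Finset.sum_sub_distrib, ← Finset.mul_sum, hK]
      have e4 : ∑ κ, (∑ u, Q u * ind (K ξ u = κ)) ^ 2
          = ∑ u, ∑ u', Q u * Q u' * ind (K ξ u = K ξ u') := by
        have : ∀ κ, (∑ u, Q u * ind (K ξ u = κ)) ^ 2
            = ∑ u, (Q u * ∑ u', Q u' * ind (K ξ u' = κ)) * ind (K ξ u = κ) := by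
          intro κ
          rw [sq, Finset.sum_mul]
          exact Finset.sum_congr rfl fun u _ => by ring
        simp only [this]
        rw [Finset.sum_comm]
        refine Finset.sum_congr rfl fun u _ => ?_
        rw [sum_mul_ind (K ξ u) (fun κ => Q u * ∑ u', Q u' * ind (K ξ u' = κ)), Finset.mul_sum]
        exact Finset.sum_congr rfl fun u' _ => by rw [ind_comm_eq]; ring
      have e5 : ∑ u, ∑ u', Q u * Q u' * (N * ind (K ξ u = K ξ u') - 1)
          = N * (∑ u, ∑ u', Q u * Q u' * ind (K ξ u = K ξ u')) - (∑ u, Q u) * ∑ u, Q u := by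
        rw [Finset.sum_mul_sum, Finset.mul_sum, ← Finset.sum_sub_distrib]
        refine Finset.sum_congr rfl fun u _ => ?_
        rw [Finset.mul_sum, ← Finset.sum_sub_distrib]
        exact Finset.sum_congr rfl fun u' _ => by ring
      rw [e4, e5, Finset.sum_const, Finset.card_univ, nsmul_eq_mul, hcard]
      field_simp
      ring
    rw [e2, Finset.sum_const, Finset.card_univ, nsmul_eq_mul, hcard]
    field_simp
  refine (avg_mono h1).trans (le_of_eq ?_)
  have e6 : ∀ u u', avg (fun ξ => Q u * Q u' * (N * ind (K ξ u = K ξ u') - 1))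
      = Q u * Q u' * (c u u' - 1) := by
    intro u u'
    rw [avg_mul_left, avg_sub, avg_mul_left, hc, avg_const]
    field_simp
  rw [avg_div, avg_add, avg_const, avg_div, avg_sum]
  simp only [avg_sum, e6]

/-! ### Patterns of superposition layers -/

/-- The sets of layers that can be determined jointly in the superposition structure: nothing,
`u₀`, `(u₀, u₁)`, `(u₀, u₂)`, or everything. -/
inductive Pat
  | none | zero | one | two | all
  deriving DecidableEq

namespace Pat

instance : Fintype Pat := ⟨{none, zero, one, two, all}, fun D => by cases D <;> simp⟩

/-- Inclusion of sets of layers. -/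
def Le : Pat → Pat → Prop
  | none, _ => True
  | zero, none => False
  | zero, _ => True
  | one, one => True
  | one, all => True
  | one, _ => False
  | two, two => True
  | two, all => True
  | two, _ => False
  | all, all => True
  | all, _ => False

/-- The product of the sizes attached to the layers of a pattern. -/
def wt {R : Type*} [MulOneClass R] (m₀ m₁ m₂ : R) : Pat → R
  | none => 1
  | zero => m₀
  | one => m₀ * m₁
  | two => m₀ * m₂
  | all => m₀ * m₁ * m₂

/-- The sum of the quantities attached to the layers of a pattern. -/
def sm (r₀ r₁ r₂ : ℝ) : Pat → ℝ
  | none => 0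
  | zero => r₀
  | one => r₀ + r₁
  | two => r₀ + r₂
  | all => r₀ + r₁ + r₂

/-- Two triples agree on the layers of a pattern. -/
def Agr {U₀ U₁ U₂ : Type*} : Pat → U₀ × U₁ × U₂ → U₀ × U₁ × U₂ → Prop
  | none, _, _ => True
  | zero, u, u' => u.1 = u'.1
  | one, u, u' => u.1 = u'.1 ∧ u.2.1 = u'.2.1
  | two, u, u' => u.1 = u'.1 ∧ u.2.2 = u'.2.2
  | all, u, u' => u.1 = u'.1 ∧ u.2.1 = u'.2.1 ∧ u.2.2 = u'.2.2

/-- The layers of a pattern as a random variable; the missing layers are masked, so that its values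
lie in one type for all patterns. -/
def proj {U₀ U₁ U₂ : Type*} : Pat → U₀ × U₁ × U₂ → Option U₀ × Option U₁ × Option U₂
  | none, _ => (Option.none, Option.none, Option.none)
  | zero, u => (some u.1, Option.none, Option.none)
  | one, u => (some u.1, some u.2.1, Option.none)
  | two, u => (some u.1, Option.none, some u.2.2)
  | all, u => (some u.1, some u.2.1, some u.2.2)

lemma proj_eq_iff {U₀ U₁ U₂ : Type*} (D : Pat) (u u' : U₀ × U₁ × U₂) :
    D.proj u = D.proj u' ↔ D.Agr u u' := by
  cases D <;> simp [proj, Agr]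

lemma agr_refl {U₀ U₁ U₂ : Type*} (D : Pat) (u : U₀ × U₁ × U₂) : D.Agr u u :=
  (proj_eq_iff D u u).1 rfl

lemma agr_comm {U₀ U₁ U₂ : Type*} (D : Pat) (u u' : U₀ × U₁ × U₂) : D.Agr u u' ↔ D.Agr u' u := by
  rw [← proj_eq_iff, ← proj_eq_iff, eq_comm]

lemma wt_cast (m₀ m₁ m₂ : ℕ) (D : Pat) :
    ((D.wt m₀ m₁ m₂ : ℕ) : ℝ) = D.wt (m₀ : ℝ) m₁ m₂ := by
  cases D <;> simp [wt]

lemma wt_pos {m₀ m₁ m₂ : ℕ} (h₀ : 0 < m₀) (h₁ : 0 < m₁) (h₂ : 0 < m₂) (D : Pat) :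
    0 < D.wt (m₀ : ℝ) m₁ m₂ := by
  cases D <;> simp only [wt] <;> positivity

lemma one_le_wt {m₀ m₁ m₂ : ℕ} (h₀ : 0 < m₀) (h₁ : 0 < m₁) (h₂ : 0 < m₂) (D : Pat) :
    1 ≤ D.wt (m₀ : ℝ) m₁ m₂ := by
  rw [← wt_cast]
  have : 0 < D.wt m₀ m₁ m₂ := by cases D <;> simp only [wt] <;> positivity
  exact_mod_cast this

end Pat

section coll3

variable {U₀ U₁ U₂ : Type*}

/-- The joint collision weight of three random functions, of `u₀`, of `(u₀, u₁)` and of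
`(u₀, u₂)`. -/
def coll3 (n₀ n₁ n₂ : ℕ) (u u' : U₀ × U₁ × U₂) : ℝ :=
  coll n₀ u.1 u'.1 * coll n₁ (u.1, u.2.1) (u'.1, u'.2.1) * coll n₂ (u.1, u.2.2) (u'.1, u'.2.2)

/-- Joint collisions depend only on the set of layers on which the triples agree. -/
lemma exists_pat_agr (u u' : U₀ × U₁ × U₂) :
    ∃ D : Pat, D.Agr u u' ∧ (∀ n₀ n₁ n₂ : ℕ, coll3 n₀ n₁ n₂ u u' = D.wt (n₀ : ℝ) n₁ n₂) ∧
      ∀ A : Pat, A.Agr u u' → A.Le D := by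
  obtain ⟨x₀, x₁, x₂⟩ := u
  obtain ⟨y₀, y₁, y₂⟩ := u'
  by_cases h₀ : x₀ = y₀
  · subst h₀
    by_cases h₁ : x₁ = y₁
    · subst h₁
      by_cases h₂ : x₂ = y₂
      · subst h₂
        exact ⟨.all, Pat.agr_refl _ _, fun _ _ _ => by simp [coll3, coll_self, Pat.wt],
          fun A _ => by cases A <;> trivial⟩
      · exact ⟨.one, by simp [Pat.Agr],
          fun _ _ _ => by simp [coll3, coll_self, Pat.wt, coll_ne, h₂],
          fun A hA => by cases A <;> simp_all [Pat.Le, Pat.Agr]⟩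
    · by_cases h₂ : x₂ = y₂
      · subst h₂
        exact ⟨.two, by simp [Pat.Agr],
          fun _ _ _ => by simp [coll3, coll_self, Pat.wt, coll_ne, h₁],
          fun A hA => by cases A <;> simp_all [Pat.Le, Pat.Agr]⟩
      · exact ⟨.zero, by simp [Pat.Agr],
          fun _ _ _ => by simp [coll3, coll_self, Pat.wt, coll_ne, h₁, h₂],
          fun A hA => by cases A <;> simp_all [Pat.Le, Pat.Agr]⟩
  · exact ⟨.none, by simp [Pat.Agr],
      fun _ _ _ => by simp [coll3, Pat.wt, coll_ne, h₀],
      fun A hA => by cases A <;> simp_all [Pat.Le, Pat.Agr]⟩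

lemma one_le_coll3 {n₀ n₁ n₂ : ℕ} (h₀ : 0 < n₀) (h₁ : 0 < n₁) (h₂ : 0 < n₂)
    (u u' : U₀ × U₁ × U₂) : 1 ≤ coll3 n₀ n₁ n₂ u u' := by
  obtain ⟨D, -, h, -⟩ := exists_pat_agr u u'
  rw [h]; exact Pat.one_le_wt h₀ h₁ h₂ D

/-- If the keys of the layers in `A` are trivial, the excess collision weight of pairs agreeing on
`A` is carried by the patterns containing `A`. -/
lemma ind_agr_mul_coll3_le {n₀ n₁ n₂ M₀ M₁ M₂ : ℕ} (hn₀ : 0 < n₀) (hn₁ : 0 < n₁) (hn₂ : 0 < n₂)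
    (A : Pat) (u u' : U₀ × U₁ × U₂) :
    ind (A.Agr u u') * (coll3 n₀ n₁ n₂ u u' - 1) * coll3 M₀ M₁ M₂ u u' ≤
      ∑ D : Pat, ind (A.Le D) * ((D.wt (n₀ : ℝ) n₁ n₂ - 1) * D.wt (M₀ : ℝ) M₁ M₂) *
        ind (D.Agr u u') := by
  have hterm : ∀ D : Pat, 0 ≤ ind (A.Le D) * ((D.wt (n₀ : ℝ) n₁ n₂ - 1) * D.wt (M₀ : ℝ) M₁ M₂) *
        ind (D.Agr u u') := by
    intro D
    have h1 := Pat.one_le_wt hn₀ hn₁ hn₂ D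
    have h2 : 0 ≤ D.wt (M₀ : ℝ) M₁ M₂ := by rw [← Pat.wt_cast]; positivity
    exact mul_nonneg (mul_nonneg (ind_nonneg _) (mul_nonneg (by linarith) h2)) (ind_nonneg _)
  obtain ⟨D, hD, hc, hA⟩ := exists_pat_agr u u'
  by_cases h : A.Agr u u'
  · refine le_trans (le_of_eq ?_) (Finset.single_le_sum (fun D _ => hterm D) (Finset.mem_univ D))
    rw [hc, hc, ind_of h, ind_of hD, ind_of (hA A h)]
    ring
  · rw [ind_of_not h, zero_mul, zero_mul]
    exact Finset.sum_nonneg fun D _ => hterm D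

end coll3

/-! ### One-shot model of the auxiliary layers and the channel -/

/-- A one-shot state `s`, superposed auxiliary layers `u = (u₀, u₁, u₂)` with `u₁` and `u₂`
conditionally independent given `(s, u₀)`, and a joint channel output `y`. -/
structure Model (S U₀ U₁ U₂ Y : Type*) [Fintype S] [Fintype U₀] [Fintype U₁] [Fintype U₂]
    [Fintype Y] where
  a : S → ℝ
  k₀ : S → U₀ → ℝ
  k₁ : S → U₀ → U₁ → ℝ
  k₂ : S → U₀ → U₂ → ℝ
  V : S → U₀ × U₁ × U₂ → Y → ℝ
  a_nonneg : ∀ s, 0 ≤ a s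
  k₀_nonneg : ∀ s u, 0 ≤ k₀ s u
  k₁_nonneg : ∀ s u v, 0 ≤ k₁ s u v
  k₂_nonneg : ∀ s u v, 0 ≤ k₂ s u v
  V_nonneg : ∀ s u y, 0 ≤ V s u y
  a_sum : ∑ s, a s = 1
  k₀_sum : ∀ s, ∑ u, k₀ s u = 1
  k₁_sum : ∀ s u, ∑ v, k₁ s u v = 1
  k₂_sum : ∀ s u, ∑ v, k₂ s u v = 1
  V_sum : ∀ s u, ∑ y, V s u y = 1

namespace Model

variable {S U₀ U₁ U₂ Y : Type*} [Fintype S] [Fintype U₀] [Fintype U₁] [Fintype U₂] [Fintype Y]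
  (m : Model S U₀ U₁ U₂ Y)

/-- The joint law of the layers and the state. -/
def R (s : S) (u : U₀ × U₁ × U₂) : ℝ :=
  m.a s * m.k₀ s u.1 * m.k₁ s u.1 u.2.1 * m.k₂ s u.1 u.2.2

/-- The joint law of state, layers and output. -/
def P (s : S) (u : U₀ × U₁ × U₂) (y : Y) : ℝ := m.R s u * m.V s u y

lemma R_nonneg (s : S) (u : U₀ × U₁ × U₂) : 0 ≤ m.R s u :=
  mul_nonneg (mul_nonneg (mul_nonneg (m.a_nonneg _) (m.k₀_nonneg _ _)) (m.k₁_nonneg _ _ _))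
    (m.k₂_nonneg _ _ _)

lemma P_nonneg (s : S) (u : U₀ × U₁ × U₂) (y : Y) : 0 ≤ m.P s u y :=
  mul_nonneg (m.R_nonneg s u) (m.V_nonneg _ _ _)

lemma sum_P (s : S) (u : U₀ × U₁ × U₂) : ∑ y, m.P s u y = m.R s u := by
  simp only [P, ← Finset.mul_sum, m.V_sum, mul_one]

lemma sum_R : ∑ s, ∑ u, m.R s u = 1 := by
  have h : ∀ s, ∑ u, m.R s u = m.a s := by
    intro s
    simp only [R, Fintype.sum_prod_type, mul_assoc, ← Finset.mul_sum, m.k₂_sum, m.k₁_sum,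
      m.k₀_sum, mul_one]
  simp only [h, m.a_sum]

/-- The joint law of the layers and a function `out` of the output, restricted to the event `G`. -/
def obs {O : Type*} (G : S → U₀ × U₁ × U₂ → Y → Prop) (out : Y → O) (u : U₀ × U₁ × U₂) (z : O) :
    ℝ :=
  ∑ s, ∑ y, m.P s u y * ind (G s u y) * ind (out y = z)

/-- The joint law of the layers in `D` and a function `out` of the output. -/
def obsPat {O : Type*} (D : Pat) (out : Y → O) (u : U₀ × U₁ × U₂) (z : O) : ℝ :=
  ∑ u', m.obs (fun _ _ _ => True) out u' z * ind (D.Agr u' u)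

variable {O : Type*} (G : S → U₀ × U₁ × U₂ → Y → Prop) (out : Y → O)

lemma obs_nonneg (u : U₀ × U₁ × U₂) (z : O) : 0 ≤ m.obs G out u z :=
  Finset.sum_nonneg fun _ _ => Finset.sum_nonneg fun _ _ =>
    mul_nonneg (mul_nonneg (m.P_nonneg _ _ _) (ind_nonneg _)) (ind_nonneg _)

lemma obs_le (u : U₀ × U₁ × U₂) (z : O) :
    m.obs G out u z ≤ m.obs (fun _ _ _ => True) out u z :=
  Finset.sum_le_sum fun _ _ => Finset.sum_le_sum fun _ _ =>
    mul_le_mul_of_nonneg_right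
      (mul_le_mul_of_nonneg_left (ind_mono fun _ => trivial) (m.P_nonneg _ _ _)) (ind_nonneg _)

lemma sum_obs_true [Fintype O] :
    ∑ u, ∑ z, m.obs (fun _ _ _ => True) out u z = 1 := by
  have h : ∀ u, ∑ z, m.obs (fun _ _ _ => True) out u z = ∑ s, m.R s u := by
    intro u
    simp only [obs, ind_true, mul_one]
    rw [Finset.sum_comm]
    refine Finset.sum_congr rfl fun s _ => ?_
    rw [Finset.sum_comm, ← m.sum_P]
    refine Finset.sum_congr rfl fun y _ => ?_
    rw [← Finset.mul_sum, sum_ind, mul_one]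
  simp only [h]
  rw [Finset.sum_comm, m.sum_R]

lemma sum_obs_le_one [Fintype O] : ∑ u, ∑ z, m.obs G out u z ≤ 1 := by
  rw [← m.sum_obs_true out]
  exact Finset.sum_le_sum fun _ _ => Finset.sum_le_sum fun _ _ => m.obs_le G out _ _

lemma obsPat_nonneg (D : Pat) (u : U₀ × U₁ × U₂) (z : O) : 0 ≤ m.obsPat D out u z :=
  Finset.sum_nonneg fun _ _ => mul_nonneg (m.obs_nonneg _ _ _ _) (ind_nonneg _)

lemma sum_obs_agr_le (D : Pat) (u : U₀ × U₁ × U₂) (z : O) :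
    ∑ u', ind (D.Agr u u') * m.obs G out u' z ≤ m.obsPat D out u z := by
  refine Finset.sum_le_sum fun u' _ => ?_
  rw [mul_comm, ind_congr (Pat.agr_comm D u u')]
  exact mul_le_mul_of_nonneg_right (m.obs_le G out u' z) (ind_nonneg _)

lemma obs_le_obsPat (D : Pat) (u : U₀ × U₁ × U₂) (z : O) : m.obs G out u z ≤ m.obsPat D out u z := by
  refine le_trans ?_ (m.sum_obs_agr_le G out D u z)
  refine le_trans (le_of_eq ?_) (Finset.single_le_sum (fun u' _ =>
    mul_nonneg (ind_nonneg _) (m.obs_nonneg G out u' z)) (Finset.mem_univ u))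
  rw [ind_of (D.agr_refl u), one_mul]

/-- The second-moment cost of a secrecy test with observation `(u_A, out y)`, before averaging over
the bins; `n₀, n₁, n₂` are the key sizes, and `c` the collision weight of the bins. -/
def pairSum [Fintype O] (A : Pat) (n₀ n₁ n₂ : ℕ)
    (c : U₀ × U₁ × U₂ → U₀ × U₁ × U₂ → ℝ) (mA : ℝ) : ℝ :=
  ∑ z, ∑ u, ∑ u', c u u' * (ind (A.Agr u u') * (coll3 n₀ n₁ n₂ u u' - 1) *
    (m.obs G out u z * m.obs G out u' z / (mA * m.obsPat A out u z)))

/-- The sizes `n` of the keys and `M` of the bins pass the secrecy test with observation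
`(u_A, out y)` up to `ε`: on the event `G`, the conditional probability of the layers in `D` given
the observation is small compared to the product of these sizes. -/
def PassesTest (A : Pat) (n₀ n₁ n₂ M₀ M₁ M₂ : ℕ) (ε : ℝ) : Prop :=
  ∀ D : Pat, A.Le D → ∀ s u y, G s u y →
    (D.wt (n₀ : ℝ) n₁ n₂ - 1) * D.wt (M₀ : ℝ) M₁ M₂ * m.obsPat D out u (out y) ≤
      ε * (A.wt (M₀ : ℝ) M₁ M₂ * m.obsPat A out u (out y))

/-- Pairs that agree exactly on the layers in `D` contribute at most `ε` to the cost: this is the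
condition on `D` in `PassesTest`. -/
lemma pairSum_le [Fintype O] {A : Pat} {n₀ n₁ n₂ M₀ M₁ M₂ : ℕ} (hn₀ : 0 < n₀) (hn₁ : 0 < n₁)
    (hn₂ : 0 < n₂) (hM₀ : 0 < M₀) (hM₁ : 0 < M₁) (hM₂ : 0 < M₂) {ε : ℝ} (hε : 0 ≤ ε)
    (hG : m.PassesTest G out A n₀ n₁ n₂ M₀ M₁ M₂ ε) :
    m.pairSum G out A n₀ n₁ n₂ (coll3 M₀ M₁ M₂) (A.wt (M₀ : ℝ) M₁ M₂) ≤ 5 * ε := by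
  have hMA := Pat.wt_pos hM₀ hM₁ hM₂ A
  set b : O → U₀ × U₁ × U₂ → U₀ × U₁ × U₂ → ℝ := fun z u u' =>
    m.obs G out u z * m.obs G out u' z / (A.wt (M₀ : ℝ) M₁ M₂ * m.obsPat A out u z) with hb
  have hb0 : ∀ z u u', 0 ≤ b z u u' := fun z u u' =>
    div_nonneg (mul_nonneg (m.obs_nonneg _ _ _ _) (m.obs_nonneg _ _ _ _))
      (mul_nonneg hMA.le (m.obsPat_nonneg _ _ _ _))
  set w : Pat → ℝ := fun D => ind (A.Le D) *
    ((D.wt (n₀ : ℝ) n₁ n₂ - 1) * D.wt (M₀ : ℝ) M₁ M₂) with hw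
  have hw0 : ∀ D, 0 ≤ w D := fun D => mul_nonneg (ind_nonneg _)
    (mul_nonneg (by linarith [Pat.one_le_wt hn₀ hn₁ hn₂ D]) (Pat.wt_pos hM₀ hM₁ hM₂ D).le)
  have h1 : m.pairSum G out A n₀ n₁ n₂ (coll3 M₀ M₁ M₂) (A.wt (M₀ : ℝ) M₁ M₂) ≤
      ∑ z, ∑ u, ∑ u', ∑ D, w D * ind (D.Agr u u') * b z u u' := by
    refine Finset.sum_le_sum fun z _ => Finset.sum_le_sum fun u _ =>
      Finset.sum_le_sum fun u' _ => ?_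
    rw [← Finset.sum_mul, ← mul_assoc, mul_comm (coll3 M₀ M₁ M₂ u u')]
    exact mul_le_mul_of_nonneg_right (ind_agr_mul_coll3_le hn₀ hn₁ hn₂ A u u') (hb0 z u u')
  have h2 : ∀ z u D, ∑ u', w D * ind (D.Agr u u') * b z u u' ≤ ε * m.obs G out u z := by
    intro z u D
    by_cases hz : m.obs G out u z = 0
    · simp [hb, hz]
    have hpos : 0 < m.obs G out u z := lt_of_le_of_ne (m.obs_nonneg _ _ _ _) (Ne.symm hz)
    have hA : 0 < A.wt (M₀ : ℝ) M₁ M₂ * m.obsPat A out u z :=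
      mul_pos hMA (hpos.trans_le (m.obs_le_obsPat G out A u z))
    have e1 : ∑ u', w D * ind (D.Agr u u') * b z u u' =
        m.obs G out u z * (w D * (∑ u', ind (D.Agr u u') * m.obs G out u' z)) /
          (A.wt (M₀ : ℝ) M₁ M₂ * m.obsPat A out u z) := by
      rw [Finset.mul_sum, Finset.mul_sum, Finset.sum_div]
      refine Finset.sum_congr rfl fun u' _ => ?_
      simp only [hb]; ring
    rw [e1, div_le_iff₀ hA]
    have e2 : w D * (∑ u', ind (D.Agr u u') * m.obs G out u' z) ≤ w D * m.obsPat D out u z :=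
      mul_le_mul_of_nonneg_left (m.sum_obs_agr_le G out D u z) (hw0 D)
    have e3 : w D * m.obsPat D out u z ≤ ε * (A.wt (M₀ : ℝ) M₁ M₂ * m.obsPat A out u z) := by
      by_cases hD : A.Le D
      · obtain ⟨s, y, hsy, rfl⟩ : ∃ s y, G s u y ∧ out y = z := by
          by_contra hcon
          push Not at hcon
          refine hz (Finset.sum_eq_zero fun s _ => Finset.sum_eq_zero fun y _ => ?_)
          by_cases h : G s u y
          · rw [ind_of_not (hcon s y h), mul_zero]
          · rw [ind_of_not h, mul_zero, zero_mul]
        simp only [hw, ind_of hD, one_mul]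
        exact hG D hD s u y hsy
      · simp only [hw, ind_of_not hD, zero_mul]
        positivity
    nlinarith [mul_le_mul_of_nonneg_left (e2.trans e3) hpos.le]
  have h3 : ∀ z u, ∑ u', ∑ D, w D * ind (D.Agr u u') * b z u u' ≤ 5 * ε * m.obs G out u z := by
    intro z u
    rw [Finset.sum_comm]
    calc _ ≤ ∑ _D : Pat, ε * m.obs G out u z := Finset.sum_le_sum fun D _ => h2 z u D
      _ = _ := by
        rw [Finset.sum_const, Finset.card_univ, show Fintype.card Pat = 5 from rfl, nsmul_eq_mul]
        push_cast; ring
  refine h1.trans ?_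
  calc _ ≤ ∑ z, ∑ u, 5 * ε * m.obs G out u z :=
        Finset.sum_le_sum fun z _ => Finset.sum_le_sum fun u _ => h3 z u
    _ = 5 * ε * ∑ u, ∑ z, m.obs G out u z := by
        rw [Finset.sum_comm, Finset.mul_sum]
        exact Finset.sum_congr rfl fun u _ => by rw [Finset.mul_sum]
    _ ≤ 5 * ε * 1 := mul_le_mul_of_nonneg_left (m.sum_obs_le_one G out) (by positivity)
    _ = _ := mul_one _

end Model

/-! ### Choice of the bins -/

section ambiguity

variable {U₀ U₁ Y₁ : Type*} [Fintype U₀] [Fintype U₁]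

/-- The number of pairs `(v₀, v₁) ≠ (u₀, u₁)` in the bins `b₀`, `b₁` that the receiver, who keeps the
pairs in `T` given `y`, confuses with `(u₀, u₁)`. -/
def ambiguity (b₀ : U₀ → ℝ) (b₁ : U₀ × U₁ → ℝ) (M₀ M₁ : ℕ) (T : U₀ → U₁ → Y₁ → Prop)
    (u : U₀ × U₁) (y : Y₁) : ℝ :=
  ∑ v : U₀ × U₁, ind (v ≠ u) * ind (T v.1 v.2 y) * (b₀ v.1 * b₁ v / (M₀ * M₁))

lemma ambiguity_nonneg {b₀ : U₀ → ℝ} {b₁ : U₀ × U₁ → ℝ} (h₀ : ∀ u, 0 ≤ b₀ u) (h₁ : ∀ u, 0 ≤ b₁ u)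
    (M₀ M₁ : ℕ) (T : U₀ → U₁ → Y₁ → Prop) (u : U₀ × U₁) (y : Y₁) :
    0 ≤ ambiguity b₀ b₁ M₀ M₁ T u y :=
  Finset.sum_nonneg fun _ _ => mul_nonneg (mul_nonneg (ind_nonneg _) (ind_nonneg _))
    (div_nonneg (mul_nonneg (h₀ _) (h₁ _)) (by positivity))

lemma sum_coll_le {M₀ M₁ : ℕ} (hM₀ : 0 < M₀) (hM₁ : 0 < M₁) (T : U₀ → U₁ → Y₁ → Prop)
    (u : U₀ × U₁) (y : Y₁) {ε : ℝ}
    (h01 : ∑ v : U₀ × U₁, ind (T v.1 v.2 y) ≤ ε * (M₀ * M₁))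
    (h1 : ∑ v₁, ind (T u.1 v₁ y) ≤ ε * M₁) :
    ∑ v : U₀ × U₁, ind (v ≠ u) * ind (T v.1 v.2 y) *
      (coll M₀ u.1 v.1 * coll M₁ u v / (M₀ * M₁)) ≤ 2 * ε := by
  have hM₀' : (0 : ℝ) < M₀ := by exact_mod_cast hM₀
  have hM₁' : (0 : ℝ) < M₁ := by exact_mod_cast hM₁
  have hpt : ∀ v : U₀ × U₁, ind (v ≠ u) * ind (T v.1 v.2 y) *
      (coll M₀ u.1 v.1 * coll M₁ u v / (M₀ * M₁)) ≤
      ind (T v.1 v.2 y) / (M₀ * M₁) + ind (u.1 = v.1) * (ind (T v.1 v.2 y) / M₁) := by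
    intro v
    have hT := ind_nonneg (T v.1 v.2 y)
    by_cases hv : v = u
    · rw [ind_of_not (by simpa using hv), zero_mul, zero_mul]
      have := ind_nonneg (u.1 = v.1)
      positivity
    · rw [ind_of hv, coll_ne M₁ (Ne.symm hv)]
      by_cases h0 : u.1 = v.1
      · rw [h0, coll_self, ind_of rfl]
        have : 1 * ind (T v.1 v.2 y) * ((M₀ : ℝ) * 1 / (M₀ * M₁)) = 1 * (ind (T v.1 v.2 y) / M₁) := by
          field_simp
        rw [this]
        have : 0 ≤ ind (T v.1 v.2 y) / (M₀ * M₁) := by positivity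
        linarith
      · rw [coll_ne M₀ h0, ind_of_not h0]
        apply le_of_eq; ring
  refine (Finset.sum_le_sum fun v _ => hpt v).trans ?_
  rw [Finset.sum_add_distrib, ← Finset.sum_div]
  have e1 : (∑ v : U₀ × U₁, ind (T v.1 v.2 y)) / (M₀ * M₁) ≤ ε := by
    rw [div_le_iff₀ (by positivity)]; exact h01
  have e2 : ∑ v : U₀ × U₁, ind (u.1 = v.1) * (ind (T v.1 v.2 y) / M₁) =
      (∑ v₁, ind (T u.1 v₁ y)) / M₁ := by
    rw [Fintype.sum_prod_type]
    simp only [← Finset.mul_sum, ← Finset.sum_div]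
    rw [sum_ind_mul u.1 (fun v₀ => (∑ v₁, ind (T v₀ v₁ y)) / (M₁ : ℝ))]
  have e3 : (∑ v₁, ind (T u.1 v₁ y)) / M₁ ≤ ε := by
    rw [div_le_iff₀ hM₁']; exact h1
  rw [e2]; linarith

end ambiguity

namespace Model

variable {S U₀ U₁ U₂ Y : Type*} [Fintype S] [Fintype U₀] [Fintype U₁] [Fintype U₂] [Fintype Y]
  (m : Model S U₀ U₁ U₂ Y)
  {Y₁ Y₂ : Type*} (y₁ : Y → Y₁) (y₂ : Y → Y₂)

/-- The joint weight of three bins at `u = (u₀, u₁, u₂)`. -/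
def binWt (b₀ : U₀ → ℝ) (b₁ : U₀ × U₁ → ℝ) (b₂ : U₀ × U₂ → ℝ) (u : U₀ × U₁ × U₂) : ℝ :=
  b₀ u.1 * b₁ (u.1, u.2.1) * b₂ (u.1, u.2.2)

/-- The cost of `(s, u)`: the probability of leaving `G` plus the expected ambiguities of those
receivers that decode by typicality, which are the receivers `j` with `¬ sel j`. -/
def badness (G : S → U₀ × U₁ × U₂ → Y → Prop) (sel₁ sel₂ : Prop)
    (M₀ M₁ M₂ : ℕ) (T₁ : U₀ → U₁ → Y₁ → Prop) (T₂ : U₀ → U₂ → Y₂ → Prop)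
    (b₀ : U₀ → ℝ) (b₁ : U₀ × U₁ → ℝ) (b₂ : U₀ × U₂ → ℝ) (s : S) (u : U₀ × U₁ × U₂) : ℝ :=
  ∑ y, m.V s u y * (ind (¬G s u y) +
    ind (¬sel₁) * ambiguity b₀ b₁ M₀ M₁ T₁ (u.1, u.2.1) (y₁ y) +
    ind (¬sel₂) * ambiguity b₀ b₂ M₀ M₂ T₂ (u.1, u.2.2) (y₂ y))

lemma badness_nonneg {G : S → U₀ × U₁ × U₂ → Y → Prop} {sel₁ sel₂ : Prop}
    {M₀ M₁ M₂ : ℕ} {T₁ : U₀ → U₁ → Y₁ → Prop} {T₂ : U₀ → U₂ → Y₂ → Prop}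
    {b₀ : U₀ → ℝ} {b₁ : U₀ × U₁ → ℝ} {b₂ : U₀ × U₂ → ℝ} (h₀ : ∀ u, 0 ≤ b₀ u)
    (h₁ : ∀ u, 0 ≤ b₁ u) (h₂ : ∀ u, 0 ≤ b₂ u) (s : S) (u : U₀ × U₁ × U₂) :
    0 ≤ m.badness y₁ y₂ G sel₁ sel₂ M₀ M₁ M₂ T₁ T₂ b₀ b₁ b₂ s u :=
  Finset.sum_nonneg fun _ _ => mul_nonneg (m.V_nonneg _ _ _)
    (add_nonneg (add_nonneg (ind_nonneg _)
      (mul_nonneg (ind_nonneg _) (ambiguity_nonneg h₀ h₁ _ _ _ _ _)))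
      (mul_nonneg (ind_nonneg _) (ambiguity_nonneg h₀ h₂ _ _ _ _ _)))

/-- The covering cost of the first layer. -/
def cov₀ (b₀ : U₀ → ℝ) : ℝ := ∑ s, m.a s * |∑ u, b₀ u * m.k₀ s u - 1|

/-- The covering cost of the second layer of receiver 1. -/
def cov₁ (b₀ : U₀ → ℝ) (b₁ : U₀ × U₁ → ℝ) : ℝ :=
  ∑ s, ∑ u, m.a s * (b₀ u * m.k₀ s u) * |∑ v, b₁ (u, v) * m.k₁ s u v - 1|

/-- The covering cost of the second layer of receiver 2. -/
def cov₂ (b₀ : U₀ → ℝ) (b₂ : U₀ × U₂ → ℝ) : ℝ :=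
  ∑ s, ∑ u, m.a s * (b₀ u * m.k₀ s u) * |∑ v, b₂ (u, v) * m.k₂ s u v - 1|

/-- The total weight of the reference measure used in a secrecy test. -/
def refMass (b₀ : U₀ → ℝ) (b₁ : U₀ × U₁ → ℝ) (b₂ : U₀ × U₂ → ℝ) (A : Pat) : ℝ :=
  ∑ s, ∑ u, m.R s u * A.wt (b₀ u.1) (b₁ (u.1, u.2.1)) (b₂ (u.1, u.2.2))

section bins

variable {Θ₀ Θ₁ Θ₂ : Type*} [Fintype Θ₀] [Fintype Θ₁] [Fintype Θ₂] [Nonempty Θ₀] [Nonempty Θ₁]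
  [Nonempty Θ₂] {M₀ M₁ M₂ : ℕ} {φ₀ : Θ₀ → U₀ → ℝ} {φ₁ : Θ₁ → U₀ × U₁ → ℝ} {φ₂ : Θ₂ → U₀ × U₂ → ℝ}

lemma sum_R_of_fst (f : S → U₀ → ℝ) : ∑ s, ∑ u, m.R s u * f s u.1
    = ∑ s, m.a s * ∑ u₀, m.k₀ s u₀ * f s u₀ := by
  refine Finset.sum_congr rfl fun s _ => ?_
  simp only [R, Fintype.sum_prod_type, mul_assoc, Finset.mul_sum]
  refine Finset.sum_congr rfl fun u _ => ?_
  have : ∀ v w, m.a s * (m.k₀ s u * (m.k₁ s u v * (m.k₂ s u w * f s u)))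
      = (m.a s * m.k₀ s u * f s u) * (m.k₁ s u v * m.k₂ s u w) := by intros; ring
  simp only [this, ← Finset.mul_sum, m.k₂_sum, m.k₁_sum, mul_one]
  ring

lemma sum_R_of_one (f : S → U₀ → U₁ → ℝ) : ∑ s, ∑ u, m.R s u * f s u.1 u.2.1
    = ∑ s, ∑ u₀, m.a s * m.k₀ s u₀ * ∑ u₁, m.k₁ s u₀ u₁ * f s u₀ u₁ := by
  refine Finset.sum_congr rfl fun s _ => ?_
  simp only [R, Fintype.sum_prod_type, mul_assoc, Finset.mul_sum]
  refine Finset.sum_congr rfl fun u _ => Finset.sum_congr rfl fun v _ => ?_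
  have : ∀ w, m.a s * (m.k₀ s u * (m.k₁ s u v * (m.k₂ s u w * f s u v)))
      = (m.a s * m.k₀ s u * m.k₁ s u v * f s u v) * (m.k₂ s u w) := by intros; ring
  simp only [this, ← Finset.mul_sum, m.k₂_sum, mul_one]
  ring

lemma sum_R_of_two (f : S → U₀ → U₂ → ℝ) : ∑ s, ∑ u, m.R s u * f s u.1 u.2.2
    = ∑ s, ∑ u₀, m.a s * m.k₀ s u₀ * ∑ u₂, m.k₂ s u₀ u₂ * f s u₀ u₂ := by
  refine Finset.sum_congr rfl fun s _ => ?_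
  simp only [R, Fintype.sum_prod_type, mul_assoc, Finset.mul_sum]
  refine Finset.sum_congr rfl fun u _ => ?_
  rw [Finset.sum_comm]
  refine Finset.sum_congr rfl fun v _ => ?_
  have : ∀ w, m.a s * (m.k₀ s u * (m.k₁ s u w * (m.k₂ s u v * f s u v)))
      = (m.a s * m.k₀ s u * m.k₂ s u v * f s u v) * (m.k₁ s u w) := by intros; ring
  simp only [this, ← Finset.mul_sum, m.k₁_sum, mul_one]
  ring

lemma sum_R_not_le {G : S → U₀ × U₁ × U₂ → Y → Prop} {ε : ℝ}
    (hG : ∑ s, ∑ u, ∑ y, m.P s u y * ind (¬G s u y) ≤ ε) (T : S → U₀ × U₁ × U₂ → Prop)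
    (hT : ∀ s u y, G s u y → T s u) : ∑ s, ∑ u, m.R s u * ind (¬T s u) ≤ ε := by
  refine le_trans (Finset.sum_le_sum fun s _ => Finset.sum_le_sum fun u _ => ?_) hG
  rw [← m.sum_P, Finset.sum_mul]
  exact Finset.sum_le_sum fun y _ => mul_le_mul_of_nonneg_left
    (ind_mono fun h h' => h (hT s u y h')) (m.P_nonneg _ _ _)

lemma cover_bound {ε M β p : ℝ} (hε : 0 < ε) (hβ : (M - 1) * β ≤ ε ^ 2) :
    2 * p + (ε + (M - 1) * β / ε) / 2 ≤ 2 * p + ε := by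
  have : (M - 1) * β / ε ≤ ε := by rw [div_le_iff₀ hε]; nlinarith
  linarith

/-- Random bins of `u₀` cover: by the second moment method, the weight of the bin given the state is
close to one, as long as `M₀` times the typical probability of `u₀` is small. -/
lemma avg_cov₀_le (h₀ : IsBinning M₀ φ₀) (hM₀ : 0 < M₀) {G : S → U₀ × U₁ × U₂ → Y → Prop}
    {ε β : ℝ} (hε : 0 < ε) (hG : ∑ s, ∑ u, ∑ y, m.P s u y * ind (¬G s u y) ≤ ε) (hβ0 : 0 ≤ β)
    (hk : ∀ s u y, G s u y → m.k₀ s u.1 ≤ β) (hβ : (M₀ - 1) * β ≤ ε ^ 2) :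
    avg (fun θ => m.cov₀ (φ₀ θ)) ≤ 3 * ε := by
  have hT := m.sum_R_not_le hG (fun s u => m.k₀ s u.1 ≤ β) hk
  rw [m.sum_R_of_fst (fun s u => ind (¬m.k₀ s u ≤ β))] at hT
  simp only [cov₀]
  rw [avg_sum]
  calc _ ≤ ∑ s, m.a s * (2 * ∑ u, m.k₀ s u * ind (¬m.k₀ s u ≤ β) + ε) := by
        refine Finset.sum_le_sum fun s _ => ?_
        rw [avg_mul_left]
        refine mul_le_mul_of_nonneg_left ?_ (m.a_nonneg s)
        exact (avg_abs_bin_sub_one_le h₀ hM₀ (m.k₀ s) (m.k₀_nonneg s) (m.k₀_sum s)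
          (fun u => m.k₀ s u ≤ β) hε hβ0 (fun u hu => hu)).trans (cover_bound hε hβ)
    _ = 2 * (∑ s, m.a s * ∑ u, m.k₀ s u * ind (¬m.k₀ s u ≤ β)) + ε * ∑ s, m.a s := by
        rw [Finset.mul_sum, Finset.mul_sum, ← Finset.sum_add_distrib]
        exact Finset.sum_congr rfl fun s _ => by ring
    _ ≤ _ := by rw [m.a_sum]; linarith

lemma avg_cov₁_le (h₀ : IsBinning M₀ φ₀) (h₁ : IsBinning M₁ φ₁) (hM₁ : 0 < M₁)
    {G : S → U₀ × U₁ × U₂ → Y → Prop}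
    {ε β : ℝ} (hε : 0 < ε) (hG : ∑ s, ∑ u, ∑ y, m.P s u y * ind (¬G s u y) ≤ ε) (hβ0 : 0 ≤ β)
    (hk : ∀ s u y, G s u y → m.k₁ s u.1 u.2.1 ≤ β) (hβ : (M₁ - 1) * β ≤ ε ^ 2) :
    avg (fun θ : Θ₀ × Θ₁ => m.cov₁ (φ₀ θ.1) (φ₁ θ.2)) ≤ 3 * ε := by
  have hT := m.sum_R_not_le hG (fun s u => m.k₁ s u.1 u.2.1 ≤ β) hk
  rw [m.sum_R_of_one (fun s u v => ind (¬m.k₁ s u v ≤ β))] at hT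
  simp only [cov₁]
  rw [avg_sum]
  have hb : ∀ u, IsBinning M₁ (fun θ (v : U₁) => φ₁ θ (u, v)) := fun u =>
    ⟨fun θ v => h₁.values θ _, fun v v' => by
      rw [h₁.corr, coll, coll, ind_congr (Prod.mk_right_injective u).eq_iff], fun v => h₁.mean _⟩
  calc _ ≤ ∑ s, ∑ u, m.a s * m.k₀ s u * (2 * ∑ v, m.k₁ s u v * ind (¬m.k₁ s u v ≤ β) + ε) := by
        refine Finset.sum_le_sum fun s _ => ?_
        rw [avg_sum]
        refine Finset.sum_le_sum fun u _ => ?_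
        have e := avg_prod_mul (fun θ => m.a s * (φ₀ θ u * m.k₀ s u))
          (fun θ => |∑ v, φ₁ θ (u, v) * m.k₁ s u v - 1|)
        rw [e, avg_mul_left, avg_mul_right, h₀.mean, one_mul]
        refine mul_le_mul_of_nonneg_left ?_ (mul_nonneg (m.a_nonneg s) (m.k₀_nonneg s u))
        exact (avg_abs_bin_sub_one_le (hb u) hM₁ (m.k₁ s u) (m.k₁_nonneg s u) (m.k₁_sum s u)
          (fun v => m.k₁ s u v ≤ β) hε hβ0 (fun u hu => hu)).trans (cover_bound hε hβ)
    _ = 2 * (∑ s, ∑ u, m.a s * m.k₀ s u * ∑ v, m.k₁ s u v * ind (¬m.k₁ s u v ≤ β))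
          + ε * ∑ s, m.a s := by
        rw [Finset.mul_sum, Finset.mul_sum, ← Finset.sum_add_distrib]
        refine Finset.sum_congr rfl fun s _ => ?_
        rw [Finset.mul_sum]
        have : ε * m.a s = ∑ u, ε * (m.a s * m.k₀ s u) := by
          rw [← Finset.mul_sum, ← Finset.mul_sum, m.k₀_sum, mul_one]
        rw [this, ← Finset.sum_add_distrib]
        exact Finset.sum_congr rfl fun u _ => by ring
    _ ≤ _ := by rw [m.a_sum]; linarith

lemma avg_cov₂_le (h₀ : IsBinning M₀ φ₀) (h₂ : IsBinning M₂ φ₂) (hM₂ : 0 < M₂)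
    {G : S → U₀ × U₁ × U₂ → Y → Prop}
    {ε β : ℝ} (hε : 0 < ε) (hG : ∑ s, ∑ u, ∑ y, m.P s u y * ind (¬G s u y) ≤ ε) (hβ0 : 0 ≤ β)
    (hk : ∀ s u y, G s u y → m.k₂ s u.1 u.2.2 ≤ β) (hβ : (M₂ - 1) * β ≤ ε ^ 2) :
    avg (fun θ : Θ₀ × Θ₂ => m.cov₂ (φ₀ θ.1) (φ₂ θ.2)) ≤ 3 * ε := by
  have hT := m.sum_R_not_le hG (fun s u => m.k₂ s u.1 u.2.2 ≤ β) hk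
  rw [m.sum_R_of_two (fun s u v => ind (¬m.k₂ s u v ≤ β))] at hT
  simp only [cov₂]
  rw [avg_sum]
  have hb : ∀ u, IsBinning M₂ (fun θ (v : U₂) => φ₂ θ (u, v)) := fun u =>
    ⟨fun θ v => h₂.values θ _, fun v v' => by
      rw [h₂.corr, coll, coll, ind_congr (Prod.mk_right_injective u).eq_iff], fun v => h₂.mean _⟩
  calc _ ≤ ∑ s, ∑ u, m.a s * m.k₀ s u * (2 * ∑ v, m.k₂ s u v * ind (¬m.k₂ s u v ≤ β) + ε) := by
        refine Finset.sum_le_sum fun s _ => ?_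
        rw [avg_sum]
        refine Finset.sum_le_sum fun u _ => ?_
        have e := avg_prod_mul (fun θ => m.a s * (φ₀ θ u * m.k₀ s u))
          (fun θ => |∑ v, φ₂ θ (u, v) * m.k₂ s u v - 1|)
        rw [e, avg_mul_left, avg_mul_right, h₀.mean, one_mul]
        refine mul_le_mul_of_nonneg_left ?_ (mul_nonneg (m.a_nonneg s) (m.k₀_nonneg s u))
        exact (avg_abs_bin_sub_one_le (hb u) hM₂ (m.k₂ s u) (m.k₂_nonneg s u) (m.k₂_sum s u)
          (fun v => m.k₂ s u v ≤ β) hε hβ0 (fun u hu => hu)).trans (cover_bound hε hβ)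
    _ = 2 * (∑ s, ∑ u, m.a s * m.k₀ s u * ∑ v, m.k₂ s u v * ind (¬m.k₂ s u v ≤ β))
          + ε * ∑ s, m.a s := by
        rw [Finset.mul_sum, Finset.mul_sum, ← Finset.sum_add_distrib]
        refine Finset.sum_congr rfl fun s _ => ?_
        rw [Finset.mul_sum]
        have : ε * m.a s = ∑ u, ε * (m.a s * m.k₀ s u) := by
          rw [← Finset.mul_sum, ← Finset.mul_sum, m.k₀_sum, mul_one]
        rw [this, ← Finset.sum_add_distrib]
        exact Finset.sum_congr rfl fun u _ => by ring
    _ ≤ _ := by rw [m.a_sum]; linarith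

/-- The joint weight of the three random bins selected by `θ`. -/
def binWtAt (φ₀ : Θ₀ → U₀ → ℝ) (φ₁ : Θ₁ → U₀ × U₁ → ℝ) (φ₂ : Θ₂ → U₀ × U₂ → ℝ)
    (θ : Θ₀ × Θ₁ × Θ₂) (u : U₀ × U₁ × U₂) : ℝ :=
  binWt (φ₀ θ.1) (φ₁ θ.2.1) (φ₂ θ.2.2) u

lemma avg_binWt (h₀ : IsBinning M₀ φ₀) (h₁ : IsBinning M₁ φ₁) (h₂ : IsBinning M₂ φ₂)
    (u : U₀ × U₁ × U₂) : avg (fun θ => binWtAt φ₀ φ₁ φ₂ θ u) = 1 := by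
  simp only [binWtAt, binWt]
  rw [avg_prod_mul₃ (fun θ => φ₀ θ u.1) (fun θ => φ₁ θ (u.1, u.2.1)) (fun θ => φ₂ θ (u.1, u.2.2)),
    h₀.mean, h₁.mean, h₂.mean]
  norm_num

lemma avg_binWt_mul (h₀ : IsBinning M₀ φ₀) (h₁ : IsBinning M₁ φ₁) (h₂ : IsBinning M₂ φ₂)
    (u u' : U₀ × U₁ × U₂) :
    avg (fun θ => binWtAt φ₀ φ₁ φ₂ θ u * binWtAt φ₀ φ₁ φ₂ θ u') = coll3 M₀ M₁ M₂ u u' := by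
  rw [coll3, ← h₀.corr, ← h₁.corr, ← h₂.corr, ← avg_prod_mul₃]
  congr 1; funext θ
  simp only [binWtAt, binWt]; ring

lemma avg_binWt_mul_one (h₀ : IsBinning M₀ φ₀) (h₁ : IsBinning M₁ φ₁) (h₂ : IsBinning M₂ φ₂)
    (u : U₀ × U₁ × U₂) (v : U₀ × U₁) :
    avg (fun θ : Θ₀ × Θ₁ × Θ₂ => binWtAt φ₀ φ₁ φ₂ θ u * (φ₀ θ.1 v.1 * φ₁ θ.2.1 v)) =
      coll M₀ u.1 v.1 * coll M₁ (u.1, u.2.1) v := by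
  rw [← mul_one (coll M₀ u.1 v.1 * coll M₁ (u.1, u.2.1) v), ← h₀.corr, ← h₁.corr,
    ← h₂.mean (u.1, u.2.2), ← avg_prod_mul₃]
  congr 1; funext θ
  simp only [binWtAt, binWt]; ring

lemma avg_binWt_mul_two (h₀ : IsBinning M₀ φ₀) (h₁ : IsBinning M₁ φ₁) (h₂ : IsBinning M₂ φ₂)
    (u : U₀ × U₁ × U₂) (v : U₀ × U₂) :
    avg (fun θ : Θ₀ × Θ₁ × Θ₂ => binWtAt φ₀ φ₁ φ₂ θ u * (φ₀ θ.1 v.1 * φ₂ θ.2.2 v)) =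
      coll M₀ u.1 v.1 * coll M₂ (u.1, u.2.2) v := by
  rw [← mul_one (coll M₀ u.1 v.1), ← h₀.corr, ← h₁.mean (u.1, u.2.1), ← h₂.corr, ← avg_prod_mul₃]
  congr 1; funext θ
  simp only [binWtAt, binWt]; ring

lemma avg_wt (h₀ : IsBinning M₀ φ₀) (h₁ : IsBinning M₁ φ₁) (h₂ : IsBinning M₂ φ₂)
    (A : Pat) (u : U₀ × U₁ × U₂) :
    avg (fun θ : Θ₀ × Θ₁ × Θ₂ =>
      A.wt (φ₀ θ.1 u.1) (φ₁ θ.2.1 (u.1, u.2.1)) (φ₂ θ.2.2 (u.1, u.2.2))) = 1 := by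
  have e := fun (f : Θ₀ → ℝ) (g : Θ₁ → ℝ) (h : Θ₂ → ℝ) => avg_prod_mul₃ f g h
  cases A
  · simp [Pat.wt, avg_const]
  · simpa [Pat.wt, avg_const, h₀.mean] using e (fun θ => φ₀ θ u.1) (fun _ => 1) (fun _ => 1)
  · simpa [Pat.wt, avg_const, h₀.mean, h₁.mean] using
      e (fun θ => φ₀ θ u.1) (fun θ => φ₁ θ (u.1, u.2.1)) (fun _ => 1)
  · simpa [Pat.wt, avg_const, h₀.mean, h₂.mean] using
      e (fun θ => φ₀ θ u.1) (fun _ => 1) (fun θ => φ₂ θ (u.1, u.2.2))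
  · simpa [Pat.wt, avg_const, h₀.mean, h₁.mean, h₂.mean] using
      e (fun θ => φ₀ θ u.1) (fun θ => φ₁ θ (u.1, u.2.1)) (fun θ => φ₂ θ (u.1, u.2.2))

lemma avg_refMass (h₀ : IsBinning M₀ φ₀) (h₁ : IsBinning M₁ φ₁) (h₂ : IsBinning M₂ φ₂)
    (A : Pat) :
    avg (fun θ : Θ₀ × Θ₁ × Θ₂ => m.refMass (φ₀ θ.1) (φ₁ θ.2.1) (φ₂ θ.2.2) A) = 1 := by
  simp only [refMass]
  rw [avg_sum]
  simp only [avg_sum, avg_mul_left, avg_wt h₀ h₁ h₂, mul_one, m.sum_R]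

lemma avg_pairSum {O : Type*} [Fintype O] (h₀ : IsBinning M₀ φ₀) (h₁ : IsBinning M₁ φ₁)
    (h₂ : IsBinning M₂ φ₂) (G : S → U₀ × U₁ × U₂ → Y → Prop) (out : Y → O) (A : Pat)
    (n₀ n₁ n₂ : ℕ) (mA : ℝ) :
    avg (fun θ => m.pairSum G out A n₀ n₁ n₂
      (fun u u' => binWtAt φ₀ φ₁ φ₂ θ u * binWtAt φ₀ φ₁ φ₂ θ u') mA) =
    m.pairSum G out A n₀ n₁ n₂ (coll3 M₀ M₁ M₂) mA := by
  simp only [pairSum]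
  rw [avg_sum]
  simp only [avg_sum, avg_mul_right, avg_binWt_mul h₀ h₁ h₂]

/-- The average badness is small if no output has many compatible layers compared with the number of
bins. -/
lemma avg_badness_le (h₀ : IsBinning M₀ φ₀) (h₁ : IsBinning M₁ φ₁) (h₂ : IsBinning M₂ φ₂)
    (hM₀ : 0 < M₀) (hM₁ : 0 < M₁) (hM₂ : 0 < M₂)
    {G : S → U₀ × U₁ × U₂ → Y → Prop} {sel₁ sel₂ : Prop}
    {T₁ : U₀ → U₁ → Y₁ → Prop} {T₂ : U₀ → U₂ → Y₂ → Prop} {ε : ℝ} (hε : 0 ≤ ε)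
    (hG : ∑ s, ∑ u, ∑ y, m.P s u y * ind (¬G s u y) ≤ ε)
    (h01 : ¬sel₁ → ∀ y, ∑ v : U₀ × U₁, ind (T₁ v.1 v.2 y) ≤ ε * (M₀ * M₁))
    (h1 : ¬sel₁ → ∀ u₀ y, ∑ v₁, ind (T₁ u₀ v₁ y) ≤ ε * M₁)
    (h02 : ¬sel₂ → ∀ y, ∑ v : U₀ × U₂, ind (T₂ v.1 v.2 y) ≤ ε * (M₀ * M₂))
    (h2 : ¬sel₂ → ∀ u₀ y, ∑ v₂, ind (T₂ u₀ v₂ y) ≤ ε * M₂) :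
    avg (fun θ : Θ₀ × Θ₁ × Θ₂ => ∑ s, ∑ u, m.R s u * binWtAt φ₀ φ₁ φ₂ θ u *
      m.badness y₁ y₂ G sel₁ sel₂ M₀ M₁ M₂ T₁ T₂ (φ₀ θ.1) (φ₁ θ.2.1) (φ₂ θ.2.2) s u) ≤ 5 * ε := by
  have hamb1 : ∀ u y, ind (¬sel₁) * avg (fun θ : Θ₀ × Θ₁ × Θ₂ => binWtAt φ₀ φ₁ φ₂ θ u *
      ambiguity (φ₀ θ.1) (φ₁ θ.2.1) M₀ M₁ T₁ (u.1, u.2.1) y) ≤ 2 * ε := by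
    intro u y
    by_cases hs : sel₁
    · rw [ind_of_not (not_not.2 hs), zero_mul]; linarith
    rw [ind_of hs, one_mul]
    refine le_trans (le_of_eq ?_) (sum_coll_le hM₀ hM₁ T₁ (u.1, u.2.1) y (h01 hs y) (h1 hs _ y))
    simp only [ambiguity, Finset.mul_sum]
    rw [avg_sum]
    refine Finset.sum_congr rfl fun v _ => ?_
    rw [← avg_binWt_mul_one h₀ h₁ h₂ u v, ← avg_div, ← avg_mul_left]
    congr 1; funext θ; ring
  have hamb2 : ∀ u y, ind (¬sel₂) * avg (fun θ : Θ₀ × Θ₁ × Θ₂ => binWtAt φ₀ φ₁ φ₂ θ u *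
      ambiguity (φ₀ θ.1) (φ₂ θ.2.2) M₀ M₂ T₂ (u.1, u.2.2) y) ≤ 2 * ε := by
    intro u y
    by_cases hs : sel₂
    · rw [ind_of_not (not_not.2 hs), zero_mul]; linarith
    rw [ind_of hs, one_mul]
    refine le_trans (le_of_eq ?_) (sum_coll_le hM₀ hM₂ T₂ (u.1, u.2.2) y (h02 hs y) (h2 hs _ y))
    simp only [ambiguity, Finset.mul_sum]
    rw [avg_sum]
    refine Finset.sum_congr rfl fun v _ => ?_
    rw [← avg_binWt_mul_two h₀ h₁ h₂ u v, ← avg_div, ← avg_mul_left]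
    congr 1; funext θ; ring
  rw [avg_sum]
  calc _ ≤ ∑ s, ∑ u, ∑ y, (m.P s u y * ind (¬G s u y) + m.P s u y * (4 * ε)) := by
        refine Finset.sum_le_sum fun s _ => ?_
        rw [avg_sum]
        refine Finset.sum_le_sum fun u _ => ?_
        have e : ∀ θ : Θ₀ × Θ₁ × Θ₂, m.R s u * binWtAt φ₀ φ₁ φ₂ θ u *
            m.badness y₁ y₂ G sel₁ sel₂ M₀ M₁ M₂ T₁ T₂ (φ₀ θ.1) (φ₁ θ.2.1) (φ₂ θ.2.2) s u =
            ∑ y, m.P s u y * (ind (¬G s u y) * binWtAt φ₀ φ₁ φ₂ θ u +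
              ind (¬sel₁) * (binWtAt φ₀ φ₁ φ₂ θ u *
                ambiguity (φ₀ θ.1) (φ₁ θ.2.1) M₀ M₁ T₁ (u.1, u.2.1) (y₁ y)) +
              ind (¬sel₂) * (binWtAt φ₀ φ₁ φ₂ θ u *
                ambiguity (φ₀ θ.1) (φ₂ θ.2.2) M₀ M₂ T₂ (u.1, u.2.2) (y₂ y))) := by
          intro θ
          simp only [badness, Finset.mul_sum, P]
          exact Finset.sum_congr rfl fun y _ => by ring
        simp only [e]
        rw [avg_sum]
        refine Finset.sum_le_sum fun y _ => ?_
        rw [avg_mul_left, avg_add, avg_add, avg_mul_left, avg_mul_left, avg_mul_left,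
          avg_binWt h₀ h₁ h₂, mul_one, ← mul_add]
        refine mul_le_mul_of_nonneg_left ?_ (m.P_nonneg _ _ _)
        linarith [hamb1 u (y₁ y), hamb2 u (y₂ y)]
    _ = ∑ s, ∑ u, ∑ y, m.P s u y * ind (¬G s u y) + 4 * ε := by
        simp only [Finset.sum_add_distrib, ← Finset.sum_mul, m.sum_P, m.sum_R, one_mul]
    _ ≤ _ := by linarith

end bins

end Model

/-! ### From bins to encoding kernels -/

/-- Replacing the unnormalized kernel `kt` by a subprobability kernel `κ`, at the expense of a
factor `2` in the cost. Without `sel`, the kernel is scaled down; with `sel`, it selects a single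
point `g (v s)`, found by minimizing the cost among the points of positive weight. -/
lemma exists_kernel {S V U : Type*} [Fintype S] [Fintype V] [Fintype U] [Nonempty U]
    (v : S → V) (kt : S → U → ℝ) (hkt : ∀ s u, 0 ≤ kt s u)
    (hv : ∀ s s', v s = v s' → kt s = kt s') (c : S → U → ℝ) (hc : ∀ s u, 0 ≤ c s u)
    (sel : Prop) :
    ∃ κ : S → U → ℝ, (∀ s u, 0 ≤ κ s u) ∧ (∀ s, ∑ u, κ s u ≤ 1) ∧
      (∀ s, 1 - 2 * |∑ u, kt s u - 1| ≤ ∑ u, κ s u) ∧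
      (∑ s, ∑ u, κ s u * c s u ≤ 2 * ∑ s, ∑ u, kt s u * c s u) ∧
      (∀ s u, κ s u ≠ 0 → kt s u ≠ 0) ∧ (¬sel → ∀ s u, κ s u ≤ kt s u) ∧
      (sel → ∃ g : V → U, ∀ s u, κ s u ≠ 0 → u = g (v s)) := by
  by_cases hsel : sel
  swap
  · have hq : ∀ s, 0 ≤ ∑ u, kt s u := fun s => Finset.sum_nonneg fun u _ => hkt s u
    have hle : ∀ s u, kt s u * min 1 (∑ u, kt s u)⁻¹ ≤ kt s u := fun s u =>
      mul_le_of_le_one_right (hkt s u) (min_le_left _ _)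
    refine ⟨fun s u => kt s u * min 1 (∑ u, kt s u)⁻¹, fun s u => mul_nonneg (hkt s u)
      (le_min zero_le_one (inv_nonneg.2 (hq s))), fun s => ?_, fun s => ?_, ?_,
      fun s u h h' => h (by simp [h']), fun _ => hle, fun h => absurd h hsel⟩
    · rw [← Finset.sum_mul]
      calc _ ≤ (∑ u, kt s u) * (∑ u, kt s u)⁻¹ :=
            mul_le_mul_of_nonneg_left (min_le_right _ _) (hq s)
        _ ≤ 1 := mul_inv_le_one
    · rw [← Finset.sum_mul]
      rcases le_or_gt (∑ u, kt s u) 1 with h | h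
      · rcases (hq s).eq_or_lt with h0 | h0
        · rw [← h0]; norm_num
        · rw [min_eq_left ((one_le_inv₀ h0).2 h), mul_one, abs_of_nonpos (by linarith)]
          linarith
      · rw [min_eq_right (inv_le_one_of_one_le₀ h.le), mul_inv_cancel₀ (by linarith)]
        linarith [abs_nonneg (∑ u, kt s u - 1)]
    · have h0 : 0 ≤ ∑ s, ∑ u, kt s u * c s u := Finset.sum_nonneg fun s _ =>
        Finset.sum_nonneg fun u _ => mul_nonneg (hkt s u) (hc s u)
      calc _ ≤ ∑ s, ∑ u, kt s u * c s u := Finset.sum_le_sum fun s _ =>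
            Finset.sum_le_sum fun u _ => mul_le_mul_of_nonneg_right (hle s u) (hc s u)
        _ ≤ _ := by linarith
  · set C : V → U → ℝ := fun x u => ∑ s, ind (v s = x) * c s u with hC
    -- the minimizer exists for the values `x` of `v` with nonzero kernel
    have hg : ∀ x, ∃ u, ∀ s, v s = x → 1 / 2 ≤ ∑ u, kt s u →
        kt s u ≠ 0 ∧ C x u ≤ 2 * ∑ u', kt s u' * C x u' := by
      intro x
      by_cases hx : ∃ s, v s = x ∧ 1 / 2 ≤ ∑ u, kt s u
      swap
      · push Not at hx
        exact ⟨Classical.arbitrary U, fun s hs h => absurd h (not_le.2 (hx s hs))⟩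
      obtain ⟨s, hs, hq⟩ := hx
      have hne : ((Finset.univ : Finset U).filter fun u => kt s u ≠ 0).Nonempty := by
        by_contra hcon
        rw [Finset.not_nonempty_iff_eq_empty, Finset.filter_eq_empty_iff] at hcon
        have : ∑ u, kt s u = 0 := Finset.sum_eq_zero fun u hu => not_not.1 (hcon hu)
        linarith
      obtain ⟨u, hu, hmin⟩ := Finset.exists_min_image _ (C x) hne
      refine ⟨u, fun s' hs' _ => ?_⟩
      rw [hv s' s (hs'.trans hs.symm)]
      refine ⟨(Finset.mem_filter.1 hu).2, ?_⟩
      have hCn : ∀ u, 0 ≤ C x u := fun u =>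
        Finset.sum_nonneg fun s _ => mul_nonneg (ind_nonneg _) (hc s u)
      have e1 : (∑ u', kt s u') * C x u ≤ ∑ u', kt s u' * C x u' := by
        rw [Finset.sum_mul]
        refine Finset.sum_le_sum fun u' _ => ?_
        by_cases h : kt s u' = 0
        · simp [h]
        · exact mul_le_mul_of_nonneg_left (hmin u' (by simp [h])) (hkt s u')
      have e2 := mul_le_mul_of_nonneg_right hq (hCn u)
      linarith
    choose g hg using hg
    set κ : S → U → ℝ := fun s u => ind (1 / 2 ≤ ∑ u, kt s u) * ind (g (v s) = u) with hκ
    have hsum : ∀ s, ∑ u, κ s u = ind (1 / 2 ≤ ∑ u, kt s u) := by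
      intro s
      simp only [hκ, ← Finset.mul_sum, sum_ind, mul_one]
    have hκg : ∀ s u, κ s u ≠ 0 → 1 / 2 ≤ ∑ u, kt s u ∧ u = g (v s) := by
      intro s u h
      by_cases h1 : 1 / 2 ≤ ∑ u, kt s u
      · by_cases h2 : g (v s) = u
        · exact ⟨h1, h2.symm⟩
        · exact absurd (by simp [hκ, ind_of_not h2]) h
      · exact absurd (by simp only [hκ, ind_of_not h1, zero_mul]) h
    refine ⟨κ, fun s u => mul_nonneg (ind_nonneg _) (ind_nonneg _), fun s => ?_, fun s => ?_, ?_,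
      fun s u h => ?_, fun h => absurd hsel h, fun _ => ⟨g, fun s u h => (hκg s u h).2⟩⟩
    · rw [hsum]; exact ind_le_one _
    · rw [hsum]
      by_cases h : 1 / 2 ≤ ∑ u, kt s u
      · rw [ind_of h]; linarith [abs_nonneg (∑ u, kt s u - 1)]
      · rw [ind_of_not h]
        push Not at h
        rw [abs_of_nonpos (by linarith)]; linarith
    · have e1 : ∀ s, ∑ u, κ s u * c s u = ∑ x, ind (v s = x) *
          (ind (1 / 2 ≤ ∑ u, kt s u) * c s (g x)) := by
        intro s
        rw [sum_ind_mul (v s) (fun x => ind (1 / 2 ≤ ∑ u, kt s u) * c s (g x))]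
        simp only [hκ, mul_assoc, ← Finset.mul_sum, sum_ind_mul (g (v s)) (c s)]
      have e2 : ∀ s, ∑ u, kt s u * c s u = ∑ x, ind (v s = x) * ∑ u, kt s u * c s u := by
        intro s; rw [sum_ind_mul (v s) (fun _ => ∑ u, kt s u * c s u)]
      simp only [e1]
      rw [Finset.sum_congr rfl fun s _ => e2 s]
      refine Finset.sum_comm.trans_le (le_of_le_of_eq ?_
        (congrArg (fun t : ℝ => 2 * t) Finset.sum_comm.symm))
      rw [Finset.mul_sum]
      refine Finset.sum_le_sum fun x _ => ?_
      by_cases hx : ∃ s, v s = x ∧ 1 / 2 ≤ ∑ u, kt s u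
      · obtain ⟨s, hs, hq⟩ := hx
        obtain ⟨-, h2⟩ := hg x s hs hq
        have e3 : ∑ s', ind (v s' = x) * (ind (1 / 2 ≤ ∑ u, kt s' u) * c s' (g x)) ≤ C x (g x) := by
          refine Finset.sum_le_sum fun s' _ => mul_le_mul_of_nonneg_left ?_ (ind_nonneg _)
          exact mul_le_of_le_one_left (hc _ _) (ind_le_one _)
        have e4 : ∑ s', ind (v s' = x) * ∑ u, kt s' u * c s' u = ∑ u', kt s u' * C x u' := by
          have : ∀ s', ind (v s' = x) * ∑ u, kt s' u * c s' u
              = ∑ u, kt s u * (ind (v s' = x) * c s' u) := by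
            intro s'
            by_cases h : v s' = x
            · rw [ind_of h, hv s' s (h.trans hs.symm), one_mul]
              simp only [one_mul]
            · simp [ind_of_not h]
          simp only [this]
          rw [Finset.sum_comm]
          simp only [hC, Finset.mul_sum]
        rw [e4]; exact e3.trans h2
      · have e5 : ∑ s', ind (v s' = x) * (ind (1 / 2 ≤ ∑ u, kt s' u) * c s' (g x)) = 0 := by
          refine Finset.sum_eq_zero fun s' _ => ?_
          by_cases h : v s' = x
          · rw [ind_of_not (fun h' => hx ⟨s', h, h'⟩), zero_mul, mul_zero]
          · rw [ind_of_not h, zero_mul]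
        rw [e5]
        exact mul_nonneg zero_le_two (Finset.sum_nonneg fun s _ => mul_nonneg (ind_nonneg _)
          (Finset.sum_nonneg fun u _ => mul_nonneg (hkt s u) (hc s u)))
    · obtain ⟨h1, rfl⟩ := hκg s u h
      exact (hg (v s) s rfl h1).1

/-- A subprobability kernel from `exists_kernel` is dominated by `Λ` times the kernel it comes from,
wherever this kernel is at least `1 / Λ` if it does not vanish. -/
lemma kernel_le {κ kt Λ t : ℝ} {sel : Prop} (hΛ : 1 ≤ Λ) (hkt : 0 ≤ kt)
    (h1 : κ ≤ t) (ht : t ≤ 1) (hne : κ ≠ 0 → kt ≠ 0) (hns : ¬sel → κ ≤ kt)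
    (hs : sel → kt ≠ 0 → 1 ≤ Λ * kt) : κ ≤ Λ * kt := by
  by_cases h : sel
  · by_cases h0 : κ = 0
    · rw [h0]; positivity
    · exact (h1.trans ht).trans (hs h (hne h0))
  · exact (hns h).trans (le_mul_of_one_le_left hkt hΛ)

namespace Model

variable {S U₀ U₁ U₂ Y : Type*} [Fintype S] [Fintype U₀] [Fintype U₁] [Fintype U₂] [Fintype Y]
  (m : Model S U₀ U₁ U₂ Y)

/-- Given bins `b₀, b₁, b₂`, there is a subprobability law `Q` of state and layers that lives on the
bins, has state marginal at most that of the model, and a total `bad`-cost comparable to that of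
the law of the model restricted to the bins. If `sel j`, then the layers of receiver `j` are
functions of `v₀ s` and `v_j s`. -/
lemma exists_encoding [Nonempty U₀] [Nonempty U₁] [Nonempty U₂]
    (v₀ v₁ v₂ : S → S) (hv₀ : ∀ s s', v₀ s = v₀ s' → m.k₀ s = m.k₀ s')
    (hv₁ : ∀ s s', v₁ s = v₁ s' → m.k₁ s = m.k₁ s')
    (hv₂ : ∀ s s', v₂ s = v₂ s' → m.k₂ s = m.k₂ s') (sel₁ sel₂ : Prop)
    {b₀ : U₀ → ℝ} {b₁ : U₀ × U₁ → ℝ} {b₂ : U₀ × U₂ → ℝ} (hb₀ : ∀ u, 0 ≤ b₀ u)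
    (hb₁ : ∀ u, 0 ≤ b₁ u) (hb₂ : ∀ u, 0 ≤ b₂ u) (bad : S → U₀ × U₁ × U₂ → ℝ)
    (hbad : ∀ s u, 0 ≤ bad s u) {ε : ℝ} (hc₀ : m.cov₀ b₀ ≤ ε) (hc₁ : m.cov₁ b₀ b₁ ≤ ε)
    (hc₂ : m.cov₂ b₀ b₂ ≤ ε) (hB : ∑ s, ∑ u, m.R s u * binWt b₀ b₁ b₂ u * bad s u ≤ ε)
    {Λ : ℝ} (hΛ : 1 ≤ Λ) :
    ∃ Q : S → U₀ × U₁ × U₂ → ℝ, (∀ s u, 0 ≤ Q s u) ∧ (∀ s, ∑ u, Q s u ≤ m.a s) ∧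
      (1 - 14 * ε ≤ ∑ s, ∑ u, Q s u) ∧ (∑ s, ∑ u, Q s u * bad s u ≤ 24 * ε) ∧
      (∀ s u, Q s u ≠ 0 → m.a s ≠ 0 ∧ binWt b₀ b₁ b₂ u ≠ 0) ∧
      (∀ s u, (sel₁ ∨ sel₂ → b₀ u.1 * m.k₀ s u.1 ≠ 0 → 1 ≤ Λ * (b₀ u.1 * m.k₀ s u.1)) →
        (sel₁ → b₁ (u.1, u.2.1) * m.k₁ s u.1 u.2.1 ≠ 0 →
          1 ≤ Λ * (b₁ (u.1, u.2.1) * m.k₁ s u.1 u.2.1)) →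
        (sel₂ → b₂ (u.1, u.2.2) * m.k₂ s u.1 u.2.2 ≠ 0 →
          1 ≤ Λ * (b₂ (u.1, u.2.2) * m.k₂ s u.1 u.2.2)) →
        Q s u ≤ Λ ^ 3 * (binWt b₀ b₁ b₂ u * m.R s u)) ∧
      (sel₁ ∨ sel₂ → ∃ g : S → U₀, ∀ s u, Q s u ≠ 0 → u.1 = g (v₀ s)) ∧
      (sel₁ → ∃ g : S → U₀ → U₁, ∀ s u, Q s u ≠ 0 → u.2.1 = g (v₁ s) u.1) ∧
      (sel₂ → ∃ g : S → U₀ → U₂, ∀ s u, Q s u ≠ 0 → u.2.2 = g (v₂ s) u.1) := by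
  have hk₁n : ∀ s u v, 0 ≤ b₁ (u, v) * m.k₁ s u v := fun s u v =>
    mul_nonneg (hb₁ _) (m.k₁_nonneg _ _ _)
  have hk₂n : ∀ s u v, 0 ≤ b₂ (u, v) * m.k₂ s u v := fun s u v =>
    mul_nonneg (hb₂ _) (m.k₂_nonneg _ _ _)
  have hk₀n : ∀ s u, 0 ≤ b₀ u * m.k₀ s u := fun s u => mul_nonneg (hb₀ _) (m.k₀_nonneg _ _)
  set E : S → U₀ → ℝ := fun s u₀ => ∑ u₁, ∑ u₂, b₁ (u₀, u₁) * m.k₁ s u₀ u₁ *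
    (b₂ (u₀, u₂) * m.k₂ s u₀ u₂) * bad s (u₀, u₁, u₂) with hE
  have hE0 : ∀ s u, 0 ≤ E s u := fun s u => Finset.sum_nonneg fun u₁ _ =>
    Finset.sum_nonneg fun u₂ _ => mul_nonneg (mul_nonneg (hk₁n _ _ _) (hk₂n _ _ _)) (hbad _ _)
  set e₁ : S → U₀ → ℝ := fun s u => |∑ v, b₁ (u, v) * m.k₁ s u v - 1| with he₁
  set e₂ : S → U₀ → ℝ := fun s u => |∑ v, b₂ (u, v) * m.k₂ s u v - 1| with he₂
  obtain ⟨κ₀, κ₀n, κ₀s, κ₀m, κ₀c, κ₀ne, κ₀ns, κ₀g⟩ := exists_kernel v₀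
    (fun s u => b₀ u * m.k₀ s u) hk₀n (fun s s' h => by simp only [hv₀ s s' h])
    (fun s u => m.a s * (E s u + e₁ s u + e₂ s u)) (fun s u => mul_nonneg (m.a_nonneg s)
      (add_nonneg (add_nonneg (hE0 s u) (abs_nonneg _)) (abs_nonneg _))) (sel₁ ∨ sel₂)
  obtain ⟨κ₁, κ₁n, κ₁s, κ₁m, κ₁c, κ₁ne, κ₁ns, κ₁g⟩ := exists_kernel
    (fun x : S × U₀ => (v₁ x.1, x.2)) (fun x u => b₁ (x.2, u) * m.k₁ x.1 x.2 u)
    (fun x u => hk₁n _ _ _) (fun x x' h => by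
      simp only [Prod.mk.injEq] at h
      simp only [hv₁ _ _ h.1, h.2])
    (fun x u₁ => m.a x.1 * κ₀ x.1 x.2 * ∑ u₂, b₂ (x.2, u₂) * m.k₂ x.1 x.2 u₂ * bad x.1 (x.2, u₁, u₂))
    (fun x u₁ => mul_nonneg (mul_nonneg (m.a_nonneg _) (κ₀n _ _)) (Finset.sum_nonneg fun u₂ _ =>
      mul_nonneg (hk₂n _ _ _) (hbad _ _))) sel₁
  obtain ⟨κ₂, κ₂n, κ₂s, κ₂m, κ₂c, κ₂ne, κ₂ns, κ₂g⟩ := exists_kernel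
    (fun x : S × U₀ => (v₂ x.1, x.2)) (fun x u => b₂ (x.2, u) * m.k₂ x.1 x.2 u)
    (fun x u => hk₂n _ _ _) (fun x x' h => by
      simp only [Prod.mk.injEq] at h
      simp only [hv₂ _ _ h.1, h.2])
    (fun x u₂ => m.a x.1 * κ₀ x.1 x.2 * ∑ u₁, κ₁ x u₁ * bad x.1 (x.2, u₁, u₂))
    (fun x u₂ => mul_nonneg (mul_nonneg (m.a_nonneg _) (κ₀n _ _)) (Finset.sum_nonneg fun u₁ _ =>
      mul_nonneg (κ₁n _ _) (hbad _ _))) sel₂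
  have htot : ∑ s, ∑ u, κ₀ s u * (m.a s * (E s u + e₁ s u + e₂ s u)) ≤ 6 * ε := by
    refine κ₀c.trans ?_
    have h1 : ∑ s, ∑ u, b₀ u * m.k₀ s u * (m.a s * (E s u + e₁ s u + e₂ s u)) =
        (∑ s, ∑ u, m.R s u * binWt b₀ b₁ b₂ u * bad s u) + m.cov₁ b₀ b₁ + m.cov₂ b₀ b₂ := by
      simp only [cov₁, cov₂, Fintype.sum_prod_type, R, binWt]
      rw [← Finset.sum_add_distrib, ← Finset.sum_add_distrib]
      refine Finset.sum_congr rfl fun s _ => ?_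
      rw [← Finset.sum_add_distrib, ← Finset.sum_add_distrib]
      refine Finset.sum_congr rfl fun u _ => ?_
      have h2 : ∑ u₁, ∑ u₂, m.a s * m.k₀ s u * m.k₁ s u u₁ * m.k₂ s u u₂ *
          (b₀ u * b₁ (u, u₁) * b₂ (u, u₂)) * bad s (u, u₁, u₂)
          = b₀ u * m.k₀ s u * m.a s * E s u := by
        simp only [hE, Finset.mul_sum]
        exact Finset.sum_congr rfl fun _ _ => Finset.sum_congr rfl fun _ _ => by ring
      rw [h2]
      ring
    rw [h1]; linarith
  have hsplit : ∑ s, ∑ u, κ₀ s u * (m.a s * (E s u + e₁ s u + e₂ s u)) =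
      (∑ s, ∑ u, m.a s * κ₀ s u * E s u) + (∑ s, ∑ u, m.a s * κ₀ s u * (e₁ s u + e₂ s u)) := by
    simp only [← Finset.sum_add_distrib]
    exact Finset.sum_congr rfl fun _ _ => Finset.sum_congr rfl fun _ _ => by ring
  have hEn : 0 ≤ ∑ s, ∑ u, m.a s * κ₀ s u * E s u := Finset.sum_nonneg fun s _ =>
    Finset.sum_nonneg fun u _ => mul_nonneg (mul_nonneg (m.a_nonneg _) (κ₀n _ _)) (hE0 _ _)
  have hen : 0 ≤ ∑ s, ∑ u, m.a s * κ₀ s u * (e₁ s u + e₂ s u) := Finset.sum_nonneg fun s _ =>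
    Finset.sum_nonneg fun u _ => mul_nonneg (mul_nonneg (m.a_nonneg _) (κ₀n _ _))
      (add_nonneg (abs_nonneg _) (abs_nonneg _))
  have hQ0 : ∀ s (u : U₀ × U₁ × U₂),
      0 ≤ m.a s * κ₀ s u.1 * κ₁ (s, u.1) u.2.1 * κ₂ (s, u.1) u.2.2 := fun s u =>
    mul_nonneg (mul_nonneg (mul_nonneg (m.a_nonneg _) (κ₀n _ _)) (κ₁n _ _)) (κ₂n _ _)
  have hQsum : ∀ s, ∑ u : U₀ × U₁ × U₂,
      m.a s * κ₀ s u.1 * κ₁ (s, u.1) u.2.1 * κ₂ (s, u.1) u.2.2 =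
      ∑ u₀, m.a s * κ₀ s u₀ * ((∑ u₁, κ₁ (s, u₀) u₁) * ∑ u₂, κ₂ (s, u₀) u₂) := by
    intro s
    simp only [Fintype.sum_prod_type]
    refine Finset.sum_congr rfl fun u₀ _ => ?_
    rw [Finset.sum_mul_sum, Finset.mul_sum]
    refine Finset.sum_congr rfl fun u₁ _ => ?_
    rw [Finset.mul_sum]
    exact Finset.sum_congr rfl fun u₂ _ => by ring
  refine ⟨fun s u => m.a s * κ₀ s u.1 * κ₁ (s, u.1) u.2.1 * κ₂ (s, u.1) u.2.2, hQ0, fun s => ?_,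
    ?_, ?_, fun s u h => ?_, fun s u h0 h1 h2 => ?_, fun h => ?_, fun h => ?_, fun h => ?_⟩
  · rw [hQsum]
    calc _ ≤ ∑ u₀, m.a s * κ₀ s u₀ * 1 := by
          refine Finset.sum_le_sum fun u₀ _ => mul_le_mul_of_nonneg_left ?_
            (mul_nonneg (m.a_nonneg _) (κ₀n _ _))
          exact mul_le_one₀ (κ₁s _) (Finset.sum_nonneg fun _ _ => κ₂n _ _) (κ₂s _)
      _ = m.a s * ∑ u₀, κ₀ s u₀ := by simp only [mul_one, Finset.mul_sum]
      _ ≤ m.a s := mul_le_of_le_one_right (m.a_nonneg s) (κ₀s s)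
  · simp only [hQsum]
    have h1 : ∀ s u₀, m.a s * κ₀ s u₀ - 2 * (m.a s * κ₀ s u₀ * (e₁ s u₀ + e₂ s u₀)) ≤
        m.a s * κ₀ s u₀ * ((∑ u₁, κ₁ (s, u₀) u₁) * ∑ u₂, κ₂ (s, u₀) u₂) := by
      intro s u₀
      have p1 := κ₁m (s, u₀)
      have p2 := κ₂m (s, u₀)
      have p3 := κ₁s (s, u₀)
      have p4 := κ₂s (s, u₀)
      simp only [he₁, he₂]
      have p5 : 1 - 2 * (|∑ v, b₁ (u₀, v) * m.k₁ s u₀ v - 1| + |∑ v, b₂ (u₀, v) * m.k₂ s u₀ v - 1|)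
          ≤ (∑ u₁, κ₁ (s, u₀) u₁) * ∑ u₂, κ₂ (s, u₀) u₂ := by
        nlinarith [mul_nonneg (sub_nonneg.2 p3) (sub_nonneg.2 p4)]
      have := mul_le_mul_of_nonneg_left p5 (mul_nonneg (m.a_nonneg s) (κ₀n s u₀))
      linarith
    have h2 : ∑ s, ∑ u₀, m.a s * κ₀ s u₀ ≥ 1 - 2 * ε := by
      have : ∀ s, m.a s - 2 * (m.a s * |∑ u, b₀ u * m.k₀ s u - 1|) ≤ ∑ u₀, m.a s * κ₀ s u₀ := by
        intro s
        rw [← Finset.mul_sum]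
        have := mul_le_mul_of_nonneg_left (κ₀m s) (m.a_nonneg s)
        linarith
      have h3 := Finset.sum_le_sum fun s (_ : s ∈ Finset.univ) => this s
      rw [Finset.sum_sub_distrib, ← Finset.mul_sum, m.a_sum] at h3
      have h4 : ∑ s, m.a s * |∑ u, b₀ u * m.k₀ s u - 1| ≤ ε := hc₀
      linarith
    have h3 := Finset.sum_le_sum fun s (_ : s ∈ Finset.univ) =>
      Finset.sum_le_sum fun u₀ (_ : u₀ ∈ Finset.univ) => h1 s u₀
    simp only [Finset.sum_sub_distrib, ← Finset.mul_sum] at h3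
    simp only [← Finset.mul_sum] at h2
    have h5 : ∑ s, ∑ u, m.a s * κ₀ s u * (e₁ s u + e₂ s u) ≤ 6 * ε := by linarith
    linarith
  · have h1 : ∑ s, ∑ u : U₀ × U₁ × U₂,
        m.a s * κ₀ s u.1 * κ₁ (s, u.1) u.2.1 * κ₂ (s, u.1) u.2.2 * bad s u =
        ∑ x : S × U₀, ∑ u₂, κ₂ x u₂ *
          (m.a x.1 * κ₀ x.1 x.2 * ∑ u₁, κ₁ x u₁ * bad x.1 (x.2, u₁, u₂)) := by
      simp only [Fintype.sum_prod_type, Finset.mul_sum]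
      refine Finset.sum_congr rfl fun s _ => Finset.sum_congr rfl fun u _ => ?_
      rw [Finset.sum_comm]
      exact Finset.sum_congr rfl fun _ _ => Finset.sum_congr rfl fun _ _ => by ring
    have h2 : ∑ x : S × U₀, ∑ u₂, b₂ (x.2, u₂) * m.k₂ x.1 x.2 u₂ *
          (m.a x.1 * κ₀ x.1 x.2 * ∑ u₁, κ₁ x u₁ * bad x.1 (x.2, u₁, u₂)) =
        ∑ x : S × U₀, ∑ u₁, κ₁ x u₁ * (m.a x.1 * κ₀ x.1 x.2 *
          ∑ u₂, b₂ (x.2, u₂) * m.k₂ x.1 x.2 u₂ * bad x.1 (x.2, u₁, u₂)) := by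
      simp only [Finset.mul_sum]
      refine Finset.sum_congr rfl fun x _ => ?_
      rw [Finset.sum_comm]
      exact Finset.sum_congr rfl fun _ _ => Finset.sum_congr rfl fun _ _ => by ring
    have h3 : ∑ x : S × U₀, ∑ u₁, b₁ (x.2, u₁) * m.k₁ x.1 x.2 u₁ * (m.a x.1 * κ₀ x.1 x.2 *
          ∑ u₂, b₂ (x.2, u₂) * m.k₂ x.1 x.2 u₂ * bad x.1 (x.2, u₁, u₂)) =
        ∑ s, ∑ u, m.a s * κ₀ s u * E s u := by
      simp only [Fintype.sum_prod_type, hE, Finset.mul_sum]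
      exact Finset.sum_congr rfl fun _ _ => Finset.sum_congr rfl fun _ _ =>
        Finset.sum_congr rfl fun _ _ => Finset.sum_congr rfl fun _ _ => by ring
    rw [h1]
    rw [h2] at κ₂c
    rw [h3] at κ₁c
    linarith
  · refine ⟨fun h' => h (by simp [h']), ?_⟩
    have h0 : κ₀ s u.1 ≠ 0 := fun h' => h (by simp [h'])
    have h1 : κ₁ (s, u.1) u.2.1 ≠ 0 := fun h' => h (by simp [h'])
    have h2 : κ₂ (s, u.1) u.2.2 ≠ 0 := fun h' => h (by simp [h'])
    have := left_ne_zero_of_mul (κ₀ne _ _ h0)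
    have := left_ne_zero_of_mul (κ₁ne _ _ h1)
    have := left_ne_zero_of_mul (κ₂ne _ _ h2)
    simp only [binWt]
    positivity
  · have p0 : κ₀ s u.1 ≤ Λ * (b₀ u.1 * m.k₀ s u.1) := kernel_le (sel := sel₁ ∨ sel₂) hΛ
      (hk₀n _ _) (Finset.single_le_sum (fun u _ => κ₀n s u) (Finset.mem_univ _)) (κ₀s s)
      (κ₀ne _ _) (fun h => κ₀ns h _ _) h0
    have p1 : κ₁ (s, u.1) u.2.1 ≤ Λ * (b₁ (u.1, u.2.1) * m.k₁ s u.1 u.2.1) :=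
      kernel_le (sel := sel₁) hΛ (hk₁n _ _ _)
        (Finset.single_le_sum (fun v _ => κ₁n (s, u.1) v) (Finset.mem_univ _)) (κ₁s _)
        (κ₁ne _ _) (fun h => κ₁ns h _ _) h1
    have p2 : κ₂ (s, u.1) u.2.2 ≤ Λ * (b₂ (u.1, u.2.2) * m.k₂ s u.1 u.2.2) :=
      kernel_le (sel := sel₂) hΛ (hk₂n _ _ _)
        (Finset.single_le_sum (fun v _ => κ₂n (s, u.1) v) (Finset.mem_univ _)) (κ₂s _)
        (κ₂ne _ _) (fun h => κ₂ns h _ _) h2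
    have q0 : m.a s * κ₀ s u.1 ≤ m.a s * (Λ * (b₀ u.1 * m.k₀ s u.1)) :=
      mul_le_mul_of_nonneg_left p0 (m.a_nonneg s)
    have r0 : 0 ≤ m.a s * (Λ * (b₀ u.1 * m.k₀ s u.1)) :=
      mul_nonneg (m.a_nonneg s) (mul_nonneg (by linarith) (hk₀n _ _))
    have r1 : 0 ≤ Λ * (b₁ (u.1, u.2.1) * m.k₁ s u.1 u.2.1) :=
      mul_nonneg (by linarith) (hk₁n _ _ _)
    have q1 := mul_le_mul q0 p1 (κ₁n _ _) r0
    have q2 := mul_le_mul q1 p2 (κ₂n _ _) (mul_nonneg r0 r1)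
    refine q2.trans (le_of_eq ?_)
    simp only [R, binWt]; ring
  · obtain ⟨g, hg⟩ := κ₀g h
    exact ⟨g, fun s u hq => hg s u.1 fun h' => hq (by simp [h'])⟩
  · obtain ⟨g, hg⟩ := κ₁g h
    exact ⟨fun s u => g (s, u), fun s u hq => hg (s, u.1) u.2.1 fun h' => hq (by simp [h'])⟩
  · obtain ⟨g, hg⟩ := κ₂g h
    exact ⟨fun s u => g (s, u), fun s u hq => hg (s, u.1) u.2.2 fun h' => hq (by simp [h'])⟩

end Model

/-! ### Choice of the keys -/

namespace Model

variable {S U₀ U₁ U₂ Y : Type*} [Fintype S] [Fintype U₀] [Fintype U₁] [Fintype U₂] [Fintype Y]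
  (m : Model S U₀ U₁ U₂ Y)

/-- The joint measure of the layers and `out y`, on the event `G`, when state and layers have
measure `Q`. -/
def through {O : Type*} (Q : S → U₀ × U₁ × U₂ → ℝ) (G : S → U₀ × U₁ × U₂ → Y → Prop) (out : Y → O)
    (u : U₀ × U₁ × U₂) (z : O) : ℝ :=
  ∑ s, ∑ y, Q s u * m.V s u y * ind (G s u y) * ind (out y = z)

/-- How far the key `K u` is from being uniform over `N` values and independent of `out y`, when
state and layers have measure `Q`. -/
def keyDev {O 𝒦 : Type*} [Fintype O] [Fintype 𝒦] (Q : S → U₀ × U₁ × U₂ → ℝ)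
    (G : S → U₀ × U₁ × U₂ → Y → Prop) (out : Y → O) (K : U₀ × U₁ × U₂ → 𝒦) (N : ℝ) : ℝ :=
  ∑ z, ∑ κ, |∑ u, m.through Q G out u z * ind (K u = κ) - (∑ u, m.through Q G out u z) / N|

lemma wt_congr {b₀ : U₀ → ℝ} {b₁ : U₀ × U₁ → ℝ} {b₂ : U₀ × U₂ → ℝ} {A : Pat}
    {u u' : U₀ × U₁ × U₂} (h : A.Agr u u') :
    A.wt (b₀ u.1) (b₁ (u.1, u.2.1)) (b₂ (u.1, u.2.2)) =
      A.wt (b₀ u'.1) (b₁ (u'.1, u'.2.1)) (b₂ (u'.1, u'.2.2)) := by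
  cases A <;> simp_all [Pat.Agr, Pat.wt]

variable {O 𝒦 : Type*} [Fintype O] [Fintype 𝒦] {Q : S → U₀ × U₁ × U₂ → ℝ}
  {G : S → U₀ × U₁ × U₂ → Y → Prop} {out : Y → O}

lemma through_nonneg (hQ : ∀ s u, 0 ≤ Q s u) (u : U₀ × U₁ × U₂) (z : O) :
    0 ≤ m.through Q G out u z :=
  Finset.sum_nonneg fun _ _ => Finset.sum_nonneg fun _ _ => mul_nonneg (mul_nonneg
    (mul_nonneg (hQ _ _) (m.V_nonneg _ _ _)) (ind_nonneg _)) (ind_nonneg _)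

/-- Privacy amplification for the measure `Q`. If `Q` is at most `Λ³` times the law of the model
restricted to the bins, then the average deviation of a random key is controlled by the cost of the
secrecy test. -/
lemma avg_keyDev_le {Ξ : Type*} [Fintype Ξ] [Nonempty Ξ] (K : Ξ → U₀ × U₁ × U₂ → 𝒦)
    {N : ℝ} (hN : 0 < N) (hcard : (Fintype.card 𝒦 : ℝ) = N) {n₀ n₁ n₂ : ℕ} (hn₀ : 0 < n₀)
    (hn₁ : 0 < n₁) (hn₂ : 0 < n₂)
    (hc : ∀ u u', avg (fun ξ => ind (K ξ u = K ξ u')) = coll3 n₀ n₁ n₂ u u' / N)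
    {M₀ M₁ M₂ : ℕ} (hM₀ : 0 < M₀) (hM₁ : 0 < M₁) (hM₂ : 0 < M₂)
    {b₀ : U₀ → ℝ} {b₁ : U₀ × U₁ → ℝ} {b₂ : U₀ × U₂ → ℝ} (hb₀ : ∀ u, b₀ u = 0 ∨ b₀ u = M₀)
    (hb₁ : ∀ u, b₁ u = 0 ∨ b₁ u = M₁) (hb₂ : ∀ u, b₂ u = 0 ∨ b₂ u = M₂)
    (hQ : ∀ s u, 0 ≤ Q s u) {Λ τ : ℝ} (hτ : 0 < τ)
    (hQG : ∀ s u y, G s u y → Q s u ≤ Λ ^ 3 * (binWt b₀ b₁ b₂ u * m.R s u)) (A : Pat) :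
    avg (fun ξ => m.keyDev Q G out (K ξ) N) ≤ (τ * m.refMass b₀ b₁ b₂ A +
      Λ ^ 6 * m.pairSum G out A n₀ n₁ n₂ (fun u u' => binWt b₀ b₁ b₂ u * binWt b₀ b₁ b₂ u')
        (A.wt (M₀ : ℝ) M₁ M₂) / τ) / 2 := by
  have hMA := Pat.wt_pos hM₀ hM₁ hM₂ A
  have hb₀n : ∀ u, 0 ≤ b₀ u := fun u => by rcases hb₀ u with h | h <;> rw [h]; positivity
  have hb₁n : ∀ u, 0 ≤ b₁ u := fun u => by rcases hb₁ u with h | h <;> rw [h]; positivity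
  have hb₂n : ∀ u, 0 ≤ b₂ u := fun u => by rcases hb₂ u with h | h <;> rw [h]; positivity
  have hbn : ∀ u, 0 ≤ binWt b₀ b₁ b₂ u := fun u =>
    mul_nonneg (mul_nonneg (hb₀n _) (hb₁n _)) (hb₂n _)
  set w : U₀ × U₁ × U₂ → ℝ := fun u => A.wt (b₀ u.1) (b₁ (u.1, u.2.1)) (b₂ (u.1, u.2.2)) with hw
  have hwn : ∀ u, 0 ≤ w u := by
    intro u
    have h0 := hb₀n u.1
    have h1 := hb₁n (u.1, u.2.1)
    have h2 := hb₂n (u.1, u.2.2)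
    simp only [hw]
    cases A <;> simp only [Pat.wt] <;> positivity
  have hwM : ∀ u, binWt b₀ b₁ b₂ u ≠ 0 → w u = A.wt (M₀ : ℝ) M₁ M₂ := by
    intro u hu
    have e0 : b₀ u.1 = M₀ := (hb₀ u.1).resolve_left fun h => hu (by simp [binWt, h])
    have e1 : b₁ (u.1, u.2.1) = M₁ := (hb₁ _).resolve_left fun h => hu (by simp [binWt, h])
    have e2 : b₂ (u.1, u.2.2) = M₂ := (hb₂ _).resolve_left fun h => hu (by simp [binWt, h])
    simp only [hw, e0, e1, e2]
  set q := m.through Q G out with hq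
  have hqn : ∀ u z, 0 ≤ q u z := m.through_nonneg hQ
  have hqle : ∀ u z, q u z ≤ Λ ^ 3 * (binWt b₀ b₁ b₂ u * m.obs G out u z) := by
    intro u z
    simp only [hq, through, obs, Finset.mul_sum]
    refine Finset.sum_le_sum fun s _ => Finset.sum_le_sum fun y _ => ?_
    by_cases h : G s u y
    · have h1 := mul_le_mul_of_nonneg_right (hQG s u y h) (m.V_nonneg s u y)
      have h2 := mul_le_mul_of_nonneg_right h1 (ind_nonneg (out y = z))
      rw [ind_of h, mul_one]
      refine h2.trans (le_of_eq ?_)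
      simp only [P]; ring
    · simp [ind_of_not h]
  -- the reference measure on observations
  set r : Option U₀ × Option U₁ × Option U₂ → O → ℝ := fun p z =>
    ∑ u, ind (A.proj u = p) * (w u * m.obs (fun _ _ _ => True) out u z) with hr
  have hrn : ∀ p z, 0 ≤ r p z := fun p z => Finset.sum_nonneg fun u _ =>
    mul_nonneg (ind_nonneg _) (mul_nonneg (hwn u) (m.obs_nonneg _ _ _ _))
  have hr_eq : ∀ u z, r (A.proj u) z = w u * m.obsPat A out u z := by
    intro u z
    simp only [hr, obsPat, Finset.mul_sum]
    refine Finset.sum_congr rfl fun u' _ => ?_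
    rw [ind_congr (Pat.proj_eq_iff A u' u)]
    by_cases h : A.Agr u' u
    · have : w u' = w u := wt_congr h
      rw [ind_of h, this]; ring
    · simp [ind_of_not h]
  have hr_sum : ∑ z, ∑ p, r p z = m.refMass b₀ b₁ b₂ A := by
    have h1 : ∀ z, ∑ p, r p z = ∑ u, w u * m.obs (fun _ _ _ => True) out u z := by
      intro z
      simp only [hr]
      rw [Finset.sum_comm]
      exact Finset.sum_congr rfl fun u _ => by rw [← Finset.sum_mul, sum_ind, one_mul]
    simp only [h1, refMass]
    rw [Finset.sum_comm]
    rw [Finset.sum_comm (s := (Finset.univ : Finset S))]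
    refine Finset.sum_congr rfl fun u _ => ?_
    rw [← Finset.mul_sum, ← Finset.sum_mul, mul_comm]
    congr 1
    simp only [obs, ind_true, mul_one]
    rw [Finset.sum_comm]
    refine Finset.sum_congr rfl fun s _ => ?_
    rw [Finset.sum_comm, ← m.sum_P]
    refine Finset.sum_congr rfl fun y _ => ?_
    rw [← Finset.mul_sum, sum_ind, mul_one]
  set qp : Option U₀ × Option U₁ × Option U₂ → O → U₀ × U₁ × U₂ → ℝ := fun p z u =>
    ind (A.proj u = p) * q u z with hqp
  have hr0 : ∀ p z, r p z = 0 → ∀ u, qp p z u = 0 := by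
    intro p z h u
    by_cases hp : A.proj u = p
    swap
    · simp [hqp, ind_of_not hp]
    subst hp
    simp only [hqp, ind_of, one_mul]
    by_contra hne
    have hpos : 0 < q u z := lt_of_le_of_ne (hqn u z) (Ne.symm hne)
    have h1 := hpos.trans_le (hqle u z)
    have hb : binWt b₀ b₁ b₂ u ≠ 0 := fun h' => by simp [h'] at h1
    have ho : m.obs G out u z ≠ 0 := fun h' => by simp [h'] at h1
    have ho' : 0 < m.obsPat A out u z :=
      (lt_of_le_of_ne (m.obs_nonneg _ _ _ _) (Ne.symm ho)).trans_le (m.obs_le_obsPat G out A u z)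
    rw [hr_eq, hwM u hb] at h
    exact (mul_pos hMA ho').ne' h
  have hsplit : ∀ ξ, m.keyDev Q G out (K ξ) N ≤ ∑ z, ∑ p, ∑ κ,
      |∑ u, qp p z u * ind (K ξ u = κ) - (∑ u, qp p z u) / N| := by
    intro ξ
    refine Finset.sum_le_sum fun z _ => ?_
    rw [Finset.sum_comm]
    refine Finset.sum_le_sum fun κ _ => ?_
    refine le_trans (le_of_eq ?_) (Finset.abs_sum_le_sum_abs _ _)
    congr 1
    rw [Finset.sum_sub_distrib, ← Finset.sum_div]
    congr 1
    · rw [Finset.sum_comm]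
      refine Finset.sum_congr rfl fun u _ => ?_
      rw [← Finset.sum_mul]
      simp only [hqp, ← Finset.sum_mul, sum_ind, one_mul]
      rfl
    · congr 1
      rw [Finset.sum_comm]
      refine Finset.sum_congr rfl fun u _ => ?_
      simp only [hqp, ← Finset.sum_mul, sum_ind, one_mul]
      rfl
  refine (avg_mono hsplit).trans ?_
  rw [avg_sum]
  have hpz : ∀ z p, avg (fun ξ => ∑ κ, |∑ u, qp p z u * ind (K ξ u = κ) - (∑ u, qp p z u) / N|) ≤
      (τ * r p z + ∑ u, ind (A.proj u = p) * ∑ u', Λ ^ 6 * (binWt b₀ b₁ b₂ u * binWt b₀ b₁ b₂ u' *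
        (ind (A.Agr u u') * (coll3 n₀ n₁ n₂ u u' - 1) * (m.obs G out u z * m.obs G out u' z /
        (A.wt (M₀ : ℝ) M₁ M₂ * m.obsPat A out u z)))) / τ) / 2 := by
    intro z p
    refine (avg_key_deviation_le K hN hcard _ hc (qp p z) (hrn p z) hτ (hr0 p z)).trans ?_
    refine div_le_div_of_nonneg_right (add_le_add (le_refl (τ * r p z)) ?_)
      (zero_le_two : (0 : ℝ) ≤ 2)
    rw [Finset.sum_div]
    refine Finset.sum_le_sum fun u _ => ?_
    rw [Finset.sum_div, Finset.mul_sum _ _ (ind (A.proj u = p))]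
    refine Finset.sum_le_sum fun u' _ => ?_
    have hcn : 0 ≤ coll3 n₀ n₁ n₂ u u' - 1 := sub_nonneg.2 (one_le_coll3 hn₀ hn₁ hn₂ u u')
    have hRn : 0 ≤ Λ ^ 6 * (binWt b₀ b₁ b₂ u * binWt b₀ b₁ b₂ u' *
        (ind (A.Agr u u') * (coll3 n₀ n₁ n₂ u u' - 1) * (m.obs G out u z * m.obs G out u' z /
        (A.wt (M₀ : ℝ) M₁ M₂ * m.obsPat A out u z)))) / τ := by
      refine div_nonneg (mul_nonneg (by positivity) (mul_nonneg (mul_nonneg (hbn _) (hbn _))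
        (mul_nonneg (mul_nonneg (ind_nonneg _) hcn) (div_nonneg (mul_nonneg (m.obs_nonneg _ _ _ _)
        (m.obs_nonneg _ _ _ _)) (mul_nonneg hMA.le (m.obsPat_nonneg _ _ _ _)))))) hτ.le
    by_cases hp : A.proj u = p
    swap
    · simp [hqp, ind_of_not hp]
    by_cases hp' : A.proj u' = p
    swap
    · have : qp p z u' = 0 := by simp [hqp, ind_of_not hp']
      rw [this, mul_zero, zero_mul, zero_div]
      exact mul_nonneg (ind_nonneg _) hRn
    have hagr : A.Agr u u' := (Pat.proj_eq_iff A u u').1 (hp.trans hp'.symm)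
    subst hp
    rw [hr_eq, ind_of rfl, one_mul]
    by_cases hb : binWt b₀ b₁ b₂ u = 0
    · have h0 : qp (A.proj u) z u = 0 := by
        have h1 := hqle u z
        rw [hb, zero_mul, mul_zero] at h1
        simp only [hqp]
        rw [le_antisymm h1 (hqn u z), mul_zero]
      rw [h0, zero_mul, zero_mul, zero_div]
      exact hRn
    rw [hwM u hb, ind_of hagr, one_mul]
    have e1 : qp (A.proj u) z u * qp (A.proj u) z u' ≤
        (Λ ^ 3 * (binWt b₀ b₁ b₂ u * m.obs G out u z)) *
        (Λ ^ 3 * (binWt b₀ b₁ b₂ u' * m.obs G out u' z)) := by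
      simp only [hqp, ind_true, ind_of hp', one_mul]
      exact mul_le_mul (hqle u z) (hqle u' z) (hqn _ _) ((hqn u z).trans (hqle u z))
    have hden : 0 ≤ τ * (A.wt (M₀ : ℝ) M₁ M₂ * m.obsPat A out u z) :=
      mul_nonneg hτ.le (mul_nonneg hMA.le (m.obsPat_nonneg _ _ _ _))
    refine (div_le_div_of_nonneg_right (mul_le_mul_of_nonneg_right e1 hcn) hden).trans (le_of_eq ?_)
    rw [div_eq_mul_inv, div_eq_mul_inv, div_eq_mul_inv, mul_inv]
    ring
  calc _ ≤ ∑ z, ∑ p, (τ * r p z + ∑ u, ind (A.proj u = p) * ∑ u', Λ ^ 6 *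
        (binWt b₀ b₁ b₂ u * binWt b₀ b₁ b₂ u' *
        (ind (A.Agr u u') * (coll3 n₀ n₁ n₂ u u' - 1) * (m.obs G out u z * m.obs G out u' z /
        (A.wt (M₀ : ℝ) M₁ M₂ * m.obsPat A out u z)))) / τ) / 2 := by
        refine Finset.sum_le_sum fun z _ => ?_
        rw [avg_sum]
        exact Finset.sum_le_sum fun p _ => hpz z p
    _ = _ := by
        simp only [← Finset.sum_div, Finset.sum_add_distrib, ← Finset.mul_sum, hr_sum]
        congr 3
        simp only [pairSum, Finset.mul_sum, Finset.sum_div]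
        refine Finset.sum_congr rfl fun z _ => ?_
        rw [Finset.sum_comm]
        refine Finset.sum_congr rfl fun u _ => ?_
        simp only [← Finset.mul_sum, ← Finset.sum_mul, sum_ind, one_mul]

/-- Restricting to the event `G` changes the deviation of a key by at most twice the mass lost. -/
lemma keyDev_le_add (hQ : ∀ s u, 0 ≤ Q s u) (K : U₀ × U₁ × U₂ → 𝒦) {N : ℝ}
    (hN : 0 < N) (hcard : (Fintype.card 𝒦 : ℝ) = N) :
    m.keyDev Q (fun _ _ _ => True) out K N ≤ m.keyDev Q G out K N +
      2 * ∑ s, ∑ u, ∑ y, Q s u * m.V s u y * ind (¬G s u y) := by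
  set g := m.through Q (fun s u y => ¬G s u y) out with hg
  have hgn : ∀ u z, 0 ≤ g u z := m.through_nonneg hQ
  have hsplit : ∀ u z, m.through Q (fun _ _ _ => True) out u z = m.through Q G out u z + g u z := by
    intro u z
    simp only [hg, through, ← Finset.sum_add_distrib, ind_not, ind_true]
    exact Finset.sum_congr rfl fun s _ => Finset.sum_congr rfl fun y _ => by ring
  have hK : ∀ z, ∑ κ, ∑ u, g u z * ind (K u = κ) = ∑ u, g u z := by
    intro z
    rw [Finset.sum_comm]
    exact Finset.sum_congr rfl fun u _ => by rw [← Finset.mul_sum, sum_ind, mul_one]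
  have htot : ∑ z, ∑ u, g u z = ∑ s, ∑ u, ∑ y, Q s u * m.V s u y * ind (¬G s u y) := by
    rw [Finset.sum_comm, Finset.sum_comm (s := (Finset.univ : Finset S))]
    refine Finset.sum_congr rfl fun u _ => ?_
    simp only [hg, through]
    rw [Finset.sum_comm]
    refine Finset.sum_congr rfl fun s _ => ?_
    rw [Finset.sum_comm]
    exact Finset.sum_congr rfl fun y _ => by rw [← Finset.mul_sum, sum_ind, mul_one]
  calc _ ≤ ∑ z, ∑ κ, (|∑ u, m.through Q G out u z * ind (K u = κ)
          - (∑ u, m.through Q G out u z) / N| +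
        (∑ u, g u z * ind (K u = κ) + (∑ u, g u z) / N)) := by
        refine Finset.sum_le_sum fun z _ => Finset.sum_le_sum fun κ _ => ?_
        have e : ∑ u, m.through Q (fun _ _ _ => True) out u z * ind (K u = κ)
            - (∑ u, m.through Q (fun _ _ _ => True) out u z) / N =
            (∑ u, m.through Q G out u z * ind (K u = κ) - (∑ u, m.through Q G out u z) / N) +
            (∑ u, g u z * ind (K u = κ) - (∑ u, g u z) / N) := by
          simp only [hsplit, add_mul, Finset.sum_add_distrib]
          ring
        rw [e]
        refine (abs_add_le _ _).trans (add_le_add le_rfl ?_)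
        have p1 : 0 ≤ ∑ u, g u z * ind (K u = κ) :=
          Finset.sum_nonneg fun u _ => mul_nonneg (hgn _ _) (ind_nonneg _)
        have p2 : 0 ≤ (∑ u, g u z) / N := div_nonneg (Finset.sum_nonneg fun u _ => hgn _ _) hN.le
        rw [abs_le]; constructor <;> linarith
    _ = _ := by
        simp only [Finset.sum_add_distrib, hK, Finset.sum_const, Finset.card_univ, nsmul_eq_mul,
          hcard, htot]
        rw [← Finset.mul_sum, ← Finset.sum_div, htot, mul_div_cancel₀ _ hN.ne']
        simp only [keyDev]
        ring

end Model

/-! ### The one-shot coding theorem -/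

namespace Model

variable {S U₀ U₁ U₂ Y : Type*} [Fintype S] [Fintype U₀] [Fintype U₁] [Fintype U₂] [Fintype Y]
  (m : Model S U₀ U₁ U₂ Y) {Y₁ Y₂ Z : Type*} [Fintype Y₁] [Fintype Y₂] [Fintype Z]

/-- The keys obtained by applying one function to each layer. -/
def keyOf {N₀ N₁ N₂ : ℕ} (ξ : (U₀ → Fin N₀) × (U₀ × U₁ → Fin N₁) × (U₀ × U₂ → Fin N₂))
    (u : U₀ × U₁ × U₂) : Fin N₀ × Fin N₁ × Fin N₂ :=
  (ξ.1 u.1, ξ.2.1 (u.1, u.2.1), ξ.2.2 (u.1, u.2.2))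

lemma pairSum_nonneg {O : Type*} [Fintype O] {M₀ M₁ M₂ : ℕ} (hM₀ : 0 < M₀) (hM₁ : 0 < M₁)
    (hM₂ : 0 < M₂) (G : S → U₀ × U₁ × U₂ → Y → Prop) (out : Y → O) (B : Pat) {n₀ n₁ n₂ : ℕ}
    (p₀ : 0 < n₀) (p₁ : 0 < n₁) (p₂ : 0 < n₂) {c : U₀ × U₁ × U₂ → ℝ} (hc : ∀ u, 0 ≤ c u) :
    0 ≤ m.pairSum G out B n₀ n₁ n₂ (fun u u' => c u * c u') (B.wt (M₀ : ℝ) M₁ M₂) := by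
  refine Finset.sum_nonneg fun _ _ => Finset.sum_nonneg fun _ _ => Finset.sum_nonneg fun _ _ => ?_
  exact mul_nonneg (mul_nonneg (hc _) (hc _)) (mul_nonneg (mul_nonneg (ind_nonneg _)
    (sub_nonneg.2 (one_le_coll3 p₀ p₁ p₂ _ _))) (div_nonneg (mul_nonneg (m.obs_nonneg _ _ _ _)
    (m.obs_nonneg _ _ _ _)) (mul_nonneg (Pat.wt_pos hM₀ hM₁ hM₂ B).le
    (m.obsPat_nonneg _ _ _ _))))

/-- Existence of one choice of bins for which all costs are within a constant factor of their
averages. The three secrecy tests have patterns `A i`, key sizes `n i` and costs `pair i`. -/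
lemma exists_bins {M₀ M₁ M₂ : ℕ} (hM₀ : 0 < M₀) (hM₁ : 0 < M₁) (hM₂ : 0 < M₂)
    {G : S → U₀ × U₁ × U₂ → Y → Prop} (y₁ : Y → Y₁) (y₂ : Y → Y₂) (z : Y → Z)
    (sel₁ sel₂ : Prop) {T₁ : U₀ → U₁ → Y₁ → Prop} {T₂ : U₀ → U₂ → Y₂ → Prop}
    {ε β₀ β₁ β₂ δ : ℝ} (hε : 0 < ε) (hδ : 0 < δ)
    (hG : ∑ s, ∑ u, ∑ y, m.P s u y * ind (¬G s u y) ≤ ε)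
    (hβ₀ : 0 ≤ β₀) (hβ₁ : 0 ≤ β₁) (hβ₂ : 0 ≤ β₂)
    (hk₀ : ∀ s u y, G s u y → m.k₀ s u.1 ≤ β₀)
    (hk₁ : ∀ s u y, G s u y → m.k₁ s u.1 u.2.1 ≤ β₁)
    (hk₂ : ∀ s u y, G s u y → m.k₂ s u.1 u.2.2 ≤ β₂)
    (hMβ₀ : (M₀ - 1) * β₀ ≤ ε ^ 2) (hMβ₁ : (M₁ - 1) * β₁ ≤ ε ^ 2) (hMβ₂ : (M₂ - 1) * β₂ ≤ ε ^ 2)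
    (h01 : ¬sel₁ → ∀ y, ∑ v : U₀ × U₁, ind (T₁ v.1 v.2 y) ≤ ε * (M₀ * M₁))
    (h1 : ¬sel₁ → ∀ u₀ y, ∑ v₁, ind (T₁ u₀ v₁ y) ≤ ε * M₁)
    (h02 : ¬sel₂ → ∀ y, ∑ v : U₀ × U₂, ind (T₂ v.1 v.2 y) ≤ ε * (M₀ * M₂))
    (h2 : ¬sel₂ → ∀ u₀ y, ∑ v₂, ind (T₂ u₀ v₂ y) ≤ ε * M₂)
    {N₀ N₁ N₂ : ℕ} (hN₀ : 0 < N₀) (hN₁ : 0 < N₁) (hN₂ : 0 < N₂) (A : Pat)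
    (hz : m.PassesTest G z A N₀ N₁ N₂ M₀ M₁ M₂ δ)
    (hy₂ : m.PassesTest G y₂ .two 1 N₁ 1 M₀ M₁ M₂ δ)
    (hy₁ : m.PassesTest G y₁ .one 1 1 N₂ M₀ M₁ M₂ δ) :
    ∃ (b₀ : U₀ → ℝ) (b₁ : U₀ × U₁ → ℝ) (b₂ : U₀ × U₂ → ℝ),
      (∀ u, b₀ u = 0 ∨ b₀ u = M₀) ∧ (∀ u, b₁ u = 0 ∨ b₁ u = M₁) ∧ (∀ u, b₂ u = 0 ∨ b₂ u = M₂) ∧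
      m.cov₀ b₀ ≤ 50 * ε ∧ m.cov₁ b₀ b₁ ≤ 50 * ε ∧ m.cov₂ b₀ b₂ ≤ 50 * ε ∧
      ∑ s, ∑ u, m.R s u * binWt b₀ b₁ b₂ u *
        m.badness y₁ y₂ G sel₁ sel₂ M₀ M₁ M₂ T₁ T₂ b₀ b₁ b₂ s u ≤ 50 * ε ∧
      (∀ A, m.refMass b₀ b₁ b₂ A ≤ 50) ∧
      m.pairSum G z A N₀ N₁ N₂ (fun u u' => binWt b₀ b₁ b₂ u * binWt b₀ b₁ b₂ u')
        (A.wt (M₀ : ℝ) M₁ M₂) ≤ 100 * δ ∧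
      m.pairSum G y₂ .two 1 N₁ 1 (fun u u' => binWt b₀ b₁ b₂ u * binWt b₀ b₁ b₂ u')
        (Pat.two.wt (M₀ : ℝ) M₁ M₂) ≤ 100 * δ ∧
      m.pairSum G y₁ .one 1 1 N₂ (fun u u' => binWt b₀ b₁ b₂ u * binWt b₀ b₁ b₂ u')
        (Pat.one.wt (M₀ : ℝ) M₁ M₂) ≤ 100 * δ := by
  obtain ⟨Θ₀, _, _, φ₀, H₀⟩ := exists_isBinning U₀ hM₀
  obtain ⟨Θ₁, _, _, φ₁, H₁⟩ := exists_isBinning (U₀ × U₁) hM₁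
  obtain ⟨Θ₂, _, _, φ₂, H₂⟩ := exists_isBinning (U₀ × U₂) hM₂
  have hn₀ := H₀.nonneg
  have hn₁ := H₁.nonneg
  have hn₂ := H₂.nonneg
  have hbn : ∀ (θ : Θ₀ × Θ₁ × Θ₂) u, 0 ≤ binWtAt φ₀ φ₁ φ₂ θ u := fun θ u =>
    mul_nonneg (mul_nonneg (hn₀ _ _) (hn₁ _ _)) (hn₂ _ _)
  have hnorm : ∀ (θ : Θ₀ × Θ₁ × Θ₂) (B : Pat),
      0 ≤ m.refMass (φ₀ θ.1) (φ₁ θ.2.1) (φ₂ θ.2.2) B := by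
    intro θ B
    refine Finset.sum_nonneg fun s _ => Finset.sum_nonneg fun u _ => mul_nonneg (m.R_nonneg s u) ?_
    have h0 := hn₀ θ.1 u.1
    have h1 := hn₁ θ.2.1 (u.1, u.2.1)
    have h2 := hn₂ θ.2.2 (u.1, u.2.2)
    cases B <;> simp only [Pat.wt] <;> positivity
  -- all costs, with their averages
  let F : Fin 8 → Θ₀ × Θ₁ × Θ₂ → ℝ := ![
    fun θ => m.cov₀ (φ₀ θ.1), fun θ => m.cov₁ (φ₀ θ.1) (φ₁ θ.2.1),
    fun θ => m.cov₂ (φ₀ θ.1) (φ₂ θ.2.2),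
    fun θ => ∑ s, ∑ u, m.R s u * binWtAt φ₀ φ₁ φ₂ θ u *
      m.badness y₁ y₂ G sel₁ sel₂ M₀ M₁ M₂ T₁ T₂ (φ₀ θ.1) (φ₁ θ.2.1) (φ₂ θ.2.2) s u,
    fun θ => ∑ B, m.refMass (φ₀ θ.1) (φ₁ θ.2.1) (φ₂ θ.2.2) B,
    fun θ => m.pairSum G z A N₀ N₁ N₂
      (fun u u' => binWtAt φ₀ φ₁ φ₂ θ u * binWtAt φ₀ φ₁ φ₂ θ u') (A.wt (M₀ : ℝ) M₁ M₂),
    fun θ => m.pairSum G y₂ .two 1 N₁ 1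
      (fun u u' => binWtAt φ₀ φ₁ φ₂ θ u * binWtAt φ₀ φ₁ φ₂ θ u') (Pat.two.wt (M₀ : ℝ) M₁ M₂),
    fun θ => m.pairSum G y₁ .one 1 1 N₂
      (fun u u' => binWtAt φ₀ φ₁ φ₂ θ u * binWtAt φ₀ φ₁ φ₂ θ u') (Pat.one.wt (M₀ : ℝ) M₁ M₂)]
  let e : Fin 8 → ℝ := ![3 * ε, 3 * ε, 3 * ε, 5 * ε, 5, 5 * δ, 5 * δ, 5 * δ]
  have he : ∀ i, 0 < e i := by
    intro i; fin_cases i <;> simp [e] <;> positivity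
  have hF : ∀ i θ, 0 ≤ F i θ := by
    intro i θ
    have hc₀ : ∀ s u, 0 ≤ m.a s * (φ₀ θ.1 u * m.k₀ s u) := fun s u =>
      mul_nonneg (m.a_nonneg s) (mul_nonneg (hn₀ _ _) (m.k₀_nonneg _ _))
    fin_cases i
    · exact Finset.sum_nonneg fun s _ => mul_nonneg (m.a_nonneg s) (abs_nonneg _)
    · exact Finset.sum_nonneg fun s _ => Finset.sum_nonneg fun u _ =>
        mul_nonneg (hc₀ s u) (abs_nonneg _)
    · exact Finset.sum_nonneg fun s _ => Finset.sum_nonneg fun u _ =>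
        mul_nonneg (hc₀ s u) (abs_nonneg _)
    · exact Finset.sum_nonneg fun s _ => Finset.sum_nonneg fun u _ =>
        mul_nonneg (mul_nonneg (m.R_nonneg _ _) (hbn _ _))
          (m.badness_nonneg y₁ y₂ (hn₀ _) (hn₁ _) (hn₂ _) s u)
    · change 0 ≤ ∑ B, m.refMass (φ₀ θ.1) (φ₁ θ.2.1) (φ₂ θ.2.2) B
      exact Finset.sum_nonneg fun B _ => hnorm θ B
    · exact m.pairSum_nonneg hM₀ hM₁ hM₂ G z A hN₀ hN₁ hN₂ (hbn θ)
    · exact m.pairSum_nonneg hM₀ hM₁ hM₂ G y₂ .two one_pos hN₁ one_pos (hbn θ)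
    · exact m.pairSum_nonneg hM₀ hM₁ hM₂ G y₁ .one one_pos one_pos hN₂ (hbn θ)
  have havg : ∀ i, avg (F i) ≤ e i := by
    intro i
    fin_cases i
    · change avg (fun θ : Θ₀ × Θ₁ × Θ₂ => m.cov₀ (φ₀ θ.1)) ≤ 3 * ε
      rw [avg_prod]
      simp only [avg_const]
      exact m.avg_cov₀_le H₀ hM₀ hε hG hβ₀ hk₀ hMβ₀
    · change avg (fun θ : Θ₀ × Θ₁ × Θ₂ => m.cov₁ (φ₀ θ.1) (φ₁ θ.2.1)) ≤ 3 * ε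
      have := m.avg_cov₁_le H₀ H₁ hM₁ hε hG hβ₁ hk₁ hMβ₁
      rw [avg_prod] at this ⊢
      simpa only [avg_prod (Θ := Θ₁), avg_const] using this
    · change avg (fun θ : Θ₀ × Θ₁ × Θ₂ => m.cov₂ (φ₀ θ.1) (φ₂ θ.2.2)) ≤ 3 * ε
      have := m.avg_cov₂_le H₀ H₂ hM₂ hε hG hβ₂ hk₂ hMβ₂
      rw [avg_prod] at this ⊢
      simpa only [avg_prod (Θ := Θ₁), avg_const] using this
    · exact m.avg_badness_le y₁ y₂ H₀ H₁ H₂ hM₀ hM₁ hM₂ hε.le hG h01 h1 h02 h2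
    · change avg (fun θ : Θ₀ × Θ₁ × Θ₂ => ∑ B, m.refMass (φ₀ θ.1) (φ₁ θ.2.1) (φ₂ θ.2.2) B) ≤ 5
      rw [avg_sum]
      simp only [m.avg_refMass H₀ H₁ H₂]
      simp [Finset.card_univ, show Fintype.card Pat = 5 from rfl]
    · exact (m.avg_pairSum H₀ H₁ H₂ G z A N₀ N₁ N₂ _).trans_le
        (m.pairSum_le G z hN₀ hN₁ hN₂ hM₀ hM₁ hM₂ hδ.le hz)
    · exact (m.avg_pairSum H₀ H₁ H₂ G y₂ .two 1 N₁ 1 _).trans_le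
        (m.pairSum_le G y₂ one_pos hN₁ one_pos hM₀ hM₁ hM₂ hδ.le hy₂)
    · exact (m.avg_pairSum H₀ H₁ H₂ G y₁ .one 1 1 N₂ _).trans_le
        (m.pairSum_le G y₁ one_pos one_pos hN₂ hM₀ hM₁ hM₂ hδ.le hy₁)
  obtain ⟨θ, hθ⟩ := exists_forall_le_of_avg_le F e he hF havg
  rw [Fintype.card_fin] at hθ
  have q0 : m.cov₀ (φ₀ θ.1) ≤ ((8 : ℕ) : ℝ) * (3 * ε) := hθ 0
  have q1 : m.cov₁ (φ₀ θ.1) (φ₁ θ.2.1) ≤ ((8 : ℕ) : ℝ) * (3 * ε) := hθ 1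
  have q2 : m.cov₂ (φ₀ θ.1) (φ₂ θ.2.2) ≤ ((8 : ℕ) : ℝ) * (3 * ε) := hθ 2
  have q3 := hθ 3
  have q4 : ∑ B, m.refMass (φ₀ θ.1) (φ₁ θ.2.1) (φ₂ θ.2.2) B ≤ ((8 : ℕ) : ℝ) * 5 := hθ 4
  have q5 := hθ 5
  have q6 := hθ 6
  have q7 := hθ 7
  have r3 : e 3 = 5 * ε := rfl
  have r5 : e 5 = 5 * δ := rfl
  have r6 : e 6 = 5 * δ := rfl
  have r7 : e 7 = 5 * δ := rfl
  rw [r3] at q3; rw [r5] at q5; rw [r6] at q6; rw [r7] at q7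
  push_cast at q0 q1 q2 q3 q4 q5 q6 q7
  refine ⟨φ₀ θ.1, φ₁ θ.2.1, φ₂ θ.2.2, H₀.values _, H₁.values _, H₂.values _, by linarith,
    by linarith, by linarith, ?_, fun B => ?_, ?_, ?_, ?_⟩
  · exact le_trans q3 (by linarith)
  · have := Finset.single_le_sum (fun B _ => hnorm θ B) (Finset.mem_univ B)
    linarith
  · exact le_trans q5 (by linarith)
  · exact le_trans q6 (by linarith)
  · exact le_trans q7 (by linarith)

lemma avg_keyOf {N₀ N₁ N₂ : ℕ} (hN₀ : 0 < N₀) (hN₁ : 0 < N₁) (hN₂ : 0 < N₂)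
    [DecidableEq U₀] [DecidableEq U₁] [DecidableEq U₂] (u u' : U₀ × U₁ × U₂) :
    avg (fun ξ : (U₀ → Fin N₀) × (U₀ × U₁ → Fin N₁) × (U₀ × U₂ → Fin N₂) =>
      ind (keyOf ξ u = keyOf ξ u')) = coll3 N₀ N₁ N₂ u u' / (N₀ * N₁ * N₂ : ℝ) := by
  have e := avg_prod_mul₃
    (fun ξ : U₀ → Fin N₀ => ind (ξ u.1 = ξ u'.1))
    (fun ξ : U₀ × U₁ → Fin N₁ => ind (ξ (u.1, u.2.1) = ξ (u'.1, u'.2.1)))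
    (fun ξ : U₀ × U₂ → Fin N₂ => ind (ξ (u.1, u.2.2) = ξ (u'.1, u'.2.2)))
  rw [avg_collision hN₀, avg_collision hN₁, avg_collision hN₂] at e
  rw [coll3]
  have : ∀ a b c d e f : ℝ, a / b * (c / d) * (e / f) = a * c * e / (b * d * f) := by
    intros; rw [div_mul_div_comm, div_mul_div_comm]
  rw [← this, ← e]
  congr 1; funext ξ
  rw [← ind_and, ← ind_and]
  refine ind_congr ?_
  simp only [keyOf, Prod.mk.injEq, and_assoc]

/-- Typicality decoding errs only outside `G` or if there is ambiguity. -/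
lemma exists_decoder [Nonempty U₀] [Nonempty U₁] {M₀ M₁ : ℕ} (hM₀ : 0 < M₀) (hM₁ : 0 < M₁)
    {b₀ : U₀ → ℝ} {b₁ : U₀ × U₁ → ℝ} (hb₀ : ∀ u, b₀ u = 0 ∨ b₀ u = M₀)
    (hb₁ : ∀ u, b₁ u = 0 ∨ b₁ u = M₁) (T : U₀ → U₁ → Y₁ → Prop) :
    ∃ D : Y₁ → U₀ × U₁, ∀ (u : U₀ × U₁) (y : Y₁), b₀ u.1 ≠ 0 → b₁ u ≠ 0 → T u.1 u.2 y →
      ind (D y ≠ u) ≤ ambiguity b₀ b₁ M₀ M₁ T u y := by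
  classical
  obtain ⟨u₀⟩ := ‹Nonempty U₀›
  obtain ⟨u₁⟩ := ‹Nonempty U₁›
  have hM₀' : (0 : ℝ) < M₀ := by exact_mod_cast hM₀
  have hM₁' : (0 : ℝ) < M₁ := by exact_mod_cast hM₁
  have hb₀n : ∀ u, 0 ≤ b₀ u := fun u => by rcases hb₀ u with h | h <;> rw [h]; positivity
  have hb₁n : ∀ u, 0 ≤ b₁ u := fun u => by rcases hb₁ u with h | h <;> rw [h]; positivity
  refine ⟨fun y => if h : ∃ v : U₀ × U₁, b₀ v.1 ≠ 0 ∧ b₁ v ≠ 0 ∧ T v.1 v.2 y then h.choose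
    else (u₀, u₁), fun u y h0 h1 hT => ?_⟩
  have hex : ∃ v : U₀ × U₁, b₀ v.1 ≠ 0 ∧ b₁ v ≠ 0 ∧ T v.1 v.2 y := ⟨u, h0, h1, hT⟩
  simp only [dif_pos hex]
  set v := hex.choose with hv
  obtain ⟨hv0, hv1, hvT⟩ := hex.choose_spec
  rw [← hv] at hv0 hv1 hvT
  by_cases hvu : v = u
  · rw [ind_of_not (not_not.2 hvu)]
    exact ambiguity_nonneg hb₀n hb₁n _ _ _ _ _
  · have := Finset.single_le_sum (f := fun v : U₀ × U₁ => ind (v ≠ u) * ind (T v.1 v.2 y) *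
      (b₀ v.1 * b₁ v / (M₀ * M₁))) (fun _ _ => mul_nonneg (mul_nonneg (ind_nonneg _) (ind_nonneg _))
      (div_nonneg (mul_nonneg (hb₀n _) (hb₁n _)) (by positivity))) (Finset.mem_univ v)
    refine le_trans (le_of_eq ?_) this
    simp only [ind_of hvu, ind_of hvT, (hb₀ v.1).resolve_left hv0, (hb₁ v).resolve_left hv1]
    rw [div_self (by positivity)]; norm_num

/-- One-shot coding theorem. If the bin sizes `Mᵢ` are small enough for covering and large enough for
decoding, and the key sizes `Nᵢ` pass the three secrecy tests, then there are a measure `Q` of state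
and layers, dominated by the law of the state, key functions and decoders of the layers with small
error and small deviations of the keys. A receiver `j` with `sel j` decodes without error, since
the layers meant for it are functions of `vⱼ s`, which it knows from its output. -/
theorem one_shot [Nonempty U₀] [Nonempty U₁] [Nonempty U₂] {M₀ M₁ M₂ : ℕ} (hM₀ : 0 < M₀)
    (hM₁ : 0 < M₁) (hM₂ : 0 < M₂)
    {G : S → U₀ × U₁ × U₂ → Y → Prop} (y₁ : Y → Y₁) (y₂ : Y → Y₂) (z : Y → Z)
    (v₀ v₁ v₂ : S → S) (hv₀ : ∀ s s', v₀ s = v₀ s' → m.k₀ s = m.k₀ s')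
    (hv₁ : ∀ s s', v₁ s = v₁ s' → m.k₁ s = m.k₁ s')
    (hv₂ : ∀ s s', v₂ s = v₂ s' → m.k₂ s = m.k₂ s')
    (hv₀₁ : ∀ s, v₀ (v₁ s) = v₀ s) (hv₀₂ : ∀ s, v₀ (v₂ s) = v₀ s)
    (sel₁ sel₂ : Prop)
    (β₁ : Y₁ → S) (hsel₁ : sel₁ → ∀ s u y, m.a s ≠ 0 → m.V s u y ≠ 0 → β₁ (y₁ y) = v₁ s)
    (β₂ : Y₂ → S) (hsel₂ : sel₂ → ∀ s u y, m.a s ≠ 0 → m.V s u y ≠ 0 → β₂ (y₂ y) = v₂ s)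
    {T₁ : U₀ → U₁ → Y₁ → Prop} {T₂ : U₀ → U₂ → Y₂ → Prop}
    (hT₁ : ∀ s u y, G s u y → T₁ u.1 u.2.1 (y₁ y)) (hT₂ : ∀ s u y, G s u y → T₂ u.1 u.2.2 (y₂ y))
    {ε b₀ b₁ b₂ Λ : ℝ} (hε : 0 < ε) (hΛ : 1 ≤ Λ)
    (hG : ∑ s, ∑ u, ∑ y, m.P s u y * ind (¬G s u y) ≤ ε)
    (hb₀ : 0 ≤ b₀) (hb₁ : 0 ≤ b₁) (hb₂ : 0 ≤ b₂)
    (hk₀ : ∀ s u y, G s u y → m.k₀ s u.1 ≤ b₀)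
    (hk₁ : ∀ s u y, G s u y → m.k₁ s u.1 u.2.1 ≤ b₁)
    (hk₂ : ∀ s u y, G s u y → m.k₂ s u.1 u.2.2 ≤ b₂)
    (hMb₀ : (M₀ - 1) * b₀ ≤ ε ^ 2) (hMb₁ : (M₁ - 1) * b₁ ≤ ε ^ 2) (hMb₂ : (M₂ - 1) * b₂ ≤ ε ^ 2)
    (hΛ₀ : sel₁ ∨ sel₂ → ∀ s u y, G s u y → 1 ≤ Λ * (M₀ * m.k₀ s u.1))
    (hΛ₁ : sel₁ → ∀ s u y, G s u y → 1 ≤ Λ * (M₁ * m.k₁ s u.1 u.2.1))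
    (hΛ₂ : sel₂ → ∀ s u y, G s u y → 1 ≤ Λ * (M₂ * m.k₂ s u.1 u.2.2))
    (h01 : ¬sel₁ → ∀ y, ∑ v : U₀ × U₁, ind (T₁ v.1 v.2 y) ≤ ε * (M₀ * M₁))
    (h1 : ¬sel₁ → ∀ u₀ y, ∑ v₁, ind (T₁ u₀ v₁ y) ≤ ε * M₁)
    (h02 : ¬sel₂ → ∀ y, ∑ v : U₀ × U₂, ind (T₂ v.1 v.2 y) ≤ ε * (M₀ * M₂))
    (h2 : ¬sel₂ → ∀ u₀ y, ∑ v₂, ind (T₂ u₀ v₂ y) ≤ ε * M₂)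
    {N₀ N₁ N₂ : ℕ} (hN₀ : 0 < N₀) (hN₁ : 0 < N₁) (hN₂ : 0 < N₂) (A : Pat)
    (hz : m.PassesTest G z A N₀ N₁ N₂ M₀ M₁ M₂ (ε ^ 2 / Λ ^ 6))
    (hy₂ : m.PassesTest G y₂ .two 1 N₁ 1 M₀ M₁ M₂ (ε ^ 2 / Λ ^ 6))
    (hy₁ : m.PassesTest G y₁ .one 1 1 N₂ M₀ M₁ M₂ (ε ^ 2 / Λ ^ 6)) :
    ∃ (Q : S → U₀ × U₁ × U₂ → ℝ)
      (ξ : (U₀ → Fin N₀) × (U₀ × U₁ → Fin N₁) × (U₀ × U₂ → Fin N₂))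
      (D₁ : Y₁ → U₀ × U₁) (D₂ : Y₂ → U₀ × U₂),
      (∀ s u, 0 ≤ Q s u) ∧ (∀ s, ∑ u, Q s u ≤ m.a s) ∧ (1 - 700 * ε ≤ ∑ s, ∑ u, Q s u) ∧
      (∑ s, ∑ u, ∑ y, Q s u * m.V s u y * ind (D₁ (y₁ y) ≠ (u.1, u.2.1)) ≤ 1200 * ε) ∧
      (∑ s, ∑ u, ∑ y, Q s u * m.V s u y * ind (D₂ (y₂ y) ≠ (u.1, u.2.2)) ≤ 1200 * ε) ∧
      m.keyDev Q (fun _ _ _ => True) z (keyOf ξ) (N₀ * N₁ * N₂) ≤ 2700 * ε ∧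
      m.keyDev Q (fun _ _ _ => True) y₂ (fun u => (keyOf ξ u).2.1) N₁ ≤ 2700 * ε ∧
      m.keyDev Q (fun _ _ _ => True) y₁ (fun u => (keyOf ξ u).2.2) N₂ ≤ 2700 * ε := by
  classical
  have hΛ0 : 0 < Λ := by linarith
  obtain ⟨c₀, c₁, c₂, hc₀, hc₁, hc₂, hcov₀, hcov₁, hcov₂, hbad, href, hpz, hp₂, hp₁⟩ :=
    m.exists_bins hM₀ hM₁ hM₂ y₁ y₂ z sel₁ sel₂ hε (δ := ε ^ 2 / Λ ^ 6) (by positivity) hG hb₀ hb₁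
      hb₂ hk₀ hk₁ hk₂ hMb₀ hMb₁ hMb₂ h01 h1 h02 h2 hN₀ hN₁ hN₂ A hz hy₂ hy₁
  have hc₀n : ∀ u, 0 ≤ c₀ u := fun u => by rcases hc₀ u with h | h <;> rw [h]; positivity
  have hc₁n : ∀ u, 0 ≤ c₁ u := fun u => by rcases hc₁ u with h | h <;> rw [h]; positivity
  have hc₂n : ∀ u, 0 ≤ c₂ u := fun u => by rcases hc₂ u with h | h <;> rw [h]; positivity
  obtain ⟨Q, hQ, hQa, hQm, hQb, hQne, hQle, hg₀, hg₁, hg₂⟩ := m.exists_encoding v₀ v₁ v₂ hv₀ hv₁ hv₂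
    sel₁ sel₂ hc₀n hc₁n hc₂n _ (m.badness_nonneg y₁ y₂ hc₀n hc₁n hc₂n) hcov₀ hcov₁ hcov₂ hbad hΛ
  set bad := m.badness y₁ y₂ G sel₁ sel₂ M₀ M₁ M₂ T₁ T₂ c₀ c₁ c₂ with hbaddef
  -- typical points in the bins have weight at least `1 / Λ`, so that each of the three selections
  -- costs at most a factor `Λ`
  have hQG : ∀ s u y, G s u y → Q s u ≤ Λ ^ 3 * (binWt c₀ c₁ c₂ u * m.R s u) := by
    intro s u y hg
    refine hQle s u (fun hs h => ?_) (fun hs h => ?_) (fun hs h => ?_)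
    · rw [(hc₀ u.1).resolve_left (left_ne_zero_of_mul h)]; exact hΛ₀ hs s u y hg
    · rw [(hc₁ _).resolve_left (left_ne_zero_of_mul h)]; exact hΛ₁ hs s u y hg
    · rw [(hc₂ _).resolve_left (left_ne_zero_of_mul h)]; exact hΛ₂ hs s u y hg
  -- whatever is pointwise at most the integrand of the badness has small expectation
  have hcost : ∀ e : S → U₀ × U₁ × U₂ → Y → ℝ,
      (∀ s u y, Q s u ≠ 0 → m.V s u y ≠ 0 → e s u y ≤ ind (¬G s u y) +
        ind (¬sel₁) * ambiguity c₀ c₁ M₀ M₁ T₁ (u.1, u.2.1) (y₁ y) +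
        ind (¬sel₂) * ambiguity c₀ c₂ M₀ M₂ T₂ (u.1, u.2.2) (y₂ y)) →
      ∑ s, ∑ u, ∑ y, Q s u * m.V s u y * e s u y ≤ 1200 * ε := by
    intro e he
    calc _ ≤ ∑ s, ∑ u, Q s u * bad s u := by
          refine Finset.sum_le_sum fun s _ => Finset.sum_le_sum fun u _ => ?_
          simp only [hbaddef, badness]
          rw [Finset.mul_sum]
          refine Finset.sum_le_sum fun y _ => ?_
          rw [mul_assoc]
          by_cases hq : Q s u = 0
          · simp [hq]
          refine mul_le_mul_of_nonneg_left ?_ (hQ s u)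
          by_cases hV : m.V s u y = 0
          · simp [hV]
          exact mul_le_mul_of_nonneg_left (he s u y hq hV) (m.V_nonneg _ _ _)
      _ ≤ _ := by linarith
  have hGc : ∑ s, ∑ u, ∑ y, Q s u * m.V s u y * ind (¬G s u y) ≤ 1200 * ε := by
    refine hcost _ fun s u y _ _ => ?_
    have q1 := mul_nonneg (ind_nonneg (¬sel₁))
      (ambiguity_nonneg hc₀n hc₁n M₀ M₁ T₁ (u.1, u.2.1) (y₁ y))
    have q2 := mul_nonneg (ind_nonneg (¬sel₂))
      (ambiguity_nonneg hc₀n hc₂n M₀ M₂ T₂ (u.1, u.2.2) (y₂ y))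
    linarith
  -- A receiver with `sel` recomputes the selected layers; any other receiver looks for layers in the
  -- bins that are typical with its output.
  have hD₁ : ∃ D₁ : Y₁ → U₀ × U₁,
      ∑ s, ∑ u, ∑ y, Q s u * m.V s u y * ind (D₁ (y₁ y) ≠ (u.1, u.2.1)) ≤ 1200 * ε := by
    by_cases hs : sel₁
    · obtain ⟨g₀, hg₀⟩ := hg₀ (Or.inl hs)
      obtain ⟨g₁, hg₁⟩ := hg₁ hs
      refine ⟨fun y => (g₀ (v₀ (β₁ y)), g₁ (β₁ y) (g₀ (v₀ (β₁ y)))), hcost _ fun s u y hq hV => ?_⟩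
      beta_reduce
      rw [hsel₁ hs s u y (hQne s u hq).1 hV, hv₀₁, ← hg₀ s u hq, ← hg₁ s u hq,
        ind_of_not (fun h => h rfl)]
      exact add_nonneg (add_nonneg (ind_nonneg _) (mul_nonneg (ind_nonneg _)
        (ambiguity_nonneg hc₀n hc₁n _ _ _ _ _))) (mul_nonneg (ind_nonneg _)
        (ambiguity_nonneg hc₀n hc₂n _ _ _ _ _))
    · obtain ⟨D, hD⟩ := exists_decoder hM₀ hM₁ hc₀ hc₁ T₁
      refine ⟨D, hcost _ fun s u y hq hV => ?_⟩
      have hw := (hQne s u hq).2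
      have q1 := ambiguity_nonneg hc₀n hc₁n M₀ M₁ T₁ (u.1, u.2.1) (y₁ y)
      have q2 := mul_nonneg (ind_nonneg (¬sel₂))
        (ambiguity_nonneg hc₀n hc₂n M₀ M₂ T₂ (u.1, u.2.2) (y₂ y))
      rw [ind_of hs, one_mul]
      by_cases hg : G s u y
      · have := hD (u.1, u.2.1) (y₁ y) (left_ne_zero_of_mul (left_ne_zero_of_mul hw))
          (right_ne_zero_of_mul (left_ne_zero_of_mul hw)) (hT₁ s u y hg)
        have := ind_nonneg (¬G s u y)
        linarith
      · rw [ind_of hg]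
        have := ind_le_one (D (y₁ y) ≠ (u.1, u.2.1))
        linarith
  have hD₂ : ∃ D₂ : Y₂ → U₀ × U₂,
      ∑ s, ∑ u, ∑ y, Q s u * m.V s u y * ind (D₂ (y₂ y) ≠ (u.1, u.2.2)) ≤ 1200 * ε := by
    by_cases hs : sel₂
    · obtain ⟨g₀, hg₀⟩ := hg₀ (Or.inr hs)
      obtain ⟨g₂, hg₂⟩ := hg₂ hs
      refine ⟨fun y => (g₀ (v₀ (β₂ y)), g₂ (β₂ y) (g₀ (v₀ (β₂ y)))), hcost _ fun s u y hq hV => ?_⟩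
      beta_reduce
      rw [hsel₂ hs s u y (hQne s u hq).1 hV, hv₀₂, ← hg₀ s u hq, ← hg₂ s u hq,
        ind_of_not (fun h => h rfl)]
      exact add_nonneg (add_nonneg (ind_nonneg _) (mul_nonneg (ind_nonneg _)
        (ambiguity_nonneg hc₀n hc₁n _ _ _ _ _))) (mul_nonneg (ind_nonneg _)
        (ambiguity_nonneg hc₀n hc₂n _ _ _ _ _))
    · obtain ⟨D, hD⟩ := exists_decoder hM₀ hM₂ hc₀ hc₂ T₂
      refine ⟨D, hcost _ fun s u y hq hV => ?_⟩
      have hw := (hQne s u hq).2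
      have q1 := ambiguity_nonneg hc₀n hc₂n M₀ M₂ T₂ (u.1, u.2.2) (y₂ y)
      have q2 := mul_nonneg (ind_nonneg (¬sel₁))
        (ambiguity_nonneg hc₀n hc₁n M₀ M₁ T₁ (u.1, u.2.1) (y₁ y))
      rw [ind_of hs, one_mul]
      by_cases hg : G s u y
      · have := hD (u.1, u.2.2) (y₂ y) (left_ne_zero_of_mul (left_ne_zero_of_mul hw))
          (right_ne_zero_of_mul hw) (hT₂ s u y hg)
        have := ind_nonneg (¬G s u y)
        linarith
      · rw [ind_of hg]
        have := ind_le_one (D (y₂ y) ≠ (u.1, u.2.2))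
        linarith
  obtain ⟨D₁, hD₁⟩ := hD₁
  obtain ⟨D₂, hD₂⟩ := hD₂
  -- The second-moment bounds for the keys: `Λ ^ 6` comes from the squares of the three factors `Λ`.
  have : Nonempty (Fin N₀) := ⟨⟨0, hN₀⟩⟩
  have : Nonempty (Fin N₁) := ⟨⟨0, hN₁⟩⟩
  have : Nonempty (Fin N₂) := ⟨⟨0, hN₂⟩⟩
  have hN₀' : (0 : ℝ) < N₀ := by exact_mod_cast hN₀
  have hN₁' : (0 : ℝ) < N₁ := by exact_mod_cast hN₁
  have hN₂' : (0 : ℝ) < N₂ := by exact_mod_cast hN₂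
  have hfin : ∀ B p, m.refMass c₀ c₁ c₂ B ≤ 50 → p ≤ 100 * (ε ^ 2 / Λ ^ 6) →
      (ε * m.refMass c₀ c₁ c₂ B + Λ ^ 6 * p / ε) / 2 ≤ 75 * ε := by
    intro B p h1 h2
    have e1 : ε * m.refMass c₀ c₁ c₂ B ≤ ε * 50 := mul_le_mul_of_nonneg_left h1 hε.le
    have e2 : Λ ^ 6 * p / ε ≤ 100 * ε := by
      rw [div_le_iff₀ hε]
      refine (mul_le_mul_of_nonneg_left h2 (by positivity)).trans_eq ?_
      field_simp
    linarith
  have d₁ : ∀ u u' : U₀ × U₁ × U₂, avg (fun ξ : (U₀ → Fin N₀) × (U₀ × U₁ → Fin N₁) ×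
      (U₀ × U₂ → Fin N₂) => ind ((keyOf ξ u).2.1 = (keyOf ξ u').2.1)) = coll3 1 N₁ 1 u u' / N₁ := by
    intro u u'
    have := avg_prod_mul₃ (fun _ : U₀ → Fin N₀ => 1)
      (fun ξ : U₀ × U₁ → Fin N₁ => ind (ξ (u.1, u.2.1) = ξ (u'.1, u'.2.1)))
      (fun _ : U₀ × U₂ → Fin N₂ => 1)
    rw [avg_collision hN₁] at this
    simpa [coll3, coll, avg_const, keyOf] using this
  have d₂ : ∀ u u' : U₀ × U₁ × U₂, avg (fun ξ : (U₀ → Fin N₀) × (U₀ × U₁ → Fin N₁) ×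
      (U₀ × U₂ → Fin N₂) => ind ((keyOf ξ u).2.2 = (keyOf ξ u').2.2)) = coll3 1 1 N₂ u u' / N₂ := by
    intro u u'
    have := avg_prod_mul₃ (fun _ : U₀ → Fin N₀ => 1) (fun _ : U₀ × U₁ → Fin N₁ => 1)
      (fun ξ : U₀ × U₂ → Fin N₂ => ind (ξ (u.1, u.2.2) = ξ (u'.1, u'.2.2)))
    rw [avg_collision hN₂] at this
    simpa [coll3, coll, avg_const, keyOf] using this
  have k₀ := (m.avg_keyDev_le (out := z) (G := G) (Q := Q)
    (K := (keyOf : (U₀ → Fin N₀) × (U₀ × U₁ → Fin N₁) × (U₀ × U₂ → Fin N₂) → _))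
    (N := N₀ * N₁ * N₂) (by positivity) (by simp [mul_assoc]) hN₀ hN₁ hN₂ (avg_keyOf hN₀ hN₁ hN₂)
    hM₀ hM₁ hM₂ hc₀ hc₁ hc₂ hQ hε hQG A).trans (hfin A _ (href A) hpz)
  have k₁ := (m.avg_keyDev_le (out := y₂) (G := G) (Q := Q)
    (K := fun (ξ : (U₀ → Fin N₀) × (U₀ × U₁ → Fin N₁) × (U₀ × U₂ → Fin N₂)) u => (keyOf ξ u).2.1)
    (N := N₁) (by positivity) (by simp) one_pos hN₁ one_pos d₁
    hM₀ hM₁ hM₂ hc₀ hc₁ hc₂ hQ hε hQG .two).trans (hfin .two _ (href .two) hp₂)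
  have k₂ := (m.avg_keyDev_le (out := y₁) (G := G) (Q := Q)
    (K := fun (ξ : (U₀ → Fin N₀) × (U₀ × U₁ → Fin N₁) × (U₀ × U₂ → Fin N₂)) u => (keyOf ξ u).2.2)
    (N := N₂) (by positivity) (by simp) one_pos one_pos hN₂ d₂
    hM₀ hM₁ hM₂ hc₀ hc₁ hc₂ hQ hε hQG .one).trans (hfin .one _ (href .one) hp₁)
  obtain ⟨ξ, hξ⟩ := exists_forall_le_of_avg_le
    (![fun ξ => m.keyDev Q G z (keyOf ξ) (N₀ * N₁ * N₂),
      fun ξ => m.keyDev Q G y₂ (fun u => (keyOf ξ u).2.1) N₁,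
      fun ξ => m.keyDev Q G y₁ (fun u => (keyOf ξ u).2.2) N₂] :
      Fin 3 → (U₀ → Fin N₀) × (U₀ × U₁ → Fin N₁) × (U₀ × U₂ → Fin N₂) → ℝ)
    (fun _ => 75 * ε) (fun _ => by positivity)
    (fun i ξ => by
      fin_cases i <;>
      exact Finset.sum_nonneg fun _ _ => Finset.sum_nonneg fun _ _ => abs_nonneg _)
    (fun i => by
      fin_cases i
      · exact k₀
      · exact k₁
      · exact k₂)
  rw [Fintype.card_fin] at hξ
  have x0 : m.keyDev Q G z (keyOf ξ) (N₀ * N₁ * N₂) ≤ ((3 : ℕ) : ℝ) * (75 * ε) := hξ 0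
  have x1 : m.keyDev Q G y₂ (fun u => (keyOf ξ u).2.1) N₁ ≤ ((3 : ℕ) : ℝ) * (75 * ε) := hξ 1
  have x2 : m.keyDev Q G y₁ (fun u => (keyOf ξ u).2.2) N₂ ≤ ((3 : ℕ) : ℝ) * (75 * ε) := hξ 2
  push_cast at x0 x1 x2
  refine ⟨Q, ξ, D₁, D₂, hQ, hQa, by linarith, hD₁, hD₂, ?_, ?_, ?_⟩
  · refine (m.keyDev_le_add (G := G) hQ (keyOf ξ) (by positivity) (by simp [mul_assoc])).trans ?_
    linarith
  · refine (m.keyDev_le_add (G := G) hQ (fun u => (keyOf ξ u).2.1) (by positivity)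
      (by simp)).trans ?_
    linarith
  · refine (m.keyDev_le_add (G := G) hQ (fun u => (keyOf ξ u).2.2) (by positivity)
      (by simp)).trans ?_
    linarith

end Model

/-! ### Entropy of real weights on a finite sample space -/

section entropy

variable {Ω α β γ : Type*}

/-- The weight with which `A` takes the value `a`. -/
def marg [Fintype Ω] (p : Ω → ℝ) (A : Ω → α) (a : α) : ℝ := ∑ ω, p ω * ind (A ω = a)

lemma marg_nonneg [Fintype Ω] {p : Ω → ℝ} (hp : ∀ ω, 0 ≤ p ω) (A : Ω → α) (a : α) :
    0 ≤ marg p A a :=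
  Finset.sum_nonneg fun _ _ => mul_nonneg (hp _) (ind_nonneg _)

lemma sum_marg_mul [Fintype Ω] [Fintype α] (p : Ω → ℝ) (A : Ω → α) (f : α → ℝ) :
    ∑ a, marg p A a * f a = ∑ ω, p ω * f (A ω) := by
  simp only [marg, Finset.sum_mul]
  rw [Finset.sum_comm]
  refine Finset.sum_congr rfl fun ω _ => ?_
  simp only [mul_assoc, ← Finset.mul_sum]
  rw [sum_ind_mul (A ω) f]

lemma sum_marg [Fintype Ω] [Fintype α] (p : Ω → ℝ) (A : Ω → α) : ∑ a, marg p A a = ∑ ω, p ω := by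
  simpa using sum_marg_mul p A (fun _ => 1)

/-- Marginals of marginals. -/
lemma marg_comp [Fintype Ω] [Fintype α] (p : Ω → ℝ) (A : Ω → α) (f : α → β) (b : β) :
    marg p (fun ω => f (A ω)) b = ∑ a, marg p A a * ind (f a = b) :=
  (sum_marg_mul p A fun a => ind (f a = b)).symm

lemma sum_marg_pair_right [Fintype Ω] [Fintype β] (p : Ω → ℝ) (A : Ω → α) (B : Ω → β) (a : α) :
    ∑ b, marg p (fun ω => (A ω, B ω)) (a, b) = marg p A a := by
  simp only [marg]
  rw [Finset.sum_comm]
  refine Finset.sum_congr rfl fun ω _ => ?_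
  rw [← Finset.mul_sum]
  simp only [Prod.mk.injEq, ind_and, ← Finset.mul_sum, sum_ind, mul_one]

lemma sum_marg_pair_left [Fintype Ω] [Fintype α] (p : Ω → ℝ) (A : Ω → α) (B : Ω → β) (b : β) :
    ∑ a, marg p (fun ω => (A ω, B ω)) (a, b) = marg p B b := by
  simp only [marg]
  rw [Finset.sum_comm]
  refine Finset.sum_congr rfl fun ω _ => ?_
  rw [← Finset.mul_sum]
  simp only [Prod.mk.injEq, ind_and, ← Finset.sum_mul, sum_ind, one_mul]

lemma marg_le_of_imp [Fintype Ω] {p : Ω → ℝ} (hp : ∀ ω, 0 ≤ p ω) {A : Ω → α} {B : Ω → β} {a : α}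
    {b : β} (h : ∀ ω, A ω = a → B ω = b) : marg p A a ≤ marg p B b :=
  Finset.sum_le_sum fun ω _ => mul_le_mul_of_nonneg_left (ind_mono (h ω)) (hp ω)

/-- The summand `-x log₂ x` of the entropy. -/
def etaLog (x : ℝ) : ℝ := -(x * Real.logb 2 x)

/-- The entropy of `A` under the weights `p`. -/
def ent [Fintype Ω] [Fintype α] (p : Ω → ℝ) (A : Ω → α) : ℝ := ∑ a, etaLog (marg p A a)

/-- The probabilities of a law as real numbers. -/
def real (p : PMF Ω) (ω : Ω) : ℝ := (p ω).toReal

lemma real_nonneg (p : PMF Ω) (ω : Ω) : 0 ≤ real p ω := ENNReal.toReal_nonneg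

lemma sum_real [Fintype Ω] (p : PMF Ω) : ∑ ω, real p ω = 1 := by
  have h := p.tsum_coe
  rw [tsum_fintype] at h
  simp only [real]
  rw [← ENNReal.toReal_sum (fun ω _ => p.apply_ne_top ω), h, ENNReal.toReal_one]

lemma real_map [Fintype Ω] (p : PMF Ω) (A : Ω → α) (a : α) :
    real (p.map A) a = marg (real p) A a := by
  classical
  simp only [real, marg, PMF.map_apply]
  rw [tsum_fintype, ENNReal.toReal_sum]
  · refine Finset.sum_congr rfl fun ω _ => ?_
    by_cases h : A ω = a
    · rw [if_pos h.symm, ind_of h, mul_one]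
    · rw [if_neg (Ne.symm h), ind_of_not h, mul_zero, ENNReal.toReal_zero]
  · intro ω _
    split_ifs
    · exact p.apply_ne_top ω
    · exact ENNReal.zero_ne_top

lemma H_eq_ent [Fintype Ω] [Fintype α] (p : PMF Ω) (A : Ω → α) : H p A = ent (real p) A := by
  simp only [H, pmfEntropy, ent, etaLog]
  refine Finset.sum_congr rfl fun a _ => ?_
  rw [← real_map]; rfl

lemma prob_eq [Fintype Ω] (p : PMF Ω) (E : Set Ω) :
    prob p E = ∑ ω, real p ω * ind (ω ∈ E) := by
  classical
  rw [prob, PMF.toOuterMeasure_apply, tsum_fintype, ENNReal.toReal_sum]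
  · refine Finset.sum_congr rfl fun ω _ => ?_
    by_cases h : ω ∈ E
    · rw [Set.indicator_of_mem h, ind_of h, mul_one]; rfl
    · rw [Set.indicator_of_notMem h, ind_of_not h, mul_zero, ENNReal.toReal_zero]
  · intro ω _
    by_cases h : ω ∈ E
    · rw [Set.indicator_of_mem h]; exact p.apply_ne_top ω
    · rw [Set.indicator_of_notMem h]; exact ENNReal.zero_ne_top

lemma H_map {Ω' : Type*} [Fintype α] (p : PMF Ω) (f : Ω → Ω') (A : Ω' → α) :
    H (p.map f) A = H p (fun ω => A (f ω)) := by
  simp only [H, PMF.map_comp]; rfl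

lemma I_map {Ω' : Type*} [Fintype α] [Fintype β] (p : PMF Ω) (f : Ω → Ω') (A : Ω' → α)
    (B : Ω' → β) : I (p.map f) A B = I p (fun ω => A (f ω)) (fun ω => B (f ω)) := by
  simp only [I, condH, H_map]

lemma prob_map {Ω' : Type*} (p : PMF Ω) (f : Ω → Ω') (E : Set Ω') :
    prob (p.map f) E = prob p (f ⁻¹' E) := by
  simp only [prob, PMF.toOuterMeasure_map_apply]

lemma marg_injective [Fintype Ω] (p : Ω → ℝ) (A : Ω → α) {f : α → β} (hf : f.Injective) (a : α) :
    marg p (fun ω => f (A ω)) (f a) = marg p A a := by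
  simp only [marg, hf.eq_iff]

lemma marg_eq_zero_of_forall_ne [Fintype Ω] (p : Ω → ℝ) {A : Ω → α} {a : α} (h : ∀ ω, A ω ≠ a) :
    marg p A a = 0 :=
  Finset.sum_eq_zero fun ω _ => by rw [ind_of_not (h ω), mul_zero]

lemma etaLog_zero : etaLog 0 = 0 := by simp [etaLog]

lemma ent_injective [Fintype Ω] [Fintype α] [Fintype β] (p : Ω → ℝ) (A : Ω → α) {f : α → β}
    (hf : f.Injective) : ent p (fun ω => f (A ω)) = ent p A := by
  classical
  simp only [ent]
  rw [← Finset.sum_subset (Finset.subset_univ (Finset.univ.image f)),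
    Finset.sum_image fun _ _ _ _ h => hf h]
  · exact Finset.sum_congr rfl fun a _ => by rw [marg_injective p A hf]
  · intro b _ hb
    rw [marg_eq_zero_of_forall_ne, etaLog_zero]
    rintro ω rfl
    exact hb (Finset.mem_image_of_mem _ (Finset.mem_univ _))

lemma H_injective [Fintype Ω] [Fintype α] [Fintype β] (p : PMF Ω) (A : Ω → α) {f : α → β}
    (hf : f.Injective) : H p (fun ω => f (A ω)) = H p A := by
  rw [H_eq_ent, H_eq_ent, ent_injective _ _ hf]

lemma I_injective [Fintype Ω] [Fintype α] [Fintype β] [Fintype γ] (p : PMF Ω) (A : Ω → α)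
    (B : Ω → γ) {f : α → β} (hf : f.Injective) : I p (fun ω => f (A ω)) B = I p A B := by
  have h := H_injective p (fun ω => (A ω, B ω)) (f := fun x : α × γ => (f x.1, x.2))
    (fun x y h => by
      simp only [Prod.mk.injEq] at h
      exact Prod.ext (hf h.1) h.2)
  simp only [I, condH, H_injective p A hf, h]

lemma indep_of_marg [Fintype Ω] (p : PMF Ω) (A : Ω → α) (B : Ω → β)
    (h : ∀ a b, marg (real p) (fun ω => (A ω, B ω)) (a, b) =
      marg (real p) A a * marg (real p) B b) : Indep p A B := by
  intro a b
  have := h a b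
  rw [← real_map, ← real_map, ← real_map, real, real, real, ← ENNReal.toReal_mul] at this
  exact (ENNReal.toReal_eq_toReal_iff' (PMF.apply_ne_top _ _)
    (ENNReal.mul_ne_top (PMF.apply_ne_top _ _) (PMF.apply_ne_top _ _))).1 this

lemma indep_comp_injective {α' β' : Type*} [Fintype Ω] {p : PMF Ω} {A : Ω → α} {B : Ω → β}
    (h : ∀ a b, marg (real p) (fun ω => (A ω, B ω)) (a, b) =
      marg (real p) A a * marg (real p) B b)
    {f : α → α'} {g : β → β'} (hf : f.Injective) (hg : g.Injective) :
    Indep p (fun ω => f (A ω)) (fun ω => g (B ω)) := by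
  refine indep_of_marg _ _ _ fun a b => ?_
  by_cases ha : ∃ x, f x = a
  · obtain ⟨x, rfl⟩ := ha
    by_cases hb : ∃ y, g y = b
    · obtain ⟨y, rfl⟩ := hb
      rw [marg_injective _ A hf, marg_injective _ B hg, ← h]
      exact marg_injective (real p) (fun ω => (A ω, B ω)) (f := Prod.map f g) (hf.prodMap hg) (x, y)
    · rw [marg_eq_zero_of_forall_ne, marg_eq_zero_of_forall_ne (A := fun ω => g (B ω)), mul_zero]
      · exact fun ω h => hb ⟨_, h⟩
      · exact fun ω h => hb ⟨_, (Prod.ext_iff.1 h).2⟩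
  · rw [marg_eq_zero_of_forall_ne, marg_eq_zero_of_forall_ne (A := fun ω => f (A ω)), zero_mul]
    · exact fun ω h => ha ⟨_, h⟩
    · exact fun ω h => ha ⟨_, (Prod.ext_iff.1 h).1⟩

lemma H_of_uniform [Fintype Ω] [Fintype α] (p : PMF Ω) (A : Ω → α) {N : ℝ}
    (hA : ∀ a, marg (real p) A a = 1 / N) : H p A = Real.logb 2 N := by
  rw [H_eq_ent]
  have : ∀ a, etaLog (marg (real p) A a) = marg (real p) A a * Real.logb 2 N := by
    intro a
    rw [etaLog, hA, one_div, Real.logb_inv]; ring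
  simp only [ent, this]
  rw [← Finset.sum_mul, sum_marg, sum_real, one_mul]

lemma mul_logb_le {r b N : ℝ} (hr : 0 ≤ r) (hrb : r ≤ b) (hN : 1 ≤ N) :
    r * (Real.logb 2 r + Real.logb 2 N - Real.logb 2 b) ≤
      (Real.logb 2 N + 2) * |r - b / N| := by
  have hlN : 0 ≤ Real.logb 2 N := Real.logb_nonneg one_lt_two hN
  have hN0 : 0 < N := by linarith
  have hR : 0 ≤ (Real.logb 2 N + 2) * |r - b / N| := by positivity
  rcases hr.eq_or_lt with h | h
  · rw [← h] at hR ⊢; simpa using hR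
  have hb : 0 < b := by linarith
  have e : Real.logb 2 r + Real.logb 2 N - Real.logb 2 b = Real.logb 2 (N * r / b) := by
    rw [Real.logb_div (by positivity) hb.ne', Real.logb_mul hN0.ne' h.ne']; ring
  rw [e]
  rcases le_or_gt (N * r / b) 1 with hx | hx
  · exact (mul_nonpos_of_nonneg_of_nonpos hr
      (Real.logb_nonpos one_lt_two (by positivity) hx)).trans hR
  have hd : 0 < r - b / N := by
    rw [lt_div_iff₀ hb] at hx
    rw [sub_pos, div_lt_iff₀ hN0]; linarith
  rw [abs_of_pos hd]
  have h1 : Real.logb 2 (N * r / b) ≤ Real.logb 2 N := by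
    refine Real.logb_le_logb_of_le one_lt_two (by positivity) ?_
    rw [div_le_iff₀ hb]
    exact mul_le_mul_of_nonneg_left hrb hN0.le
  have h2 : Real.logb 2 (N * r / b) ≤ 2 * (N * r / b - 1) := by
    rw [Real.logb, div_le_iff₀ (Real.log_pos one_lt_two)]
    have := Real.log_le_sub_one_of_pos (show 0 < N * r / b by positivity)
    have h3 := Real.log_two_gt_d9
    nlinarith
  have h3 : b / N * Real.logb 2 (N * r / b) ≤ 2 * (r - b / N) := by
    refine (mul_le_mul_of_nonneg_left h2 (by positivity)).trans_eq ?_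
    field_simp
  have h4 := mul_le_mul_of_nonneg_left h1 hd.le
  nlinarith

/-- The information leaked about a uniform variable is bounded by its deviation from uniformity and
independence. -/
lemma I_le_of_uniform [Fintype Ω] [Fintype α] [Fintype β] (p : PMF Ω) (A : Ω → α) (B : Ω → β)
    {N : ℝ} (hN : 1 ≤ N) (hA : ∀ a, marg (real p) A a = 1 / N) :
    I p A B ≤ (Real.logb 2 N + 2) * ∑ b, ∑ a,
      |marg (real p) (fun ω => (A ω, B ω)) (a, b) - marg (real p) B b / N| := by
  have hp := real_nonneg p
  have e1 : I p A B = ∑ b, ∑ a, marg (real p) (fun ω => (A ω, B ω)) (a, b) *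
      (Real.logb 2 (marg (real p) (fun ω => (A ω, B ω)) (a, b)) + Real.logb 2 N -
        Real.logb 2 (marg (real p) B b)) := by
    have h1 : ∑ b, ∑ a, marg (real p) (fun ω => (A ω, B ω)) (a, b) * Real.logb 2 N =
        Real.logb 2 N := by
      simp only [← Finset.sum_mul, sum_marg_pair_left, sum_marg, sum_real, one_mul]
    have h2 : ∑ b, ∑ a, marg (real p) (fun ω => (A ω, B ω)) (a, b) *
        Real.logb 2 (marg (real p) B b) = - H p B := by
      simp only [← Finset.sum_mul, sum_marg_pair_left, H_eq_ent, ent, etaLog, Finset.sum_neg_distrib,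
        neg_neg]
    have h3 : ∑ b, ∑ a, marg (real p) (fun ω => (A ω, B ω)) (a, b) *
        Real.logb 2 (marg (real p) (fun ω => (A ω, B ω)) (a, b)) =
        - H p (fun ω => (A ω, B ω)) := by
      rw [Finset.sum_comm, ← Fintype.sum_prod_type']
      simp only [H_eq_ent, ent, etaLog, Finset.sum_neg_distrib, neg_neg]
    simp only [mul_sub, mul_add, Finset.sum_add_distrib, Finset.sum_sub_distrib]
    rw [h1, h2, h3, I, condH, H_of_uniform p A hA]
    ring
  rw [e1, Finset.mul_sum]
  refine Finset.sum_le_sum fun b _ => ?_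
  rw [Finset.mul_sum]
  refine Finset.sum_le_sum fun a _ => mul_logb_le (marg_nonneg hp _ _) ?_ hN
  exact marg_le_of_imp hp fun ω h => (Prod.ext_iff.1 h).2

end entropy

/-! ### Laws built from kernels -/

section joint

variable {α β : Type*}

/-- The law of `(a, b)` when `a` has law `p` and `b` has conditional law `q a`. -/
def joint (p : PMF α) (q : α → PMF β) : PMF (α × β) := p.bind fun a => (q a).map fun b => (a, b)

lemma joint_apply [Fintype α] [Fintype β] (p : PMF α) (q : α → PMF β) (x : α × β) :
    real (joint p q) x = real p x.1 * real (q x.1) x.2 := by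
  classical
  obtain ⟨a, b⟩ := x
  simp only [joint, real]
  rw [PMF.bind_apply, tsum_eq_single a, PMF.map_apply, tsum_eq_single b]
  · simp
  · intro b' hb; simp [Ne.symm hb]
  · intro a' ha
    rw [PMF.map_apply]
    simp [Ne.symm ha]

lemma map_joint {γ : Type*} (p : PMF α) (q : α → PMF β) (f : α × β → γ) :
    (joint p q).map f = p.bind fun a => (q a).map fun b => f (a, b) := by
  simp only [joint, PMF.map_bind, PMF.map_comp]; rfl

/-- Nonnegative weights on a nonempty finite type are proportional to a law. -/
lemma exists_pmf_mul_sum [Fintype α] [Nonempty α] (f : α → ℝ) (hf : ∀ a, 0 ≤ f a) :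
    ∃ q : PMF α, ∀ a, (∑ a, f a) * real q a = f a := by
  classical
  rcases (Finset.sum_nonneg fun a (_ : a ∈ Finset.univ) => hf a).eq_or_lt with h | h
  · refine ⟨PMF.pure (Classical.arbitrary α), fun a => ?_⟩
    rw [← h, zero_mul]
    exact ((Finset.sum_eq_zero_iff_of_nonneg fun a _ => hf a).1 h.symm a (Finset.mem_univ a)).symm
  · refine ⟨PMF.ofFintype (fun a => ENNReal.ofReal (f a / ∑ a, f a)) ?_, fun a => ?_⟩
    · rw [← ENNReal.ofReal_sum_of_nonneg (fun a _ => div_nonneg (hf a) h.le), ← Finset.sum_div,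
        div_self h.ne', ENNReal.ofReal_one]
    · rw [real, PMF.ofFintype_apply, ENNReal.toReal_ofReal (div_nonneg (hf a) h.le)]
      field_simp

lemma real_piPMF [Fintype α] {n : ℕ} (p : Fin n → PMF α) (a : Fin n → α) :
    real (piPMF p) a = ∏ i, real (p i) (a i) := by
  simp only [real, piPMF, PMF.ofFintype_apply, ENNReal.toReal_prod]

end joint

/-! ### Correcting the law of state and keys -/

/-- A measure `Q` on states and layers, dominated by the state law `a` and with nearly uniform key,
can be turned into a joint law of state, key and input with state law exactly `a` and with key
exactly uniform: the part of `Q` that respects the uniform law is kept, and the missing mass is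
filled with a product measure. -/
lemma exists_coupling {S U X 𝒩 : Type*} [Fintype S] [Fintype U] [Fintype X] [Fintype 𝒩]
    [Nonempty 𝒩] [Nonempty X] (a : S → ℝ) (ha1 : ∑ s, a s = 1) (Q : S → U → ℝ)
    (hQ : ∀ s u, 0 ≤ Q s u) (hQa : ∀ s, ∑ u, Q s u ≤ a s) (pX : S → U → X → ℝ)
    (hpX : ∀ s u x, 0 ≤ pX s u x) (hpX1 : ∀ s u, ∑ x, pX s u x = 1) (K : U → 𝒩) :
    ∃ J : S → 𝒩 → X → ℝ, (∀ s κ x, 0 ≤ J s κ x) ∧ (∀ s, ∑ κ, ∑ x, J s κ x = a s) ∧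
      (∀ κ, ∑ s, ∑ x, J s κ x = 1 / Fintype.card 𝒩) ∧
      ∑ s, ∑ κ, ∑ x, |J s κ x - ∑ u, Q s u * ind (K u = κ) * pX s u x| ≤
        2 * (2 * (1 - ∑ s, ∑ u, Q s u) + ∑ κ, |∑ s, ∑ u, Q s u * ind (K u = κ) -
          (∑ s, ∑ u, Q s u) / Fintype.card 𝒩|) := by
  classical
  obtain ⟨x₀⟩ := ‹Nonempty X›
  have hN : (0 : ℝ) < Fintype.card 𝒩 := by exact_mod_cast Fintype.card_pos
  set μ : ℝ := 1 / Fintype.card 𝒩 with hμ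
  have hμ0 : 0 < μ := by positivity
  have hμ1 : ∑ _κ : 𝒩, μ = 1 := by
    rw [Finset.sum_const, Finset.card_univ, nsmul_eq_mul, hμ]; field_simp
  set q : ℝ := ∑ s, ∑ u, Q s u with hq
  set QK : 𝒩 → ℝ := fun κ => ∑ s, ∑ u, Q s u * ind (K u = κ) with hQK
  have hQKn : ∀ κ, 0 ≤ QK κ := fun κ => Finset.sum_nonneg fun s _ => Finset.sum_nonneg fun u _ =>
    mul_nonneg (hQ s u) (ind_nonneg _)
  have hq1 : q ≤ 1 := (Finset.sum_le_sum fun s _ => hQa s).trans_eq ha1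
  have hsumQK : ∑ κ, QK κ = q := by
    simp only [hQK, hq]
    rw [Finset.sum_comm]
    refine Finset.sum_congr rfl fun s _ => ?_
    rw [Finset.sum_comm]
    exact Finset.sum_congr rfl fun u _ => sum_mul_ind (K u) fun _ => Q s u
  -- the factor by which keys of too large probability are thinned
  set w : 𝒩 → ℝ := fun κ => min 1 (μ / QK κ) with hw
  have hw0 : ∀ κ, 0 ≤ w κ := fun κ => le_min zero_le_one (div_nonneg hμ0.le (hQKn κ))
  have hw1 : ∀ κ, w κ ≤ 1 := fun κ => min_le_left _ _
  have hwμ : ∀ κ, w κ * QK κ ≤ μ := by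
    intro κ
    rcases (hQKn κ).eq_or_lt with h | h
    · rw [← h, mul_zero]; exact hμ0.le
    · exact (mul_le_mul_of_nonneg_right (min_le_right _ _) h.le).trans_eq (div_mul_cancel₀ _ h.ne')
  have hwd : ∀ κ, QK κ - w κ * QK κ ≤ |QK κ - μ| := by
    intro κ
    rcases le_total (QK κ) μ with h | h
    · rcases (hQKn κ).eq_or_lt with h0 | h0
      · rw [← h0]; simp
      · have : w κ = 1 := min_eq_left (by rwa [le_div_iff₀ h0, one_mul])
        rw [this, one_mul, sub_self]; exact abs_nonneg _
    · have h0 : 0 < QK κ := hμ0.trans_le h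
      have : w κ = μ / QK κ := min_eq_right (by rwa [div_le_one h0])
      rw [this, div_mul_cancel₀ _ h0.ne']; exact le_abs_self _
  set Q' : S → U → ℝ := fun s u => Q s u * w (K u) with hQ'
  have hQ'0 : ∀ s u, 0 ≤ Q' s u := fun s u => mul_nonneg (hQ s u) (hw0 _)
  have hQ'le : ∀ s u, Q' s u ≤ Q s u := fun s u => mul_le_of_le_one_right (hQ s u) (hw1 _)
  have hQ'K : ∀ κ, ∑ s, ∑ u, Q' s u * ind (K u = κ) = w κ * QK κ := by
    intro κ
    simp only [hQK, Finset.mul_sum]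
    refine Finset.sum_congr rfl fun s _ => Finset.sum_congr rfl fun u _ => ?_
    by_cases h : K u = κ
    · simp only [hQ', h]; ring
    · rw [ind_of_not h]; ring
  set r : S → ℝ := fun s => a s - ∑ u, Q' s u with hr
  set t : 𝒩 → ℝ := fun κ => μ - w κ * QK κ with ht
  have hr0 : ∀ s, 0 ≤ r s := fun s =>
    sub_nonneg.2 ((Finset.sum_le_sum fun u _ => hQ'le s u).trans (hQa s))
  have ht0 : ∀ κ, 0 ≤ t κ := fun κ => sub_nonneg.2 (hwμ κ)
  set ρ : ℝ := ∑ κ, t κ with hρ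
  have hrρ : ∑ s, r s = ρ := by
    simp only [hr, hρ, ht, Finset.sum_sub_distrib, ha1, hμ1, ← hQ'K]
    congr 1
    symm
    rw [Finset.sum_comm]
    refine Finset.sum_congr rfl fun s _ => ?_
    rw [Finset.sum_comm]
    exact Finset.sum_congr rfl fun u _ => sum_mul_ind (K u) fun _ => Q' s u
  have hrz : ρ = 0 → ∀ s, r s = 0 := fun h s =>
    (Finset.sum_eq_zero_iff_of_nonneg fun s _ => hr0 s).1 (hrρ.trans h) s (Finset.mem_univ s)
  have htz : ρ = 0 → ∀ κ, t κ = 0 := fun h κ =>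
    (Finset.sum_eq_zero_iff_of_nonneg fun s _ => ht0 s).1 h κ (Finset.mem_univ κ)
  have hρ0 : 0 ≤ ρ := Finset.sum_nonneg fun κ _ => ht0 κ
  set rest : S → 𝒩 → ℝ := fun s κ => r s * t κ / ρ with hrest
  have hrest0 : ∀ s κ, 0 ≤ rest s κ := fun s κ => div_nonneg (mul_nonneg (hr0 s) (ht0 κ)) hρ0
  have hrestS : ∀ s, ∑ κ, rest s κ = r s := by
    intro s
    simp only [hrest, ← Finset.sum_div, ← Finset.mul_sum]
    by_cases h : ρ = 0
    · rw [h, div_zero, hrz h]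
    · exact mul_div_cancel_right₀ _ h
  have hrestK : ∀ κ, ∑ s, rest s κ = t κ := by
    intro κ
    simp only [hrest, ← Finset.sum_div, ← Finset.sum_mul, hrρ]
    by_cases h : ρ = 0
    · rw [h, div_zero, htz h]
    · exact mul_div_cancel_left₀ _ h
  have hsx : ∀ s κ, ∑ x, (∑ u, Q' s u * ind (K u = κ) * pX s u x + rest s κ * ind (x₀ = x)) =
      ∑ u, Q' s u * ind (K u = κ) + rest s κ := by
    intro s κ
    rw [Finset.sum_add_distrib, ← Finset.mul_sum, sum_ind, mul_one, Finset.sum_comm]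
    simp only [← Finset.mul_sum, hpX1, mul_one]
  refine ⟨fun s κ x => ∑ u, Q' s u * ind (K u = κ) * pX s u x + rest s κ * ind (x₀ = x),
    fun s κ x => add_nonneg (Finset.sum_nonneg fun u _ => mul_nonneg (mul_nonneg (hQ'0 s u)
      (ind_nonneg _)) (hpX _ _ _)) (mul_nonneg (hrest0 s κ) (ind_nonneg _)), ?_, ?_, ?_⟩
  · intro s
    simp only [hsx, Finset.sum_add_distrib, hrestS]
    rw [Finset.sum_comm]
    simp only [← Finset.mul_sum, sum_ind, mul_one, hr]
    ring
  · intro κ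
    simp only [hsx, Finset.sum_add_distrib, hrestK, hQ'K, ht]
    ring
  · have hd : ∑ κ, |QK κ - μ| ≤ (1 - q) + ∑ κ, |QK κ - q / Fintype.card 𝒩| := by
      have hpt : ∀ κ, |QK κ - μ| ≤ μ * (1 - q) + |QK κ - q / Fintype.card 𝒩| := by
        intro κ
        have e : QK κ - μ = (QK κ - q / Fintype.card 𝒩) + -(μ * (1 - q)) := by
          rw [hμ]; field_simp; ring
        rw [e]
        refine (abs_add_le _ _).trans ?_
        rw [abs_neg, abs_of_nonneg (mul_nonneg hμ0.le (sub_nonneg.2 hq1))]; linarith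
      refine (Finset.sum_le_sum fun κ _ => hpt κ).trans_eq ?_
      rw [Finset.sum_add_distrib, ← Finset.sum_mul, hμ1, one_mul]
    have hlost : ∑ κ, (QK κ - w κ * QK κ) ≤ ∑ κ, |QK κ - μ| := Finset.sum_le_sum fun κ _ => hwd κ
    have hρe : ρ = (1 - q) + ∑ κ, (QK κ - w κ * QK κ) := by
      simp only [hρ, ht, Finset.sum_sub_distrib, hμ1, hsumQK]; ring
    calc _ ≤ ∑ s, ∑ κ, ∑ x, (∑ u, (Q s u - Q' s u) * ind (K u = κ) * pX s u x +
            rest s κ * ind (x₀ = x)) := by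
          refine Finset.sum_le_sum fun s _ => Finset.sum_le_sum fun κ _ =>
            Finset.sum_le_sum fun x _ => ?_
          have e : ∑ u, Q' s u * ind (K u = κ) * pX s u x + rest s κ * ind (x₀ = x) -
              ∑ u, Q s u * ind (K u = κ) * pX s u x = rest s κ * ind (x₀ = x) +
              -∑ u, (Q s u - Q' s u) * ind (K u = κ) * pX s u x := by
            simp only [sub_mul, Finset.sum_sub_distrib]; ring
          rw [e]
          refine (abs_add_le _ _).trans_eq ?_
          rw [abs_neg, abs_of_nonneg (mul_nonneg (hrest0 s κ) (ind_nonneg _)), abs_of_nonneg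
            (Finset.sum_nonneg fun u _ => mul_nonneg (mul_nonneg (sub_nonneg.2 (hQ'le s u))
              (ind_nonneg _)) (hpX _ _ _))]
          ring
      _ = ∑ κ, (QK κ - w κ * QK κ) + ρ := by
          have e1 : ∀ s κ, ∑ x, (∑ u, (Q s u - Q' s u) * ind (K u = κ) * pX s u x +
              rest s κ * ind (x₀ = x)) = ∑ u, Q s u * ind (K u = κ) -
                ∑ u, Q' s u * ind (K u = κ) + rest s κ := by
            intro s κ
            rw [Finset.sum_add_distrib, ← Finset.mul_sum, sum_ind, mul_one, Finset.sum_comm]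
            simp only [← Finset.mul_sum, hpX1, mul_one, sub_mul, Finset.sum_sub_distrib]
          simp only [e1, Finset.sum_add_distrib, hrestS, hrρ]
          rw [Finset.sum_comm]
          simp only [Finset.sum_sub_distrib, hQ'K]
          rfl
      _ ≤ _ := by linarith

/-! ### From the one-shot theorem to a protocol -/

/-- Deviations of the second variable from uniformity and independence change little under a small
change of the measure. -/
lemma sum_abs_dev_le {α β : Type*} [Fintype α] [Fintype β] (f g : α → β → ℝ) {N : ℝ} (hN : 0 < N)
    (hcard : (Fintype.card β : ℝ) = N) :
    ∑ a, ∑ b, |f a b - (∑ b, f a b) / N| ≤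
      ∑ a, ∑ b, |g a b - (∑ b, g a b) / N| + 2 * ∑ a, ∑ b, |f a b - g a b| := by
  rw [Finset.mul_sum, ← Finset.sum_add_distrib]
  refine Finset.sum_le_sum fun a _ => ?_
  have hpt : ∀ b, |f a b - (∑ b, f a b) / N| ≤ |g a b - (∑ b, g a b) / N| +
      (|f a b - g a b| + (∑ b, |f a b - g a b|) / N) := by
    intro b
    have e : f a b - (∑ b, f a b) / N = (g a b - (∑ b, g a b) / N) +
        ((f a b - g a b) + -((∑ b, (f a b - g a b)) / N)) := by
      rw [Finset.sum_sub_distrib]; ring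
    rw [e]
    refine (abs_add_le _ _).trans (add_le_add le_rfl ((abs_add_le _ _).trans ?_))
    rw [abs_neg, abs_div, abs_of_pos hN]
    gcongr
    exact Finset.abs_sum_le_sum_abs _ _
  refine (Finset.sum_le_sum fun b _ => hpt b).trans_eq ?_
  rw [Finset.sum_add_distrib, Finset.sum_add_distrib, Finset.sum_const, Finset.card_univ,
    nsmul_eq_mul, hcard, mul_div_cancel₀ _ hN.ne']
  ring

lemma sum_ind_left {α : Type*} [Fintype α] (b : α) : ∑ a, ind (a = b) = 1 := by
  simp only [ind_comm_eq _ b, sum_ind]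

section protocol

variable {S X Y₁ Y₂ Z V₀ V₁ V₂ : Type*} [Fintype S] [Fintype X] [Fintype Y₁] [Fintype Y₂]
  [Fintype Z] [Fintype V₀] [Fintype V₁] [Fintype V₂]

/-- If `J` is close to the joint measure of state, key and input that is induced by `Q`, then
all statistics of key and output under `J` are close to those under `Q`. -/
lemma sum_abs_stat_sub_le {S U X Y 𝒩 γ : Type*} [Fintype S] [Fintype U] [Fintype X] [Fintype Y]
    [Fintype 𝒩] [Fintype γ] (J : S → 𝒩 → X → ℝ) (Q : S → U → ℝ) (pX : S → U → X → ℝ)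
    (w : S → X → Y → ℝ) (hw : ∀ s x y, 0 ≤ w s x y) (hw1 : ∀ s x, ∑ y, w s x y = 1)
    (V : S → U → Y → ℝ) (hV : ∀ s u y, V s u y = ∑ x, pX s u x * w s x y) (K : U → 𝒩) {ρ : ℝ}
    (hρ : ∑ s, ∑ κ, ∑ x, |J s κ x - ∑ u, Q s u * ind (K u = κ) * pX s u x| ≤ ρ)
    (f : γ → 𝒩 → Y → ℝ) (hf : ∀ c κ y, 0 ≤ f c κ y) (hf1 : ∀ κ y, ∑ c, f c κ y ≤ 1) :
    ∑ c, |∑ s, ∑ κ, ∑ x, ∑ y, J s κ x * w s x y * f c κ y -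
      ∑ s, ∑ u, ∑ y, Q s u * V s u y * f c (K u) y| ≤ ρ := by
  set D : S → 𝒩 → X → ℝ := fun s κ x => J s κ x - ∑ u, Q s u * ind (K u = κ) * pX s u x with hD
  have e : ∀ c, ∑ s, ∑ κ, ∑ x, ∑ y, J s κ x * w s x y * f c κ y -
      ∑ s, ∑ u, ∑ y, Q s u * V s u y * f c (K u) y =
      ∑ s, ∑ κ, ∑ x, D s κ x * ∑ y, w s x y * f c κ y := by
    intro c
    rw [← Finset.sum_sub_distrib]
    refine Finset.sum_congr rfl fun s _ => ?_
    have e2 : ∑ u, ∑ y, Q s u * V s u y * f c (K u) y = ∑ κ, ∑ x, ∑ y,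
        (∑ u, Q s u * ind (K u = κ) * pX s u x) * w s x y * f c κ y := by
      have : ∀ u, ∑ y, Q s u * V s u y * f c (K u) y =
          ∑ κ, ∑ x, ∑ y, Q s u * ind (K u = κ) * pX s u x * w s x y * f c κ y := by
        intro u
        rw [← sum_ind_mul (K u) (fun κ => ∑ y, Q s u * V s u y * f c κ y)]
        refine Finset.sum_congr rfl fun κ _ => ?_
        rw [Finset.sum_comm, Finset.mul_sum]
        refine Finset.sum_congr rfl fun y _ => ?_
        rw [hV, Finset.mul_sum, Finset.sum_mul, Finset.mul_sum]
        exact Finset.sum_congr rfl fun x _ => by ring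
      simp only [this]
      rw [Finset.sum_comm]
      refine Finset.sum_congr rfl fun κ _ => ?_
      rw [Finset.sum_comm]
      refine Finset.sum_congr rfl fun x _ => ?_
      rw [Finset.sum_comm]
      exact Finset.sum_congr rfl fun y _ => by rw [Finset.sum_mul, Finset.sum_mul]
    rw [e2, ← Finset.sum_sub_distrib]
    refine Finset.sum_congr rfl fun κ _ => ?_
    rw [← Finset.sum_sub_distrib]
    refine Finset.sum_congr rfl fun x _ => ?_
    rw [← Finset.sum_sub_distrib, Finset.mul_sum]
    exact Finset.sum_congr rfl fun y _ => by simp only [hD]; ring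
  have hn : ∀ s x c κ, 0 ≤ ∑ y, w s x y * f c κ y := fun s x c κ =>
    Finset.sum_nonneg fun y _ => mul_nonneg (hw s x y) (hf c κ y)
  calc _ ≤ ∑ c, ∑ s, ∑ κ, ∑ x, |D s κ x| * ∑ y, w s x y * f c κ y := by
        refine Finset.sum_le_sum fun c _ => ?_
        rw [e]
        refine (Finset.abs_sum_le_sum_abs _ _).trans (Finset.sum_le_sum fun s _ => ?_)
        refine (Finset.abs_sum_le_sum_abs _ _).trans (Finset.sum_le_sum fun κ _ => ?_)
        refine (Finset.abs_sum_le_sum_abs _ _).trans_eq (Finset.sum_congr rfl fun x _ => ?_)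
        rw [abs_mul, abs_of_nonneg (hn s x c κ)]
    _ = ∑ s, ∑ κ, ∑ x, |D s κ x| * ∑ y, w s x y * ∑ c, f c κ y := by
        rw [Finset.sum_comm]
        refine Finset.sum_congr rfl fun s _ => ?_
        rw [Finset.sum_comm]
        refine Finset.sum_congr rfl fun κ _ => ?_
        rw [Finset.sum_comm]
        refine Finset.sum_congr rfl fun x _ => ?_
        rw [← Finset.mul_sum, Finset.sum_comm]
        simp only [Finset.mul_sum]
    _ ≤ ∑ s, ∑ κ, ∑ x, |D s κ x| * 1 := by
        refine Finset.sum_le_sum fun s _ => Finset.sum_le_sum fun κ _ => Finset.sum_le_sum fun x _ =>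
          mul_le_mul_of_nonneg_left ?_ (abs_nonneg _)
        calc _ ≤ ∑ y, w s x y * 1 := Finset.sum_le_sum fun y _ =>
              mul_le_mul_of_nonneg_left (hf1 κ y) (hw s x y)
          _ = 1 := by simp only [mul_one, hw1]
    _ ≤ ρ := by simpa only [mul_one] using hρ

/-- The deviation of a key under a law is controlled by its deviation under a measure `Q` with close
statistics of key and observation. -/
lemma sum_abs_marg_sub_le {S Y Ω 𝒦 O : Type*} [Fintype S] [Fintype Y] [Fintype Ω] [Fintype 𝒦]
    [Fintype O] (m : Model S V₀ V₁ V₂ Y) (Q : S → V₀ × V₁ × V₂ → ℝ) (p : Ω → ℝ) (A : Ω → 𝒦)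
    (B : Ω → O) (K : V₀ × V₁ × V₂ → 𝒦) (out : Y → O) {N ρ η : ℝ} (hN : 0 < N)
    (hcard : (Fintype.card 𝒦 : ℝ) = N)
    (h : ∑ c : O × 𝒦, |∑ ω, p ω * ind (A ω = c.2 ∧ B ω = c.1) -
      ∑ s, ∑ u, ∑ y, Q s u * m.V s u y * ind (K u = c.2 ∧ out y = c.1)| ≤ ρ)
    (hη : m.keyDev Q (fun _ _ _ => True) out K N ≤ η) :
    ∑ b, ∑ a, |marg p (fun ω => (A ω, B ω)) (a, b) - marg p B b / N| ≤ η + 2 * ρ := by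
  have h1 := sum_abs_dev_le (fun b a => marg p (fun ω => (A ω, B ω)) (a, b))
    (fun b a => ∑ u, m.through Q (fun _ _ _ => True) out u b * ind (K u = a)) hN hcard
  have e1 : ∀ b, ∑ a, ∑ u, m.through Q (fun _ _ _ => True) out u b * ind (K u = a) =
      ∑ u, m.through Q (fun _ _ _ => True) out u b := by
    intro b
    rw [Finset.sum_comm]
    exact Finset.sum_congr rfl fun u _ => by rw [← Finset.mul_sum, sum_ind, mul_one]
  simp only [sum_marg_pair_left, e1] at h1
  refine h1.trans (add_le_add hη (mul_le_mul_of_nonneg_left (le_trans (le_of_eq ?_) h) zero_le_two))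
  rw [Fintype.sum_prod_type]
  refine Finset.sum_congr rfl fun b _ => Finset.sum_congr rfl fun a _ => ?_
  congr 2
  · simp only [marg, Prod.mk.injEq]
  · simp only [Model.through, Finset.sum_mul, ind_true, mul_one, ind_and]
    rw [Finset.sum_comm]
    exact Finset.sum_congr rfl fun u _ => Finset.sum_congr rfl fun s _ =>
      Finset.sum_congr rfl fun y _ => by ring

/-- A measure `Q`, key functions and decoders as provided by the one-shot coding theorem give a good
protocol. -/
theorem exists_isGood [Nonempty X] (W : Channel S X Y₁ Y₂ Z) {n : ℕ} (hn : 0 < n) {R₀ R₁ R₂ : ℝ}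
    (m : Model (Fin n → S) V₀ V₁ V₂ (Fin n → Y₁ × Y₂ × Z))
    (hma : ∀ s, m.a s = real (piPMF fun _ => W.state) s)
    (pX : (Fin n → S) → V₀ × V₁ × V₂ → (Fin n → X) → ℝ) (hpX : ∀ s u x, 0 ≤ pX s u x)
    (hpX1 : ∀ s u, ∑ x, pX s u x = 1)
    (hmV : ∀ s u y, m.V s u y = ∑ x, pX s u x * real (piPMF fun i => W.trans (x i) (s i)) y)
    {N₀ N₁ N₂ : ℕ} (hN₀ : 0 < N₀) (hN₁ : 0 < N₁) (hN₂ : 0 < N₂)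
    (hNR₀ : N₀ ≤ 2 ^ ⌊(n : ℝ) * R₀⌋₊) (hNR₁ : N₁ ≤ 2 ^ ⌊(n : ℝ) * R₁⌋₊)
    (hNR₂ : N₂ ≤ 2 ^ ⌊(n : ℝ) * R₂⌋₊)
    (Q : (Fin n → S) → V₀ × V₁ × V₂ → ℝ)
    (ξ : (V₀ → Fin N₀) × (V₀ × V₁ → Fin N₁) × (V₀ × V₂ → Fin N₂))
    (D₁ : (Fin n → Y₁) → V₀ × V₁) (D₂ : (Fin n → Y₂) → V₀ × V₂) {ε ε' : ℝ}
    (hQ : ∀ s u, 0 ≤ Q s u) (hQa : ∀ s, ∑ u, Q s u ≤ m.a s) (hQ1 : 1 - 700 * ε ≤ ∑ s, ∑ u, Q s u)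
    (hD₁ : ∑ s, ∑ u, ∑ y, Q s u * m.V s u y * ind (D₁ (fun i => (y i).1) ≠ (u.1, u.2.1)) ≤ 1200 * ε)
    (hD₂ : ∑ s, ∑ u, ∑ y, Q s u * m.V s u y * ind (D₂ (fun i => (y i).2.1) ≠ (u.1, u.2.2)) ≤
      1200 * ε)
    (hz : m.keyDev Q (fun _ _ _ => True) (fun y i => (y i).2.2) (Model.keyOf ξ) (N₀ * N₁ * N₂) ≤
      2700 * ε)
    (hy₂ : m.keyDev Q (fun _ _ _ => True) (fun y i => (y i).2.1) (fun u => (Model.keyOf ξ u).2.1) N₁ ≤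
      2700 * ε)
    (hy₁ : m.keyDev Q (fun _ _ _ => True) (fun y i => (y i).1) (fun u => (Model.keyOf ξ u).2.2) N₂ ≤
      2700 * ε)
    (hε₁ : 10000 * ε < ε')
    (hε₂ : (Real.logb 2 (N₀ * N₁ * N₂) + 2) * (20000 * ε) < n * ε')
    (hr₀ : n * (R₀ - ε') < Real.logb 2 N₀) (hr₁ : n * (R₁ - ε') < Real.logb 2 N₁)
    (hr₂ : n * (R₂ - ε') < Real.logb 2 N₂) :
    ∃ P : Protocol S X Y₁ Y₂ n R₀ R₁ R₂, P.IsGood W ε' := by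
  classical
  have hn' : (0 : ℝ) < n := by exact_mod_cast hn
  have hN₀' : (1 : ℝ) ≤ N₀ := by exact_mod_cast hN₀
  have hN₁' : (1 : ℝ) ≤ N₁ := by exact_mod_cast hN₁
  have hN₂' : (1 : ℝ) ≤ N₂ := by exact_mod_cast hN₂
  have : Nonempty (Fin N₀) := ⟨⟨0, hN₀⟩⟩
  have : Nonempty (Fin N₁) := ⟨⟨0, hN₁⟩⟩
  have : Nonempty (Fin N₂) := ⟨⟨0, hN₂⟩⟩
  have hcard : (Fintype.card (Fin N₀ × Fin N₁ × Fin N₂) : ℝ) = N₀ * N₁ * N₂ := by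
    simp [mul_assoc]
  set N : ℝ := N₀ * N₁ * N₂ with hN
  have hN0 : 0 < N := by positivity
  set K := Model.keyOf ξ with hK
  set w : (Fin n → S) → (Fin n → X) → (Fin n → Y₁ × Y₂ × Z) → ℝ :=
    fun s x y => real (piPMF fun i => W.trans (x i) (s i)) y with hw
  have hw0 : ∀ s x y, 0 ≤ w s x y := fun s x y => real_nonneg _ _
  have hw1 : ∀ s x, ∑ y, w s x y = 1 := fun s x => sum_real _
  obtain ⟨J, hJ, hJa, hJK, hJd⟩ := exists_coupling m.a m.a_sum Q hQ hQa pX hpX hpX1 K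
  rw [hcard] at hJK hJd
  -- total variation distance of the corrected law
  have hV1 : ∀ s u, ∑ y, m.V s u y = 1 := by
    intro s u
    simp only [hmV]
    rw [Finset.sum_comm]
    simp only [← Finset.mul_sum, sum_real, mul_one, hpX1]
  have hdev : ∑ κ, |∑ s, ∑ u, Q s u * ind (K u = κ) - (∑ s, ∑ u, Q s u) / N| ≤ 2700 * ε := by
    have hz' := hz
    rw [Model.keyDev, Finset.sum_comm] at hz'
    refine le_trans (Finset.sum_le_sum fun κ _ => ?_) hz'
    have e : ∀ u, ∑ z, m.through Q (fun _ _ _ => True) (fun y i => (y i).2.2) u z = ∑ s, Q s u := by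
      intro u
      simp only [Model.through, ind_true, mul_one]
      rw [Finset.sum_comm]
      refine Finset.sum_congr rfl fun s _ => ?_
      rw [Finset.sum_comm]
      simp only [← Finset.mul_sum, sum_ind, mul_one, hV1]
    have e1 : ∑ s, ∑ u, Q s u * ind (K u = κ) = ∑ z, ∑ u,
        m.through Q (fun _ _ _ => True) (fun y i => (y i).2.2) u z * ind (K u = κ) := by
      rw [Finset.sum_comm, Finset.sum_comm (γ := Fin n → Z)]
      exact Finset.sum_congr rfl fun u _ => by rw [← Finset.sum_mul, ← Finset.sum_mul, e]
    have e2 : ∑ s, ∑ u, Q s u = ∑ z, ∑ u,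
        m.through Q (fun _ _ _ => True) (fun y i => (y i).2.2) u z := by
      rw [Finset.sum_comm, Finset.sum_comm (γ := Fin n → Z)]
      exact Finset.sum_congr rfl fun u _ => by rw [e]
    rw [e1, e2, Finset.sum_div, ← Finset.sum_sub_distrib]
    exact Finset.abs_sum_le_sum_abs _ _
  have hρ : ∑ s, ∑ κ, ∑ x, |J s κ x - ∑ u, Q s u * ind (K u = κ) * pX s u x| ≤ 8200 * ε := by
    refine hJd.trans ?_
    linarith
  -- the random choices of the protocol
  choose q₁ hq₁ using fun s => exists_pmf_mul_sum (fun κ => ∑ x, J s κ x)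
    (fun κ => Finset.sum_nonneg fun x _ => hJ s κ x)
  choose q₂ hq₂ using fun s κ => exists_pmf_mul_sum (J s κ) (hJ s κ)
  let P' : PMF ((Fin n → S) × (Fin N₀ × Fin N₁ × Fin N₂) × (Fin n → X) × (Fin n → Y₁ × Y₂ × Z)) :=
    joint (piPMF fun _ => W.state) fun s => joint (q₁ s) fun κ => joint (q₂ s κ) fun x =>
      piPMF fun i => W.trans (x i) (s i)
  have hP' : ∀ ω, real P' ω = J ω.1 ω.2.1 ω.2.2.1 * w ω.1 ω.2.2.1 ω.2.2.2 := by
    intro ω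
    rw [joint_apply, joint_apply, joint_apply, ← mul_assoc, ← mul_assoc, ← hma, ← hJa ω.1]
    rw [hq₁, hq₂]
  have hPsum : ∀ f : (Fin N₀ × Fin N₁ × Fin N₂) → (Fin n → Y₁ × Y₂ × Z) → ℝ,
      ∑ ω, real P' ω * f ω.2.1 ω.2.2.2 = ∑ s, ∑ κ, ∑ x, ∑ y, J s κ x * w s x y * f κ y := by
    intro f
    simp only [hP', Fintype.sum_prod_type]
  set ι₀ : Fin N₀ → KeySet n R₀ := Fin.castLE hNR₀
  set ι₁ : Fin N₁ → KeySet n R₁ := Fin.castLE hNR₁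
  set ι₂ : Fin N₂ → KeySet n R₂ := Fin.castLE hNR₂
  have hι₀ : ι₀.Injective := Fin.castLE_injective _
  have hι₁ : ι₁.Injective := Fin.castLE_injective _
  have hι₂ : ι₂.Injective := Fin.castLE_injective _
  set ι := Prod.map ι₀ (Prod.map ι₁ ι₂) with hι
  have hιi : ι.Injective := hι₀.prodMap (hι₁.prodMap hι₂)
  let P : Protocol S X Y₁ Y₂ n R₀ R₁ R₂ :=
    { keyGen := fun s => (q₁ s).map ι
      enc := fun k s => q₂ s (Function.invFun ι k)
      dec₁ := fun y => (ι₀ (ξ.1 (D₁ y).1), ι₁ (ξ.2.1 (D₁ y)))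
      dec₂ := fun y => (ι₀ (ξ.1 (D₂ y).1), ι₂ (ξ.2.2 (D₂ y))) }
  have hlaw : P.law W = P'.map fun ω =>
      { s := ω.1, k₀ := ι₀ ω.2.1.1, k₁ := ι₁ ω.2.1.2.1, k₂ := ι₂ ω.2.1.2.2, x := ω.2.2.1,
        y₁ := fun i => (ω.2.2.2 i).1, y₂ := fun i => (ω.2.2.2 i).2.1,
        z := fun i => (ω.2.2.2 i).2.2 } := by
    simp only [P', map_joint, Protocol.law, P, PMF.bind_map]
    congr 1; funext s
    congr 1; funext κ
    simp only [Function.comp_apply, Function.leftInverse_invFun hιi κ]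
    rfl
  -- the keys are uniform
  have huK : ∀ κ, marg (real P') (fun ω => ω.2.1) κ = 1 / N := by
    intro κ
    have := hPsum fun κ' _ => ind (κ' = κ)
    rw [marg, this]
    simp only [← Finset.sum_mul, ← Finset.mul_sum, hw1, mul_one]
    rw [← hJK κ]
    refine Finset.sum_congr rfl fun s _ => ?_
    simp only [ind_comm_eq _ κ]
    exact sum_mul_ind κ (fun κ => ∑ x, J s κ x)
  have huf : ∀ {γ : Type} (f : Fin N₀ × Fin N₁ × Fin N₂ → γ) (c : γ),
      marg (real P') (fun ω => f ω.2.1) c = (1 / N) * ∑ κ, ind (f κ = c) := by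
    intro γ f c
    rw [marg_comp (real P') (fun ω => ω.2.1) f c, Finset.mul_sum]
    simp only [huK]
  have hu₀ : ∀ c, marg (real P') (fun ω => ω.2.1.1) c = 1 / N₀ := by
    intro c
    rw [huf (fun κ => κ.1)]
    simp only [Fintype.sum_prod_type, Finset.sum_const, Finset.card_univ, Fintype.card_prod,
      Fintype.card_fin, Nat.cast_mul,
      nsmul_eq_mul, ← Finset.mul_sum, sum_ind_left, hN]
    field_simp
  have hu₁ : ∀ c, marg (real P') (fun ω => ω.2.1.2.1) c = 1 / N₁ := by
    intro c
    rw [huf (fun κ => κ.2.1)]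
    simp only [Fintype.sum_prod_type, Finset.sum_const, Finset.card_univ, Fintype.card_fin,
      nsmul_eq_mul, ← Finset.mul_sum, sum_ind_left, hN]
    field_simp
  have hu₂ : ∀ c, marg (real P') (fun ω => ω.2.1.2.2) c = 1 / N₂ := by
    intro c
    rw [huf (fun κ => κ.2.2)]
    simp only [Fintype.sum_prod_type, Finset.sum_const, Finset.card_univ, Fintype.card_fin,
      nsmul_eq_mul, sum_ind_left, hN]
    field_simp
  have hu₁₂ : ∀ c d, marg (real P') (fun ω => (ω.2.1.2.1, ω.2.1.2.2)) (c, d) =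
      marg (real P') (fun ω => ω.2.1.2.1) c * marg (real P') (fun ω => ω.2.1.2.2) d := by
    intro c d
    rw [huf (fun κ => (κ.2.1, κ.2.2)), hu₁, hu₂]
    simp only [Fintype.sum_prod_type, Finset.sum_const, Finset.card_univ, Fintype.card_fin,
      nsmul_eq_mul, ← Finset.mul_sum, Prod.mk.injEq, ind_and, sum_ind_left, hN, mul_one]
    field_simp
  -- reliability
  have hprob : ∀ (E : Fin N₀ × Fin N₁ × Fin N₂ → (Fin n → Y₁ × Y₂ × Z) → Prop) (e : (Fin n → S) →
      V₀ × V₁ × V₂ → (Fin n → Y₁ × Y₂ × Z) → ℝ), (∀ s u y, ind (E (K u) y) ≤ e s u y) →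
      ∑ s, ∑ u, ∑ y, Q s u * m.V s u y * e s u y ≤ 1200 * ε →
      ∑ ω, real P' ω * ind (E ω.2.1 ω.2.2.2) < ε' := by
    intro E e hE he
    have h := sum_abs_stat_sub_le J Q pX w hw0 hw1 m.V hmV K hρ (γ := Unit)
      (fun _ κ y => ind (E κ y)) (fun _ _ _ => ind_nonneg _)
      (fun _ _ => by simpa using ind_le_one _)
    rw [Finset.univ_unique, Finset.sum_singleton, ← hPsum fun κ y => ind (E κ y)] at h
    have h2 : ∑ s, ∑ u, ∑ y, Q s u * m.V s u y * ind (E (K u) y) ≤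
        ∑ s, ∑ u, ∑ y, Q s u * m.V s u y * e s u y :=
      Finset.sum_le_sum fun s _ => Finset.sum_le_sum fun u _ => Finset.sum_le_sum fun y _ =>
        mul_le_mul_of_nonneg_left (hE s u y) (mul_nonneg (hQ s u) (m.V_nonneg _ _ _))
    have h3 := le_abs_self (∑ ω, real P' ω * ind (E ω.2.1 ω.2.2.2) -
      ∑ s, ∑ u, ∑ y, Q s u * m.V s u y * ind (E (K u) y))
    have hε0 : 0 ≤ ε := by
      have := (abs_nonneg _).trans h
      linarith
    linarith
  have hε0 : 0 ≤ ε := by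
    have : (0 : ℝ) ≤ _ := (Finset.sum_nonneg fun κ _ => abs_nonneg _).trans hdev
    linarith
  -- secrecy
  have hsz := sum_abs_marg_sub_le m Q (real P') (fun ω => ω.2.1) (fun ω i => (ω.2.2.2 i).2.2) K
    (fun y i => (y i).2.2) hN0 hcard (ρ := 8200 * ε) (by
      have := sum_abs_stat_sub_le J Q pX w hw0 hw1 m.V hmV K hρ
        (γ := (Fin n → Z) × (Fin N₀ × Fin N₁ × Fin N₂))
        (fun c κ y => ind (κ = c.2 ∧ (fun i => (y i).2.2) = c.1)) (fun _ _ _ => ind_nonneg _)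
        (fun κ y => by
          simp only [Fintype.sum_prod_type, ind_and, ← Finset.sum_mul, sum_ind, one_mul]
          rfl)
      simp only [← hPsum] at this
      exact this) hz
  have hsy₂ := sum_abs_marg_sub_le m Q (real P') (fun ω => ω.2.1.2.1) (fun ω i => (ω.2.2.2 i).2.1)
    (fun u => (K u).2.1) (fun y i => (y i).2.1) (N := N₁) (by positivity) (by simp)
    (ρ := 8200 * ε) (by
      have := sum_abs_stat_sub_le J Q pX w hw0 hw1 m.V hmV K hρ
        (γ := (Fin n → Y₂) × Fin N₁)
        (fun c κ y => ind (κ.2.1 = c.2 ∧ (fun i => (y i).2.1) = c.1)) (fun _ _ _ => ind_nonneg _)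
        (fun κ y => by
          simp only [Fintype.sum_prod_type, ind_and, ← Finset.sum_mul, sum_ind, one_mul]
          rfl)
      simp only [← hPsum] at this
      exact this) hy₂
  have hsy₁ := sum_abs_marg_sub_le m Q (real P') (fun ω => ω.2.1.2.2) (fun ω i => (ω.2.2.2 i).1)
    (fun u => (K u).2.2) (fun y i => (y i).1) (N := N₂) (by positivity) (by simp)
    (ρ := 8200 * ε) (by
      have := sum_abs_stat_sub_le J Q pX w hw0 hw1 m.V hmV K hρ
        (γ := (Fin n → Y₁) × Fin N₂)
        (fun c κ y => ind (κ.2.2 = c.2 ∧ (fun i => (y i).1) = c.1)) (fun _ _ _ => ind_nonneg _)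
        (fun κ y => by
          simp only [Fintype.sum_prod_type, ind_and, ← Finset.sum_mul, sum_ind, one_mul]
          rfl)
      simp only [← hPsum] at this
      exact this) hy₁
  have hN1 : 1 ≤ N := one_le_mul_of_one_le_of_one_le (one_le_mul_of_one_le_of_one_le hN₀' hN₁') hN₂'
  have hlogN : 0 ≤ Real.logb 2 N := Real.logb_nonneg one_lt_two hN1
  have hfin : ∀ {x D N' : ℝ}, 1 ≤ N' → N' ≤ N → x ≤ (Real.logb 2 N' + 2) * D →
      D ≤ 2700 * ε + 2 * (8200 * ε) → 1 / (n : ℝ) * x < ε' := by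
    intro x D N' h1 h2 h3 h4
    have hl : Real.logb 2 N' ≤ Real.logb 2 N :=
      Real.logb_le_logb_of_le one_lt_two (by linarith) h2
    have hl0 : 0 ≤ Real.logb 2 N' := Real.logb_nonneg one_lt_two h1
    rw [one_div, inv_mul_lt_iff₀ hn']
    refine lt_of_le_of_lt ?_ hε₂
    calc x ≤ (Real.logb 2 N' + 2) * D := h3
      _ ≤ (Real.logb 2 N' + 2) * (20000 * ε) :=
          mul_le_mul_of_nonneg_left (by linarith) (by linarith)
      _ ≤ _ := mul_le_mul_of_nonneg_right (by linarith) (by linarith)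
  have hNN₁ : (N₁ : ℝ) ≤ N := by
    rw [hN, mul_right_comm]
    have : 1 ≤ (N₀ : ℝ) * N₂ := one_le_mul_of_one_le_of_one_le hN₀' hN₂'
    exact le_mul_of_one_le_left (by linarith) this
  have hNN₂ : (N₂ : ℝ) ≤ N := by
    have : 1 ≤ (N₀ : ℝ) * N₁ := one_le_mul_of_one_le_of_one_le hN₀' hN₁'
    exact le_mul_of_one_le_left (by linarith) this
  have hrate : ∀ {R x : ℝ}, n * (R - ε') < x → R - ε' < 1 / (n : ℝ) * x := by
    intro R x h
    rwa [one_div, lt_inv_mul_iff₀ hn']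
  refine ⟨P, ?_⟩
  constructor
  · rw [hlaw, Indep]
    simp only [PMF.map_comp]
    exact indep_comp_injective hu₁₂ hι₁ hι₂
  · rw [hlaw, prob_map, prob_eq]
    refine hprob (fun κ y => ι₀ κ.1 ≠ ι₀ (ξ.1 (D₁ fun i => (y i).1).1)) _ (fun s u y => ind_mono ?_)
      hD₁
    intro h h'
    rw [h'] at h
    exact h rfl
  · rw [hlaw, prob_map, prob_eq]
    refine hprob (fun κ y => ι₀ κ.1 ≠ ι₀ (ξ.1 (D₂ fun i => (y i).2.1).1)) _
      (fun s u y => ind_mono ?_) hD₂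
    intro h h'
    rw [h'] at h
    exact h rfl
  · rw [hlaw, prob_map, prob_eq]
    refine hprob (fun κ y => ι₁ κ.2.1 ≠ ι₁ (ξ.2.1 (D₁ fun i => (y i).1))) _
      (fun s u y => ind_mono ?_) hD₁
    intro h h'
    rw [h'] at h
    exact h rfl
  · rw [hlaw, prob_map, prob_eq]
    refine hprob (fun κ y => ι₂ κ.2.2 ≠ ι₂ (ξ.2.2 (D₂ fun i => (y i).2.1))) _
      (fun s u y => ind_mono ?_) hD₂
    intro h h'
    rw [h'] at h
    exact h rfl
  · rw [hlaw, I_map]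
    have e := I_injective P' (fun ω => ω.2.1) (fun ω i => (ω.2.2.2 i).2.2) hιi
    have := I_le_of_uniform P' (fun ω => ω.2.1) (fun ω i => (ω.2.2.2 i).2.2) hN1 huK
    rw [← e] at this
    exact hfin hN1 le_rfl this hsz
  · rw [hlaw, I_map, I_injective P' (fun ω => ω.2.1.2.1) _ hι₁]
    exact hfin hN₁' hNN₁ (I_le_of_uniform P' _ _ hN₁' hu₁) hsy₂
  · rw [hlaw, I_map, I_injective P' (fun ω => ω.2.1.2.2) _ hι₂]
    exact hfin hN₂' hNN₂ (I_le_of_uniform P' _ _ hN₂' hu₂) hsy₁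
  · rw [hlaw, H_map, H_injective P' (fun ω => ω.2.1.1) hι₀, H_of_uniform P' _ hu₀]
    exact hrate hr₀
  · rw [hlaw, H_map, H_injective P' (fun ω => ω.2.1.2.1) hι₁, H_of_uniform P' _ hu₁]
    exact hrate hr₁
  · rw [hlaw, H_map, H_injective P' (fun ω => ω.2.1.2.2) hι₂, H_of_uniform P' _ hu₂]
    exact hrate hr₂

end protocol

/-! ### Typical sequences -/

section typical

variable {Ω α β : Type*}

lemma sum_pi_prod [Fintype α] {n : ℕ} (f : Fin n → α → ℝ) :
    ∑ a : Fin n → α, ∏ i, f i (a i) = ∏ i, ∑ a, f i a := by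
  classical
  rw [Finset.prod_univ_sum, Fintype.piFinset_univ]

lemma ind_forall {n : ℕ} (p : Fin n → Prop) : ind (∀ i, p i) = ∏ i, ind (p i) := by
  by_cases h : ∀ i, p i
  · rw [ind_of h, Finset.prod_eq_one fun i _ => ind_of (h i)]
  · rw [ind_of_not h]
    push Not at h
    obtain ⟨i, hi⟩ := h
    exact (Finset.prod_eq_zero (Finset.mem_univ i) (ind_of_not hi)).symm

/-- The marginal of a product measure is the product of the marginals. -/
lemma sum_pi_prod_mul_ind [Fintype Ω] {n : ℕ} (p : Ω → ℝ) (A : Ω → α) (a : Fin n → α) :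
    ∑ ω : Fin n → Ω, (∏ i, p (ω i)) * ind (∀ i, A (ω i) = a i) = ∏ i, marg p A (a i) := by
  simp only [ind_forall, ← Finset.prod_mul_distrib]
  exact sum_pi_prod fun i ω => p ω * ind (A ω = a i)

lemma sum_pi_comp [Fintype Ω] [Fintype α] {n : ℕ} (p : Ω → ℝ) (A : Ω → α)
    (F : (Fin n → α) → ℝ) :
    ∑ ω : Fin n → Ω, (∏ i, p (ω i)) * F (fun i => A (ω i)) =
      ∑ a, (∏ i, marg p A (a i)) * F a := by
  simp only [← sum_pi_prod_mul_ind, Finset.sum_mul]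
  rw [Finset.sum_comm]
  refine Finset.sum_congr rfl fun ω _ => ?_
  rw [← sum_ind_mul (fun i => A (ω i)) F, Finset.mul_sum]
  refine Finset.sum_congr rfl fun a _ => ?_
  rw [ind_congr (funext_iff (f := fun i => A (ω i)) (g := a))]
  ring

lemma sum_pi_succ [Fintype α] (q : α → ℝ) {n : ℕ} (F : (Fin (n + 1) → α) → ℝ) :
    ∑ a, (∏ i, q (a i)) * F a = ∑ x, q x * ∑ a : Fin n → α, (∏ i, q (a i)) * F (Fin.cons x a) := by
  rw [← (Fin.consEquiv fun _ => α).sum_comp, Fintype.sum_prod_type]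
  refine Finset.sum_congr rfl fun x _ => ?_
  rw [Finset.mul_sum]
  refine Finset.sum_congr rfl fun a _ => ?_
  have e : (Fin.consEquiv fun _ => α) (x, a) = (Fin.cons x a : Fin (n + 1) → α) := rfl
  simp only [e, Fin.prod_univ_succ, Fin.cons_zero, Fin.cons_succ]
  ring

lemma sum_pi_eq_one [Fintype α] {q : α → ℝ} (hq1 : ∑ a, q a = 1) (n : ℕ) :
    ∑ a : Fin n → α, ∏ i, q (a i) = 1 := by
  rw [sum_pi_prod fun _ => q, Finset.prod_eq_one fun _ _ => hq1]

lemma sum_pi_mean [Fintype α] {q g : α → ℝ} (hq1 : ∑ a, q a = 1) (hg : ∑ a, q a * g a = 0) (n : ℕ) :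
    ∑ a : Fin n → α, (∏ i, q (a i)) * ∑ i, g (a i) = 0 := by
  induction n with
  | zero => simp
  | succ n ih =>
    rw [sum_pi_succ]
    simp only [Fin.sum_univ_succ, Fin.cons_zero, Fin.cons_succ, mul_add, Finset.sum_add_distrib, ih,
      ← Finset.sum_mul, sum_pi_eq_one hq1, one_mul, add_zero, hg]

/-- The second moment of a sum of independent centred variables. -/
lemma sum_pi_variance [Fintype α] {q g : α → ℝ} (hq1 : ∑ a, q a = 1) (hg : ∑ a, q a * g a = 0)
    (n : ℕ) :
    ∑ a : Fin n → α, (∏ i, q (a i)) * (∑ i, g (a i)) ^ 2 = n * ∑ a, q a * g a ^ 2 := by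
  induction n with
  | zero => simp
  | succ n ih =>
    rw [sum_pi_succ]
    have e : ∀ x, ∑ a : Fin n → α, (∏ i, q (a i)) *
        (∑ i, g ((Fin.cons x a : Fin (n + 1) → α) i)) ^ 2 = g x ^ 2 + n * ∑ a, q a * g a ^ 2 := by
      intro x
      rw [← ih]
      have e2 : ∀ a : Fin n → α, (∏ i, q (a i)) *
          (∑ i, g ((Fin.cons x a : Fin (n + 1) → α) i)) ^ 2 = (∏ i, q (a i)) * g x ^ 2 +
          2 * g x * ((∏ i, q (a i)) * ∑ i, g (a i)) + (∏ i, q (a i)) * (∑ i, g (a i)) ^ 2 := by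
        intro a
        simp only [Fin.sum_univ_succ, Fin.cons_zero, Fin.cons_succ]
        ring
      simp only [e2, Finset.sum_add_distrib, ← Finset.mul_sum, ← Finset.sum_mul,
        sum_pi_eq_one hq1, sum_pi_mean hq1 hg]
      ring
    simp only [e, mul_add, Finset.sum_add_distrib, ← Finset.sum_mul, hq1]
    push_cast; ring

/-- The exponential function `2 ^ (n x)`. -/
def bexp (n : ℕ) (x : ℝ) : ℝ := 2 ^ ((n : ℝ) * x)

/-- The sequence `a` has probability `2 ^ (-n (h ± δ))` under the `n`-fold product of `q`. -/
def Typical {n : ℕ} (q : α → ℝ) (h δ : ℝ) (a : Fin n → α) : Prop :=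
  bexp n (-(h + δ)) ≤ ∏ i, q (a i) ∧ ∏ i, q (a i) ≤ bexp n (-(h - δ))

/-- Asymptotic equipartition, by Chebyshev's inequality. -/
lemma sum_not_typical_le [Fintype α] {q : α → ℝ} (hq : ∀ a, 0 ≤ q a) (hq1 : ∑ a, q a = 1)
    {δ : ℝ} (hδ : 0 < δ) {n : ℕ} (hn : 0 < n) :
    ∑ a : Fin n → α, (∏ i, q (a i)) * ind (¬Typical q (∑ a, etaLog (q a)) δ a) ≤
      (∑ a, q a * (-Real.logb 2 (q a) - ∑ a, etaLog (q a)) ^ 2) / (n * δ ^ 2) := by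
  set h := ∑ a, etaLog (q a) with hh
  set g : α → ℝ := fun a => -Real.logb 2 (q a) - h with hg
  have hn' : (0 : ℝ) < n := by exact_mod_cast hn
  have hg0 : ∑ a, q a * g a = 0 := by
    simp only [hg, mul_sub, Finset.sum_sub_distrib, ← Finset.sum_mul, hq1, one_mul, mul_neg]
    rw [sub_eq_zero, hh]; rfl
  have hpt : ∀ a : Fin n → α, (∏ i, q (a i)) * ind (¬Typical q h δ a) ≤
      (∏ i, q (a i)) * (∑ i, g (a i)) ^ 2 / (n * δ) ^ 2 := by
    intro a
    have hp : 0 ≤ ∏ i, q (a i) := Finset.prod_nonneg fun i _ => hq _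
    rcases hp.eq_or_lt with h0 | h0
    · rw [← h0]; simp
    rw [mul_div_assoc]
    refine mul_le_mul_of_nonneg_left ?_ hp
    by_cases ht : Typical q h δ a
    · rw [ind_of_not (not_not.2 ht)]; positivity
    rw [ind_of ht, le_div_iff₀ (by positivity), one_mul]
    by_contra hlt
    have habs := abs_lt_of_sq_lt_sq (not_le.1 hlt) (by positivity)
    have hs : ∑ i, g (a i) = -Real.logb 2 (∏ i, q (a i)) - n * h := by
      simp only [hg, Finset.sum_sub_distrib, Finset.sum_neg_distrib, Finset.sum_const,
        Finset.card_univ, Fintype.card_fin, nsmul_eq_mul]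
      congr 2
      simp only [Real.logb]
      rw [Real.log_prod, Finset.sum_div]
      intro i _ h1
      exact h0.ne' (Finset.prod_eq_zero (Finset.mem_univ i) h1)
    rw [hs, abs_lt] at habs
    refine ht ⟨?_, ?_⟩
    · rw [bexp, ← Real.le_logb_iff_rpow_le one_lt_two h0]; linarith
    · rw [bexp, ← Real.logb_le_iff_le_rpow one_lt_two h0]; linarith
  refine (Finset.sum_le_sum fun a _ => hpt a).trans_eq ?_
  rw [← Finset.sum_div, sum_pi_variance hq1 hg0]
  simp only [hg]
  field_simp

lemma eventually_sum_not_typical_le [Fintype α] {q : α → ℝ} (hq : ∀ a, 0 ≤ q a)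
    (hq1 : ∑ a, q a = 1) {δ ε : ℝ} (hδ : 0 < δ) (hε : 0 < ε) :
    ∀ᶠ n : ℕ in Filter.atTop, ∑ a : Fin n → α, (∏ i, q (a i)) *
      ind (¬Typical q (∑ a, etaLog (q a)) δ a) ≤ ε := by
  set C := ∑ a, q a * (-Real.logb 2 (q a) - ∑ a, etaLog (q a)) ^ 2
  filter_upwards [Filter.eventually_gt_atTop 0, Filter.eventually_ge_atTop ⌈C / (ε * δ ^ 2)⌉₊]
    with n hn hnC
  refine (sum_not_typical_le hq hq1 hδ hn).trans ?_
  have hn' : (0 : ℝ) < n := by exact_mod_cast hn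
  rw [div_le_iff₀ (by positivity)]
  have := (Nat.le_ceil _).trans (Nat.cast_le (α := ℝ).2 hnC)
  rw [div_le_iff₀ (by positivity)] at this
  linarith

end typical

/-! ### Memoryless extension of a model -/

namespace Model

variable {S U₀ U₁ U₂ Y : Type*} [Fintype S] [Fintype U₀] [Fintype U₁] [Fintype U₂] [Fintype Y]
  (m : Model S U₀ U₁ U₂ Y)

/-- The letters of a sequence of triples. -/
def nth {n : ℕ} (u : (Fin n → U₀) × (Fin n → U₁) × (Fin n → U₂)) (i : Fin n) : U₀ × U₁ × U₂ :=
  (u.1 i, u.2.1 i, u.2.2 i)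

/-- `n` independent copies of a model. -/
def pow (n : ℕ) :
    Model (Fin n → S) (Fin n → U₀) (Fin n → U₁) (Fin n → U₂) (Fin n → Y) where
  a s := ∏ i, m.a (s i)
  k₀ s u := ∏ i, m.k₀ (s i) (u i)
  k₁ s u v := ∏ i, m.k₁ (s i) (u i) (v i)
  k₂ s u v := ∏ i, m.k₂ (s i) (u i) (v i)
  V s u y := ∏ i, m.V (s i) (nth u i) (y i)
  a_nonneg s := Finset.prod_nonneg fun i _ => m.a_nonneg _
  k₀_nonneg s u := Finset.prod_nonneg fun i _ => m.k₀_nonneg _ _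
  k₁_nonneg s u v := Finset.prod_nonneg fun i _ => m.k₁_nonneg _ _ _
  k₂_nonneg s u v := Finset.prod_nonneg fun i _ => m.k₂_nonneg _ _ _
  V_nonneg s u y := Finset.prod_nonneg fun i _ => m.V_nonneg _ _ _
  a_sum := sum_pi_eq_one m.a_sum n
  k₀_sum s := by rw [sum_pi_prod fun i => m.k₀ (s i)]; exact Finset.prod_eq_one fun i _ => m.k₀_sum _
  k₁_sum s u := by
    rw [sum_pi_prod fun i => m.k₁ (s i) (u i)]; exact Finset.prod_eq_one fun i _ => m.k₁_sum _ _
  k₂_sum s u := by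
    rw [sum_pi_prod fun i => m.k₂ (s i) (u i)]; exact Finset.prod_eq_one fun i _ => m.k₂_sum _ _
  V_sum s u := by
    rw [sum_pi_prod fun i => m.V (s i) (nth u i)]; exact Finset.prod_eq_one fun i _ => m.V_sum _ _

/-- The joint law of a letter of state, layers and output as a function on triples. -/
def law (ω : S × (U₀ × U₁ × U₂) × Y) : ℝ := m.P ω.1 ω.2.1 ω.2.2

lemma law_nonneg (ω : S × (U₀ × U₁ × U₂) × Y) : 0 ≤ m.law ω := m.P_nonneg _ _ _

lemma sum_law : ∑ ω, m.law ω = 1 := by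
  simp only [Fintype.sum_prod_type (α₁ := S), law]
  rw [← m.sum_R]
  refine Finset.sum_congr rfl fun s _ => ?_
  rw [Fintype.sum_prod_type]
  exact Finset.sum_congr rfl fun u _ => m.sum_P s u

lemma pow_P {n : ℕ} (s : Fin n → S) (u : (Fin n → U₀) × (Fin n → U₁) × (Fin n → U₂))
    (y : Fin n → Y) : (m.pow n).P s u y = ∏ i, m.law (s i, nth u i, y i) := by
  simp only [P, R, law, pow, Finset.prod_mul_distrib, nth]

/-- Sums over sequences of state, layers and output are sums over sequences of letters. -/
lemma sum_pow (n : ℕ) (F : (Fin n → S) → (Fin n → U₀ × U₁ × U₂) → (Fin n → Y) → ℝ) :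
    ∑ s, ∑ u, ∑ y, (m.pow n).P s u y * F s (nth u) y =
      ∑ ω : Fin n → S × (U₀ × U₁ × U₂) × Y, (∏ i, m.law (ω i)) *
        F (fun i => (ω i).1) (fun i => (ω i).2.1) (fun i => (ω i).2.2) := by
  let e : (Fin n → S) × ((Fin n → U₀) × (Fin n → U₁) × (Fin n → U₂)) × (Fin n → Y) ≃
      (Fin n → S × (U₀ × U₁ × U₂) × Y) :=
    { toFun := fun x i => (x.1 i, nth x.2.1 i, x.2.2 i)
      invFun := fun ω => (fun i => (ω i).1, (fun i => (ω i).2.1.1, fun i => (ω i).2.1.2.1,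
        fun i => (ω i).2.1.2.2), fun i => (ω i).2.2)
      left_inv := fun x => rfl
      right_inv := fun ω => rfl }
  rw [← e.sum_comp, Fintype.sum_prod_type]
  refine Finset.sum_congr rfl fun s _ => ?_
  symm
  rw [Fintype.sum_prod_type]
  refine Finset.sum_congr rfl fun u _ => Finset.sum_congr rfl fun y _ => ?_
  rw [pow_P]; rfl

/-- The joint law of the layers in `D` and a letter `B` of state and output. -/
def margPat {O : Type*} (D : Pat) (B : S × Y → O) : (Option U₀ × Option U₁ × Option U₂) × O → ℝ :=
  marg m.law fun ω => (D.proj ω.2.1, B (ω.1, ω.2.2))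

/-- The joint entropy of the layers in `D` and a letter `B` of state and output. -/
def entPat {O : Type*} [Fintype O] (D : Pat) (B : S × Y → O) : ℝ :=
  ent m.law fun ω => (D.proj ω.2.1, B (ω.1, ω.2.2))

variable {O : Type*}

lemma margPat_nonneg (D : Pat) (B : S × Y → O) (x : (Option U₀ × Option U₁ × Option U₂) × O) :
    0 ≤ m.margPat D B x :=
  marg_nonneg m.law_nonneg _ _

lemma pow_obsPat (n : ℕ) (D : Pat) (out : Y → O)
    (u : (Fin n → U₀) × (Fin n → U₁) × (Fin n → U₂)) (z : Fin n → O) :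
    (m.pow n).obsPat D (fun y i => out (y i)) u z =
      ∏ i, m.margPat D (fun x => out x.2) (D.proj (nth u i), z i) := by
  have hagr : ∀ u' : (Fin n → U₀) × (Fin n → U₁) × (Fin n → U₂),
      D.Agr u' u ↔ ∀ i, D.proj (nth u' i) = D.proj (nth u i) := by
    intro u'
    cases D <;> simp [Pat.Agr, Pat.proj, nth, funext_iff, forall_and]
  simp only [margPat]
  rw [← sum_pi_prod_mul_ind, obsPat]
  have h := m.sum_pow n fun _ v y => ind (∀ i, (D.proj (v i), out (y i)) = (D.proj (nth u i), z i))
  rw [← h]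
  symm
  rw [Finset.sum_comm]
  refine Finset.sum_congr rfl fun u' _ => ?_
  rw [obs, Finset.sum_mul]
  refine Finset.sum_congr rfl fun s _ => ?_
  rw [Finset.sum_mul]
  refine Finset.sum_congr rfl fun y _ => ?_
  rw [ind_true, mul_one, mul_assoc, ← ind_and]
  congr 1
  refine ind_congr ?_
  simp only [Prod.mk.injEq, forall_and, hagr, funext_iff]
  tauto

end Model

/-! ### Exponential rates -/

section bexp

lemma bexp_pos (n : ℕ) (x : ℝ) : 0 < bexp n x := Real.rpow_pos_of_pos two_pos _

lemma bexp_add (n : ℕ) (x y : ℝ) : bexp n (x + y) = bexp n x * bexp n y := by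
  rw [bexp, mul_add, Real.rpow_add two_pos]; rfl

lemma bexp_zero (n : ℕ) : bexp n 0 = 1 := by simp [bexp]

lemma bexp_mono (n : ℕ) {x y : ℝ} (h : x ≤ y) : bexp n x ≤ bexp n y :=
  Real.rpow_le_rpow_of_exponent_le one_le_two (mul_le_mul_of_nonneg_left h (Nat.cast_nonneg n))

lemma one_le_bexp (n : ℕ) {x : ℝ} (h : 0 ≤ x) : 1 ≤ bexp n x := by
  rw [← bexp_zero n]; exact bexp_mono n h

lemma bexp_pow (n : ℕ) (x : ℝ) (k : ℕ) : bexp n x ^ k = bexp n (k * x) := by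
  rw [bexp, ← Real.rpow_natCast, ← Real.rpow_mul two_pos.le, bexp]; congr 1; ring

lemma eventually_bexp_le {c C : ℝ} (hc : c < 0) (hC : 0 < C) :
    ∀ᶠ n : ℕ in Filter.atTop, bexp n c ≤ C := by
  have h1 : (2 : ℝ) ^ c < 1 := Real.rpow_lt_one_of_one_lt_of_neg one_lt_two hc
  have h0 : (0 : ℝ) ≤ 2 ^ c := (Real.rpow_pos_of_pos two_pos _).le
  filter_upwards [(tendsto_pow_atTop_nhds_zero_of_lt_one h0 h1).eventually (gt_mem_nhds hC)]
    with n hn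
  have : bexp n c = (2 ^ c) ^ n := by
    rw [bexp, mul_comm, Real.rpow_mul two_pos.le, Real.rpow_natCast]
  rw [this]; exact hn.le

lemma two_pow_floor_le (n : ℕ) {r : ℝ} (hr : 0 ≤ r) :
    ((2 ^ ⌊(n : ℝ) * r⌋₊ : ℕ) : ℝ) ≤ bexp n r := by
  push_cast
  rw [bexp, ← Real.rpow_natCast]
  exact Real.rpow_le_rpow_of_exponent_le one_le_two (Nat.floor_le (by positivity))

lemma eventually_nhdsGT_add_mul_le {a b : ℝ} (c : ℝ) (h : a < b) :
    ∀ᶠ δ : ℝ in nhdsWithin 0 (Set.Ioi 0), a + c * δ ≤ b := by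
  have : Filter.Tendsto (fun δ : ℝ => a + c * δ) (nhds 0) (nhds (a + c * 0)) :=
    (by fun_prop : Continuous fun δ : ℝ => a + c * δ).tendsto 0
  rw [mul_zero, add_zero] at this
  exact ((this.mono_left nhdsWithin_le_nhds).eventually (gt_mem_nhds h)).mono fun _ h => le_of_lt h

end bexp

/-! ### Consequences of typicality -/

namespace Model

variable {S U₀ U₁ U₂ Y : Type*} [Fintype S] [Fintype U₀] [Fintype U₁] [Fintype U₂] [Fintype Y]
  (m : Model S U₀ U₁ U₂ Y) {O Y₁ Y₂ Z : Type*} [Fintype O] [Fintype Y₁] [Fintype Y₂] [Fintype Z]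

/-- The layers in `D` together with `B` are jointly typical. -/
def TypAt (D : Pat) (B : S × Y → O) (δ : ℝ) {n : ℕ} (s : Fin n → S)
    (u : (Fin n → U₀) × (Fin n → U₁) × (Fin n → U₂)) (y : Fin n → Y) : Prop :=
  Typical (m.margPat D B) (m.entPat D B) δ fun i => (D.proj (nth u i), B (s i, y i))

/-- Everything that matters is typical. -/
def AllTyp (y₁ : Y → Y₁) (y₂ : Y → Y₂) (z : Y → Z) (δ : ℝ) {n : ℕ} (s : Fin n → S)
    (u : (Fin n → U₀) × (Fin n → U₁) × (Fin n → U₂)) (y : Fin n → Y) : Prop :=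
  ∀ D, m.TypAt D Prod.fst δ s u y ∧ m.TypAt D (fun x => y₁ x.2) δ s u y ∧
    m.TypAt D (fun x => y₂ x.2) δ s u y ∧ m.TypAt D (fun x => z x.2) δ s u y

lemma eventually_sum_not_typAt_le (D : Pat) (B : S × Y → O) {δ ε : ℝ} (hδ : 0 < δ) (hε : 0 < ε) :
    ∀ᶠ n : ℕ in Filter.atTop,
      ∑ s, ∑ u, ∑ y, (m.pow n).P s u y * ind (¬m.TypAt D B δ s u y) ≤ ε := by
  filter_upwards [eventually_sum_not_typical_le (q := m.margPat D B) (m.margPat_nonneg D B)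
    (by rw [margPat, sum_marg, m.sum_law]) hδ hε] with n hn
  refine le_trans (le_of_eq ?_) hn
  have h1 := m.sum_pow n fun s u y => ind (¬Typical (m.margPat D B) (m.entPat D B) δ
    fun i => (D.proj (u i), B (s i, y i)))
  have h2 := sum_pi_comp (n := n) m.law (fun ω => (D.proj ω.2.1, B (ω.1, ω.2.2)))
    (fun a => ind (¬Typical (m.margPat D B) (m.entPat D B) δ a))
  exact h1.trans h2

lemma eventually_sum_not_allTyp_le (y₁ : Y → Y₁) (y₂ : Y → Y₂) (z : Y → Z) {δ ε : ℝ} (hδ : 0 < δ)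
    (hε : 0 < ε) : ∀ᶠ n : ℕ in Filter.atTop,
      ∑ s, ∑ u, ∑ y, (m.pow n).P s u y * ind (¬m.AllTyp y₁ y₂ z δ s u y) ≤ ε := by
  have hε' : 0 < ε / 20 := by positivity
  have h1 := Filter.eventually_all.2 fun D =>
    m.eventually_sum_not_typAt_le D (Prod.fst : S × Y → S) hδ hε'
  have h2 := Filter.eventually_all.2 fun D =>
    m.eventually_sum_not_typAt_le D (fun x : S × Y => y₁ x.2) hδ hε'
  have h3 := Filter.eventually_all.2 fun D =>
    m.eventually_sum_not_typAt_le D (fun x : S × Y => y₂ x.2) hδ hε'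
  have h4 := Filter.eventually_all.2 fun D =>
    m.eventually_sum_not_typAt_le D (fun x : S × Y => z x.2) hδ hε'
  filter_upwards [h1, h2, h3, h4] with n h1 h2 h3 h4
  have hpt : ∀ s u y, ind (¬m.AllTyp y₁ y₂ z δ (n := n) s u y) ≤ ∑ D,
      (ind (¬m.TypAt D Prod.fst δ s u y) + ind (¬m.TypAt D (fun x => y₁ x.2) δ s u y) +
      ind (¬m.TypAt D (fun x => y₂ x.2) δ s u y) + ind (¬m.TypAt D (fun x => z x.2) δ s u y)) := by
    intro s u y
    have hn : ∀ D, 0 ≤ (ind (¬m.TypAt D Prod.fst δ s u y) +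
        ind (¬m.TypAt D (fun x => y₁ x.2) δ s u y) + ind (¬m.TypAt D (fun x => y₂ x.2) δ s u y) +
        ind (¬m.TypAt D (fun x => z x.2) δ s u y)) := fun D =>
      add_nonneg (add_nonneg (add_nonneg (ind_nonneg _) (ind_nonneg _)) (ind_nonneg _))
        (ind_nonneg _)
    by_cases h : m.AllTyp y₁ y₂ z δ s u y
    · rw [ind_of_not (not_not.2 h)]
      exact Finset.sum_nonneg fun D _ => hn D
    · rw [ind_of h]
      simp only [AllTyp, not_forall] at h
      obtain ⟨D, hD⟩ := h
      refine le_trans ?_ (Finset.single_le_sum (fun D _ => hn D) (Finset.mem_univ D))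
      have q1 := ind_nonneg (¬m.TypAt D Prod.fst δ s u y)
      have q2 := ind_nonneg (¬m.TypAt D (fun x => y₁ x.2) δ s u y)
      have q3 := ind_nonneg (¬m.TypAt D (fun x => y₂ x.2) δ s u y)
      have q4 := ind_nonneg (¬m.TypAt D (fun x => z x.2) δ s u y)
      by_cases a1 : m.TypAt D Prod.fst δ s u y
      · by_cases a2 : m.TypAt D (fun x => y₁ x.2) δ s u y
        · by_cases a3 : m.TypAt D (fun x => y₂ x.2) δ s u y
          · have a4 : ¬m.TypAt D (fun x => z x.2) δ s u y := fun a4 => hD ⟨a1, a2, a3, a4⟩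
            have := ind_of a4
            linarith
          · have := ind_of a3
            linarith
        · have := ind_of a2
          linarith
      · have := ind_of a1
        linarith
  calc _ ≤ ∑ s, ∑ u, ∑ y, (m.pow n).P s u y * ∑ D,
      (ind (¬m.TypAt D Prod.fst δ s u y) + ind (¬m.TypAt D (fun x => y₁ x.2) δ s u y) +
      ind (¬m.TypAt D (fun x => y₂ x.2) δ s u y) + ind (¬m.TypAt D (fun x => z x.2) δ s u y)) :=
        Finset.sum_le_sum fun s _ => Finset.sum_le_sum fun u _ => Finset.sum_le_sum fun y _ =>
          mul_le_mul_of_nonneg_left (hpt s u y) ((m.pow n).P_nonneg _ _ _)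
    _ = ∑ D, (∑ s, ∑ u, ∑ y, (m.pow n).P s u y * ind (¬m.TypAt D Prod.fst δ s u y) +
        ∑ s, ∑ u, ∑ y, (m.pow n).P s u y * ind (¬m.TypAt D (fun x => y₁ x.2) δ s u y) +
        ∑ s, ∑ u, ∑ y, (m.pow n).P s u y * ind (¬m.TypAt D (fun x => y₂ x.2) δ s u y) +
        ∑ s, ∑ u, ∑ y, (m.pow n).P s u y * ind (¬m.TypAt D (fun x => z x.2) δ s u y)) := by
        simp only [← Finset.sum_add_distrib, Finset.mul_sum, ← mul_add]
        symm
        rw [Finset.sum_comm]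
        refine Finset.sum_congr rfl fun s _ => ?_
        rw [Finset.sum_comm]
        refine Finset.sum_congr rfl fun u _ => ?_
        rw [Finset.sum_comm]
    _ ≤ ∑ _D : Pat, (ε / 20 + ε / 20 + ε / 20 + ε / 20) :=
        Finset.sum_le_sum fun D _ => add_le_add (add_le_add (add_le_add (h1 D) (h2 D)) (h3 D)) (h4 D)
    _ = ε := by
        rw [Finset.sum_const, Finset.card_univ, show Fintype.card Pat = 5 from rfl, nsmul_eq_mul]
        push_cast; ring

lemma pow_obsPat_bounds {D : Pat} {out : Y → O} {δ : ℝ} {n : ℕ} {s : Fin n → S}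
    {u : (Fin n → U₀) × (Fin n → U₁) × (Fin n → U₂)} {y : Fin n → Y}
    (h : m.TypAt D (fun x => out x.2) δ s u y) :
    bexp n (-(m.entPat D (fun x => out x.2) + δ)) ≤
      (m.pow n).obsPat D (fun y i => out (y i)) u (fun i => out (y i)) ∧
    (m.pow n).obsPat D (fun y i => out (y i)) u (fun i => out (y i)) ≤
      bexp n (-(m.entPat D (fun x => out x.2) - δ)) := by
  rw [pow_obsPat]; exact h

lemma margPat_fst (D : Pat) (s : S) (u : U₀ × U₁ × U₂) :
    m.margPat D Prod.fst (D.proj u, s) = ∑ u', m.R s u' * ind (D.Agr u' u) := by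
  simp only [margPat, marg, Fintype.sum_prod_type (α₁ := S), law]
  rw [Finset.sum_eq_single s]
  · rw [Fintype.sum_prod_type]
    refine Finset.sum_congr rfl fun u' _ => ?_
    rw [← m.sum_P, Finset.sum_mul]
    refine Finset.sum_congr rfl fun y _ => ?_
    congr 1
    refine ind_congr ?_
    simp [Pat.proj_eq_iff]
  · intro s' _ hs
    refine Finset.sum_eq_zero fun x _ => ?_
    rw [ind_of_not, mul_zero]
    simp [hs]
  · simp

lemma margPat_fst_none (s : S) (u : U₀ × U₁ × U₂) :
    m.margPat .none Prod.fst (Pat.none.proj u, s) = m.a s := by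
  rw [margPat_fst]
  simp only [Pat.Agr, ind_true, mul_one, R, Fintype.sum_prod_type, mul_assoc, ← Finset.mul_sum,
    m.k₂_sum, m.k₁_sum, m.k₀_sum]

lemma margPat_fst_zero (s : S) (u : U₀ × U₁ × U₂) :
    m.margPat .zero Prod.fst (Pat.zero.proj u, s) = m.a s * m.k₀ s u.1 := by
  rw [margPat_fst]
  simp only [Pat.Agr, R, Fintype.sum_prod_type, mul_assoc, mul_comm _ (ind _), ← Finset.mul_sum, m.k₂_sum, m.k₁_sum, mul_one]
  simp only [ind_comm_eq _ u.1]
  exact sum_ind_mul u.1 fun x => m.a s * m.k₀ s x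

lemma margPat_fst_one (s : S) (u : U₀ × U₁ × U₂) :
    m.margPat .one Prod.fst (Pat.one.proj u, s) = m.a s * m.k₀ s u.1 * m.k₁ s u.1 u.2.1 := by
  rw [margPat_fst]
  have e : ∀ x y z, m.R s (x, y, z) * ind (Pat.one.Agr (x, y, z) u) =
      ind (u.1 = x) * (ind (u.2.1 = y) * (m.a s * m.k₀ s x * m.k₁ s x y * m.k₂ s x z)) := by
    intro x y z
    simp only [Pat.Agr, ind_and, R, ind_comm_eq _ u.1, ind_comm_eq _ u.2.1]; ring
  simp only [Fintype.sum_prod_type, e, ← Finset.mul_sum, m.k₂_sum, mul_one]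
  rw [sum_ind_mul u.1 fun x => ∑ y, ind (u.2.1 = y) * (m.a s * m.k₀ s x * m.k₁ s x y)]
  exact sum_ind_mul u.2.1 fun y => m.a s * m.k₀ s u.1 * m.k₁ s u.1 y

lemma margPat_fst_two (s : S) (u : U₀ × U₁ × U₂) :
    m.margPat .two Prod.fst (Pat.two.proj u, s) = m.a s * m.k₀ s u.1 * m.k₂ s u.1 u.2.2 := by
  rw [margPat_fst]
  have e : ∀ x y z, m.R s (x, y, z) * ind (Pat.two.Agr (x, y, z) u) =
      ind (u.1 = x) * (m.k₁ s x y * (ind (u.2.2 = z) * (m.a s * m.k₀ s x * m.k₂ s x z))) := by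
    intro x y z
    simp only [Pat.Agr, ind_and, R, ind_comm_eq _ u.1, ind_comm_eq _ u.2.2]; ring
  simp only [Fintype.sum_prod_type, e, ← Finset.mul_sum, ← Finset.sum_mul, m.k₁_sum, one_mul]
  rw [sum_ind_mul u.1 fun x => ∑ z, ind (u.2.2 = z) * (m.a s * m.k₀ s x * m.k₂ s x z)]
  exact sum_ind_mul u.2.2 fun z => m.a s * m.k₀ s u.1 * m.k₂ s u.1 z

lemma typical_ratio {n : ℕ} {x k h h' δ : ℝ}
    (hx : bexp n (-(h + δ)) ≤ x ∧ x ≤ bexp n (-(h - δ)))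
    (hxk : bexp n (-(h' + δ)) ≤ x * k ∧ x * k ≤ bexp n (-(h' - δ))) :
    bexp n (-(h' - h + 2 * δ)) ≤ k ∧ k ≤ bexp n (-(h' - h - 2 * δ)) := by
  have hx0 : 0 < x := (bexp_pos _ _).trans_le hx.1
  have hk0 : 0 < k := (mul_pos_iff_of_pos_left hx0).1 ((bexp_pos _ _).trans_le hxk.1)
  constructor
  · have e : bexp n (-(h' + δ)) = bexp n (-(h - δ)) * bexp n (-(h' - h + 2 * δ)) := by
      rw [← bexp_add]; congr 1; ring
    have h1 : bexp n (-(h - δ)) * bexp n (-(h' - h + 2 * δ)) ≤ bexp n (-(h - δ)) * k :=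
      (e.symm.trans_le hxk.1).trans (mul_le_mul_of_nonneg_right hx.2 hk0.le)
    exact le_of_mul_le_mul_left h1 (bexp_pos _ _)
  · have e : bexp n (-(h' - δ)) = bexp n (-(h + δ)) * bexp n (-(h' - h - 2 * δ)) := by
      rw [← bexp_add]; congr 1; ring
    have h1 : bexp n (-(h + δ)) * k ≤ bexp n (-(h + δ)) * bexp n (-(h' - h - 2 * δ)) :=
      (mul_le_mul_of_nonneg_right hx.1 hk0.le).trans (hxk.2.trans_eq e)
    exact le_of_mul_le_mul_left h1 (bexp_pos _ _)

section layers

variable {δ : ℝ} {n : ℕ} {s : Fin n → S} {u : (Fin n → U₀) × (Fin n → U₁) × (Fin n → U₂)}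
  {y : Fin n → Y}

lemma pow_k₀_bounds (hn : m.TypAt .none Prod.fst δ s u y) (h0 : m.TypAt .zero Prod.fst δ s u y) :
    bexp n (-(m.entPat .zero Prod.fst - m.entPat .none Prod.fst + 2 * δ)) ≤ (m.pow n).k₀ s u.1 ∧
    (m.pow n).k₀ s u.1 ≤ bexp n (-(m.entPat .zero Prod.fst - m.entPat .none Prod.fst - 2 * δ)) := by
  refine typical_ratio (x := ∏ i, m.a (s i)) ?_ ?_
  · simpa only [TypAt, Typical, margPat_fst_none] using hn
  · simp only [TypAt, Typical, margPat_fst_zero, Finset.prod_mul_distrib] at h0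
    exact h0

lemma pow_k₁_bounds (h0 : m.TypAt .zero Prod.fst δ s u y) (h1 : m.TypAt .one Prod.fst δ s u y) :
    bexp n (-(m.entPat .one Prod.fst - m.entPat .zero Prod.fst + 2 * δ)) ≤
      (m.pow n).k₁ s u.1 u.2.1 ∧
    (m.pow n).k₁ s u.1 u.2.1 ≤
      bexp n (-(m.entPat .one Prod.fst - m.entPat .zero Prod.fst - 2 * δ)) := by
  refine typical_ratio (x := ∏ i, m.a (s i) * m.k₀ (s i) (u.1 i)) ?_ ?_
  · simp only [TypAt, Typical, margPat_fst_zero] at h0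
    exact h0
  · simp only [TypAt, Typical, margPat_fst_one, Finset.prod_mul_distrib] at h1 ⊢
    exact h1

lemma pow_k₂_bounds (h0 : m.TypAt .zero Prod.fst δ s u y) (h2 : m.TypAt .two Prod.fst δ s u y) :
    bexp n (-(m.entPat .two Prod.fst - m.entPat .zero Prod.fst + 2 * δ)) ≤
      (m.pow n).k₂ s u.1 u.2.2 ∧
    (m.pow n).k₂ s u.1 u.2.2 ≤
      bexp n (-(m.entPat .two Prod.fst - m.entPat .zero Prod.fst - 2 * δ)) := by
  refine typical_ratio (x := ∏ i, m.a (s i) * m.k₀ (s i) (u.1 i)) ?_ ?_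
  · simp only [TypAt, Typical, margPat_fst_zero] at h0
    exact h0
  · simp only [TypAt, Typical, margPat_fst_two, Finset.prod_mul_distrib] at h2 ⊢
    exact h2

end layers

/-! ### Counting typical sequences -/

lemma sum_ind_le_of_sum_le {V : Type*} [Fintype V] (T : V → Prop) (f : V → ℝ) (hf : ∀ v, 0 ≤ f v)
    {c d : ℝ} (hc : 0 < c) (hT : ∀ v, T v → c ≤ f v) (hd : 0 ≤ d)
    (hs : (∃ v, T v) → ∑ v, f v ≤ c * d) : ∑ v, ind (T v) ≤ d := by
  by_cases h : ∃ v, T v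
  · have : ∑ v, c * ind (T v) ≤ ∑ v, f v := by
      refine Finset.sum_le_sum fun v _ => ?_
      by_cases hv : T v
      · rw [ind_of hv, mul_one]; exact hT v hv
      · rw [ind_of_not hv, mul_zero]; exact hf v
    rw [← Finset.mul_sum] at this
    exact le_of_mul_le_mul_left (this.trans (hs h)) hc
  · push Not at h
    rw [Finset.sum_eq_zero fun v _ => ind_of_not (h v)]; exact hd

section count

variable {B : S × Y → O}

lemma sum_margPat_one (b : O) :
    ∑ v : U₀ × U₁, m.margPat .one B ((some v.1, some v.2, none), b) =
      m.margPat .none B ((none, none, none), b) := by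
  simp only [margPat, marg]
  rw [Finset.sum_comm]
  refine Finset.sum_congr rfl fun ω _ => ?_
  rw [← Finset.mul_sum]
  simp only [Pat.proj, Prod.mk.injEq, Option.some.injEq, and_true, true_and, ind_and,
    Fintype.sum_prod_type, ← Finset.sum_mul, ← Finset.mul_sum, sum_ind, mul_one, one_mul]

lemma sum_margPat_one_snd (u₀ : U₀) (b : O) :
    ∑ v : U₁, m.margPat .one B ((some u₀, some v, none), b) =
      m.margPat .zero B ((some u₀, none, none), b) := by
  simp only [margPat, marg]
  rw [Finset.sum_comm]
  refine Finset.sum_congr rfl fun ω _ => ?_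
  rw [← Finset.mul_sum]
  simp only [Pat.proj, Prod.mk.injEq, Option.some.injEq, and_true, ind_and,
    ← Finset.sum_mul, ← Finset.mul_sum, sum_ind, mul_one]

lemma sum_margPat_two (b : O) :
    ∑ v : U₀ × U₂, m.margPat .two B ((some v.1, none, some v.2), b) =
      m.margPat .none B ((none, none, none), b) := by
  simp only [margPat, marg]
  rw [Finset.sum_comm]
  refine Finset.sum_congr rfl fun ω _ => ?_
  rw [← Finset.mul_sum]
  simp only [Pat.proj, Prod.mk.injEq, Option.some.injEq, true_and, ind_and,
    Fintype.sum_prod_type, ← Finset.sum_mul, ← Finset.mul_sum, sum_ind, mul_one, one_mul]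

lemma sum_margPat_two_snd (u₀ : U₀) (b : O) :
    ∑ v : U₂, m.margPat .two B ((some u₀, none, some v), b) =
      m.margPat .zero B ((some u₀, none, none), b) := by
  simp only [margPat, marg]
  rw [Finset.sum_comm]
  refine Finset.sum_congr rfl fun ω _ => ?_
  rw [← Finset.mul_sum]
  simp only [Pat.proj, Prod.mk.injEq, Option.some.injEq, and_true, true_and, ind_and,
    ← Finset.sum_mul, ← Finset.mul_sum, sum_ind, mul_one]

/-- Joint typicality of `(u₀, u₁)` with a sequence `b` of observations. -/
def Typ₁ (B : S × Y → O) (δ : ℝ) {n : ℕ} (u₀ : Fin n → U₀) (u₁ : Fin n → U₁) (b : Fin n → O) :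
    Prop :=
  Typical (m.margPat .none B) (m.entPat .none B) δ (fun i => ((none, none, none), b i)) ∧
  Typical (m.margPat .zero B) (m.entPat .zero B) δ (fun i => ((some (u₀ i), none, none), b i)) ∧
  Typical (m.margPat .one B) (m.entPat .one B) δ (fun i => ((some (u₀ i), some (u₁ i), none), b i))

/-- Joint typicality of `(u₀, u₂)` with a sequence `b` of observations. -/
def Typ₂ (B : S × Y → O) (δ : ℝ) {n : ℕ} (u₀ : Fin n → U₀) (u₂ : Fin n → U₂) (b : Fin n → O) :
    Prop :=
  Typical (m.margPat .none B) (m.entPat .none B) δ (fun i => ((none, none, none), b i)) ∧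
  Typical (m.margPat .zero B) (m.entPat .zero B) δ (fun i => ((some (u₀ i), none, none), b i)) ∧
  Typical (m.margPat .two B) (m.entPat .two B) δ (fun i => ((some (u₀ i), none, some (u₂ i)), b i))

variable {δ : ℝ} {n : ℕ}

lemma sum_ind_typ₁_le (b : Fin n → O) :
    ∑ v : (Fin n → U₀) × (Fin n → U₁), ind (m.Typ₁ B δ v.1 v.2 b) ≤
      bexp n (m.entPat .one B - m.entPat .none B + 2 * δ) := by
  refine sum_ind_le_of_sum_le _
    (fun v => ∏ i, m.margPat .one B ((some (v.1 i), some (v.2 i), none), b i))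
    (fun v => Finset.prod_nonneg fun i _ => m.margPat_nonneg _ _ _) (bexp_pos n (-(m.entPat .one B + δ)))
    (fun v hv => hv.2.2.1) (bexp_pos n _).le ?_
  rintro ⟨v, hv⟩
  rw [← (Equiv.arrowProdEquivProdArrow (Fin n) (fun _ => U₀) (fun _ => U₁)).sum_comp]
  refine (sum_pi_prod fun i (v : U₀ × U₁) =>
    m.margPat .one B ((some v.1, some v.2, none), b i)).trans_le ?_
  simp only [sum_margPat_one]
  refine hv.1.2.trans_eq ?_
  rw [← bexp_add]; congr 1; ring

lemma sum_ind_typ₁_snd_le (u₀ : Fin n → U₀) (b : Fin n → O) :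
    ∑ v : Fin n → U₁, ind (m.Typ₁ B δ u₀ v b) ≤
      bexp n (m.entPat .one B - m.entPat .zero B + 2 * δ) := by
  refine sum_ind_le_of_sum_le _
    (fun v => ∏ i, m.margPat .one B ((some (u₀ i), some (v i), none), b i))
    (fun v => Finset.prod_nonneg fun i _ => m.margPat_nonneg _ _ _) (bexp_pos n (-(m.entPat .one B + δ)))
    (fun v hv => hv.2.2.1) (bexp_pos n _).le ?_
  rintro ⟨v, hv⟩
  refine (sum_pi_prod fun i (v : U₁) =>
    m.margPat .one B ((some (u₀ i), some v, none), b i)).trans_le ?_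
  simp only [sum_margPat_one_snd]
  refine hv.2.1.2.trans_eq ?_
  rw [← bexp_add]; congr 1; ring

lemma sum_ind_typ₂_le (b : Fin n → O) :
    ∑ v : (Fin n → U₀) × (Fin n → U₂), ind (m.Typ₂ B δ v.1 v.2 b) ≤
      bexp n (m.entPat .two B - m.entPat .none B + 2 * δ) := by
  refine sum_ind_le_of_sum_le _
    (fun v => ∏ i, m.margPat .two B ((some (v.1 i), none, some (v.2 i)), b i))
    (fun v => Finset.prod_nonneg fun i _ => m.margPat_nonneg _ _ _) (bexp_pos n (-(m.entPat .two B + δ)))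
    (fun v hv => hv.2.2.1) (bexp_pos n _).le ?_
  rintro ⟨v, hv⟩
  rw [← (Equiv.arrowProdEquivProdArrow (Fin n) (fun _ => U₀) (fun _ => U₂)).sum_comp]
  refine (sum_pi_prod fun i (v : U₀ × U₂) =>
    m.margPat .two B ((some v.1, none, some v.2), b i)).trans_le ?_
  simp only [sum_margPat_two]
  refine hv.1.2.trans_eq ?_
  rw [← bexp_add]; congr 1; ring

lemma sum_ind_typ₂_snd_le (u₀ : Fin n → U₀) (b : Fin n → O) :
    ∑ v : Fin n → U₂, ind (m.Typ₂ B δ u₀ v b) ≤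
      bexp n (m.entPat .two B - m.entPat .zero B + 2 * δ) := by
  refine sum_ind_le_of_sum_le _
    (fun v => ∏ i, m.margPat .two B ((some (u₀ i), none, some (v i)), b i))
    (fun v => Finset.prod_nonneg fun i _ => m.margPat_nonneg _ _ _) (bexp_pos n (-(m.entPat .two B + δ)))
    (fun v hv => hv.2.2.1) (bexp_pos n _).le ?_
  rintro ⟨v, hv⟩
  refine (sum_pi_prod fun i (v : U₂) =>
    m.margPat .two B ((some (u₀ i), none, some v), b i)).trans_le ?_
  simp only [sum_margPat_two_snd]
  refine hv.2.1.2.trans_eq ?_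
  rw [← bexp_add]; congr 1; ring

end count

end Model

/-! ### The coding theorem for long blocks -/

namespace Pat

lemma sm_nonneg {r₀ r₁ r₂ : ℝ} (h₀ : 0 ≤ r₀) (h₁ : 0 ≤ r₁) (h₂ : 0 ≤ r₂) (D : Pat) :
    0 ≤ D.sm r₀ r₁ r₂ := by
  cases D <;> simp only [sm] <;> positivity

/-- Sizes that are nearly exponential have nearly exponential products. -/
lemma wt_le_mul_bexp {n : ℕ} {M₀ M₁ M₂ F₀ F₁ F₂ δ : ℝ} (hM₀ : 0 < M₀) (hM₁ : 0 < M₁) (hM₂ : 0 < M₂)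
    (hδ : 0 ≤ δ) (h₀ : M₀ ≤ 2 * bexp n (F₀ + δ)) (h₁ : M₁ ≤ 2 * bexp n (F₁ + δ))
    (h₂ : M₂ ≤ 2 * bexp n (F₂ + δ)) {A D : Pat} (h : A.Le D) :
    D.wt M₀ M₁ M₂ ≤ A.wt M₀ M₁ M₂ *
      (8 * bexp n (D.sm F₀ F₁ F₂ - A.sm F₀ F₁ F₂ + 3 * δ)) := by
  have b := bexp_pos n
  have z : 1 ≤ 8 * bexp n (0 + 3 * δ) := by
    have := one_le_bexp n (show 0 ≤ 0 + 3 * δ by positivity)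
    linarith
  have single : ∀ {M F : ℝ}, M ≤ 2 * bexp n (F + δ) → M ≤ 8 * bexp n (F + 3 * δ) := by
    intro M F h
    have := bexp_mono n (show F + δ ≤ F + 3 * δ by linarith)
    linarith [b (F + 3 * δ)]
  have pair : ∀ {M F M' F' : ℝ}, 0 < M' → M ≤ 2 * bexp n (F + δ) → M' ≤ 2 * bexp n (F' + δ) →
      M * M' ≤ 8 * bexp n (F + F' + 3 * δ) := by
    intro M F M' F' h0 h h'
    have e : bexp n (F + δ) * bexp n (F' + δ) ≤ bexp n (F + F' + 3 * δ) := by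
      rw [← bexp_add]; exact bexp_mono n (by linarith)
    have := mul_le_mul h h' h0.le (by linarith [b (F + δ)])
    nlinarith [b (F + F' + 3 * δ)]
  have triple : M₀ * M₁ * M₂ ≤ 8 * bexp n (F₀ + F₁ + F₂ + 3 * δ) := by
    have e : bexp n (F₀ + δ) * bexp n (F₁ + δ) * bexp n (F₂ + δ) = bexp n (F₀ + F₁ + F₂ + 3 * δ) := by
      rw [← bexp_add, ← bexp_add]; congr 1; ring
    have h1 := mul_le_mul h₀ h₁ hM₁.le (by linarith [b (F₀ + δ)])
    have h2 := mul_le_mul h1 h₂ hM₂.le (by nlinarith [b (F₀ + δ), b (F₁ + δ), mul_pos (b (F₀ + δ)) (b (F₁ + δ))])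
    linarith
  have fin : ∀ {A' x r t : ℝ}, 0 < A' → x ≤ 8 * bexp n (t + 3 * δ) → r = t →
      A' * x ≤ A' * (8 * bexp n (r + 3 * δ)) := by
    rintro A' x r t h0 h rfl
    exact mul_le_mul_of_nonneg_left h h0.le
  have p01 := mul_pos hM₀ hM₁
  have p02 := mul_pos hM₀ hM₂
  have p012 := mul_pos p01 hM₂
  cases A <;> cases D <;> simp only [Le] at h <;> simp only [wt, sm]
  · simpa using fin one_pos z (sub_self 0)
  · simpa using fin one_pos (single h₀) (sub_zero F₀)
  · simpa using fin one_pos (pair hM₁ h₀ h₁) (sub_zero _)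
  · simpa using fin one_pos (pair hM₂ h₀ h₂) (sub_zero _)
  · simpa using fin one_pos triple (sub_zero _)
  · simpa using fin hM₀ z (sub_self F₀)
  · exact fin hM₀ (single h₁) (by ring)
  · exact fin hM₀ (single h₂) (by ring)
  · rw [mul_assoc]; exact fin hM₀ (pair hM₂ h₁ h₂) (by ring)
  · simpa using fin p01 z (sub_self (F₀ + F₁))
  · exact fin p01 (single h₂) (by ring)
  · simpa using fin p02 z (sub_self (F₀ + F₂))
  · rw [mul_right_comm]; exact fin p02 (single h₁) (by ring)
  · simpa using fin p012 z (sub_self (F₀ + F₁ + F₂))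

end Pat

namespace Model

variable {S U₀ U₁ U₂ Y : Type*} [Fintype S] [Fintype U₀] [Fintype U₁] [Fintype U₂] [Fintype Y]
  (m : Model S U₀ U₁ U₂ Y) {O Y₁ Y₂ Z : Type*} [Fintype O] [Fintype Y₁] [Fintype Y₂] [Fintype Z]

/-- The conditions on the key rates `ρ` under which the secrecy test is passed: they lie below the
equivocation rates of the layers given the observation, minus the bin rates `F`. -/
lemma pow_passesTest {n : ℕ} {G : (Fin n → S) → (Fin n → U₀) × (Fin n → U₁) × (Fin n → U₂) →
      (Fin n → Y) → Prop} (out : Y → O) (A : Pat) {F₀ F₁ F₂ ρ₀ ρ₁ ρ₂ γ δ ε : ℝ}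
    (hρ₀ : 0 ≤ ρ₀) (hρ₁ : 0 ≤ ρ₁) (hρ₂ : 0 ≤ ρ₂) {M₀ M₁ M₂ : ℕ} (hM₀ : 0 < M₀) (hM₁ : 0 < M₁)
    (hM₂ : 0 < M₂) (h₀ : (M₀ : ℝ) ≤ 2 * bexp n (F₀ + δ)) (h₁ : (M₁ : ℝ) ≤ 2 * bexp n (F₁ + δ))
    (h₂ : (M₂ : ℝ) ≤ 2 * bexp n (F₂ + δ)) (hδ : 0 < δ) (hγ : 20 * δ ≤ γ)
    (hG : ∀ D s u y, G s u y → m.TypAt D (fun x => out x.2) (δ / 10) s u y)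
    (hr : ∀ D, A.Le D → D.sm ρ₀ ρ₁ ρ₂ = 0 ∨ D.sm ρ₀ ρ₁ ρ₂ + γ ≤
      (m.entPat D (fun x => out x.2) - D.sm F₀ F₁ F₂) -
        (m.entPat A (fun x => out x.2) - A.sm F₀ F₁ F₂))
    (hn : bexp n (-δ) ≤ ε ^ 2 / 8) :
    (m.pow n).PassesTest G (fun y i => out (y i)) A (2 ^ ⌊(n : ℝ) * ρ₀⌋₊) (2 ^ ⌊(n : ℝ) * ρ₁⌋₊)
      (2 ^ ⌊(n : ℝ) * ρ₂⌋₊) M₀ M₁ M₂ (ε ^ 2 / bexp n (2 * δ) ^ 6) := by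
  intro D hAD s u y hg
  have hM₀' : (0 : ℝ) < M₀ := by exact_mod_cast hM₀
  have hM₁' : (0 : ℝ) < M₁ := by exact_mod_cast hM₁
  have hM₂' : (0 : ℝ) < M₂ := by exact_mod_cast hM₂
  have hMA := Pat.wt_pos hM₀ hM₁ hM₂ A
  have oA := (m.pow_obsPat_bounds (hG A s u y hg)).1
  have oD := (m.pow_obsPat_bounds (hG D s u y hg)).2
  have hoA := (bexp_pos _ _).trans_le oA
  rcases hr D hAD with h | h
  · have : D.wt ((2 ^ ⌊(n : ℝ) * ρ₀⌋₊ : ℕ) : ℝ) ((2 ^ ⌊(n : ℝ) * ρ₁⌋₊ : ℕ) : ℝ)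
        ((2 ^ ⌊(n : ℝ) * ρ₂⌋₊ : ℕ) : ℝ) = 1 := by
      cases D <;> simp only [Pat.sm] at h <;> simp only [Pat.wt]
      · simp [h]
      · simp [show ρ₀ = 0 by linarith, show ρ₁ = 0 by linarith]
      · simp [show ρ₀ = 0 by linarith, show ρ₂ = 0 by linarith]
      · simp [show ρ₀ = 0 by linarith, show ρ₁ = 0 by linarith, show ρ₂ = 0 by linarith]
    rw [this, sub_self, zero_mul, zero_mul]
    exact mul_nonneg (div_nonneg (sq_nonneg _) (pow_nonneg (bexp_pos _ _).le _))
      (mul_nonneg hMA.le hoA.le)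
  · have hN : D.wt ((2 ^ ⌊(n : ℝ) * ρ₀⌋₊ : ℕ) : ℝ) ((2 ^ ⌊(n : ℝ) * ρ₁⌋₊ : ℕ) : ℝ)
        ((2 ^ ⌊(n : ℝ) * ρ₂⌋₊ : ℕ) : ℝ) ≤ bexp n (D.sm ρ₀ ρ₁ ρ₂) := by
      have q₀ := two_pow_floor_le n hρ₀
      have q₁ := two_pow_floor_le n hρ₁
      have q₂ := two_pow_floor_le n hρ₂
      have p₀ := (bexp_pos n ρ₀).le
      have p₁ := (bexp_pos n ρ₁).le
      cases D <;> simp only [Pat.sm, Pat.wt, bexp_add, bexp_zero] <;> gcongr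
    have hM := Pat.wt_le_mul_bexp hM₀' hM₁' hM₂' hδ.le h₀ h₁ h₂ hAD
    have hoD0 := (m.pow n).obsPat_nonneg (fun (y : Fin n → Y) i => out (y i)) D u
      (fun i => out (y i))
    have hMD := Pat.wt_pos hM₀ hM₁ hM₂ D
    set eA := m.entPat A (fun x => out x.2)
    set eD := m.entPat D (fun x => out x.2)
    set fA := A.sm F₀ F₁ F₂
    set fD := D.sm F₀ F₁ F₂
    set r := D.sm ρ₀ ρ₁ ρ₂
    have hexp : bexp n r * (8 * bexp n (fD - fA + 3 * δ)) * bexp n (-(eD - δ / 10)) ≤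
        ε ^ 2 / bexp n (2 * δ) ^ 6 * bexp n (-(eA + δ / 10)) := by
      rw [bexp_pow, div_mul_eq_mul_div, le_div_iff₀ (bexp_pos _ _)]
      have e1 : bexp n r * (8 * bexp n (fD - fA + 3 * δ)) * bexp n (-(eD - δ / 10)) *
          bexp n ((6 : ℕ) * (2 * δ)) =
          8 * bexp n (r + (fD - fA + 3 * δ) + (eA - eD + 2 * δ / 10) + 12 * δ) *
            bexp n (-(eA + δ / 10)) := by
        have : ∀ a b c d e : ℝ, a + b + c + d = e →
            bexp n a * (8 * bexp n b) * bexp n c * bexp n d = 8 * bexp n e := by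
          rintro a b c d e rfl
          rw [bexp_add, bexp_add, bexp_add]; ring
        rw [mul_assoc 8, ← bexp_add]
        refine this _ _ _ _ _ ?_
        push_cast; ring
      rw [e1]
      refine mul_le_mul_of_nonneg_right ?_ (bexp_pos _ _).le
      have := bexp_mono n (show r + (fD - fA + 3 * δ) + (eA - eD + 2 * δ / 10) + 12 * δ ≤ -δ by
        linarith)
      linarith
    calc _ ≤ bexp n r * (A.wt (M₀ : ℝ) M₁ M₂ * (8 * bexp n (fD - fA + 3 * δ))) *
          bexp n (-(eD - δ / 10)) := by
          refine mul_le_mul (mul_le_mul (by linarith) hM hMD.le (bexp_pos _ _).le) oD hoD0 ?_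
          have := bexp_pos n r
          have := bexp_pos n (fD - fA + 3 * δ)
          positivity
      _ = A.wt (M₀ : ℝ) M₁ M₂ * (bexp n r * (8 * bexp n (fD - fA + 3 * δ)) *
          bexp n (-(eD - δ / 10))) := by ring
      _ ≤ A.wt (M₀ : ℝ) M₁ M₂ * (ε ^ 2 / bexp n (2 * δ) ^ 6 * bexp n (-(eA + δ / 10))) :=
          mul_le_mul_of_nonneg_left hexp hMA.le
      _ ≤ A.wt (M₀ : ℝ) M₁ M₂ * (ε ^ 2 / bexp n (2 * δ) ^ 6 *
          (m.pow n).obsPat A (fun y i => out (y i)) u (fun i => out (y i))) :=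
          mul_le_mul_of_nonneg_left (mul_le_mul_of_nonneg_left oA
            (div_nonneg (sq_nonneg _) (pow_nonneg (bexp_pos _ _).le _))) hMA.le
      _ = _ := by ring

/-- The coding theorem for long blocks. The numbers `F₀, F₁, F₂` are the rates needed by the
receivers to decode the layers. A receiver `j` with `sel j` knows from its output all that the
layers meant for it depend on; for the others, decoding needs strictly smaller rates than
covering. -/
theorem eventually_one_shot [Nonempty U₀] [Nonempty U₁] [Nonempty U₂]
    (y₁ : Y → Y₁) (y₂ : Y → Y₂) (z : Y → Z)
    (v₀ v₁ v₂ : S → S) (hv₀ : ∀ s s', v₀ s = v₀ s' → m.k₀ s = m.k₀ s')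
    (hv₁ : ∀ s s', v₁ s = v₁ s' → m.k₁ s = m.k₁ s')
    (hv₂ : ∀ s s', v₂ s = v₂ s' → m.k₂ s = m.k₂ s')
    (hv₀₁ : ∀ s, v₀ (v₁ s) = v₀ s) (hv₀₂ : ∀ s, v₀ (v₂ s) = v₀ s)
    (sel₁ sel₂ : Prop)
    (β₁ : Y₁ → S) (hsel₁ : sel₁ → ∀ s u y, m.a s ≠ 0 → m.V s u y ≠ 0 → β₁ (y₁ y) = v₁ s)
    (β₂ : Y₂ → S) (hsel₂ : sel₂ → ∀ s u y, m.a s ≠ 0 → m.V s u y ≠ 0 → β₂ (y₂ y) = v₂ s)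
    {F₀ F₁ F₂ r₀ r₁ r₂ γ : ℝ} (hF₀n : 0 ≤ F₀) (hF₁n : 0 ≤ F₁) (hF₂n : 0 ≤ F₂)
    (hr₀ : 0 ≤ r₀) (hr₁ : 0 ≤ r₁) (hr₂ : 0 ≤ r₂) (hγ : 0 < γ)
    (hF₀₁ : m.entPat .zero (fun x => y₁ x.2) - m.entPat .none (fun x => y₁ x.2) ≤ F₀)
    (hF₀₂ : m.entPat .zero (fun x => y₂ x.2) - m.entPat .none (fun x => y₂ x.2) ≤ F₀)
    (hF₁ : m.entPat .one (fun x => y₁ x.2) - m.entPat .zero (fun x => y₁ x.2) ≤ F₁)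
    (hF₂ : m.entPat .two (fun x => y₂ x.2) - m.entPat .zero (fun x => y₂ x.2) ≤ F₂)
    (hs₀ : sel₁ ∨ sel₂ → m.entPat .zero Prod.fst - m.entPat .none Prod.fst ≤ F₀)
    (hs₁ : sel₁ → m.entPat .one Prod.fst - m.entPat .zero Prod.fst ≤ F₁)
    (hs₂ : sel₂ → m.entPat .two Prod.fst - m.entPat .zero Prod.fst ≤ F₂)
    (ht₀₁ : ¬sel₁ → m.entPat .zero (fun x => y₁ x.2) - m.entPat .none (fun x => y₁ x.2) <
      m.entPat .zero Prod.fst - m.entPat .none Prod.fst)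
    (ht₁ : ¬sel₁ → m.entPat .one (fun x => y₁ x.2) - m.entPat .zero (fun x => y₁ x.2) <
      m.entPat .one Prod.fst - m.entPat .zero Prod.fst)
    (ht₀₂ : ¬sel₂ → m.entPat .zero (fun x => y₂ x.2) - m.entPat .none (fun x => y₂ x.2) <
      m.entPat .zero Prod.fst - m.entPat .none Prod.fst)
    (ht₂ : ¬sel₂ → m.entPat .two (fun x => y₂ x.2) - m.entPat .zero (fun x => y₂ x.2) <
      m.entPat .two Prod.fst - m.entPat .zero Prod.fst)
    (hr : ∀ D, D.sm r₀ r₁ r₂ = 0 ∨ D.sm r₀ r₁ r₂ + γ ≤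
      m.entPat D (fun x => z x.2) - m.entPat .none (fun x => z x.2) - D.sm F₀ F₁ F₂)
    (hp₁ : r₁ = 0 ∨ r₁ + γ ≤
      m.entPat .all (fun x => y₂ x.2) - m.entPat .two (fun x => y₂ x.2) - F₁)
    (hp₂ : r₂ = 0 ∨ r₂ + γ ≤
      m.entPat .all (fun x => y₁ x.2) - m.entPat .one (fun x => y₁ x.2) - F₂)
    {ε : ℝ} (hε : 0 < ε) :
    ∀ᶠ n : ℕ in Filter.atTop, ∃ (Q : (Fin n → S) → (Fin n → U₀) × (Fin n → U₁) × (Fin n → U₂) → ℝ)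
      (ξ : ((Fin n → U₀) → Fin (2 ^ ⌊(n : ℝ) * r₀⌋₊)) ×
        ((Fin n → U₀) × (Fin n → U₁) → Fin (2 ^ ⌊(n : ℝ) * r₁⌋₊)) ×
        ((Fin n → U₀) × (Fin n → U₂) → Fin (2 ^ ⌊(n : ℝ) * r₂⌋₊)))
      (D₁ : (Fin n → Y₁) → (Fin n → U₀) × (Fin n → U₁))
      (D₂ : (Fin n → Y₂) → (Fin n → U₀) × (Fin n → U₂)),
      (∀ s u, 0 ≤ Q s u) ∧ (∀ s, ∑ u, Q s u ≤ (m.pow n).a s) ∧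
      (1 - 700 * ε ≤ ∑ s, ∑ u, Q s u) ∧
      (∑ s, ∑ u, ∑ y, Q s u * (m.pow n).V s u y *
        ind (D₁ (fun i => y₁ (y i)) ≠ (u.1, u.2.1)) ≤ 1200 * ε) ∧
      (∑ s, ∑ u, ∑ y, Q s u * (m.pow n).V s u y *
        ind (D₂ (fun i => y₂ (y i)) ≠ (u.1, u.2.2)) ≤ 1200 * ε) ∧
      (m.pow n).keyDev Q (fun _ _ _ => True) (fun y i => z (y i)) (keyOf ξ)
        (((2 ^ ⌊(n : ℝ) * r₀⌋₊ : ℕ) : ℝ) * (2 ^ ⌊(n : ℝ) * r₁⌋₊ : ℕ) * (2 ^ ⌊(n : ℝ) * r₂⌋₊ : ℕ)) ≤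
        2700 * ε ∧
      (m.pow n).keyDev Q (fun _ _ _ => True) (fun y i => y₂ (y i)) (fun u => (keyOf ξ u).2.1)
        ((2 ^ ⌊(n : ℝ) * r₁⌋₊ : ℕ) : ℝ) ≤ 2700 * ε ∧
      (m.pow n).keyDev Q (fun _ _ _ => True) (fun y i => y₁ (y i)) (fun u => (keyOf ξ u).2.2)
        ((2 ^ ⌊(n : ℝ) * r₂⌋₊ : ℕ) : ℝ) ≤ 2700 * ε := by
  set eS := fun D => m.entPat D (Prod.fst : S × Y → S) with heS
  set e₁ := fun D => m.entPat D (fun x => y₁ x.2) with he₁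
  set e₂ := fun D => m.entPat D (fun x => y₂ x.2) with he₂
  set eZ := fun D => m.entPat D (fun x => z x.2) with heZ
  -- the slack `δ`, small compared to all gaps in strict inequalities
  obtain ⟨δ, hδγ, hd₁, hd₂, hd₃, hd₄, hδ⟩ : ∃ δ : ℝ, 0 + 20 * δ ≤ γ ∧
      (¬sel₁ → e₁ .zero - e₁ .none + 2 * δ ≤ eS .zero - eS .none) ∧
      (¬sel₁ → e₁ .one - e₁ .zero + 2 * δ ≤ eS .one - eS .zero) ∧
      (¬sel₂ → e₂ .zero - e₂ .none + 2 * δ ≤ eS .zero - eS .none) ∧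
      (¬sel₂ → e₂ .two - e₂ .zero + 2 * δ ≤ eS .two - eS .zero) ∧ 0 < δ := by
    have aux : ∀ {p : Prop} {a b : ℝ}, (p → a < b) →
        ∀ᶠ δ : ℝ in nhdsWithin 0 (Set.Ioi 0), p → a + 2 * δ ≤ b := by
      intro p a b h
      by_cases hp : p
      · exact (eventually_nhdsGT_add_mul_le 2 (h hp)).mono fun δ hδ _ => hδ
      · exact Filter.Eventually.of_forall fun δ h => absurd h hp
    exact ((eventually_nhdsGT_add_mul_le 20 hγ).and ((aux ht₀₁).and ((aux ht₁).and
      ((aux ht₀₂).and ((aux ht₂).and self_mem_nhdsWithin))))).exists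
  rw [zero_add] at hδγ
  -- The bin rates: below the threshold for covering, and above that for decoding. If no receiver has
  -- `sel`, the first term exceeds the second threshold by `hd₁`-`hd₄`; with `sel`, it is the minimum.
  set f₀ := min (eS .zero - eS .none - δ) (F₀ + δ) with hf₀
  set f₁ := min (eS .one - eS .zero - δ) (F₁ + δ) with hf₁
  set f₂ := min (eS .two - eS .zero - δ) (F₂ + δ) with hf₂
  -- The eavesdropper can be given the layers in the set `A` with the least surplus equivocation. No
  -- positive key rate is available on `A`, and all other keys are secret even given these layers.
  obtain ⟨A, -, hA⟩ := Finset.exists_min_image Finset.univ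
    (fun D => eZ D - eZ .none - D.sm F₀ F₁ F₂) ⟨Pat.none, Finset.mem_univ _⟩
  have hA0 : eZ A - eZ .none - A.sm F₀ F₁ F₂ ≤ 0 := by
    have := hA .none (Finset.mem_univ _)
    simpa [Pat.sm] using this
  filter_upwards [m.eventually_sum_not_allTyp_le y₁ y₂ z (δ := δ / 10) (by positivity) hε,
    eventually_bexp_le (c := -δ) (C := ε ^ 2 / 8) (by linarith) (by positivity),
    eventually_bexp_le (c := -(8 / 10 * δ)) (C := ε ^ 2) (by linarith) (by positivity),
    eventually_bexp_le (c := -(8 / 10 * δ)) (C := ε) (by linarith) hε]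
    with n hG hn₁ hn₂ hn₃
  have hceil : ∀ f, 0 < ⌈bexp n f⌉₊ := fun f => Nat.ceil_pos.2 (bexp_pos n f)
  have hle : ∀ f, bexp n f ≤ (⌈bexp n f⌉₊ : ℝ) := fun f => Nat.le_ceil _
  have hlt : ∀ f, (⌈bexp n f⌉₊ : ℝ) - 1 ≤ bexp n f := fun f => by
    linarith [Nat.ceil_lt_add_one (bexp_pos n f).le]
  have htwo : ∀ {f F : ℝ}, 0 ≤ F → f ≤ F + δ → (⌈bexp n f⌉₊ : ℝ) ≤ 2 * bexp n (F + δ) := by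
    intro f F hF hf
    have h1 := bexp_mono n hf
    have h2 := one_le_bexp n (show 0 ≤ F + δ by linarith)
    linarith [hlt f]
  have hcov : ∀ {L F : ℝ}, ((⌈bexp n (min (L - δ) F)⌉₊ : ℝ) - 1) *
      bexp n (-(L - 2 * (δ / 10))) ≤ ε ^ 2 := by
    intro L F
    refine le_trans ?_ hn₂
    refine (mul_le_mul_of_nonneg_right (hlt _) (bexp_pos _ _).le).trans ?_
    rw [← bexp_add]
    exact bexp_mono n (by linarith [min_le_left (L - δ) F])
  have hsel : ∀ {L F k : ℝ}, L ≤ F → bexp n (-(L + 2 * (δ / 10))) ≤ k →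
      1 ≤ bexp n (2 * δ) * (⌈bexp n (min (L - δ) (F + δ))⌉₊ * k) := by
    intro L F k hLF hk
    rw [min_eq_left (by linarith)]
    calc 1 ≤ bexp n (8 / 10 * δ) := one_le_bexp n (by positivity)
      _ = bexp n (2 * δ) * (bexp n (L - δ) * bexp n (-(L + 2 * (δ / 10)))) := by
          rw [← bexp_add, ← bexp_add]; congr 1; ring
      _ ≤ _ := mul_le_mul_of_nonneg_left (mul_le_mul (hle _) hk (bexp_pos _ _).le
          (Nat.cast_nonneg _)) (bexp_pos _ _).le
  have hcount₁ : ∀ {x f : ℝ}, x + δ ≤ f → bexp n (x + 2 * (δ / 10)) ≤ ε * ⌈bexp n f⌉₊ := by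
    intro x f h
    calc bexp n (x + 2 * (δ / 10)) ≤ bexp n (-(8 / 10 * δ) + f) := bexp_mono n (by linarith)
      _ = bexp n (-(8 / 10 * δ)) * bexp n f := bexp_add _ _ _
      _ ≤ _ := mul_le_mul hn₃ (hle f) (bexp_pos _ _).le hε.le
  have hcount₂ : ∀ {x f f' : ℝ}, x + δ ≤ f + f' →
      bexp n (x + 2 * (δ / 10)) ≤ ε * (⌈bexp n f⌉₊ * ⌈bexp n f'⌉₊) := by
    intro x f f' h
    calc bexp n (x + 2 * (δ / 10)) ≤ bexp n (-(8 / 10 * δ) + (f + f')) := bexp_mono n (by linarith)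
      _ = bexp n (-(8 / 10 * δ)) * (bexp n f * bexp n f') := by rw [bexp_add, bexp_add]
      _ ≤ _ := mul_le_mul hn₃ (mul_le_mul (hle f) (hle f') (bexp_pos _ _).le (Nat.cast_nonneg _))
          (mul_pos (bexp_pos _ _) (bexp_pos _ _)).le hε.le
  have hone : (1 : ℕ) = 2 ^ ⌊(n : ℝ) * 0⌋₊ := by simp
  have hM := fun f => hceil f
  refine (m.pow n).one_shot (hM f₀) (hM f₁) (hM f₂)
    (G := fun s u y => m.AllTyp y₁ y₂ z (δ / 10) s u y)
    (fun y i => y₁ (y i)) (fun y i => y₂ (y i)) (fun y i => z (y i))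
    (fun s i => v₀ (s i)) (fun s i => v₁ (s i)) (fun s i => v₂ (s i)) ?_ ?_ ?_
    (fun s => funext fun i => hv₀₁ _) (fun s => funext fun i => hv₀₂ _) sel₁ sel₂
    (fun y i => β₁ (y i)) ?_ (fun y i => β₂ (y i)) ?_
    (T₁ := fun u₀ u₁ b => m.Typ₁ (fun x => y₁ x.2) (δ / 10) u₀ u₁ b)
    (T₂ := fun u₀ u₂ b => m.Typ₂ (fun x => y₂ x.2) (δ / 10) u₀ u₂ b)
    (fun s u y h => ⟨(h .none).2.1, (h .zero).2.1, (h .one).2.1⟩)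
    (fun s u y h => ⟨(h .none).2.2.1, (h .zero).2.2.1, (h .two).2.2.1⟩)
    (b₀ := bexp n (-(eS .zero - eS .none - 2 * (δ / 10))))
    (b₁ := bexp n (-(eS .one - eS .zero - 2 * (δ / 10))))
    (b₂ := bexp n (-(eS .two - eS .zero - 2 * (δ / 10))))
    (Λ := bexp n (2 * δ)) hε (one_le_bexp n (by positivity)) hG (bexp_pos _ _).le (bexp_pos _ _).le
    (bexp_pos _ _).le
    (fun s u y h => (m.pow_k₀_bounds (h .none).1 (h .zero).1).2)
    (fun s u y h => (m.pow_k₁_bounds (h .zero).1 (h .one).1).2)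
    (fun s u y h => (m.pow_k₂_bounds (h .zero).1 (h .two).1).2)
    hcov hcov hcov
    (fun hs s u y h => hsel (hs₀ hs) (m.pow_k₀_bounds (h .none).1 (h .zero).1).1)
    (fun hs s u y h => hsel (hs₁ hs) (m.pow_k₁_bounds (h .zero).1 (h .one).1).1)
    (fun hs s u y h => hsel (hs₂ hs) (m.pow_k₂_bounds (h .zero).1 (h .two).1).1)
    (fun hs y => (m.sum_ind_typ₁_le y).trans (hcount₂ ?_))
    (fun hs u₀ y => (m.sum_ind_typ₁_snd_le u₀ y).trans (hcount₁ ?_))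
    (fun hs y => (m.sum_ind_typ₂_le y).trans (hcount₂ ?_))
    (fun hs u₀ y => (m.sum_ind_typ₂_snd_le u₀ y).trans (hcount₁ ?_))
    (by positivity) (by positivity) (by positivity) A
    (m.pow_passesTest z A (F₀ := F₀) (F₁ := F₁) (F₂ := F₂) hr₀ hr₁ hr₂ (hM _) (hM _) (hM _)
      (htwo hF₀n (min_le_right _ _)) (htwo hF₁n (min_le_right _ _)) (htwo hF₂n (min_le_right _ _))
      hδ hδγ (fun D s u y h => (h D).2.2.2) (fun D hD => ?_) hn₁) ?_ ?_
  · intro s s' h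
    simp only [pow, hv₀ _ _ (congrFun h _)]
  · intro s s' h
    simp only [pow, hv₁ _ _ (congrFun h _)]
  · intro s s' h
    simp only [pow, hv₂ _ _ (congrFun h _)]
  · intro hs s u y ha hV
    simp only [pow, Finset.prod_ne_zero_iff] at ha hV
    funext i
    exact hsel₁ hs _ _ _ (ha i (Finset.mem_univ i))
      (hV i (Finset.mem_univ i))
  · intro hs s u y ha hV
    simp only [pow, Finset.prod_ne_zero_iff] at ha hV
    funext i
    exact hsel₂ hs _ _ _ (ha i (Finset.mem_univ i))
      (hV i (Finset.mem_univ i))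
  · have h1 : e₁ .zero - e₁ .none + δ ≤ f₀ := le_min (by linarith [hd₁ hs]) (by linarith)
    have h2 : e₁ .one - e₁ .zero + δ ≤ f₁ := le_min (by linarith [hd₂ hs]) (by linarith)
    change e₁ .one - e₁ .none + δ ≤ _
    linarith
  · exact le_min (by linarith [hd₂ hs]) (by linarith)
  · have h1 : e₂ .zero - e₂ .none + δ ≤ f₀ := le_min (by linarith [hd₃ hs]) (by linarith)
    have h2 : e₂ .two - e₂ .zero + δ ≤ f₂ := le_min (by linarith [hd₄ hs]) (by linarith)
    change e₂ .two - e₂ .none + δ ≤ _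
    linarith
  · exact le_min (by linarith [hd₄ hs]) (by linarith)
  · refine (hr D).imp id fun h => h.trans ?_
    change eZ D - eZ .none - _ ≤ (eZ D - _) - (eZ A - _)
    linarith
  · have := m.pow_passesTest (n := n) (ρ₀ := 0) (ρ₁ := r₁) (ρ₂ := 0)
      (G := fun s u y => m.AllTyp y₁ y₂ z (δ / 10) s u y) y₂ .two (F₀ := F₀) (F₁ := F₁) (F₂ := F₂)
      le_rfl hr₁ le_rfl (hM f₀) (hM f₁) (hM f₂)
      (htwo hF₀n (min_le_right _ _)) (htwo hF₁n (min_le_right _ _)) (htwo hF₂n (min_le_right _ _))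
      hδ hδγ (fun D s u y h => (h D).2.2.1) (fun D hD => ?_) hn₁
    · rwa [← hone] at this
    · cases D <;> simp only [Pat.Le] at hD <;> simp only [Pat.sm]
      · simp
      · rcases hp₁ with h | h
        · left; linarith
        · right; linarith
  · have := m.pow_passesTest (n := n) (ρ₀ := 0) (ρ₁ := 0) (ρ₂ := r₂)
      (G := fun s u y => m.AllTyp y₁ y₂ z (δ / 10) s u y) y₁ .one (F₀ := F₀) (F₁ := F₁) (F₂ := F₂)
      le_rfl le_rfl hr₂ (hM f₀) (hM f₁) (hM f₂)
      (htwo hF₀n (min_le_right _ _)) (htwo hF₁n (min_le_right _ _)) (htwo hF₂n (min_le_right _ _))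
      hδ hδγ (fun D s u y h => (h D).2.1) (fun D hD => ?_) hn₁
    · rwa [← hone] at this
    · cases D <;> simp only [Pat.Le] at hD <;> simp only [Pat.sm]
      · simp
      · rcases hp₂ with h | h
        · left; linarith
        · right; linarith

end Model

/-! ### Submodularity of entropy -/

section submodular

variable {Ω α β γ : Type*} [Fintype Ω] [Fintype α] [Fintype β] [Fintype γ]

/-- The pointwise inequality behind the nonnegativity of conditional mutual information. -/
lemma sub_le_mul_logb {r x y z : ℝ} (hr : 0 ≤ r) (hrx : r ≤ x) (hry : r ≤ y) (hxz : x ≤ z) :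
    (r - x * y / z) / Real.log 2 ≤
      r * (Real.logb 2 r + Real.logb 2 z - Real.logb 2 x - Real.logb 2 y) ∧
    (r * (Real.logb 2 r + Real.logb 2 z - Real.logb 2 x - Real.logb 2 y) =
      (r - x * y / z) / Real.log 2 → r * z = x * y) := by
  have hl := Real.log_pos one_lt_two
  have e : r * (Real.logb 2 r + Real.logb 2 z - Real.logb 2 x - Real.logb 2 y) =
      r * (Real.log r + Real.log z - Real.log x - Real.log y) / Real.log 2 := by
    simp only [Real.logb]; ring
  rw [e, div_le_div_iff_of_pos_right hl, div_left_inj' hl.ne']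
  rcases hr.eq_or_lt with h | h
  · rw [← h, zero_mul, zero_sub, zero_mul]
    have hx : 0 ≤ x := by linarith
    have hy : 0 ≤ y := by linarith
    have hz : 0 ≤ z := by linarith
    refine ⟨by linarith [show 0 ≤ x * y / z by positivity], fun h0 => ?_⟩
    rcases hz.eq_or_lt with h1 | h1
    · rw [show x = 0 by linarith, zero_mul]
    · have : x * y / z = 0 := by linarith
      rw [div_eq_zero_iff] at this
      rcases this with h2 | h2
      · exact h2.symm
      · exact absurd h2 h1.ne'
  have hx : 0 < x := by linarith
  have hy : 0 < y := by linarith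
  have hz : 0 < z := by linarith
  have e2 : Real.log r + Real.log z - Real.log x - Real.log y = -Real.log (x * y / z / r) := by
    rw [Real.log_div (by positivity) h.ne', Real.log_div (by positivity) hz.ne',
      Real.log_mul hx.ne' hy.ne']; ring
  have e3 : r - x * y / z = r * -(x * y / z / r - 1) := by field_simp; ring
  rw [e2, e3]
  constructor
  · exact mul_le_mul_of_nonneg_left (neg_le_neg (Real.log_le_sub_one_of_pos (by positivity))) h.le
  · intro h0
    have h1 : Real.log (x * y / z / r) = x * y / z / r - 1 := by
      have := mul_left_cancel₀ h.ne' h0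
      linarith
    by_contra hne
    refine absurd h1 (Real.log_lt_sub_one_of_pos (by positivity) fun h2 => hne ?_).ne
    rw [div_div, div_eq_one_iff_eq (by positivity)] at h2
    linarith

lemma ent_eq_neg_sum (p : Ω → ℝ) (A : Ω → α) :
    ent p A = -∑ ω, p ω * Real.logb 2 (marg p A (A ω)) := by
  rw [← sum_marg_mul p A fun a => Real.logb 2 (marg p A a)]
  simp only [ent, etaLog, Finset.sum_neg_distrib]

lemma ent_sub_eq (p : Ω → ℝ) (A : Ω → α) (B : Ω → β) (C : Ω → γ) :
    ent p (fun ω => (A ω, C ω)) + ent p (fun ω => (B ω, C ω)) -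
      ent p (fun ω => (A ω, B ω, C ω)) - ent p C =
    ∑ x : α × β × γ, marg p (fun ω => (A ω, B ω, C ω)) x *
      (Real.logb 2 (marg p (fun ω => (A ω, B ω, C ω)) x) + Real.logb 2 (marg p C x.2.2) -
        Real.logb 2 (marg p (fun ω => (A ω, C ω)) (x.1, x.2.2)) -
        Real.logb 2 (marg p (fun ω => (B ω, C ω)) x.2)) := by
  rw [sum_marg_mul p (fun ω => (A ω, B ω, C ω)) fun x =>
    (Real.logb 2 (marg p (fun ω => (A ω, B ω, C ω)) x) + Real.logb 2 (marg p C x.2.2) -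
        Real.logb 2 (marg p (fun ω => (A ω, C ω)) (x.1, x.2.2)) -
        Real.logb 2 (marg p (fun ω => (B ω, C ω)) x.2))]
  simp only [ent_eq_neg_sum, mul_sub, mul_add, Finset.sum_sub_distrib, Finset.sum_add_distrib]
  ring

lemma sum_marg_sub (p : Ω → ℝ) (A : Ω → α) (B : Ω → β) (C : Ω → γ) :
    ∑ x : α × β × γ, (marg p (fun ω => (A ω, B ω, C ω)) x -
      marg p (fun ω => (A ω, C ω)) (x.1, x.2.2) * marg p (fun ω => (B ω, C ω)) x.2 /
        marg p C x.2.2) = 0 := by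
  rw [Finset.sum_sub_distrib, sum_marg, sub_eq_zero, ← sum_marg p C]
  simp only [Fintype.sum_prod_type]
  symm
  calc ∑ a, ∑ b, ∑ c, marg p (fun ω => (A ω, C ω)) (a, c) * marg p (fun ω => (B ω, C ω)) (b, c) /
        marg p C c = ∑ a, ∑ c, marg p (fun ω => (A ω, C ω)) (a, c) * marg p C c / marg p C c := by
        refine Finset.sum_congr rfl fun a _ => ?_
        rw [Finset.sum_comm]
        refine Finset.sum_congr rfl fun c _ => ?_
        rw [← Finset.sum_div, ← Finset.mul_sum, sum_marg_pair_left]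
    _ = ∑ c, marg p C c * marg p C c / marg p C c := by
        rw [Finset.sum_comm]
        refine Finset.sum_congr rfl fun c _ => ?_
        rw [← Finset.sum_div, ← Finset.sum_mul, sum_marg_pair_left]
    _ = ∑ c, marg p C c := Finset.sum_congr rfl fun c _ => mul_self_div_self _

/-- Entropy is submodular: conditional mutual information is nonnegative. -/
theorem ent_submodular {p : Ω → ℝ} (hp : ∀ ω, 0 ≤ p ω) (A : Ω → α) (B : Ω → β) (C : Ω → γ) :
    ent p (fun ω => (A ω, B ω, C ω)) + ent p C ≤
      ent p (fun ω => (A ω, C ω)) + ent p (fun ω => (B ω, C ω)) := by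
  have h : 0 ≤ ∑ x : α × β × γ, marg p (fun ω => (A ω, B ω, C ω)) x *
      (Real.logb 2 (marg p (fun ω => (A ω, B ω, C ω)) x) + Real.logb 2 (marg p C x.2.2) -
        Real.logb 2 (marg p (fun ω => (A ω, C ω)) (x.1, x.2.2)) -
        Real.logb 2 (marg p (fun ω => (B ω, C ω)) x.2)) := by
    rw [← zero_div (Real.log 2), ← sum_marg_sub p A B C, Finset.sum_div]
    refine Finset.sum_le_sum fun x _ => (sub_le_mul_logb (marg_nonneg hp _ _) ?_ ?_ ?_).1
    · exact marg_le_of_imp hp fun ω h => by rw [← h]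
    · exact marg_le_of_imp hp fun ω h => by rw [← h]
    · exact marg_le_of_imp hp fun ω h => (Prod.ext_iff.1 h).2
  rw [← ent_sub_eq] at h
  linarith

/-- The case of equality in submodularity is conditional independence. -/
theorem marg_mul_of_ent_eq {p : Ω → ℝ} (hp : ∀ ω, 0 ≤ p ω) (A : Ω → α) (B : Ω → β) (C : Ω → γ)
    (h : ent p (fun ω => (A ω, C ω)) + ent p (fun ω => (B ω, C ω)) ≤
      ent p (fun ω => (A ω, B ω, C ω)) + ent p C) (a : α) (b : β) (c : γ) :
    marg p (fun ω => (A ω, B ω, C ω)) (a, b, c) * marg p C c =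
      marg p (fun ω => (A ω, C ω)) (a, c) * marg p (fun ω => (B ω, C ω)) (b, c) := by
  have key : ∀ x : α × β × γ, _ := fun x => sub_le_mul_logb
    (marg_nonneg hp (fun ω => (A ω, B ω, C ω)) x)
    (marg_le_of_imp hp (B := fun ω => (A ω, C ω)) (b := (x.1, x.2.2)) fun ω h => by rw [← h])
    (marg_le_of_imp hp (B := fun ω => (B ω, C ω)) (b := x.2) fun ω h => by rw [← h])
    (marg_le_of_imp hp (B := C) (b := x.2.2) fun ω h => (Prod.ext_iff.1 h).2)
  have h0 := ent_sub_eq p A B C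
  have h1 := sum_marg_sub p A B C
  rw [← div_left_inj' (Real.log_pos one_lt_two).ne', zero_div, Finset.sum_div] at h1
  have h2 := (Finset.sum_eq_sum_iff_of_le fun x (_ : x ∈ Finset.univ) => (key x).1).1 (by
    refine le_antisymm (Finset.sum_le_sum fun x _ => (key x).1) ?_
    rw [h1, ← h0]; linarith) (a, b, c) (Finset.mem_univ _)
  exact (key (a, b, c)).2 h2.symm

/-- Conditional independence implies equality in submodularity. -/
theorem ent_eq_of_marg_mul {p : Ω → ℝ} (hp : ∀ ω, 0 ≤ p ω) (A : Ω → α) (B : Ω → β) (C : Ω → γ)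
    (h : ∀ a b c, marg p (fun ω => (A ω, B ω, C ω)) (a, b, c) * marg p C c =
      marg p (fun ω => (A ω, C ω)) (a, c) * marg p (fun ω => (B ω, C ω)) (b, c)) :
    ent p (fun ω => (A ω, B ω, C ω)) + ent p C =
      ent p (fun ω => (A ω, C ω)) + ent p (fun ω => (B ω, C ω)) := by
  have h0 := ent_sub_eq p A B C
  rw [Finset.sum_eq_zero] at h0
  · linarith
  rintro ⟨a, b, c⟩ -
  have hx : marg p (fun ω => (A ω, B ω, C ω)) (a, b, c) ≤ marg p (fun ω => (A ω, C ω)) (a, c) :=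
    marg_le_of_imp hp fun ω h => by simp_all
  have hy : marg p (fun ω => (A ω, B ω, C ω)) (a, b, c) ≤ marg p (fun ω => (B ω, C ω)) (b, c) :=
    marg_le_of_imp hp fun ω h => by simp_all
  have hz : marg p (fun ω => (A ω, B ω, C ω)) (a, b, c) ≤ marg p C c :=
    marg_le_of_imp hp fun ω h => by simp_all
  rcases (marg_nonneg hp (fun ω => (A ω, B ω, C ω)) (a, b, c)).eq_or_lt with h1 | h1
  · rw [← h1, zero_mul]
  · have e := congrArg (Real.logb 2) (h a b c)
    rw [Real.logb_mul h1.ne' (h1.trans_le hz).ne', Real.logb_mul (h1.trans_le hx).ne'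
      (h1.trans_le hy).ne'] at e
    dsimp only
    rw [e]; ring

/-- The entropy of a function of a variable is at most that of the variable. -/
lemma ent_comp_le {p : Ω → ℝ} (hp : ∀ ω, 0 ≤ p ω) (A : Ω → α) (f : α → β) :
    ent p (fun ω => f (A ω)) ≤ ent p A := by
  rw [ent_eq_neg_sum, ent_eq_neg_sum]
  refine neg_le_neg (Finset.sum_le_sum fun ω _ => ?_)
  rcases (hp ω).eq_or_lt with h | h
  · rw [← h]; simp
  refine mul_le_mul_of_nonneg_left (Real.logb_le_logb_of_le one_lt_two ?_ ?_) h.le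
  · refine h.trans_le ?_
    have := Finset.single_le_sum (fun ω' _ => mul_nonneg (hp ω') (ind_nonneg (A ω' = A ω)))
      (Finset.mem_univ ω)
    simpa [marg] using this
  · exact marg_le_of_imp hp fun ω' h' => by rw [h']

end submodular

/-! ### Entropies of layers -/

section congr

variable {Ω α β : Type*} [Fintype Ω]

lemma marg_congr (p : Ω → ℝ) {A : Ω → α} {A' : Ω → β} {a : α} {a' : β}
    (h : ∀ ω, A ω = a ↔ A' ω = a') : marg p A a = marg p A' a' := by
  simp only [marg, ind_congr (h _)]

/-- Entropy depends only on the partition of the sample space. -/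
lemma ent_congr [Fintype α] [Fintype β] (p : Ω → ℝ) {A : Ω → α} {A' : Ω → β}
    (h : ∀ ω ω', A ω = A ω' ↔ A' ω = A' ω') : ent p A = ent p A' := by
  rw [ent_eq_neg_sum, ent_eq_neg_sum]
  simp only [marg_congr p fun ω => h ω _]

end congr

namespace Pat

lemma Agr.mono {U₀ U₁ U₂ : Type*} {D D' : Pat} (h : D.Le D') {u u' : U₀ × U₁ × U₂}
    (h' : D'.Agr u u') : D.Agr u u' := by
  cases D <;> cases D' <;> simp_all [Le, Agr]

end Pat

namespace Model

variable {S U₀ U₁ U₂ Y : Type*} [Fintype S] [Fintype U₀] [Fintype U₁] [Fintype U₂] [Fintype Y]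
  (m : Model S U₀ U₁ U₂ Y) {O O' : Type*} [Fintype O] [Fintype O'] {D D' : Pat}

lemma entPat_mono (h : D.Le D') (B : S × Y → O) : m.entPat D B ≤ m.entPat D' B := by
  have h1 := ent_comp_le m.law_nonneg
    (fun ω => ((D'.proj ω.2.1, B (ω.1, ω.2.2)), (D.proj ω.2.1, B (ω.1, ω.2.2)))) Prod.snd
  refine h1.trans_eq (ent_congr _ fun ω ω' => ?_)
  simp only [Prod.mk.injEq, Pat.proj_eq_iff]
  exact ⟨fun h => h.1, fun h' => ⟨h', h'.1.mono h, h'.2⟩⟩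

/-- Conditional on `B`, the observation `B'` is at most as informative about the layers in `D` as
about the larger set of layers in `D'`. -/
lemma entPat_submodular (h : D.Le D') (B : S × Y → O) (B' : S × Y → O') :
    m.entPat D' (fun x => (B' x, B x)) + m.entPat D B ≤
      m.entPat D' B + m.entPat D (fun x => (B' x, B x)) := by
  have h1 := ent_submodular m.law_nonneg (fun ω => D'.proj ω.2.1) (fun ω => B' (ω.1, ω.2.2))
    (fun ω => (D.proj ω.2.1, B (ω.1, ω.2.2)))
  refine le_trans (le_of_eq ?_) (h1.trans_eq ?_)
  · refine congrArg₂ _ (ent_congr _ fun ω ω' => ?_) rfl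
    simp only [Prod.mk.injEq, Pat.proj_eq_iff]
    exact ⟨fun h' => ⟨h'.1, h'.2.1, h'.1.mono h, h'.2.2⟩, fun h' => ⟨h'.1, h'.2.1, h'.2.2.2⟩⟩
  · refine congrArg₂ _ (ent_congr _ fun ω ω' => ?_) (ent_congr _ fun ω ω' => ?_)
    · simp only [Prod.mk.injEq, Pat.proj_eq_iff]
      exact ⟨fun h' => ⟨h'.1, h'.2.2⟩, fun h' => ⟨h'.1, h'.1.mono h, h'.2⟩⟩
    · simp only [Prod.mk.injEq]; tauto

/-- The case of equality in `entPat_submodular`. -/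
lemma margPat_mul_of_entPat_eq (h : D.Le D') (B : S × Y → O) (B' : S × Y → O')
    (he : m.entPat D' B + m.entPat D (fun x => (B' x, B x)) ≤
      m.entPat D' (fun x => (B' x, B x)) + m.entPat D B) (u : U₀ × U₁ × U₂) (b' : O') (b : O) :
    m.margPat D' (fun x => (B' x, B x)) (D'.proj u, b', b) * m.margPat D B (D.proj u, b) =
      m.margPat D' B (D'.proj u, b) * m.margPat D (fun x => (B' x, B x)) (D.proj u, b', b) := by
  have e1 : m.entPat D' B =
      ent m.law fun ω => (D'.proj ω.2.1, D.proj ω.2.1, B (ω.1, ω.2.2)) := by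
    refine ent_congr _ fun ω ω' => ?_
    simp only [Prod.mk.injEq, Pat.proj_eq_iff]
    exact ⟨fun h' => ⟨h'.1, h'.1.mono h, h'.2⟩, fun h' => ⟨h'.1, h'.2.2⟩⟩
  have e2 : m.entPat D (fun x => (B' x, B x)) =
      ent m.law fun ω => (B' (ω.1, ω.2.2), D.proj ω.2.1, B (ω.1, ω.2.2)) := by
    refine ent_congr _ fun ω ω' => ?_
    simp only [Prod.mk.injEq]; tauto
  have e3 : m.entPat D' (fun x => (B' x, B x)) = ent m.law fun ω =>
      (D'.proj ω.2.1, B' (ω.1, ω.2.2), D.proj ω.2.1, B (ω.1, ω.2.2)) := by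
    refine ent_congr _ fun ω ω' => ?_
    simp only [Prod.mk.injEq, Pat.proj_eq_iff]
    exact ⟨fun h' => ⟨h'.1, h'.2.1, h'.1.mono h, h'.2.2⟩, fun h' => ⟨h'.1, h'.2.1, h'.2.2.2⟩⟩
  rw [e1, e2, e3] at he
  have h1 := marg_mul_of_ent_eq m.law_nonneg (fun ω => D'.proj ω.2.1) (fun ω => B' (ω.1, ω.2.2))
    (fun ω => (D.proj ω.2.1, B (ω.1, ω.2.2))) he (D'.proj u) b' (D.proj u, b)
  refine Eq.trans ?_ (h1.trans ?_)
  · refine congrArg₂ _ (marg_congr _ fun ω => ?_) rfl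
    simp only [Prod.mk.injEq, Pat.proj_eq_iff]
    exact ⟨fun h' => ⟨h'.1, h'.2.1, h'.1.mono h, h'.2.2⟩, fun h' => ⟨h'.1, h'.2.1, h'.2.2.2⟩⟩
  · refine congrArg₂ _ (marg_congr _ fun ω => ?_) (marg_congr _ fun ω => ?_)
    · simp only [Prod.mk.injEq, Pat.proj_eq_iff]
      exact ⟨fun h' => ⟨h'.1, h'.2.2⟩, fun h' => ⟨h'.1, h'.1.mono h, h'.2⟩⟩
    · simp only [Prod.mk.injEq]; tauto

/-! ### Outputs that depend only on the state -/

section degenerate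

/-- The output `out` depends on the layers only through the state, with law `w s` given `s`. -/
def StateOnly (out : Y → O) (w : S → O → ℝ) : Prop :=
  ∀ s, m.a s ≠ 0 → ∀ u b, ∑ y, m.V s u y * ind (out y = b) = w s b

variable {m} {out : Y → O} {w : S → O → ℝ}

lemma StateOnly.margPat_pair (hw : m.StateOnly out w) (D : Pat)
    (d : Option U₀ × Option U₁ × Option U₂) (s : S) (b : O) :
    m.margPat D (fun x => (x.1, out x.2)) (d, s, b) = m.margPat D Prod.fst (d, s) * w s b := by
  simp only [margPat, marg, law, Fintype.sum_prod_type (α₁ := S), Finset.sum_mul]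
  refine Finset.sum_congr rfl fun s' _ => ?_
  simp only [Fintype.sum_prod_type (α₂ := Y)]
  refine Finset.sum_congr rfl fun u _ => ?_
  simp only [Prod.mk.injEq, ind_and]
  by_cases hs : s' = s
  · subst hs
    by_cases ha : m.a s' = 0
    · simp [P, R, ha]
    · simp only [← Finset.sum_mul, m.sum_P]
      rw [← hw s' ha u b, Finset.mul_sum]
      refine Finset.sum_congr rfl fun y _ => ?_
      rw [P]; ring
  · simp [ind_of_not hs]

lemma marg_law_fst (s : S) : marg m.law (fun ω => ω.1) s = m.a s := by
  simp only [marg, law, Fintype.sum_prod_type (α₁ := S), Fintype.sum_prod_type (α₂ := Y),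
    ← Finset.sum_mul, m.sum_P]
  have h : ∀ s, ∑ u, m.R s u = m.a s := by
    intro s
    simp only [R, Fintype.sum_prod_type, mul_assoc, ← Finset.mul_sum, m.k₂_sum, m.k₁_sum,
      m.k₀_sum, mul_one]
  simp only [h, ind_comm_eq _ s]
  exact sum_mul_ind s m.a

lemma StateOnly.entPat_pair (hw : m.StateOnly out w) (D : Pat) :
    m.entPat D (fun x => (x.1, out x.2)) + m.entPat .none Prod.fst =
      m.entPat D Prod.fst + m.entPat .none (fun x => (x.1, out x.2)) := by
  have h1 := ent_eq_of_marg_mul m.law_nonneg (fun ω => D.proj ω.2.1) (fun ω => out ω.2.2)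
    (fun ω => ω.1) fun d b s => ?_
  · refine Eq.trans ?_ (h1.trans ?_)
    · refine congrArg₂ _ (ent_congr _ fun ω ω' => ?_) (ent_congr _ fun ω ω' => ?_) <;>
        simp only [Prod.mk.injEq, Pat.proj] <;> tauto
    · refine congrArg₂ _ rfl (ent_congr _ fun ω ω' => ?_)
      simp only [Prod.mk.injEq, Pat.proj]; tauto
  · have e1 : marg m.law (fun ω => (D.proj ω.2.1, out ω.2.2, ω.1)) (d, b, s) =
        m.margPat D (fun x => (x.1, out x.2)) (d, s, b) :=
      marg_congr _ fun ω => by simp only [Prod.mk.injEq]; tauto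
    have e2 : marg m.law (fun ω => ω.1) s =
        m.margPat .none Prod.fst ((Option.none, Option.none, Option.none), s) :=
      marg_congr _ fun ω => by simp only [Prod.mk.injEq, Pat.proj]; tauto
    have e3 : marg m.law (fun ω => (out ω.2.2, ω.1)) (b, s) =
        m.margPat .none (fun x => (x.1, out x.2)) ((Option.none, Option.none, Option.none), s, b) :=
      marg_congr _ fun ω => by simp only [Prod.mk.injEq, Pat.proj]; tauto
    have e4 : marg m.law (fun ω => (D.proj ω.2.1, ω.1)) (d, s) = m.margPat D Prod.fst (d, s) := rfl
    rw [e1, e3, e4, hw.margPat_pair, hw.margPat_pair, ← e2]; ring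

/-- Data processing: an output that depends only on the state tells less about the layers than the
state. -/
lemma StateOnly.entPat_fst_sub_le (hw : m.StateOnly out w) (h : D.Le D') :
    m.entPat D' Prod.fst - m.entPat D Prod.fst ≤
      m.entPat D' (fun x => out x.2) - m.entPat D (fun x => out x.2) := by
  have h1 := m.entPat_submodular h (fun x => out x.2) Prod.fst
  have h2 := hw.entPat_pair D
  have h3 := hw.entPat_pair D'
  linarith

/-- If such an output tells as much about the layers as the state, then the conditional law of the
layers given the state is determined by the output. -/
lemma StateOnly.margPat_fst_eq (hw : m.StateOnly out w)
    (he : m.entPat D (fun x => out x.2) - m.entPat .none (fun x => out x.2) ≤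
      m.entPat D Prod.fst - m.entPat .none Prod.fst) {s s' : S} {b : O} (hs : m.a s * w s b ≠ 0)
    (hs' : m.a s' * w s' b ≠ 0) (u : U₀ × U₁ × U₂) :
    m.margPat D Prod.fst (D.proj u, s) * m.a s' = m.margPat D Prod.fst (D.proj u, s') * m.a s := by
  have h2 := hw.entPat_pair D
  have h1 := m.margPat_mul_of_entPat_eq (D := .none) (D' := D) trivial (fun x => out x.2) Prod.fst
    (by linarith) u
  have e : ∀ s, m.a s * w s b ≠ 0 →
      m.margPat D Prod.fst (D.proj u, s) * m.margPat .none (fun x => out x.2) (Pat.none.proj u, b) =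
        m.margPat D (fun x => out x.2) (D.proj u, b) * m.a s := by
    intro s hs
    have h3 := h1 s b
    rw [hw.margPat_pair, hw.margPat_pair, margPat_fst_none] at h3
    refine mul_right_cancel₀ (right_ne_zero_of_mul hs) ?_
    linarith
  have hb : m.margPat .none (fun x => out x.2) (Pat.none.proj u, b) ≠ 0 := by
    have h3 : m.margPat .none (fun x => (x.1, out x.2)) (Pat.none.proj u, s, b) ≤
        m.margPat .none (fun x => out x.2) (Pat.none.proj u, b) :=
      marg_le_of_imp m.law_nonneg fun ω h => by simp_all
    have h4 := m.margPat_nonneg .none (fun x => (x.1, out x.2)) (Pat.none.proj u, s, b)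
    rw [hw.margPat_pair, margPat_fst_none] at h3 h4
    exact ((lt_of_le_of_ne h4 hs.symm).trans_le h3).ne'
  refine mul_right_cancel₀ hb ?_
  linear_combination m.a s' * e s hs - m.a s * e s' hs'

end degenerate

end Model

/-! ### Mixtures -/

section mixture

variable {Ω Ω' α α' β : Type*} [Fintype Ω] [Fintype Ω'] [Fintype α] [Fintype α'] [Fintype β]

lemma etaLog_mul (t x : ℝ) : etaLog (t * x) = t * etaLog x + x * etaLog t := by
  rcases eq_or_ne t 0 with rfl | ht
  · simp [etaLog]
  rcases eq_or_ne x 0 with rfl | hx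
  · simp [etaLog]
  rw [etaLog, etaLog, etaLog, Real.logb_mul ht hx]; ring

/-- The binary entropy function. -/
def binEnt (θ : ℝ) : ℝ := etaLog (1 - θ) + etaLog θ

/-- The mixture of two weights, on the disjoint union of the sample spaces. -/
def mixWt (θ : ℝ) (p : Ω → ℝ) (p' : Ω' → ℝ) : Ω ⊕ Ω' → ℝ :=
  Sum.elim (fun ω => (1 - θ) * p ω) (fun ω => θ * p' ω)

/-- The chain rule for a mixture whose component is visible. -/
lemma ent_mixWt_map (θ : ℝ) {p : Ω → ℝ} {p' : Ω' → ℝ} (hp : ∑ ω, p ω = 1) (hp' : ∑ ω, p' ω = 1)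
    (A : Ω → α) (A' : Ω' → α') :
    ent (mixWt θ p p') (Sum.map A A') = (1 - θ) * ent p A + θ * ent p' A' + binEnt θ := by
  have h1 : ∀ a, marg (mixWt θ p p') (Sum.map A A') (Sum.inl a) = (1 - θ) * marg p A a := by
    intro a
    simp [marg, mixWt, Fintype.sum_sum_type, Finset.mul_sum, mul_assoc, ind_of_not]
  have h2 : ∀ a, marg (mixWt θ p p') (Sum.map A A') (Sum.inr a) = θ * marg p' A' a := by
    intro a
    simp [marg, mixWt, Fintype.sum_sum_type, Finset.mul_sum, mul_assoc, ind_of_not]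
  simp only [ent, Fintype.sum_sum_type, h1, h2, etaLog_mul, Finset.sum_add_distrib,
    ← Finset.mul_sum, ← Finset.sum_mul, sum_marg, hp, hp', binEnt]
  ring

lemma ent_const {p : Ω → ℝ} (hp : ∑ ω, p ω = 1) (c : Unit) : ent p (fun _ => c) = 0 := by
  simp [ent, marg, hp, etaLog, ind_of]

lemma mixWt_nonneg {θ : ℝ} (hθ : 0 ≤ θ) (hθ' : θ ≤ 1) {p : Ω → ℝ} {p' : Ω' → ℝ}
    (hp : ∀ ω, 0 ≤ p ω) (hp' : ∀ ω, 0 ≤ p' ω) (x : Ω ⊕ Ω') : 0 ≤ mixWt θ p p' x := by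
  rcases x with ω | ω
  · exact mul_nonneg (by linarith) (hp ω)
  · exact mul_nonneg hθ (hp' ω)

/-- Forgetting the component of a mixture does not increase the entropy. -/
lemma ent_mixWt_elim_le {θ : ℝ} (hθ : 0 ≤ θ) (hθ' : θ ≤ 1) {p : Ω → ℝ} {p' : Ω' → ℝ}
    (hp : ∀ ω, 0 ≤ p ω) (hp' : ∀ ω, 0 ≤ p' ω) (hp1 : ∑ ω, p ω = 1) (hp1' : ∑ ω, p' ω = 1)
    (A : Ω → α) (A' : Ω' → α) :
    ent (mixWt θ p p') (Sum.elim A A') ≤ (1 - θ) * ent p A + θ * ent p' A' + binEnt θ := by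
  rw [← ent_mixWt_map θ hp1 hp1']
  refine le_trans (le_of_eq (congrArg _ ?_))
    (ent_comp_le (mixWt_nonneg hθ hθ' hp hp') (Sum.map A A') (Sum.elim id id))
  funext x; rcases x with ω | ω <;> rfl

/-- Concavity of entropy. -/
lemma le_ent_mixWt_elim {θ : ℝ} (hθ : 0 ≤ θ) (hθ' : θ ≤ 1) {p : Ω → ℝ} {p' : Ω' → ℝ}
    (hp : ∀ ω, 0 ≤ p ω) (hp' : ∀ ω, 0 ≤ p' ω) (hp1 : ∑ ω, p ω = 1) (hp1' : ∑ ω, p' ω = 1)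
    (A : Ω → α) (A' : Ω' → α) :
    (1 - θ) * ent p A + θ * ent p' A' ≤ ent (mixWt θ p p') (Sum.elim A A') := by
  have h0 := mixWt_nonneg hθ hθ' hp hp'
  have h1 := ent_submodular h0 (Sum.map (fun _ => ()) fun _ => ()) (Sum.elim A A') fun _ => ()
  have e1 : ent (mixWt θ p p') (fun x => (Sum.map (fun _ => ()) (fun _ => ()) x, Sum.elim A A' x, ()))
      = (1 - θ) * ent p A + θ * ent p' A' + binEnt θ := by
    rw [← ent_mixWt_map θ hp1 hp1']
    refine ent_congr _ fun x y => ?_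
    rcases x with x | x <;> rcases y with y | y <;> simp
  have e2 : ent (mixWt θ p p') (fun x => (Sum.map (fun _ => ()) (fun _ => ()) x, ())) =
      binEnt θ := by
    rw [show binEnt θ = (1 - θ) * ent p (fun _ => ()) + θ * ent p' (fun _ => ()) + binEnt θ by
      rw [ent_const hp1, ent_const hp1']; ring, ← ent_mixWt_map θ hp1 hp1']
    exact ent_congr _ fun x y => by simp
  have e3 : ent (mixWt θ p p') (fun x => (Sum.elim A A' x, ())) =
      ent (mixWt θ p p') (Sum.elim A A') := ent_congr _ fun x y => by simp
  have e4 : ent (mixWt θ p p') (fun _ => ()) = 0 := ent_const (by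
    simp only [mixWt, Fintype.sum_sum_type, Sum.elim_inl, Sum.elim_inr, ← Finset.mul_sum, hp1, hp1']
    ring) ()
  rw [e1, e2, e3, e4] at h1
  linarith

end mixture

/-! ### Single-letter encoders -/

lemma Model.sum_law_mul {S U₀ U₁ U₂ Y : Type*} [Fintype S] [Fintype U₀] [Fintype U₁] [Fintype U₂]
    [Fintype Y] (m : Model S U₀ U₁ U₂ Y) (f : S × (U₀ × U₁ × U₂) × Y → ℝ) :
    ∑ ω, m.law ω * f ω = ∑ s, ∑ u, m.R s u * ∑ y, m.V s u y * f (s, u, y) := by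
  rw [Fintype.sum_prod_type]
  refine Finset.sum_congr rfl fun s _ => ?_
  rw [Fintype.sum_prod_type]
  refine Finset.sum_congr rfl fun u _ => ?_
  simp only [Model.law, Model.P, Finset.mul_sum, mul_assoc]

/-- The kernels with which the transmitter generates the layers `u₀`, `u₁`, `u₂` and the channel
input from the state. -/
structure Encoder (S U₀ U₁ U₂ X : Type*) [Fintype U₀] [Fintype U₁] [Fintype U₂] [Fintype X] where
  k₀ : S → U₀ → ℝ
  k₁ : S → U₀ → U₁ → ℝ
  k₂ : S → U₀ → U₂ → ℝ
  c : S → U₀ × U₁ × U₂ → X → ℝ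
  k₀_nonneg : ∀ s u, 0 ≤ k₀ s u
  k₁_nonneg : ∀ s u v, 0 ≤ k₁ s u v
  k₂_nonneg : ∀ s u v, 0 ≤ k₂ s u v
  c_nonneg : ∀ s u x, 0 ≤ c s u x
  k₀_sum : ∀ s, ∑ u, k₀ s u = 1
  k₁_sum : ∀ s u, ∑ v, k₁ s u v = 1
  k₂_sum : ∀ s u, ∑ v, k₂ s u v = 1
  c_sum : ∀ s u, ∑ x, c s u x = 1

namespace Encoder

variable {S U₀ U₁ U₂ T₀ T₁ T₂ X Y₁ Y₂ Z O : Type*} [Fintype S] [Fintype U₀] [Fintype U₁]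
  [Fintype U₂] [Fintype T₀] [Fintype T₁] [Fintype T₂] [Fintype X] [Fintype Y₁] [Fintype Y₂]
  [Fintype Z] [Fintype O]

/-- The model given by an encoder and a channel. -/
def model (E : Encoder S U₀ U₁ U₂ X) (W : Channel S X Y₁ Y₂ Z) :
    Model S U₀ U₁ U₂ (Y₁ × Y₂ × Z) where
  a := real W.state
  k₀ := E.k₀
  k₁ := E.k₁
  k₂ := E.k₂
  V s u y := ∑ x, E.c s u x * real (W.trans x s) y
  a_nonneg := real_nonneg _
  k₀_nonneg := E.k₀_nonneg
  k₁_nonneg := E.k₁_nonneg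
  k₂_nonneg := E.k₂_nonneg
  V_nonneg s u y := Finset.sum_nonneg fun x _ => mul_nonneg (E.c_nonneg _ _ _) (real_nonneg _ _)
  a_sum := sum_real _
  k₀_sum := E.k₀_sum
  k₁_sum := E.k₁_sum
  k₂_sum := E.k₂_sum
  V_sum s u := by
    rw [Finset.sum_comm]
    simp only [← Finset.mul_sum, sum_real, mul_one, E.c_sum]

/-- The channel input of a mixture; for layers from different components, which do not occur, it
is a fixed letter. -/
def mixC (x₀ : X) (c : S → U₀ × U₁ × U₂ → X → ℝ) (c' : S → T₀ × T₁ × T₂ → X → ℝ) (s : S) :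
    (U₀ ⊕ T₀) × (U₁ ⊕ T₁) × (U₂ ⊕ T₂) → X → ℝ
  | (.inl u₀, .inl u₁, .inl u₂), x => c s (u₀, u₁, u₂) x
  | (.inr u₀, .inr u₁, .inr u₂), x => c' s (u₀, u₁, u₂) x
  | _, x => ind (x₀ = x)

/-- Time sharing between two encoders: with probability `θ` all layers are generated with the second
one; every layer reveals which encoder is used. -/
def mix (θ : ℝ) (hθ : 0 ≤ θ) (hθ' : θ ≤ 1) (x₀ : X) (E : Encoder S U₀ U₁ U₂ X)
    (E' : Encoder S T₀ T₁ T₂ X) : Encoder S (U₀ ⊕ T₀) (U₁ ⊕ T₁) (U₂ ⊕ T₂) X where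
  k₀ s := mixWt θ (E.k₀ s) (E'.k₀ s)
  k₁ s := Sum.elim (fun u => Sum.elim (E.k₁ s u) fun _ => 0) fun u => Sum.elim (fun _ => 0) (E'.k₁ s u)
  k₂ s := Sum.elim (fun u => Sum.elim (E.k₂ s u) fun _ => 0) fun u => Sum.elim (fun _ => 0) (E'.k₂ s u)
  c := mixC x₀ E.c E'.c
  k₀_nonneg s := mixWt_nonneg hθ hθ' (E.k₀_nonneg s) (E'.k₀_nonneg s)
  k₁_nonneg s u v := by
    rcases u with u | u <;> rcases v with v | v <;> simp [E.k₁_nonneg, E'.k₁_nonneg]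
  k₂_nonneg s u v := by
    rcases u with u | u <;> rcases v with v | v <;> simp [E.k₂_nonneg, E'.k₂_nonneg]
  c_nonneg s u x := by
    rcases u with ⟨u₀ | u₀, u₁ | u₁, u₂ | u₂⟩ <;>
      simp only [mixC, E.c_nonneg, E'.c_nonneg, ind_nonneg]
  k₀_sum s := by
    simp only [mixWt, Fintype.sum_sum_type, Sum.elim_inl, Sum.elim_inr, ← Finset.mul_sum, E.k₀_sum,
      E'.k₀_sum]
    ring
  k₁_sum s u := by
    rcases u with u | u <;> simp [Fintype.sum_sum_type, E.k₁_sum, E'.k₁_sum]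
  k₂_sum s u := by
    rcases u with u | u <;> simp [Fintype.sum_sum_type, E.k₂_sum, E'.k₂_sum]
  c_sum s u := by
    rcases u with ⟨u₀ | u₀, u₁ | u₁, u₂ | u₂⟩ <;>
      simp only [mixC, E.c_sum, E'.c_sum, sum_ind]

variable {θ : ℝ} (hθ : 0 ≤ θ) (hθ' : θ ≤ 1) (x₀ : X) (E : Encoder S U₀ U₁ U₂ X)
    (E' : Encoder S T₀ T₁ T₂ X) (W : Channel S X Y₁ Y₂ Z)

/-- The embedding of the letters of the first component. -/
def embL {Y : Type*} (ω : S × (U₀ × U₁ × U₂) × Y) :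
    S × ((U₀ ⊕ T₀) × (U₁ ⊕ T₁) × (U₂ ⊕ T₂)) × Y :=
  (ω.1, (.inl ω.2.1.1, .inl ω.2.1.2.1, .inl ω.2.1.2.2), ω.2.2)

/-- The embedding of the letters of the second component. -/
def embR {Y : Type*} (ω : S × (T₀ × T₁ × T₂) × Y) :
    S × ((U₀ ⊕ T₀) × (U₁ ⊕ T₁) × (U₂ ⊕ T₂)) × Y :=
  (ω.1, (.inr ω.2.1.1, .inr ω.2.1.2.1, .inr ω.2.1.2.2), ω.2.2)

lemma sum_R_mix (s : S) (G : (U₀ ⊕ T₀) × (U₁ ⊕ T₁) × (U₂ ⊕ T₂) → ℝ) :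
    ∑ u, ((mix θ hθ hθ' x₀ E E').model W).R s u * G u =
      (1 - θ) * ∑ u : U₀ × U₁ × U₂, (E.model W).R s u * G (.inl u.1, .inl u.2.1, .inl u.2.2) +
        θ * ∑ u : T₀ × T₁ × T₂, (E'.model W).R s u * G (.inr u.1, .inr u.2.1, .inr u.2.2) := by
  simp only [Fintype.sum_prod_type, Fintype.sum_sum_type, Model.R, model, mix, mixWt, Sum.elim_inl,
    Sum.elim_inr, mul_zero, zero_mul, Finset.sum_const_zero, add_zero, zero_add, Finset.mul_sum]
  congr 1 <;>
  · refine Finset.sum_congr rfl fun _ _ => Finset.sum_congr rfl fun _ _ =>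
      Finset.sum_congr rfl fun _ _ => ?_
    ring

lemma sum_law_mix (f : S × ((U₀ ⊕ T₀) × (U₁ ⊕ T₁) × (U₂ ⊕ T₂)) × (Y₁ × Y₂ × Z) → ℝ) :
    ∑ ω, ((mix θ hθ hθ' x₀ E E').model W).law ω * f ω =
      (1 - θ) * ∑ ω, (E.model W).law ω * f (embL ω) + θ * ∑ ω, (E'.model W).law ω * f (embR ω) := by
  rw [Model.sum_law_mul, Model.sum_law_mul, Model.sum_law_mul, Finset.mul_sum, Finset.mul_sum, ← Finset.sum_add_distrib]
  refine Finset.sum_congr rfl fun s _ => ?_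
  rw [sum_R_mix]
  rfl

lemma ent_law_mix {α : Type*} [Fintype α]
    (A : S × ((U₀ ⊕ T₀) × (U₁ ⊕ T₁) × (U₂ ⊕ T₂)) × (Y₁ × Y₂ × Z) → α) :
    ent ((mix θ hθ hθ' x₀ E E').model W).law A =
      ent (mixWt θ (E.model W).law (E'.model W).law)
        (Sum.elim (fun ω => A (embL ω)) fun ω => A (embR ω)) := by
  refine Finset.sum_congr rfl fun a _ => congrArg _ ?_
  rw [marg, sum_law_mix]
  simp only [marg, mixWt, Fintype.sum_sum_type, Sum.elim_inl, Sum.elim_inr, mul_assoc,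
    ← Finset.mul_sum]

/-- As every layer reveals the component, entropies of nonempty sets of layers are affine in the
components, up to the common term `binEnt θ`. -/
lemma entPat_mix {D : Pat} (hD : D ≠ .none) (B : S × (Y₁ × Y₂ × Z) → O) :
    ((mix θ hθ hθ' x₀ E E').model W).entPat D B =
      (1 - θ) * (E.model W).entPat D B + θ * (E'.model W).entPat D B + binEnt θ := by
  rw [Model.entPat, ent_law_mix, Model.entPat, Model.entPat,
    ← ent_mixWt_map θ (E.model W).sum_law (E'.model W).sum_law]
  refine ent_congr _ fun x y => ?_
  cases D
  · exact absurd rfl hD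
  all_goals
    rcases x with x | x <;> rcases y with y | y <;> simp [embL, embR, Pat.proj]

lemma entPat_none_mix_le (B : S × (Y₁ × Y₂ × Z) → O) :
    ((mix θ hθ hθ' x₀ E E').model W).entPat .none B ≤
      (1 - θ) * (E.model W).entPat .none B + θ * (E'.model W).entPat .none B + binEnt θ := by
  have h := ent_mixWt_elim_le hθ hθ' (E.model W).law_nonneg (E'.model W).law_nonneg
    (E.model W).sum_law (E'.model W).sum_law (fun ω => B (ω.1, ω.2.2)) (fun ω => B (ω.1, ω.2.2))
  refine le_trans (le_of_eq ?_) (h.trans_eq ?_)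
  · rw [Model.entPat, ent_law_mix]
    exact ent_congr _ fun x y => by
      rcases x with x | x <;> rcases y with y | y <;> simp [embL, embR, Pat.proj]
  · refine congrArg₂ _ (congrArg₂ _ (congrArg _ ?_) (congrArg _ ?_)) rfl <;>
    exact ent_congr _ fun x y => by simp [Pat.proj]

lemma le_entPat_none_mix (B : S × (Y₁ × Y₂ × Z) → O) :
    (1 - θ) * (E.model W).entPat .none B + θ * (E'.model W).entPat .none B ≤
    ((mix θ hθ hθ' x₀ E E').model W).entPat .none B := by
  have h := le_ent_mixWt_elim hθ hθ' (E.model W).law_nonneg (E'.model W).law_nonneg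
    (E.model W).sum_law (E'.model W).sum_law (fun ω => B (ω.1, ω.2.2)) (fun ω => B (ω.1, ω.2.2))
  refine le_trans (le_of_eq ?_) (h.trans_eq ?_)
  · refine congrArg₂ _ (congrArg _ ?_) (congrArg _ ?_) <;>
    exact ent_congr _ fun x y => by simp [Pat.proj]
  · rw [Model.entPat, ent_law_mix]
    exact ent_congr _ fun x y => by
      rcases x with x | x <;> rcases y with y | y <;> simp [embL, embR, Pat.proj]

/-- The entropy of the state does not depend on the encoder. -/
lemma entPat_none_fst : (E.model W).entPat .none Prod.fst = ∑ s, etaLog (real W.state s) := by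
  have h : (E.model W).entPat .none Prod.fst = ent (E.model W).law fun ω => ω.1 :=
    ent_congr _ fun x y => by simp [Pat.proj]
  rw [h]
  exact Finset.sum_congr rfl fun s _ => congrArg _ (Model.marg_law_fst s)

end Encoder

/-! ### Strategies as layers -/

namespace Model

variable {S U₀ U₁ U₂ Y O : Type*} [Fintype S] [Fintype U₀] [Fintype U₁] [Fintype U₂] [Fintype Y]
  [Fintype O] (m : Model S U₀ U₁ U₂ Y) {D D' : Pat}

/-- The entropy of a layer that is uniform on `N` values given the layers in `D` and `B`. -/
lemma entPat_sub_eq_logb {B : S × Y → O} {N : ℝ} (hN : 0 < N)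
    (h : ∀ u b, m.margPat D' B (D'.proj u, b) = N⁻¹ * m.margPat D B (D.proj u, b)) :
    m.entPat D' B - m.entPat D B = Real.logb 2 N := by
  rw [entPat, entPat, ent_eq_neg_sum, ent_eq_neg_sum, neg_sub_neg, ← Finset.sum_sub_distrib,
    ← one_mul (Real.logb 2 N), ← m.sum_law, Finset.sum_mul]
  refine Finset.sum_congr rfl fun ω _ => ?_
  rcases (m.law_nonneg ω).eq_or_lt with h0 | h0
  · rw [← h0]; ring
  have h1 : 0 < m.margPat D B (D.proj ω.2.1, B (ω.1, ω.2.2)) := by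
    refine h0.trans_le ?_
    have h2 := Finset.single_le_sum (fun ω' _ => mul_nonneg (m.law_nonneg ω')
      (ind_nonneg ((D.proj ω'.2.1, B (ω'.1, ω'.2.2)) = (D.proj ω.2.1, B (ω.1, ω.2.2)))))
      (Finset.mem_univ ω)
    simpa [margPat, marg, ind_of] using h2
  have h2 := h ω.2.1 (B (ω.1, ω.2.2))
  rw [margPat, margPat] at h2
  rw [margPat] at h1
  rw [h2, Real.logb_mul (by positivity) h1.ne', Real.logb_inv]
  ring

lemma margPat_unit (D : Pat) (d : Option U₀ × Option U₁ × Option U₂) :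
    m.margPat D (fun _ => ()) (d, ()) = ∑ s, m.margPat D Prod.fst (d, s) := by
  have h := sum_marg_pair_right m.law (fun ω => D.proj ω.2.1) (fun ω => ω.1) d
  refine Eq.trans (marg_congr _ fun ω => ?_) h.symm
  simp

/-- Let a layer be independent of the state and uniform on `N` values. If an output tells at most as
much about it as the state, namely nothing, then the output is independent of it. -/
lemma margPat_eq_of_uniform (hD : D.Le D') {N : ℝ} (hN : 0 < N)
    (h : ∀ u s, m.margPat D' Prod.fst (D'.proj u, s) = N⁻¹ * m.margPat D Prod.fst (D.proj u, s))
    (h0 : ∀ u, ∑ s, m.margPat D Prod.fst (D.proj u, s) ≠ 0) (out : Y → O)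
    (he : m.entPat D' Prod.fst - m.entPat D Prod.fst ≤
      m.entPat D' (fun x => out x.2) - m.entPat D (fun x => out x.2))
    {u u' : U₀ × U₁ × U₂} (hu : D.proj u = D.proj u') (b : O) :
    m.margPat D' (fun x => out x.2) (D'.proj u, b) =
      m.margPat D' (fun x => out x.2) (D'.proj u', b) := by
  have hunit : ∀ u (b : Unit), m.margPat D' (fun _ => ()) (D'.proj u, b) =
      N⁻¹ * m.margPat D (fun _ => ()) (D.proj u, b) := by
    intro u b
    rw [m.margPat_unit, m.margPat_unit, Finset.mul_sum]
    exact Finset.sum_congr rfl fun s _ => h u s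
  have h1 := m.entPat_sub_eq_logb hN h
  have h2 := m.entPat_sub_eq_logb hN hunit
  have e : ∀ D, m.entPat D (fun x => (out x.2, ())) = m.entPat D (fun x => out x.2) :=
    fun D => ent_congr _ fun ω ω' => by simp
  have h3 : ∀ u, m.margPat D' (fun x => out x.2) (D'.proj u, b) =
      N⁻¹ * m.margPat D (fun x => out x.2) (D.proj u, b) := by
    intro u
    have h4 := m.margPat_mul_of_entPat_eq hD (fun _ => ()) (fun x => out x.2) (by
      rw [e, e]; linarith) u b ()
    have e' : ∀ D d, m.margPat D (fun x => (out x.2, ())) (d, b, ()) =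
        m.margPat D (fun x => out x.2) (d, b) := fun D d => marg_congr _ fun ω => by simp
    have h5 : m.margPat D (fun _ => ()) (D.proj u, ()) ≠ 0 := by rw [m.margPat_unit]; exact h0 u
    rw [e', e', hunit] at h4
    refine mul_right_cancel₀ h5 ?_
    linarith
  rw [h3, h3, hu]

end Model

namespace Encoder

variable {S X Y₁ Y₂ Z O : Type*} [Fintype S] [DecidableEq S] [Fintype X] [Nonempty X] [Fintype Y₁]
  [Fintype Y₂] [Fintype Z] [Fintype O]

/-- The encoder whose layers are three independent uniform maps from states to inputs, one of which
is chosen at random to produce the channel input. -/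
def strategy : Encoder S (S → X) (S → X) (S → X) X where
  k₀ _ _ := (Fintype.card (S → X) : ℝ)⁻¹
  k₁ _ _ _ := (Fintype.card (S → X) : ℝ)⁻¹
  k₂ _ _ _ := (Fintype.card (S → X) : ℝ)⁻¹
  c s t x := (ind (t.1 s = x) + ind (t.2.1 s = x) + ind (t.2.2 s = x)) / 3
  k₀_nonneg _ _ := by positivity
  k₁_nonneg _ _ _ := by positivity
  k₂_nonneg _ _ _ := by positivity
  c_nonneg s t x := div_nonneg (add_nonneg (add_nonneg (ind_nonneg _) (ind_nonneg _))
    (ind_nonneg _)) (by norm_num)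
  k₀_sum _ := by simp
  k₁_sum _ _ := by simp
  k₂_sum _ _ := by simp
  c_sum s t := by
    simp only [← Finset.sum_div, Finset.sum_add_distrib, sum_ind]; norm_num

/-- The probability of the output letter `b`, averaged over the state, when the input is
`t s`. -/
def stratOut (W : Channel S X Y₁ Y₂ Z) (out : Y₁ × Y₂ × Z → O) (b : O) (t : S → X) : ℝ :=
  ∑ s, real W.state s * marg (real (W.trans (t s) s)) out b

variable (W : Channel S X Y₁ Y₂ Z) (out : Y₁ × Y₂ × Z → O)

lemma margPat_strategy (D : Pat) (u : (S → X) × (S → X) × (S → X)) (b : O) :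
    (strategy.model W).margPat D (fun x => out x.2) (D.proj u, b) =
      ((Fintype.card (S → X) : ℝ)⁻¹ ^ 3 / 3) * ∑ u' : (S → X) × (S → X) × (S → X),
        ind (D.Agr u' u) *
        (stratOut W out b u'.1 + stratOut W out b u'.2.1 + stratOut W out b u'.2.2) := by
  rw [Model.margPat, marg, Model.sum_law_mul, Finset.sum_comm, Finset.mul_sum]
  refine Finset.sum_congr rfl fun u' _ => ?_
  simp only [stratOut, ← Finset.sum_add_distrib, Finset.mul_sum]
  refine Finset.sum_congr rfl fun s _ => ?_
  simp only [Prod.mk.injEq, ind_and, Pat.proj_eq_iff]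
  have e : ∑ y, (strategy.model W).V s u' y * ind (out y = b) =
      (marg (real (W.trans (u'.1 s) s)) out b + marg (real (W.trans (u'.2.1 s) s)) out b +
        marg (real (W.trans (u'.2.2 s) s)) out b) / 3 := by
    have e1 : ∀ t : S → X, ∀ y, ∑ x, ind (t s = x) * real (W.trans x s) y =
        real (W.trans (t s) s) y := fun t y => sum_ind_mul (t s) fun x => real (W.trans x s) y
    simp only [model, strategy, div_mul_eq_mul_div, add_mul, Finset.sum_add_distrib,
      ← Finset.sum_div, e1, marg]
  have e2 : ∑ y, (strategy.model W).V s u' y * (ind (D.Agr u' u) * ind (out y = b)) =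
      ind (D.Agr u' u) * ∑ y, (strategy.model W).V s u' y * ind (out y = b) := by
    rw [Finset.mul_sum]
    exact Finset.sum_congr rfl fun y _ => by ring
  rw [← Finset.mul_sum, e2, e]
  simp only [Model.R, model, strategy]
  ring

section sums

variable {T : Type*} [Fintype T] (f : T → ℝ) (u : T × T × T)

lemma sum_agr_zero : ∑ u' : T × T × T, ind (Pat.zero.Agr u' u) * (f u'.1 + f u'.2.1 + f u'.2.2) =
    (Fintype.card T : ℝ) ^ 2 * f u.1 + 2 * Fintype.card T * ∑ t, f t := by
  simp only [Fintype.sum_prod_type, Pat.Agr, ind_comm_eq _ u.1, ← Finset.mul_sum]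
  rw [sum_ind_mul u.1 fun x => ∑ y, ∑ z, (f x + f y + f z)]
  simp only [Finset.sum_add_distrib, Finset.sum_const, Finset.card_univ, nsmul_eq_mul,
    ← Finset.mul_sum]
  ring

lemma sum_agr_one : ∑ u' : T × T × T, ind (Pat.one.Agr u' u) * (f u'.1 + f u'.2.1 + f u'.2.2) =
    (Fintype.card T : ℝ) * (f u.1 + f u.2.1) + ∑ t, f t := by
  simp only [Fintype.sum_prod_type, Pat.Agr, ind_and, ind_comm_eq _ u.1, ind_comm_eq _ u.2.1,
    mul_assoc, ← Finset.mul_sum]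
  rw [sum_ind_mul u.1 fun x => ∑ y, ind (u.2.1 = y) * ∑ z, (f x + f y + f z),
    sum_ind_mul u.2.1 fun y => ∑ z, (f u.1 + f y + f z)]
  simp only [Finset.sum_add_distrib, Finset.sum_const, Finset.card_univ, nsmul_eq_mul]
  ring

lemma sum_agr_two : ∑ u' : T × T × T, ind (Pat.two.Agr u' u) * (f u'.1 + f u'.2.1 + f u'.2.2) =
    (Fintype.card T : ℝ) * (f u.1 + f u.2.2) + ∑ t, f t := by
  simp only [Fintype.sum_prod_type, Pat.Agr, ind_and, ind_comm_eq _ u.1, ind_comm_eq _ u.2.2,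
    mul_assoc, ← Finset.mul_sum]
  rw [sum_ind_mul u.1 fun x => ∑ y, ∑ z, ind (u.2.2 = z) * (f x + f y + f z)]
  have e : ∀ y, ∑ z, ind (u.2.2 = z) * (f u.1 + f y + f z) = f u.1 + f y + f u.2.2 :=
    fun y => sum_ind_mul u.2.2 fun z => f u.1 + f y + f z
  simp only [e, Finset.sum_add_distrib, Finset.sum_const, Finset.card_univ, nsmul_eq_mul]
  ring

end sums

/-- If the output depends on the input for a possible state, then it tells more about each layer of
uniform strategies than the state. -/
theorem strategy_strict {s : S} (hs : real W.state s ≠ 0) {x x' : X} {b : O}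
    (hb : marg (real (W.trans x s)) out b ≠ marg (real (W.trans x' s)) out b) {D D' : Pat}
    (hD : D = .none ∧ D' = .zero ∨ D = .zero ∧ D' = .one ∨ D = .zero ∧ D' = .two) :
    (strategy.model W).entPat D' (fun x => out x.2) - (strategy.model W).entPat D (fun x => out x.2) <
      (strategy.model W).entPat D' Prod.fst - (strategy.model W).entPat D Prod.fst := by
  by_contra! hcon
  set N : ℝ := ((Fintype.card (S → X) : ℕ) : ℝ) with hN
  have hN0 : 0 < N := by rw [hN]; exact_mod_cast Fintype.card_pos
  set f := stratOut W out b with hf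
  -- two strategies that differ in the state `s` only
  set t : S → X := fun _ => x
  set t' : S → X := Function.update t s x'
  have hne : f t ≠ f t' := by
    rw [← sub_ne_zero, hf, stratOut, stratOut, ← Finset.sum_sub_distrib, Finset.sum_eq_single s]
    · rw [← mul_sub]
      refine mul_ne_zero hs (sub_ne_zero.2 ?_)
      simpa [t, t'] using hb
    · intro s' _ hs'
      simp [t, t', hs']
    · simp
  have hsum : ∑ s, real W.state s = 1 := sum_real _
  have hz : ∀ u s, (strategy.model W).margPat .none Prod.fst (Pat.none.proj u, s) = real W.state s :=
    fun u s => (strategy.model W).margPat_fst_none s u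
  have ho : ∀ u s, (strategy.model W).margPat .zero Prod.fst (Pat.zero.proj u, s) =
      real W.state s * N⁻¹ := fun u s => (strategy.model W).margPat_fst_zero s u
  have h0 : ∀ u : (S → X) × (S → X) × (S → X),
      ∑ s, (strategy.model W).margPat .zero Prod.fst (Pat.zero.proj u, s) ≠ 0 := by
    intro u
    simp only [ho, ← Finset.sum_mul, hsum]
    positivity
  have hc : (N⁻¹ ^ 3 / 3) ≠ 0 := by positivity
  refine hne ?_
  rcases hD with ⟨rfl, rfl⟩ | ⟨rfl, rfl⟩ | ⟨rfl, rfl⟩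
  · have h := (strategy.model W).margPat_eq_of_uniform (D := .none) (D' := .zero) trivial hN0
      (fun u s => by rw [hz, ho, mul_comm]) (fun u => by simp only [hz, hsum]; exact one_ne_zero)
      out hcon (u := (t, t, t)) (u' := (t', t, t)) rfl b
    rw [margPat_strategy, margPat_strategy, sum_agr_zero, sum_agr_zero] at h
    have h2 := mul_left_cancel₀ hc h
    exact mul_left_cancel₀ (pow_ne_zero 2 hN0.ne') (add_right_cancel h2)
  · have h := (strategy.model W).margPat_eq_of_uniform (D := .zero) (D' := .one) trivial hN0
      (fun u s => by
        rw [ho, (strategy.model W).margPat_fst_one, mul_comm N⁻¹]; rfl) h0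
      out hcon (u := (t, t, t)) (u' := (t, t', t)) rfl b
    rw [margPat_strategy, margPat_strategy, sum_agr_one, sum_agr_one] at h
    have h2 := mul_left_cancel₀ hc h
    exact add_left_cancel (mul_left_cancel₀ hN0.ne' (add_right_cancel h2))
  · have h := (strategy.model W).margPat_eq_of_uniform (D := .zero) (D' := .two) trivial hN0
      (fun u s => by
        rw [ho, (strategy.model W).margPat_fst_two, mul_comm N⁻¹]; rfl) h0
      out hcon (u := (t, t, t)) (u' := (t, t, t')) rfl b
    rw [margPat_strategy, margPat_strategy, sum_agr_two, sum_agr_two] at h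
    have h2 := mul_left_cancel₀ hc h
    exact add_left_cancel (mul_left_cancel₀ hN0.ne' (add_right_cancel h2))

end Encoder

/-! ### Receivers whose output does not depend on the input -/

/-- The output `out` of the channel does not depend on its input in possible states. -/
def Channel.InputFree {S X Y₁ Y₂ Z O : Type*} [Fintype Y₁] [Fintype Y₂] [Fintype Z]
    (W : Channel S X Y₁ Y₂ Z) (out : Y₁ × Y₂ × Z → O) : Prop :=
  ∀ s, real W.state s ≠ 0 → ∀ x x' b,
    marg (real (W.trans x s)) out b = marg (real (W.trans x' s)) out b

lemma Model.StateOnly.ne_zero {S U₀ U₁ U₂ Y O : Type*} [Fintype S] [Fintype U₀] [Fintype U₁]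
    [Fintype U₂] [Fintype Y] [Fintype O] {m : Model S U₀ U₁ U₂ Y} {out : Y → O} {w : S → O → ℝ}
    (hw : m.StateOnly out w) {s : S} {u : U₀ × U₁ × U₂} {y : Y} (ha : m.a s ≠ 0)
    (hV : m.V s u y ≠ 0) : w s (out y) ≠ 0 := by
  rw [← hw s ha u (out y)]
  have h := Finset.single_le_sum (fun y' _ => mul_nonneg (m.V_nonneg s u y')
    (ind_nonneg (out y' = out y))) (Finset.mem_univ y)
  rw [ind_of rfl, mul_one] at h
  exact ((lt_of_le_of_ne (m.V_nonneg s u y) hV.symm).trans_le h).ne'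

/-- A canonical representative of the fibre of `f` through `s`. -/
def rep {S α : Type*} [Nonempty S] (f : S → α) (s : S) : S := Function.invFun f (f s)

lemma apply_rep {S α : Type*} [Nonempty S] (f : S → α) (s : S) : f (rep f s) = f s :=
  Function.invFun_eq ⟨s, rfl⟩

lemma rep_congr {S α : Type*} [Nonempty S] {f : S → α} {s s' : S} (h : f s = f s') :
    rep f s = rep f s' := by rw [rep, rep, h]

lemma apply_eq_of_rep_eq {S α : Type*} [Nonempty S] {f : S → α} {s s' : S}
    (h : rep f s = rep f s') : f s = f s' := by
  rw [← apply_rep f s, h, apply_rep f s']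

/-- A function that is constant on each set of states compatible with an observation can be computed
from the observation. -/
lemma exists_observer {S O α : Type*} [Nonempty α] (R : S → O → Prop) (v : S → α)
    (h : ∀ s s' b, R s b → R s' b → v s = v s') : ∃ β : O → α, ∀ s b, R s b → β b = v s := by
  classical
  refine ⟨fun b => if hb : ∃ s, R s b then v hb.choose else Classical.arbitrary α,
    fun s b hs => ?_⟩
  have hb : ∃ s, R s b := ⟨s, hs⟩
  simp only [dif_pos hb]
  exact h _ _ b hb.choose_spec hs

namespace Encoder

variable {S U₀ U₁ U₂ X Y₁ Y₂ Z O : Type*} [Fintype S] [Fintype U₀] [Fintype U₁]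
  [Fintype U₂] [Fintype X] [Fintype Y₁] [Fintype Y₂] [Fintype Z] [Fintype O]

/-- Where `u₀` has probability zero, the kernels of the other layers do not depend on the
state. -/
def Normal (E : Encoder S U₀ U₁ U₂ X) : Prop :=
  ∀ s s' u, E.k₀ s u = 0 → E.k₀ s' u = 0 → E.k₁ s u = E.k₁ s' u ∧ E.k₂ s u = E.k₂ s' u

variable (E : Encoder S U₀ U₁ U₂ X) (W : Channel S X Y₁ Y₂ Z) (out : Y₁ × Y₂ × Z → O)

lemma stateOnly (h : W.InputFree out) (x₀ : X) :
    (E.model W).StateOnly out fun s b => marg (real (W.trans x₀ s)) out b := by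
  intro s hs u b
  simp only [model, Finset.sum_mul]
  rw [Finset.sum_comm]
  simp only [mul_assoc, ← Finset.mul_sum]
  have e : ∀ x, ∑ y, real (W.trans x s) y * ind (out y = b) = marg (real (W.trans x₀ s)) out b :=
    fun x => h s hs x x₀ b
  simp only [e, ← Finset.sum_mul, E.c_sum, one_mul]

variable {W out}

lemma k₀_eq (h : W.InputFree out) (x₀ : X)
    (he : (E.model W).entPat .zero (fun x => out x.2) - (E.model W).entPat .none (fun x => out x.2) ≤
      (E.model W).entPat .zero Prod.fst - (E.model W).entPat .none Prod.fst) {s s' : S} {b : O}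
    (hs : real W.state s * marg (real (W.trans x₀ s)) out b ≠ 0)
    (hs' : real W.state s' * marg (real (W.trans x₀ s')) out b ≠ 0) [Nonempty U₁] [Nonempty U₂] :
    E.k₀ s = E.k₀ s' := by
  funext u
  have h1 := (E.stateOnly W out h x₀).margPat_fst_eq he hs hs'
    (u, Classical.arbitrary U₁, Classical.arbitrary U₂)
  rw [Model.margPat_fst_zero, Model.margPat_fst_zero] at h1
  refine mul_left_cancel₀ (mul_ne_zero (left_ne_zero_of_mul hs) (left_ne_zero_of_mul hs')) ?_
  simp only [model] at h1
  linarith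

lemma k₁_eq (h : W.InputFree out) (x₀ : X) (hn : E.Normal)
    (he₀ : (E.model W).entPat .zero (fun x => out x.2) - (E.model W).entPat .none (fun x => out x.2) ≤
      (E.model W).entPat .zero Prod.fst - (E.model W).entPat .none Prod.fst)
    (he₁ : (E.model W).entPat .one (fun x => out x.2) - (E.model W).entPat .zero (fun x => out x.2) ≤
      (E.model W).entPat .one Prod.fst - (E.model W).entPat .zero Prod.fst) {s s' : S} {b : O}
    (hs : real W.state s * marg (real (W.trans x₀ s)) out b ≠ 0)
    (hs' : real W.state s' * marg (real (W.trans x₀ s')) out b ≠ 0) [Nonempty U₁] [Nonempty U₂] :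
    E.k₁ s = E.k₁ s' := by
  have h0 := E.k₀_eq h x₀ he₀ hs hs'
  funext u v
  by_cases hu : E.k₀ s u = 0
  · rw [(hn s s' u hu (by rw [← h0, hu])).1]
  have h1 := (E.stateOnly W out h x₀).margPat_fst_eq (D := .one) (by linarith) hs hs'
    (u, v, Classical.arbitrary U₂)
  rw [Model.margPat_fst_one, Model.margPat_fst_one] at h1
  simp only [model, ← h0] at h1
  refine mul_left_cancel₀ (mul_ne_zero (mul_ne_zero (left_ne_zero_of_mul hs)
    (left_ne_zero_of_mul hs')) hu) ?_
  linarith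

lemma k₂_eq (h : W.InputFree out) (x₀ : X) (hn : E.Normal)
    (he₀ : (E.model W).entPat .zero (fun x => out x.2) - (E.model W).entPat .none (fun x => out x.2) ≤
      (E.model W).entPat .zero Prod.fst - (E.model W).entPat .none Prod.fst)
    (he₂ : (E.model W).entPat .two (fun x => out x.2) - (E.model W).entPat .zero (fun x => out x.2) ≤
      (E.model W).entPat .two Prod.fst - (E.model W).entPat .zero Prod.fst) {s s' : S} {b : O}
    (hs : real W.state s * marg (real (W.trans x₀ s)) out b ≠ 0)
    (hs' : real W.state s' * marg (real (W.trans x₀ s')) out b ≠ 0) [Nonempty U₁] [Nonempty U₂] :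
    E.k₂ s = E.k₂ s' := by
  have h0 := E.k₀_eq h x₀ he₀ hs hs'
  funext u v
  by_cases hu : E.k₀ s u = 0
  · rw [(hn s s' u hu (by rw [← h0, hu])).2]
  have h1 := (E.stateOnly W out h x₀).margPat_fst_eq (D := .two) (by linarith) hs hs'
    (u, Classical.arbitrary U₁, v)
  rw [Model.margPat_fst_two, Model.margPat_fst_two] at h1
  simp only [model, ← h0] at h1
  refine mul_left_cancel₀ (mul_ne_zero (mul_ne_zero (left_ne_zero_of_mul hs)
    (left_ne_zero_of_mul hs')) hu) ?_
  linarith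

/-! ### Small perturbations -/

lemma continuous_etaLog : Continuous etaLog := by
  have e : etaLog = fun x => Real.negMulLog x / Real.log 2 := by
    funext x
    rw [etaLog, Real.negMulLog, Real.logb]; ring
  rw [e]
  exact Real.continuous_negMulLog.div_const _

lemma tendsto_binEnt : Filter.Tendsto binEnt (nhds 0) (nhds 0) := by
  have h : Continuous binEnt :=
    (continuous_etaLog.comp (continuous_const.sub continuous_id)).add continuous_etaLog
  have h0 : binEnt 0 = 0 := by simp [binEnt, etaLog]
  simpa [h0] using h.tendsto 0

variable {T₀ T₁ T₂ : Type*} [Fintype T₀] [Fintype T₁] [Fintype T₂] (W)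

/-- Rare use of another encoder hardly changes the entropies. -/
lemma eventually_entPat_mix_close (x₀ : X) (E' : Encoder S T₀ T₁ T₂ X) (D : Pat)
    (B : S × (Y₁ × Y₂ × Z) → O) {δ : ℝ} (hδ : 0 < δ) :
    ∀ᶠ θ : ℝ in nhdsWithin 0 (Set.Ioi 0), ∀ (hθ : 0 ≤ θ) (hθ' : θ ≤ 1),
      |((mix θ hθ hθ' x₀ E E').model W).entPat D B - (E.model W).entPat D B| ≤ δ := by
  set e := (E.model W).entPat D B
  set e' := (E'.model W).entPat D B
  have h1 : Filter.Tendsto (fun θ : ℝ => (1 - θ) * e + θ * e') (nhds 0) (nhds e) := by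
    have : Continuous fun θ : ℝ => (1 - θ) * e + θ * e' := by fun_prop
    simpa using this.tendsto 0
  have h2 : Filter.Tendsto (fun θ : ℝ => (1 - θ) * e + θ * e' + binEnt θ) (nhds 0) (nhds e) := by
    simpa using h1.add tendsto_binEnt
  have l := nhdsWithin_le_nhds (a := (0 : ℝ)) (s := Set.Ioi 0)
  have h1' := (h1.mono_left l).eventually (lt_mem_nhds (show e - δ < e by linarith))
  have h2' := (h2.mono_left l).eventually (lt_mem_nhds (show e - δ < e by linarith))
  have h2'' := (h2.mono_left l).eventually (gt_mem_nhds (show e < e + δ by linarith))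
  filter_upwards [h1', h2', h2''] with θ a1 a2 a3 hθ hθ'
  rw [abs_le]
  by_cases hD : D = .none
  · subst hD
    have b1 := entPat_none_mix_le hθ hθ' x₀ E E' W B
    have b2 := le_entPat_none_mix hθ hθ' x₀ E E' W B
    constructor <;> linarith
  · rw [entPat_mix hθ hθ' x₀ E E' W hD]
    constructor <;> linarith

end Encoder

/-! ### Achievability for single-letter encoders -/

namespace Encoder

variable {S U₀ U₁ U₂ X Y₁ Y₂ Z : Type*} [Fintype S] [Fintype U₀] [Fintype U₁]
  [Fintype U₂] [Fintype X] [Fintype Y₁] [Fintype Y₂] [Fintype Z]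

lemma logb_two_pow_floor (n : ℕ) (r : ℝ) :
    Real.logb 2 ((2 ^ ⌊(n : ℝ) * r⌋₊ : ℕ) : ℝ) = ⌊(n : ℝ) * r⌋₊ := by
  push_cast
  rw [Real.logb_pow, Real.logb_self_eq_one one_lt_two, mul_one]

/-- Good schemes for the auxiliary layers in long blocks give good protocols. -/
lemma eventually_isGood_of_scheme [Nonempty X] (E : Encoder S U₀ U₁ U₂ X) (W : Channel S X Y₁ Y₂ Z)
    {r₀ r₁ r₂ R₀ R₁ R₂ ε' : ℝ} (hr₀ : 0 ≤ r₀) (hr₁ : 0 ≤ r₁) (hr₂ : 0 ≤ r₂) (hε' : 0 < ε')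
    (hR₀ : r₀ ≤ R₀) (hR₁ : r₁ ≤ R₁) (hR₂ : r₂ ≤ R₂)
    (hR₀' : R₀ - ε' < r₀) (hR₁' : R₁ - ε' < r₁) (hR₂' : R₂ - ε' < r₂)
    (h : ∀ ε : ℝ, 0 < ε → ∀ᶠ n : ℕ in Filter.atTop,
      ∃ (Q : (Fin n → S) → (Fin n → U₀) × (Fin n → U₁) × (Fin n → U₂) → ℝ)
      (ξ : ((Fin n → U₀) → Fin (2 ^ ⌊(n : ℝ) * r₀⌋₊)) ×
        ((Fin n → U₀) × (Fin n → U₁) → Fin (2 ^ ⌊(n : ℝ) * r₁⌋₊)) ×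
        ((Fin n → U₀) × (Fin n → U₂) → Fin (2 ^ ⌊(n : ℝ) * r₂⌋₊)))
      (D₁ : (Fin n → Y₁) → (Fin n → U₀) × (Fin n → U₁))
      (D₂ : (Fin n → Y₂) → (Fin n → U₀) × (Fin n → U₂)),
      (∀ s u, 0 ≤ Q s u) ∧ (∀ s, ∑ u, Q s u ≤ ((E.model W).pow n).a s) ∧
      (1 - 700 * ε ≤ ∑ s, ∑ u, Q s u) ∧
      (∑ s, ∑ u, ∑ y, Q s u * ((E.model W).pow n).V s u y *
        ind (D₁ (fun i => (y i).1) ≠ (u.1, u.2.1)) ≤ 1200 * ε) ∧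
      (∑ s, ∑ u, ∑ y, Q s u * ((E.model W).pow n).V s u y *
        ind (D₂ (fun i => (y i).2.1) ≠ (u.1, u.2.2)) ≤ 1200 * ε) ∧
      ((E.model W).pow n).keyDev Q (fun _ _ _ => True) (fun y i => (y i).2.2) (Model.keyOf ξ)
        (((2 ^ ⌊(n : ℝ) * r₀⌋₊ : ℕ) : ℝ) * (2 ^ ⌊(n : ℝ) * r₁⌋₊ : ℕ) * (2 ^ ⌊(n : ℝ) * r₂⌋₊ : ℕ)) ≤
        2700 * ε ∧
      ((E.model W).pow n).keyDev Q (fun _ _ _ => True) (fun y i => (y i).2.1)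
        (fun u => (Model.keyOf ξ u).2.1) ((2 ^ ⌊(n : ℝ) * r₁⌋₊ : ℕ) : ℝ) ≤ 2700 * ε ∧
      ((E.model W).pow n).keyDev Q (fun _ _ _ => True) (fun y i => (y i).1)
        (fun u => (Model.keyOf ξ u).2.2) ((2 ^ ⌊(n : ℝ) * r₂⌋₊ : ℕ) : ℝ) ≤ 2700 * ε) :
    ∀ᶠ n : ℕ in Filter.atTop, ∃ P : Protocol S X Y₁ Y₂ n R₀ R₁ R₂, P.IsGood W ε' := by
  set ε : ℝ := ε' / (40000 * (r₀ + r₁ + r₂ + 3)) with hε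
  have hε0 : 0 < ε := by positivity
  have hmul : 40000 * (r₀ + r₁ + r₂ + 3) * ε = ε' := by rw [hε]; field_simp
  have hlarge : ∀ {r R : ℝ}, R - ε' < r → 0 ≤ r →
      ∀ᶠ n : ℕ in Filter.atTop, (n : ℝ) * (R - ε') < Real.logb 2 ((2 ^ ⌊(n : ℝ) * r⌋₊ : ℕ) : ℝ) := by
    intro r R hr h0
    have hpos : 0 < r - (R - ε') := by linarith
    filter_upwards [Filter.eventually_ge_atTop ⌈1 / (r - (R - ε'))⌉₊] with n hn
    rw [logb_two_pow_floor]
    have h1 : 1 / (r - (R - ε')) ≤ n := (Nat.le_ceil _).trans (by exact_mod_cast hn)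
    rw [div_le_iff₀ hpos] at h1
    have h2 := Nat.lt_floor_add_one ((n : ℝ) * r)
    linarith
  filter_upwards [h ε hε0, hlarge hR₀' hr₀, hlarge hR₁' hr₁, hlarge hR₂' hr₂,
    Filter.eventually_gt_atTop 0] with n ⟨Q, ξ, D₁, D₂, c1, c2, c3, c4, c5, c6, c7, c8⟩ l₀ l₁ l₂ hn
  have hn1 : (1 : ℝ) ≤ n := by exact_mod_cast hn
  have hpow : ∀ {r R : ℝ}, r ≤ R → 2 ^ ⌊(n : ℝ) * r⌋₊ ≤ 2 ^ ⌊(n : ℝ) * R⌋₊ := fun h =>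
    Nat.pow_le_pow_right two_pos (Nat.floor_le_floor (mul_le_mul_of_nonneg_left h (by positivity)))
  have hfl : ∀ {r : ℝ}, 0 ≤ r → (⌊(n : ℝ) * r⌋₊ : ℝ) ≤ n * r := fun h =>
    Nat.floor_le (by positivity)
  refine exists_isGood W hn ((E.model W).pow n)
    (fun s => by rw [real_piPMF]; rfl)
    (fun s u x => ∏ i, E.c (s i) (Model.nth u i) (x i))
    (fun s u x => Finset.prod_nonneg fun i _ => E.c_nonneg _ _ _)
    (fun s u => by
      rw [sum_pi_prod fun i => E.c (s i) (Model.nth u i)]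
      exact Finset.prod_eq_one fun i _ => E.c_sum _ _)
    (fun s u y => by
      simp only [real_piPMF, ← Finset.prod_mul_distrib]
      rw [sum_pi_prod fun i x => E.c (s i) (Model.nth u i) x * real (W.trans x (s i)) (y i)]
      rfl)
    (by positivity) (by positivity) (by positivity) (hpow hR₀) (hpow hR₁) (hpow hR₂)
    Q ξ D₁ D₂ c1 c2 c3 c4 c5 c6 c7 c8 (by nlinarith) ?_ l₀ l₁ l₂
  rw [Real.logb_mul (by positivity) (by positivity), Real.logb_mul (by positivity) (by positivity),
    logb_two_pow_floor, logb_two_pow_floor, logb_two_pow_floor]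
  have a := hfl hr₀
  have b := hfl hr₁
  have c := hfl hr₂
  have d : (⌊(n : ℝ) * r₀⌋₊ + ⌊(n : ℝ) * r₁⌋₊ + ⌊(n : ℝ) * r₂⌋₊ + 2 : ℝ) ≤
      n * (r₀ + r₁ + r₂ + 3) := by nlinarith
  have e := mul_le_mul_of_nonneg_right d (show 0 ≤ 20000 * ε by positivity)
  have f : n * (r₀ + r₁ + r₂ + 3) * (20000 * ε) = n * ε' / 2 := by rw [← hmul]; ring
  have g : 0 < (n : ℝ) * ε' := by positivity
  linarith

end Encoder

/-! ### Removing the degenerate cases -/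

namespace Encoder

variable {S U₀ U₁ U₂ T₀ T₁ T₂ X Y₁ Y₂ Z O : Type*} [Fintype S] [Fintype U₀] [Fintype U₁]
  [Fintype U₂] [Fintype T₀] [Fintype T₁] [Fintype T₂] [Fintype X] [Fintype Y₁] [Fintype Y₂]
  [Fintype Z] [Fintype O]

/-- Mixing turns a weak inequality between the information that an output and the state give about a
layer into a strict one, if the second encoder satisfies it strictly. -/
lemma entPat_mix_lt {θ : ℝ} (hθ : 0 < θ) (hθ' : θ ≤ 1) (x₀ : X) (E : Encoder S U₀ U₁ U₂ X)
    (E' : Encoder S T₀ T₁ T₂ X) (W : Channel S X Y₁ Y₂ Z) (out : Y₁ × Y₂ × Z → O) {D D' : Pat}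
    (hD' : D' ≠ .none)
    (h : (E.model W).entPat D' (fun x => out x.2) - (E.model W).entPat D (fun x => out x.2) ≤
      (E.model W).entPat D' Prod.fst - (E.model W).entPat D Prod.fst)
    (h' : (E'.model W).entPat D' (fun x => out x.2) - (E'.model W).entPat D (fun x => out x.2) <
      (E'.model W).entPat D' Prod.fst - (E'.model W).entPat D Prod.fst) :
    ((mix θ hθ.le hθ' x₀ E E').model W).entPat D' (fun x => out x.2) -
        ((mix θ hθ.le hθ' x₀ E E').model W).entPat D (fun x => out x.2) <
      ((mix θ hθ.le hθ' x₀ E E').model W).entPat D' Prod.fst -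
        ((mix θ hθ.le hθ' x₀ E E').model W).entPat D Prod.fst := by
  have a := mul_le_mul_of_nonneg_left h (sub_nonneg.2 hθ')
  have b := mul_lt_mul_of_pos_left h' hθ
  rw [entPat_mix _ _ _ _ _ _ hD', entPat_mix _ _ _ _ _ _ hD']
  by_cases hD : D = .none
  · subst hD
    have c := le_entPat_none_mix hθ.le hθ' x₀ E E' W (fun x => out x.2)
    have d₁ := E.entPat_none_fst W
    have d₂ := E'.entPat_none_fst W
    have d₃ := (mix θ hθ.le hθ' x₀ E E').entPat_none_fst W
    rw [d₁] at a
    rw [d₂] at b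
    rw [d₃]
    linarith
  · rw [entPat_mix _ _ _ _ _ _ hD, entPat_mix _ _ _ _ _ _ hD]
    linarith

/-- An output that depends on the input of the channel tells strictly more about each layer than the
state, once the layers are mixed with strategies. -/
lemma entPat_mix_strategy_lt [DecidableEq S] [Nonempty X] {θ : ℝ} (hθ : 0 < θ) (hθ' : θ ≤ 1)
    (x₀ : X) (E : Encoder S U₀ U₁ U₂ X) (W : Channel S X Y₁ Y₂ Z) (out : Y₁ × Y₂ × Z → O)
    (hout : ¬W.InputFree out) {D D' : Pat}
    (hD : D = .none ∧ D' = .zero ∨ D = .zero ∧ D' = .one ∨ D = .zero ∧ D' = .two)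
    (h : (E.model W).entPat D' (fun x => out x.2) - (E.model W).entPat D (fun x => out x.2) ≤
      (E.model W).entPat D' Prod.fst - (E.model W).entPat D Prod.fst) :
    ((mix θ hθ.le hθ' x₀ E strategy).model W).entPat D' (fun x => out x.2) -
        ((mix θ hθ.le hθ' x₀ E strategy).model W).entPat D (fun x => out x.2) <
      ((mix θ hθ.le hθ' x₀ E strategy).model W).entPat D' Prod.fst -
        ((mix θ hθ.le hθ' x₀ E strategy).model W).entPat D Prod.fst := by
  obtain ⟨s, hs, x, x', b, hb⟩ : ∃ s, real W.state s ≠ 0 ∧ ∃ x x' b,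
      marg (real (W.trans x s)) out b ≠ marg (real (W.trans x' s)) out b := by
    simpa [Channel.InputFree] using hout
  exact entPat_mix_lt hθ hθ' x₀ E strategy W out
    (by rcases hD with ⟨-, rfl⟩ | ⟨-, rfl⟩ | ⟨-, rfl⟩ <;> decide) h (strategy_strict W out hs hb hD)

variable (E : Encoder S U₀ U₁ U₂ X) (W : Channel S X Y₁ Y₂ Z)

/-- The joint entropy of the layers in `D` and the state. -/
abbrev entS (D : Pat) : ℝ := (E.model W).entPat D Prod.fst

/-- The joint entropy of the layers in `D` and the output of receiver 1. -/
abbrev entY₁ (D : Pat) : ℝ := (E.model W).entPat D (fun x => x.2.1)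

/-- The joint entropy of the layers in `D` and the output of receiver 2. -/
abbrev entY₂ (D : Pat) : ℝ := (E.model W).entPat D (fun x => x.2.2.1)

/-- The joint entropy of the layers in `D` and the output of the eavesdropper. -/
abbrev entZ (D : Pat) : ℝ := (E.model W).entPat D (fun x => x.2.2.2)

/-- The equivocation of `u₀` at the worse receiver. -/
abbrev equiv₀ : ℝ := max (E.entY₁ W .zero - E.entY₁ W .none) (E.entY₂ W .zero - E.entY₂ W .none)

/-- The equivocation of `u₁` at receiver 1 given `u₀`. -/
abbrev equiv₁ : ℝ := E.entY₁ W .one - E.entY₁ W .zero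

/-- The equivocation of `u₂` at receiver 2 given `u₀`. -/
abbrev equiv₂ : ℝ := E.entY₂ W .two - E.entY₂ W .zero

variable {E W}

/-- Achievability for an encoder whose layers tell each receiver at least as much as the state, and
rates that satisfy the conditions with some slack `γ`. -/
theorem eventually_isGood [Nonempty U₀] [Nonempty U₁] [Nonempty U₂] [Nonempty X] (hn : E.Normal)
    (hc₀₁ : E.entY₁ W .zero - E.entY₁ W .none ≤ E.entS W .zero - E.entS W .none)
    (hc₀₂ : E.entY₂ W .zero - E.entY₂ W .none ≤ E.entS W .zero - E.entS W .none)
    (hc₁ : E.entY₁ W .one - E.entY₁ W .zero ≤ E.entS W .one - E.entS W .zero)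
    (hc₂ : E.entY₂ W .two - E.entY₂ W .zero ≤ E.entS W .two - E.entS W .zero)
    {r₀ r₁ r₂ R₀ R₁ R₂ ε' γ : ℝ} (hr₀ : 0 ≤ r₀) (hr₁ : 0 ≤ r₁) (hr₂ : 0 ≤ r₂) (hε' : 0 < ε')
    (hR₀ : r₀ ≤ R₀) (hR₁ : r₁ ≤ R₁) (hR₂ : r₂ ≤ R₂)
    (hR₀' : R₀ - ε' < r₀) (hR₁' : R₁ - ε' < r₁) (hR₂' : R₂ - ε' < r₂) (hγ : 0 < γ)
    (hr : ∀ D, D.sm r₀ r₁ r₂ = 0 ∨ D.sm r₀ r₁ r₂ + γ ≤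
      E.entZ W D - E.entZ W .none - D.sm (E.equiv₀ W) (E.equiv₁ W) (E.equiv₂ W))
    (hp₁ : r₁ = 0 ∨ r₁ + γ ≤ E.entY₂ W .all - E.entY₂ W .two - E.equiv₁ W)
    (hp₂ : r₂ = 0 ∨ r₂ + γ ≤ E.entY₁ W .all - E.entY₁ W .one - E.equiv₂ W) :
    ∀ᶠ n : ℕ in Filter.atTop, ∃ P : Protocol S X Y₁ Y₂ n R₀ R₁ R₂, P.IsGood W ε' := by
  classical
  have x₀ : X := Classical.arbitrary X
  obtain ⟨s₀, -⟩ := W.state.support_nonempty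
  have : Nonempty S := ⟨s₀⟩
  -- Mix with strategies so rarely that the entropies move by at most `γ / 20`. Each rate condition
  -- involves at most eight of them and keeps the slack `γ / 2`.
  have hδ : 0 < γ / 20 := by positivity
  obtain ⟨θ, ⟨⟨hy₁, hy₂⟩, hz⟩, hθ, hθ'⟩ := (((Filter.eventually_all.2 fun D =>
    E.eventually_entPat_mix_close W x₀ strategy D (fun x => x.2.1) hδ).and
    (Filter.eventually_all.2 fun D =>
    E.eventually_entPat_mix_close W x₀ strategy D (fun x => x.2.2.1) hδ)).and
    (Filter.eventually_all.2 fun D =>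
    E.eventually_entPat_mix_close W x₀ strategy D (fun x => x.2.2.2) hδ)).and
    (Ioo_mem_nhdsGT (zero_lt_one' ℝ)) |>.exists
  replace hy₁ := fun D => abs_le.1 (hy₁ D hθ.le hθ'.le)
  replace hy₂ := fun D => abs_le.1 (hy₂ D hθ.le hθ'.le)
  replace hz := fun D => abs_le.1 (hz D hθ.le hθ'.le)
  set M := mix θ hθ.le hθ'.le x₀ E strategy with hM
  have hk₀ : ∀ s s', E.k₀ s = E.k₀ s' → M.k₀ s = M.k₀ s' := fun s s' h => by
    simp only [hM, mix, h]; rfl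
  have hk₁ : ∀ s s', E.k₁ s = E.k₁ s' → M.k₁ s = M.k₁ s' := fun s s' h => by
    simp only [hM, mix, h]; rfl
  have hk₂ : ∀ s s', E.k₂ s = E.k₂ s' → M.k₂ s = M.k₂ s' := fun s s' h => by
    simp only [hM, mix, h]; rfl
  -- A receiver whose output is free of the input knows the kernels of its layers, by the case of
  -- equality in the data processing inequality.
  obtain ⟨β₁, hβ₁⟩ : ∃ β₁ : Y₁ → S, W.InputFree (fun y => y.1) → ∀ s b,
      real W.state s * marg (real (W.trans x₀ s)) (fun y => y.1) b ≠ 0 →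
      β₁ b = rep (fun s => (E.k₀ s, E.k₁ s)) s := by
    by_cases h : W.InputFree (fun y => y.1)
    · obtain ⟨β, hβ⟩ := exists_observer
        (fun s b => real W.state s * marg (real (W.trans x₀ s)) (fun y => y.1) b ≠ 0)
        (rep fun s => (E.k₀ s, E.k₁ s))
        fun s s' b hs hs' => rep_congr (Prod.ext (E.k₀_eq h x₀ hc₀₁ hs hs')
          (E.k₁_eq h x₀ hn hc₀₁ hc₁ hs hs'))
      exact ⟨β, fun _ => hβ⟩
    · exact ⟨fun _ => s₀, fun h' => absurd h' h⟩
  obtain ⟨β₂, hβ₂⟩ : ∃ β₂ : Y₂ → S, W.InputFree (fun y => y.2.1) → ∀ s b,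
      real W.state s * marg (real (W.trans x₀ s)) (fun y => y.2.1) b ≠ 0 →
      β₂ b = rep (fun s => (E.k₀ s, E.k₂ s)) s := by
    by_cases h : W.InputFree (fun y => y.2.1)
    · obtain ⟨β, hβ⟩ := exists_observer
        (fun s b => real W.state s * marg (real (W.trans x₀ s)) (fun y => y.2.1) b ≠ 0)
        (rep fun s => (E.k₀ s, E.k₂ s))
        fun s s' b hs hs' => rep_congr (Prod.ext (E.k₀_eq h x₀ hc₀₂ hs hs')
          (E.k₂_eq h x₀ hn hc₀₂ hc₂ hs hs'))
      exact ⟨β, fun _ => hβ⟩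
    · exact ⟨fun _ => s₀, fun h' => absurd h' h⟩
  have hF₀ : M.equiv₀ W ≤ E.equiv₀ W + γ / 10 := by
    refine max_le ?_ ?_
    · have := le_max_left (E.entY₁ W .zero - E.entY₁ W .none) (E.entY₂ W .zero - E.entY₂ W .none)
      linarith [hy₁ .zero, hy₁ .none]
    · have := le_max_right (E.entY₁ W .zero - E.entY₁ W .none) (E.entY₂ W .zero - E.entY₂ W .none)
      linarith [hy₂ .zero, hy₂ .none]
  have hF₁ : M.equiv₁ W ≤ E.equiv₁ W + γ / 10 := by
    linarith [hy₁ .zero, hy₁ .one]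
  have hF₂ : M.equiv₂ W ≤ E.equiv₂ W + γ / 10 := by
    linarith [hy₂ .zero, hy₂ .two]
  refine eventually_isGood_of_scheme M W hr₀ hr₁ hr₂ hε' hR₀ hR₁ hR₂ hR₀' hR₁' hR₂' fun ε hε =>
    (M.model W).eventually_one_shot (fun y => y.1) (fun y => y.2.1) (fun y => y.2.2)
      (rep E.k₀) (rep fun s => (E.k₀ s, E.k₁ s)) (rep fun s => (E.k₀ s, E.k₂ s))
      (fun s s' h => hk₀ s s' (apply_eq_of_rep_eq h))
      (fun s s' h => hk₁ s s' (Prod.ext_iff.1 (apply_eq_of_rep_eq h)).2)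
      (fun s s' h => hk₂ s s' (Prod.ext_iff.1 (apply_eq_of_rep_eq h)).2)
      (fun s => rep_congr (Prod.ext_iff.1 (apply_rep (fun s => (E.k₀ s, E.k₁ s)) s)).1)
      (fun s => rep_congr (Prod.ext_iff.1 (apply_rep (fun s => (E.k₀ s, E.k₂ s)) s)).1)
      (W.InputFree fun y => y.1) (W.InputFree fun y => y.2.1)
      β₁ (fun h s u y ha hV => hβ₁ h s _ (mul_ne_zero ha ((M.stateOnly W _ h x₀).ne_zero ha hV)))
      β₂ (fun h s u y ha hV => hβ₂ h s _ (mul_ne_zero ha ((M.stateOnly W _ h x₀).ne_zero ha hV)))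
      (F₀ := M.equiv₀ W) (F₁ := M.equiv₁ W) (F₂ := M.equiv₂ W) (γ := γ / 2)
      (le_max_of_le_left (sub_nonneg.2 ((M.model W).entPat_mono (D := .none) (D' := .zero) trivial _)))
      (sub_nonneg.2 ((M.model W).entPat_mono (D := .zero) (D' := .one) trivial _))
      (sub_nonneg.2 ((M.model W).entPat_mono (D := .zero) (D' := .two) trivial _))
      hr₀ hr₁ hr₂ (by positivity) (le_max_left _ _) (le_max_right _ _) le_rfl le_rfl
      (fun h => ?_) (fun h => (M.stateOnly W _ h x₀).entPat_fst_sub_le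
        (D := .zero) (D' := .one) trivial)
      (fun h => (M.stateOnly W _ h x₀).entPat_fst_sub_le
        (D := .zero) (D' := .two) trivial)
      (fun h => entPat_mix_strategy_lt hθ hθ'.le x₀ E W _ h (by simp) hc₀₁)
      (fun h => entPat_mix_strategy_lt hθ hθ'.le x₀ E W _ h (by simp) hc₁)
      (fun h => entPat_mix_strategy_lt hθ hθ'.le x₀ E W _ h (by simp) hc₀₂)
      (fun h => entPat_mix_strategy_lt hθ hθ'.le x₀ E W _ h (by simp) hc₂)
      (fun D => (hr D).imp_right fun h => ?_)
      (hp₁.imp_right fun h => ?_) (hp₂.imp_right fun h => ?_) hε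
  · rcases h with h | h
    · exact ((M.stateOnly W _ h x₀).entPat_fst_sub_le (D := .none) (D' := .zero) trivial).trans (le_max_left _ _)
    · exact ((M.stateOnly W _ h x₀).entPat_fst_sub_le (D := .none) (D' := .zero) trivial).trans (le_max_right _ _)
  · have hs : D.sm (M.equiv₀ W) (M.equiv₁ W) (M.equiv₂ W) ≤
        D.sm (E.equiv₀ W) (E.equiv₁ W) (E.equiv₂ W) + 3 * (γ / 10) := by
      cases D <;> simp only [Pat.sm] <;> linarith
    linarith [hz D, hz .none]
  · linarith [hy₂ .all, hy₂ .two]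
  · linarith [hy₁ .all, hy₁ .one]

end Encoder

/-! ### The encoder of an input distribution -/

lemma real_bind {α β : Type*} [Fintype α] (p : PMF α) (q : α → PMF β) (b : β) :
    real (p.bind q) b = ∑ a, real p a * real (q a) b := by
  simp only [real, PMF.bind_apply]
  rw [tsum_fintype, ENNReal.toReal_sum fun a _ => ENNReal.mul_ne_top (p.apply_ne_top a)
    ((q a).apply_ne_top b)]
  simp only [ENNReal.toReal_mul]

section ofPMF

variable {S U₀ U₁ U₂ X Y₁ Y₂ Z : Type*} [Fintype S] [Fintype U₀] [Fintype U₁] [Fintype U₂]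
  [Fintype X] [Fintype Y₁] [Fintype Y₂] [Fintype Z]

/-- The encoder with the given conditional laws; where `u₀` has probability zero, the laws of the
other layers are replaced by those in the state `s₀`, so that the encoder is normal. -/
def Encoder.ofPMF (s₀ : S) (pU₀ : S → PMF U₀) (pU₁ : S → U₀ → PMF U₁) (pU₂ : S → U₀ → PMF U₂)
    (pX : S → U₀ → U₁ → U₂ → PMF X) : Encoder S U₀ U₁ U₂ X where
  k₀ s := real (pU₀ s)
  k₁ s u := real (pU₁ (if real (pU₀ s) u = 0 then s₀ else s) u)
  k₂ s u := real (pU₂ (if real (pU₀ s) u = 0 then s₀ else s) u)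
  c s u := real (pX s u.1 u.2.1 u.2.2)
  k₀_nonneg _ _ := real_nonneg _ _
  k₁_nonneg _ _ _ := real_nonneg _ _
  k₂_nonneg _ _ _ := real_nonneg _ _
  c_nonneg _ _ _ := real_nonneg _ _
  k₀_sum _ := sum_real _
  k₁_sum _ _ := sum_real _
  k₂_sum _ _ := sum_real _
  c_sum _ _ := sum_real _

variable (s₀ : S) (pU₀ : S → PMF U₀) (pU₁ : S → U₀ → PMF U₁) (pU₂ : S → U₀ → PMF U₂)
    (pX : S → U₀ → U₁ → U₂ → PMF X) (W : Channel S X Y₁ Y₂ Z)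

lemma Encoder.normal_ofPMF : (Encoder.ofPMF s₀ pU₀ pU₁ pU₂ pX).Normal := by
  intro s s' u h h'
  simp only [ofPMF] at h h' ⊢
  rw [if_pos h, if_pos h']
  exact ⟨rfl, rfl⟩

/-- The state, layers and outputs of a letter. -/
def Letter.visible (l : Letter S U₀ U₁ U₂ X Y₁ Y₂ Z) : S × (U₀ × U₁ × U₂) × (Y₁ × Y₂ × Z) :=
  (l.s, (l.u₀, l.u₁, l.u₂), (l.y₁, l.y₂, l.z))

lemma real_map_letterLaw {α : Type*} (g : S × (U₀ × U₁ × U₂) × (Y₁ × Y₂ × Z) → α) (a : α) :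
    real ((W.letterLaw pU₀ pU₁ pU₂ pX).map fun l => g l.visible) a =
      marg ((Encoder.ofPMF s₀ pU₀ pU₁ pU₂ pX).model W).law g a := by
  simp only [Channel.letterLaw, PMF.map_bind, PMF.map_comp, real_bind, real_map]
  rw [marg, Model.sum_law_mul]
  refine Finset.sum_congr rfl fun s _ => ?_
  simp only [Fintype.sum_prod_type (α₂ := U₁ × U₂), Fintype.sum_prod_type (α₂ := U₂), Finset.mul_sum]
  refine Finset.sum_congr rfl fun u₀ _ => Finset.sum_congr rfl fun u₁ _ =>
    Finset.sum_congr rfl fun u₂ _ => ?_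
  simp only [marg, Encoder.model, Finset.sum_mul, Finset.mul_sum]
  rw [Finset.sum_comm]
  refine Finset.sum_congr rfl fun y _ => Finset.sum_congr rfl fun x _ => ?_
  simp only [Model.R, Encoder.ofPMF, Function.comp, Letter.visible]
  by_cases h : real (pU₀ s) u₀ = 0
  · simp only [h, mul_zero, zero_mul]
  · simp only [if_neg h]; ring

/-- Shannon entropies of an input distribution that do not involve the input are entropies of
layers. -/
lemma H_letterLaw {α O : Type*} [Fintype α] [Fintype O] (D : Pat) (B : S × (Y₁ × Y₂ × Z) → O)
    (f : Letter S U₀ U₁ U₂ X Y₁ Y₂ Z → α)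
    (h : ∀ l l', f l = f l' ↔ D.Agr l.visible.2.1 l'.visible.2.1 ∧
      B (l.visible.1, l.visible.2.2) = B (l'.visible.1, l'.visible.2.2)) :
    H (W.letterLaw pU₀ pU₁ pU₂ pX) f =
      ((Encoder.ofPMF s₀ pU₀ pU₁ pU₂ pX).model W).entPat D B := by
  obtain ⟨l₀, -⟩ := (W.letterLaw pU₀ pU₁ pU₂ pX).support_nonempty
  set g : S × (U₀ × U₁ × U₂) × (Y₁ × Y₂ × Z) → α := fun ω =>
    f ⟨ω.1, ω.2.1.1, ω.2.1.2.1, ω.2.1.2.2, l₀.x, ω.2.2.1, ω.2.2.2.1, ω.2.2.2.2⟩ with hg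
  have hf : f = fun l => g l.visible := by
    funext l
    exact (h _ _).2 ⟨D.agr_refl _, rfl⟩
  have e : H (W.letterLaw pU₀ pU₁ pU₂ pX) f =
      ent ((Encoder.ofPMF s₀ pU₀ pU₁ pU₂ pX).model W).law g := by
    rw [hf]
    exact Finset.sum_congr rfl fun a _ => congrArg etaLog (real_map_letterLaw s₀ _ _ _ _ _ _ _)
  rw [e]
  refine ent_congr _ fun ω ω' => ?_
  rw [hg]
  simp only [Prod.mk.injEq, Pat.proj_eq_iff]
  exact h _ _

lemma I_letterLaw {α β O : Type*} [Fintype α] [Fintype β] [Fintype O] (D : Pat)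
    (B : S × (Y₁ × Y₂ × Z) → O) (f : Letter S U₀ U₁ U₂ X Y₁ Y₂ Z → α)
    (b : Letter S U₀ U₁ U₂ X Y₁ Y₂ Z → β)
    (hf : ∀ l l', f l = f l' ↔ D.Agr l.visible.2.1 l'.visible.2.1)
    (hb : ∀ l l', b l = b l' ↔
      B (l.visible.1, l.visible.2.2) = B (l'.visible.1, l'.visible.2.2)) :
    I (W.letterLaw pU₀ pU₁ pU₂ pX) f b =
      ((Encoder.ofPMF s₀ pU₀ pU₁ pU₂ pX).model W).entPat D (fun _ => ()) -
        (((Encoder.ofPMF s₀ pU₀ pU₁ pU₂ pX).model W).entPat D B -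
          ((Encoder.ofPMF s₀ pU₀ pU₁ pU₂ pX).model W).entPat .none B) := by
  rw [I, condH]
  refine congrArg₂ _ ?_ (congrArg₂ _ ?_ ?_)
  · exact H_letterLaw s₀ pU₀ pU₁ pU₂ pX W D _ _ fun l l' => by simp [hf]
  · exact H_letterLaw s₀ pU₀ pU₁ pU₂ pX W D B _ fun l l' => by simp [hf, hb]
  · exact H_letterLaw s₀ pU₀ pU₁ pU₂ pX W .none B _ fun l l' => by simp [hb, Pat.Agr]

lemma condI_letterLaw {α β γ O : Type*} [Fintype α] [Fintype β] [Fintype γ] [Fintype O]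
    (C A A' D : Pat) (B : S × (Y₁ × Y₂ × Z) → O) (f : Letter S U₀ U₁ U₂ X Y₁ Y₂ Z → α)
    (b : Letter S U₀ U₁ U₂ X Y₁ Y₂ Z → β) (c : Letter S U₀ U₁ U₂ X Y₁ Y₂ Z → γ)
    (hc : ∀ l l', c l = c l' ↔ C.Agr l.visible.2.1 l'.visible.2.1)
    (hf : ∀ l l', f l = f l' ∧ c l = c l' ↔ A.Agr l.visible.2.1 l'.visible.2.1)
    (hb : ∀ l l', b l = b l' ∧ c l = c l' ↔ A'.Agr l.visible.2.1 l'.visible.2.1 ∧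
      B (l.visible.1, l.visible.2.2) = B (l'.visible.1, l'.visible.2.2))
    (hfb : ∀ l l', f l = f l' ∧ b l = b l' ∧ c l = c l' ↔
      D.Agr l.visible.2.1 l'.visible.2.1 ∧
      B (l.visible.1, l.visible.2.2) = B (l'.visible.1, l'.visible.2.2)) :
    condI (W.letterLaw pU₀ pU₁ pU₂ pX) f b c =
      (((Encoder.ofPMF s₀ pU₀ pU₁ pU₂ pX).model W).entPat A (fun _ => ()) -
        ((Encoder.ofPMF s₀ pU₀ pU₁ pU₂ pX).model W).entPat C (fun _ => ())) -
      (((Encoder.ofPMF s₀ pU₀ pU₁ pU₂ pX).model W).entPat D B -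
        ((Encoder.ofPMF s₀ pU₀ pU₁ pU₂ pX).model W).entPat A' B) := by
  rw [condI, condH, condH]
  refine congrArg₂ _ (congrArg₂ _ ?_ ?_) (congrArg₂ _ ?_ ?_)
  · exact H_letterLaw s₀ pU₀ pU₁ pU₂ pX W A _ _ fun l l' => by simp [hf]
  · exact H_letterLaw s₀ pU₀ pU₁ pU₂ pX W C _ _ fun l l' => by simp [hc]
  · exact H_letterLaw s₀ pU₀ pU₁ pU₂ pX W D B _ fun l l' => by simp only [Prod.mk.injEq, hfb]
  · exact H_letterLaw s₀ pU₀ pU₁ pU₂ pX W A' B _ fun l l' => by simp only [Prod.mk.injEq, hb]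

end ofPMF

lemma rate_backoff {R δ f : ℝ} (h : R ≤ max f 0) (hδ : 0 ≤ δ) :
    max (R - δ) 0 = 0 ∨ max (R - δ) 0 + δ ≤ f := by
  rcases max_choice (R - δ) 0 with h1 | h1
  · rcases le_max_iff.1 h with h2 | h2
    · exact Or.inr (by rw [h1]; linarith)
    · exact Or.inl (max_eq_right (by linarith))
  · exact Or.inl h1

/-- Rates slightly below `R₀, R₁, R₂`, as long as these are positive. -/
lemma sm_backoff {R₀ R₁ R₂ δ f : ℝ} (hδ : 0 ≤ δ) (hR₀ : 0 ≤ R₀) (hR₁ : 0 ≤ R₁) (hR₂ : 0 ≤ R₂) (D : Pat)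
    (h : D.sm R₀ R₁ R₂ ≤ max f 0) :
    D.sm (max (R₀ - δ) 0) (max (R₁ - δ) 0) (max (R₂ - δ) 0) = 0 ∨
      D.sm (max (R₀ - δ) 0) (max (R₁ - δ) 0) (max (R₂ - δ) 0) + δ ≤ f := by
  have h0 : ∀ {R : ℝ}, 0 ≤ R → max (R - δ) 0 ≤ R := fun h => max_le (by linarith) h
  have h1 : D.sm (max (R₀ - δ) 0) (max (R₁ - δ) 0) (max (R₂ - δ) 0) = 0 ∨
      D.sm (max (R₀ - δ) 0) (max (R₁ - δ) 0) (max (R₂ - δ) 0) + δ ≤ D.sm R₀ R₁ R₂ := by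
    have a₀ := h0 hR₀
    have a₁ := h0 hR₁
    have a₂ := h0 hR₂
    rcases max_choice (R₀ - δ) 0 with b₀ | b₀ <;> rcases max_choice (R₁ - δ) 0 with b₁ | b₁ <;>
    rcases max_choice (R₂ - δ) 0 with b₂ | b₂ <;> rw [b₀, b₁, b₂] <;> rw [b₀] at a₀ <;>
    rw [b₁] at a₁ <;> rw [b₂] at a₂ <;> cases D <;> simp only [Pat.sm, add_zero, true_or] <;>
    first
    | exact Or.inl rfl
    | exact Or.inr (by linarith)
  have h2 := Pat.sm_nonneg (le_max_right (R₀ - δ) 0) (le_max_right (R₁ - δ) 0)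
    (le_max_right (R₂ - δ) 0) D
  rcases h1 with h1 | h1
  · exact Or.inl h1
  · rcases le_max_iff.1 h with h3 | h3
    · exact Or.inr (h1.trans h3)
    · exact Or.inl (by linarith)

end KeyAgreement

end

theorem theorem1 {S U₀ U₁ U₂ X Y₁ Y₂ Z : Type*}
    [Fintype S] [Fintype U₀] [Fintype U₁] [Fintype U₂]
    [Fintype X] [Fintype Y₁] [Fintype Y₂] [Fintype Z]
    (W : KeyAgreement.Channel S X Y₁ Y₂ Z)
    (pU₀ : S → PMF U₀) (pU₁ : S → U₀ → PMF U₁) (pU₂ : S → U₀ → PMF U₂)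
    (pX : S → U₀ → U₁ → U₂ → PMF X)
    (p : PMF (KeyAgreement.Letter S U₀ U₁ U₂ X Y₁ Y₂ Z))
    (hp : p = W.letterLaw pU₀ pU₁ pU₂ pX)
    -- the constraints on the input distribution
    (hc₀₁ : KeyAgreement.I p (·.u₀) (·.s) ≤ KeyAgreement.I p (·.u₀) (·.y₁))
    (hc₀₂ : KeyAgreement.I p (·.u₀) (·.s) ≤ KeyAgreement.I p (·.u₀) (·.y₂))
    (hc₁ : KeyAgreement.condI p (·.u₁) (·.s) (·.u₀) ≤ KeyAgreement.condI p (·.u₁) (·.y₁) (·.u₀))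
    (hc₂ : KeyAgreement.condI p (·.u₂) (·.s) (·.u₀) ≤ KeyAgreement.condI p (·.u₂) (·.y₂) (·.u₀))
    -- the rates
    (R₀ R₁ R₂ : ℝ) (hR₀ : 0 ≤ R₀) (hR₁ : 0 ≤ R₁) (hR₂ : 0 ≤ R₂)
    (h₀ : R₀ ≤ max (min (KeyAgreement.I p (·.u₀) (·.y₁)) (KeyAgreement.I p (·.u₀) (·.y₂))
        - KeyAgreement.I p (·.u₀) (·.z)) 0)
    (h₁ : R₁ ≤ max (KeyAgreement.condI p (·.u₁) (·.y₁) (·.u₀)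
        - KeyAgreement.condI p (·.u₁) (fun ω => (ω.y₂, ω.u₂)) (·.u₀)) 0)
    (h₂ : R₂ ≤ max (KeyAgreement.condI p (·.u₂) (·.y₂) (·.u₀)
        - KeyAgreement.condI p (·.u₂) (fun ω => (ω.y₁, ω.u₁)) (·.u₀)) 0)
    (h₀₁ : R₀ + R₁ ≤
      max (min (KeyAgreement.I p (·.u₀) (·.y₁)) (KeyAgreement.I p (·.u₀) (·.y₂))
        + KeyAgreement.condI p (·.u₁) (·.y₁) (·.u₀)
        - KeyAgreement.I p (fun ω => (ω.u₀, ω.u₁)) (·.z)) 0)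
    (h₀₂ : R₀ + R₂ ≤
      max (min (KeyAgreement.I p (·.u₀) (·.y₁)) (KeyAgreement.I p (·.u₀) (·.y₂))
        + KeyAgreement.condI p (·.u₂) (·.y₂) (·.u₀)
        - KeyAgreement.I p (fun ω => (ω.u₀, ω.u₂)) (·.z)) 0)
    (h₀₁₂ : R₀ + R₁ + R₂ ≤
      max (min (KeyAgreement.I p (·.u₀) (·.y₁)) (KeyAgreement.I p (·.u₀) (·.y₂))
        + KeyAgreement.condI p (·.u₁) (·.y₁) (·.u₀)
        + KeyAgreement.condI p (·.u₂) (·.y₂) (·.u₀)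
        - KeyAgreement.I p (fun ω => (ω.u₀, ω.u₁, ω.u₂)) (·.z)
        - KeyAgreement.condI p (·.u₁) (·.u₂) (·.u₀)) 0) :
    KeyAgreement.Achievable W R₀ R₁ R₂ := by 
  subst hp
  obtain ⟨s₀, -⟩ := W.state.support_nonempty
  obtain ⟨v₀, -⟩ := (pU₀ s₀).support_nonempty
  obtain ⟨v₁, -⟩ := (pU₁ s₀ v₀).support_nonempty
  obtain ⟨v₂, -⟩ := (pU₂ s₀ v₀).support_nonempty
  obtain ⟨x₀, -⟩ := (pX s₀ v₀ v₁ v₂).support_nonempty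
  have : Nonempty U₀ := ⟨v₀⟩
  have : Nonempty U₁ := ⟨v₁⟩
  have : Nonempty U₂ := ⟨v₂⟩
  have : Nonempty X := ⟨x₀⟩
  rw [KeyAgreement.I_letterLaw s₀ pU₀ pU₁ pU₂ pX W .zero Prod.fst (·.u₀) (·.s)
    (fun l l' => by simp [KeyAgreement.Pat.Agr, KeyAgreement.Letter.visible])
    (fun l l' => by simp [KeyAgreement.Letter.visible])] at hc₀₁ hc₀₂
  rw [KeyAgreement.I_letterLaw s₀ pU₀ pU₁ pU₂ pX W .zero (fun x => x.2.1) (·.u₀) (·.y₁)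
    (fun l l' => by simp [KeyAgreement.Pat.Agr, KeyAgreement.Letter.visible])
    (fun l l' => by simp [KeyAgreement.Letter.visible])] at hc₀₁ h₀ h₀₁ h₀₂ h₀₁₂
  rw [KeyAgreement.I_letterLaw s₀ pU₀ pU₁ pU₂ pX W .zero (fun x => x.2.2.1) (·.u₀) (·.y₂)
    (fun l l' => by simp [KeyAgreement.Pat.Agr, KeyAgreement.Letter.visible])
    (fun l l' => by simp [KeyAgreement.Letter.visible])] at hc₀₂ h₀ h₀₁ h₀₂ h₀₁₂
  rw [KeyAgreement.I_letterLaw s₀ pU₀ pU₁ pU₂ pX W .zero (fun x => x.2.2.2) (·.u₀) (·.z)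
    (fun l l' => by simp [KeyAgreement.Pat.Agr, KeyAgreement.Letter.visible])
    (fun l l' => by simp [KeyAgreement.Letter.visible])] at h₀
  rw [KeyAgreement.I_letterLaw s₀ pU₀ pU₁ pU₂ pX W .one (fun x => x.2.2.2) (fun ω => (ω.u₀, ω.u₁)) (·.z)
    (fun l l' => by simp [KeyAgreement.Pat.Agr, KeyAgreement.Letter.visible])
    (fun l l' => by simp [KeyAgreement.Letter.visible])] at h₀₁
  rw [KeyAgreement.I_letterLaw s₀ pU₀ pU₁ pU₂ pX W .two (fun x => x.2.2.2) (fun ω => (ω.u₀, ω.u₂)) (·.z)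
    (fun l l' => by simp [KeyAgreement.Pat.Agr, KeyAgreement.Letter.visible])
    (fun l l' => by simp [KeyAgreement.Letter.visible])] at h₀₂
  rw [KeyAgreement.I_letterLaw s₀ pU₀ pU₁ pU₂ pX W .all (fun x => x.2.2.2) (fun ω => (ω.u₀, ω.u₁, ω.u₂)) (·.z)
    (fun l l' => by simp [KeyAgreement.Pat.Agr, KeyAgreement.Letter.visible])
    (fun l l' => by simp [KeyAgreement.Letter.visible])] at h₀₁₂
  rw [KeyAgreement.condI_letterLaw s₀ pU₀ pU₁ pU₂ pX W .zero .one .zero .one Prod.fst (·.u₁) (·.s) (·.u₀)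
    (fun l l' => by simp [KeyAgreement.Pat.Agr, KeyAgreement.Letter.visible])
    (fun l l' => by simp [KeyAgreement.Pat.Agr, KeyAgreement.Letter.visible]; tauto)
    (fun l l' => by simp [KeyAgreement.Pat.Agr, KeyAgreement.Letter.visible]; tauto)
    (fun l l' => by simp [KeyAgreement.Pat.Agr, KeyAgreement.Letter.visible]; tauto)] at hc₁
  rw [KeyAgreement.condI_letterLaw s₀ pU₀ pU₁ pU₂ pX W .zero .two .zero .two Prod.fst (·.u₂) (·.s) (·.u₀)
    (fun l l' => by simp [KeyAgreement.Pat.Agr, KeyAgreement.Letter.visible])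
    (fun l l' => by simp [KeyAgreement.Pat.Agr, KeyAgreement.Letter.visible]; tauto)
    (fun l l' => by simp [KeyAgreement.Pat.Agr, KeyAgreement.Letter.visible]; tauto)
    (fun l l' => by simp [KeyAgreement.Pat.Agr, KeyAgreement.Letter.visible]; tauto)] at hc₂
  rw [KeyAgreement.condI_letterLaw s₀ pU₀ pU₁ pU₂ pX W .zero .one .zero .one (fun x => x.2.1) (·.u₁) (·.y₁) (·.u₀)
    (fun l l' => by simp [KeyAgreement.Pat.Agr, KeyAgreement.Letter.visible])
    (fun l l' => by simp [KeyAgreement.Pat.Agr, KeyAgreement.Letter.visible]; tauto)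
    (fun l l' => by simp [KeyAgreement.Pat.Agr, KeyAgreement.Letter.visible]; tauto)
    (fun l l' => by simp [KeyAgreement.Pat.Agr, KeyAgreement.Letter.visible]; tauto)] at hc₁ h₁ h₀₁ h₀₁₂
  rw [KeyAgreement.condI_letterLaw s₀ pU₀ pU₁ pU₂ pX W .zero .two .zero .two (fun x => x.2.2.1) (·.u₂) (·.y₂) (·.u₀)
    (fun l l' => by simp [KeyAgreement.Pat.Agr, KeyAgreement.Letter.visible])
    (fun l l' => by simp [KeyAgreement.Pat.Agr, KeyAgreement.Letter.visible]; tauto)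
    (fun l l' => by simp [KeyAgreement.Pat.Agr, KeyAgreement.Letter.visible]; tauto)
    (fun l l' => by simp [KeyAgreement.Pat.Agr, KeyAgreement.Letter.visible]; tauto)] at hc₂ h₂ h₀₂ h₀₁₂
  rw [KeyAgreement.condI_letterLaw s₀ pU₀ pU₁ pU₂ pX W .zero .one .two .all (fun x => x.2.2.1) (·.u₁) (fun ω => (ω.y₂, ω.u₂)) (·.u₀)
    (fun l l' => by simp [KeyAgreement.Pat.Agr, KeyAgreement.Letter.visible])
    (fun l l' => by simp [KeyAgreement.Pat.Agr, KeyAgreement.Letter.visible]; tauto)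
    (fun l l' => by simp [KeyAgreement.Pat.Agr, KeyAgreement.Letter.visible]; tauto)
    (fun l l' => by simp [KeyAgreement.Pat.Agr, KeyAgreement.Letter.visible]; tauto)] at h₁
  rw [KeyAgreement.condI_letterLaw s₀ pU₀ pU₁ pU₂ pX W .zero .two .one .all (fun x => x.2.1) (·.u₂) (fun ω => (ω.y₁, ω.u₁)) (·.u₀)
    (fun l l' => by simp [KeyAgreement.Pat.Agr, KeyAgreement.Letter.visible])
    (fun l l' => by simp [KeyAgreement.Pat.Agr, KeyAgreement.Letter.visible]; tauto)
    (fun l l' => by simp [KeyAgreement.Pat.Agr, KeyAgreement.Letter.visible]; tauto)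
    (fun l l' => by simp [KeyAgreement.Pat.Agr, KeyAgreement.Letter.visible]; tauto)] at h₂
  rw [KeyAgreement.condI_letterLaw s₀ pU₀ pU₁ pU₂ pX W .zero .one .two .all (fun _ => ()) (·.u₁) (·.u₂) (·.u₀)
    (fun l l' => by simp [KeyAgreement.Pat.Agr, KeyAgreement.Letter.visible])
    (fun l l' => by simp [KeyAgreement.Pat.Agr, KeyAgreement.Letter.visible]; tauto)
    (fun l l' => by simp [KeyAgreement.Pat.Agr, KeyAgreement.Letter.visible]; tauto)
    (fun l l' => by simp [KeyAgreement.Pat.Agr, KeyAgreement.Letter.visible]; tauto)] at h₀₁₂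
  -- all rate conditions are now in terms of entropies of layers
  rw [min_sub_sub_left] at h₀ h₀₁ h₀₂ h₀₁₂
  intro ε hε
  -- backing off by `ε / 2` from positive rates gives slack in all conditions, whereas the tolerance
  -- in the uniformity of the keys is `ε`
  have hε2 : 0 < ε / 2 := by positivity
  have hpos : ∀ {R : ℝ}, 0 ≤ R → max (R - ε / 2) 0 ≤ R := fun h => max_le (by linarith) h
  have hclose : ∀ R : ℝ, R - ε < max (R - ε / 2) 0 := fun R => lt_max_of_lt_left (by linarith)
  refine Filter.eventually_atTop.1 (KeyAgreement.Encoder.eventually_isGood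
    (E := KeyAgreement.Encoder.ofPMF s₀ pU₀ pU₁ pU₂ pX)
    (KeyAgreement.Encoder.normal_ofPMF s₀ pU₀ pU₁ pU₂ pX) (by linarith) (by linarith)
    (by linarith) (by linarith) (le_max_right (R₀ - ε / 2) 0) (le_max_right (R₁ - ε / 2) 0)
    (le_max_right (R₂ - ε / 2) 0) hε (hpos hR₀) (hpos hR₁) (hpos hR₂) (hclose R₀) (hclose R₁)
    (hclose R₂) hε2 (fun D => KeyAgreement.sm_backoff hε2.le hR₀ hR₁ hR₂ D ?_) ?_ ?_)
  · cases D <;> simp only [KeyAgreement.Pat.sm]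
    · exact le_max_right _ _
    · refine h₀.trans_eq ?_
      congr 1; ring
    · refine h₀₁.trans_eq ?_
      congr 1; ring
    · refine h₀₂.trans_eq ?_
      congr 1; ring
    · refine h₀₁₂.trans_eq ?_
      congr 1; ring
  · refine KeyAgreement.rate_backoff (h₁.trans_eq ?_) hε2.le
    congr 1; ring
  · refine KeyAgreement.rate_backoff (h₂.trans_eq ?_) hε2.le
    congr 1; ring
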